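/- **Setting.** Let $H=-\Delta+V$ on $L^2(\mathbb R^3,\mathbb C)$ with domain $H^2$, where $V\in\mathcal S(\mathbb R^3,\mathbb R)$. Let $g\in C^\infty(\mathbb R,\mathbb R)$ satisfy $g(0)=0$ and, for every $n\ge 0$, $|g^{(n)}(s)|\le C_n(1+s^2)^{(2-n)/2}$ for all $s\in\mathbb R$, for some $C_n>0$. Assume that for some $N\ge 2$ the discrete spectrum of $H$ is $\{\omega_1<\dots<\omega_N\}$ with $\omega_N<0$, that all $\omega_j$ are simple eigenvalues, and that $\mathbf m\cdot\boldsymbol\omega\ne 0$ for all $\mathbf m\in\mathbb Z^N\setminus\{0\}$, where $\boldsymbol\omega=(\omega_1,\dots,\omega_N)$. Let $\phi_j$ be a real-valued eigenfunction of $H$ for $\omega_j$ with $\|\phi_j\|_{L^2}=1$, and $\boldsymbol\phi=(\phi_1,\dots,\phi_N)$. *Spaces.* For $\gamma>0$ and $s\ge 0$ let $\Sigma^s=\Sigma^s_\gamma=\{u\in H^s(\mathbb R^3,\mathbb C): \|u\|_{\Sigma^s}:=\|\cosh(\gamma|x|)u\|_{H^s}<\infty\}$ and $\Sigma^\infty=\bigcap_{s\ge0}\Sigma^s$.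 *Indices.* For $\mathbf m\in\mathbb Z^N$ let $|\mathbf m|=(|m_1|,\dots,|m_N|)$, and write $|\mathbf n|\prec|\mathbf m|$ if $|n_j|\le|m_j|$ for all $j$ and $|\mathbf n|\neq|\mathbf m|$. Let $\mathbf e_1,\dots,\mathbf e_N$ be the standard basis and $$\mathbf{NR}_0=\{\mathbf e_1,\dots,\mathbf e_N\},\quad \mathbf R=\{\mathbf m:\textstyle\sum_j m_j=1,\ \boldsymbol\omega\cdot\mathbf m>0\},\quad \mathbf{NR}=\{\mathbf m:\textstyle\sum_j m_j=1,\ \boldsymbol\omega\cdot\mathbf m<0\},$$ $$\mathbf R_{\min}=\{\mathbf m\in\mathbf R:\nexists\,\mathbf n\in\mathbf R,\ |\mathbf n|\prec|\mathbf m|\},\qquad \mathbf{NR}_1=\{\mathbf m\in\mathbf{NR}:\forall\,\mathbf n\in\mathbf R_{\min},\ |\mathbf n|\not\prec|\mathbf m|\}.$$ *Leading profiles and forcing terms.* For $k\ge1$ let $A(k,\mathbf m)$ be the set of $(\mathbf m_1,\dots,\mathbf m_{2k+1})\in(\mathbf{NR}_1)^{2k+1}$ with $\sum_{j=0}^k\mathbf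 m_{2j+1}-\sum_{j=1}^k\mathbf m_{2j}=\mathbf m$ and $\sum_{j=1}^{2k+1}|\mathbf m_j|=|\mathbf m|$. Define recursively $\widetilde\phi_{\mathbf e_j}(0)=\phi_j$ and, for $\mathbf m\in\mathbf{NR}_1\setminus\mathbf{NR}_0$, $\widetilde\phi_{\mathbf m}(0)=-(H-\mathbf m\cdot\boldsymbol\omega)^{-1}G_{\mathbf m}$, where for $\mathbf m\in(\mathbf{NR}_1\setminus\mathbf{NR}_0)\cup\mathbf R_{\min}$ $$G_{\mathbf m}=\sum_{k\ge1}\frac{g^{(k)}(0)}{k!}\sum_{(\mathbf m_1,\dots,\mathbf m_{2k+1})\in A(k,\mathbf m)}\widetilde\phi_{\mathbf m_1}(0)\cdots\widetilde\phi_{\mathbf m_{2k+1}}(0)$$ (only finitely many terms are nonzero). *Further notation.* For $\mathbf z\in\mathbb C^N$ let $\mathbf z^{\mathbf m}=\prod_j z_j^{(m_j)}$ with $z^{(k)}=z^k$ for $k\ge0$ and $z^{(k)}=\bar z^{-k}$ for $k<0$; $|\mathbf z|^2=(|z_1|^2,\dots,|z_N|^2)$; $\|\mathbf z\|=\sum_j|z_j|$;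 $\mathbf z\cdot\boldsymbol\phi=\sum_j z_j\phi_j$. Let $\mathcal B_{\mathbb R^N}(0,r)$ and $\mathcal B_{\mathbb C^N}(0,r)$ be the balls of radius $r$ for the norm $\|\cdot\|$, the sum of the moduli of the coordinates. **Proposition (Refined Profile).** The sets $\mathbf R_{\min}$ and $\mathbf{NR}_1$ are finite. For all sufficiently small $\gamma>0$, one has $\phi_j\in\Sigma^\infty$ for all $j$ and $G_{\mathbf m}\in\Sigma^\infty$ for all $\mathbf m\in\mathbf R_{\min}$, and the following holds. For every $s\ge0$ there exist $\delta_s>0$ and $C_s>0$, with $\delta_s$ nonincreasing in $s$, and $$\psi_{\mathbf m}\in C^\infty(\mathcal B_{\mathbb R^N}(0,\delta_s^2),\Sigma^s)\ (\mathbf m\in\mathbf{NR}_1),\quad \boldsymbol\varpi\in C^\infty(\mathcal B_{\mathbb R^N}(0,\delta_s^2),\mathbb R^N),\quad \mathcal R\in C^\infty(\mathcal B_{\mathbb C^N}(0,\delta_s),\Sigma^s)$$ (smoothness in the real sense) such that $\boldsymbol\varpi(0)=\boldsymbol\omega$, $\psi_{\mathbf e_j}(0)=0$ for all $j$, $\psi_{\mathbf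 m}(0)=\widetilde\phi_{\mathbf m}(0)$ for $\mathbf m\in\mathbf{NR}_1\setminus\mathbf{NR}_0$, and $$\|\mathcal R(\mathbf z)\|_{\Sigma^s}\le C_s\|\mathbf z\|^2\sum_{\mathbf m\in\mathbf R_{\min}}|\mathbf z^{\mathbf m}|\qquad(\mathbf z\in\mathcal B_{\mathbb C^N}(0,\delta_s)),$$ and such that, setting $$\phi(\mathbf z)=\mathbf z\cdot\boldsymbol\phi+\sum_{\mathbf m\in\mathbf{NR}_1}\mathbf z^{\mathbf m}\psi_{\mathbf m}(|\mathbf z|^2),\qquad z_j(t)=e^{-\mathrm i\varpi_j(|\mathbf z|^2)t}z_j,\qquad \mathbf z(t)=(z_1(t),\dots,z_N(t)),$$ for every $\mathbf z\in\mathcal B_{\mathbb C^N}(0,\delta_s)$ the function $u(t)=\phi(\mathbf z(t))$ satisfies, for all $t\in\mathbb R$ (with $u(t)\in H^2$, the time derivative in $L^2$, and the equation holding in $L^2$), $$\mathrm i\partial_t u=Hu+g(|u|^2)u-\sum_{\mathbf m\in\mathbf R_{\min}}\mathbf z(t)^{\mathbf m}G_{\mathbf m}-\mathcal R(\mathbf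 z(t)).$$ Finally, writing $\psi^{(s)}_{\mathbf m},\boldsymbol\varpi^{(s)},\mathcal R^{(s)}$ for the objects belonging to $s$, for all $0\le s_1<s_2$ and $\mathbf z\in\mathcal B_{\mathbb C^N}(0,\delta_{s_2})$ one has $\psi^{(s_1)}_{\mathbf m}(|\mathbf z|^2)=\psi^{(s_2)}_{\mathbf m}(|\mathbf z|^2)$ for all $\mathbf m\in\mathbf{NR}_1$, $\boldsymbol\varpi^{(s_1)}(|\mathbf z|^2)=\boldsymbol\varpi^{(s_2)}(|\mathbf z|^2)$ and $\mathcal R^{(s_1)}(\mathbf z)=\mathcal R^{(s_2)}(\mathbf z)$. -/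

import Mathlib

open MeasureTheory TemperedDistribution
open scoped SchwartzMap Laplacian

noncomputable section

namespace NLSProfile

/-! ### Function spaces on `ℝ³` -/

/-- The physical space `ℝ³` with its Euclidean norm. -/
abbrev R3 : Type := EuclideanSpace ℝ (Fin 3)

/-- `L²(ℝ³, ℂ)`. -/
abbrev L2 : Type := Lp ℂ 2 (volume : Measure R3)

/-- Complex measurable functions on `ℝ³` up to almost everywhere equality (a commutative ring under
pointwise operations). -/
abbrev AEFun : Type := R3 →ₘ[(volume : Measure R3)] ℂ

/-- The (injective) inclusion of `L²` into tempered distributions. -/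
def toDist : L2 →ₗ[ℂ] 𝓢'(R3, ℂ) :=
  (Lp.toTemperedDistributionCLM ℂ (volume : Measure R3) 2).toLinearMap

theorem toDist_apply (f : L2) : toDist f = (f : 𝓢'(R3, ℂ)) := rfl

theorem toDist_injective : Function.Injective toDist :=
  LinearMap.ker_eq_bot.mp <| by
    have h := Lp.ker_toTemperedDistributionCLM_eq_bot
      (F := ℂ) (μ := (volume : Measure R3)) (p := 2)
    rw [← h]
    rfl

/-- A distribution-valued linear map all of whose values are `L²` functions, seen as an
`L²`-valued linear map. -/
def l2Valued {W : Type*} [AddCommGroup W] [Module ℂ W] (A : W →ₗ[ℂ] 𝓢'(R3, ℂ))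
    (hA : ∀ u, A u ∈ LinearMap.range toDist) : W →ₗ[ℂ] L2 :=
  (LinearEquiv.ofInjective toDist toDist_injective).symm.toLinearMap ∘ₗ
    A.codRestrict (LinearMap.range toDist) hA

theorem toDist_l2Valued {W : Type*} [AddCommGroup W] [Module ℂ W] (A : W →ₗ[ℂ] 𝓢'(R3, ℂ))
    (hA : ∀ u, A u ∈ LinearMap.range toDist) (u : W) : toDist (l2Valued A hA u) = A u :=
  congrArg Subtype.val
    ((LinearEquiv.ofInjective toDist toDist_injective).apply_symm_apply ⟨A u, hA u⟩)

/-- The part of the Sobolev space `H^s(ℝ³, ℂ)` in `L²` (all of `H^s` when `s ≥ 0`). -/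
def sobolev (s : ℝ) : Submodule ℂ L2 where
  carrier := {u | MemSobolev s 2 (u : 𝓢'(R3, ℂ))}
  add_mem' := by
    intro a b ha hb
    have := MemSobolev.add ha hb
    simpa only [Set.mem_ofPred_eq, ← toDist_apply, map_add] using this
  zero_mem' := by
    have := memSobolev_fun_zero R3 ℂ s 2
    simpa only [Set.mem_ofPred_eq, ← toDist_apply, map_zero] using this
  smul_mem' := by
    intro c a ha
    have := MemSobolev.smul c ha
    simpa only [Set.mem_ofPred_eq, ← toDist_apply, map_smul] using this

/-- The isometry defining the norm of `H^s`: `u ↦ ⟨D⟩^s u ∈ L²`, where `⟨D⟩^s` is the Fourier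
multiplier with symbol `(1 + |ξ|²)^{s/2}`. -/
def bessel (s : ℝ) : sobolev s →ₗ[ℂ] L2 :=
  l2Valued ((besselPotential R3 ℂ s).toLinearMap ∘ₗ toDist ∘ₗ (sobolev s).subtype) (by
    rintro ⟨u, f, hf⟩
    exact ⟨f, hf.symm⟩)

theorem toDist_bessel (s : ℝ) (u : sobolev s) :
    toDist (bessel s u) = besselPotential R3 ℂ s (toDist u.1) :=
  toDist_l2Valued _ _ u

theorem bessel_injective (s : ℝ) : Function.Injective (bessel s) := by
  intro u v h
  have h' := congrArg toDist h
  rw [toDist_bessel, toDist_bessel] at h'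
  have h2 := congrArg (besselPotential R3 ℂ (-s)) h'
  simp only [besselPotential_besselPotential_apply, add_neg_cancel, besselPotential_zero,
    ContinuousLinearMap.id_apply] at h2
  exact Subtype.ext (toDist_injective h2)

/-- The weight `cosh (γ |x|)`. -/
def weight (γ : ℝ) (x : R3) : ℂ := (Real.cosh (γ * ‖x‖) : ℝ)

theorem weight_ne_zero (γ : ℝ) (x : R3) : weight γ x ≠ 0 := by
  exact Complex.ofReal_ne_zero.mpr (Real.cosh_pos (γ * ‖x‖)).ne'

/-- The functions `u ∈ L²` with `cosh (γ |x|) u ∈ L²`. -/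
def weightedL2 (γ : ℝ) : Submodule ℂ L2 where
  carrier := {u | MemLp (fun x => weight γ x * u x) 2 (volume : Measure R3)}
  add_mem' := by
    intro a b ha hb
    refine (MemLp.add ha hb).ae_eq ?_
    filter_upwards [Lp.coeFn_add a b] with x hx
    rw [hx, Pi.add_apply, Pi.add_apply, mul_add]
  zero_mem' := by
    refine (MemLp.zero : MemLp (0 : R3 → ℂ) 2 volume).ae_eq ?_
    filter_upwards [Lp.coeFn_zero ℂ 2 (volume : Measure R3)] with x hx
    rw [hx, Pi.zero_apply, mul_zero]
  smul_mem' := by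
    intro c a ha
    refine (MemLp.const_smul ha c).ae_eq ?_
    filter_upwards [Lp.coeFn_smul c a] with x hx
    rw [hx, Pi.smul_apply, Pi.smul_apply, smul_eq_mul, smul_eq_mul, mul_left_comm]

theorem memLp_weight_mul {γ : ℝ} (u : weightedL2 γ) :
    MemLp (fun x => weight γ x * u.1 x) 2 (volume : Measure R3) := u.2

/-- Multiplication by the weight: `u ↦ cosh (γ |x|) u`. -/
def weightMul (γ : ℝ) : weightedL2 γ →ₗ[ℂ] L2 where
  toFun u := (memLp_weight_mul u).toLp _
  map_add' := by
    intro a b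
    refine Eq.trans ?_ (MemLp.toLp_add (memLp_weight_mul a) (memLp_weight_mul b))
    rw [MemLp.toLp_eq_toLp_iff]
    filter_upwards [Lp.coeFn_add a.1 b.1] with x hx
    rw [Submodule.coe_add, hx, Pi.add_apply, Pi.add_apply, mul_add]
  map_smul' := by
    intro c a
    refine Eq.trans ?_ (MemLp.toLp_const_smul c (memLp_weight_mul a))
    rw [MemLp.toLp_eq_toLp_iff]
    filter_upwards [Lp.coeFn_smul c a.1] with x hx
    rw [Submodule.coe_smul, hx, Pi.smul_apply, Pi.smul_apply, smul_eq_mul, smul_eq_mul,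
      mul_left_comm]

theorem weightMul_injective (γ : ℝ) : Function.Injective (weightMul γ) := by
  intro u v h
  have h' := (MemLp.toLp_eq_toLp_iff (memLp_weight_mul u) (memLp_weight_mul v)).mp h
  refine Subtype.ext (Lp.ext ?_)
  filter_upwards [h'] with x hx
  exact mul_left_cancel₀ (weight_ne_zero γ x) hx

/-- The weighted Sobolev space `Σ^s = {u ∈ H^s | cosh (γ |x|) u ∈ H^s}` (`s ≥ 0`), as a set of
functions. -/
def sigmaSub (γ s : ℝ) : Submodule ℂ L2 :=
  sobolev s ⊓ ((sobolev s).comap (weightMul γ)).map (weightedL2 γ).subtype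

theorem mem_sigmaSub {γ s : ℝ} {u : L2} : u ∈ sigmaSub γ s ↔
    u ∈ sobolev s ∧ ∃ h : u ∈ weightedL2 γ, weightMul γ ⟨u, h⟩ ∈ sobolev s := by
  simp [sigmaSub]

/-- The space `Σ^s` as a type of its own, to carry the norm
`‖u‖_{Σ^s} = ‖cosh (γ |x|) u‖_{H^s}`. -/
def SigmaSp (γ s : ℝ) : Type := sigmaSub γ s

instance (γ s : ℝ) : AddCommGroup (SigmaSp γ s) := inferInstanceAs (AddCommGroup (sigmaSub γ s))

instance (γ s : ℝ) : Module ℂ (SigmaSp γ s) := inferInstanceAs (Module ℂ (sigmaSub γ s))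

/-- The function underlying an element of `Σ^s`. -/
def SigmaSp.toL2 {γ s : ℝ} : SigmaSp γ s →ₗ[ℂ] L2 := (sigmaSub γ s).subtype

/-- The map `u ↦ cosh (γ |x|) u`, from `Σ^s` to `H^s`. -/
def SigmaSp.weighted {γ s : ℝ} : SigmaSp γ s →ₗ[ℂ] sobolev s :=
  LinearMap.codRestrict (sobolev s)
    (weightMul γ ∘ₗ LinearMap.codRestrict (weightedL2 γ) SigmaSp.toL2
      fun u => (mem_sigmaSub.mp u.2).2.1)
    fun u => (mem_sigmaSub.mp u.2).2.2

theorem SigmaSp.weighted_injective {γ s : ℝ} :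
    Function.Injective (SigmaSp.weighted : SigmaSp γ s →ₗ[ℂ] sobolev s) := by
  intro u v h
  have h1 := weightMul_injective γ (congrArg Subtype.val h)
  have h2 : SigmaSp.toL2 u = SigmaSp.toL2 v := congrArg (fun w : weightedL2 γ => w.1) h1
  exact Subtype.ext h2

/-- `u ↦ ⟨D⟩^s (cosh (γ |x|) u)`, the map whose `L²` norm is the norm of `Σ^s`. -/
def SigmaSp.normMap (γ s : ℝ) : SigmaSp γ s →ₗ[ℂ] L2 := bessel s ∘ₗ SigmaSp.weighted

instance (γ s : ℝ) : NormedAddCommGroup (SigmaSp γ s) :=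
  NormedAddCommGroup.induced (SigmaSp γ s) L2 (SigmaSp.normMap γ s)
    ((bessel_injective s).comp SigmaSp.weighted_injective)

instance (γ s : ℝ) : NormedSpace ℂ (SigmaSp γ s) :=
  NormedSpace.induced ℂ (SigmaSp γ s) L2 (SigmaSp.normMap γ s)

theorem SigmaSp.norm_def {γ s : ℝ} (u : SigmaSp γ s) :
    ‖u‖ = ‖bessel s (SigmaSp.weighted u)‖ := rfl

/-- Membership of a function in `Σ^∞ = ⋂_{s ≥ 0} Σ^s`. -/
def MemSigmaInfty (γ : ℝ) (f : AEFun) : Prop :=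
  ∀ s : ℝ, 0 ≤ s → ∃ u ∈ sigmaSub γ s, (u : AEFun) = f

/-! ### The Schrödinger operator and its spectrum -/

/-- The tempered distribution `-Δ u + V u` for `u ∈ L²`. -/
def schrodingerDist (V : 𝓢(R3, ℝ)) : L2 →ₗ[ℂ] 𝓢'(R3, ℂ) :=
  (-(LineDeriv.laplacianCLM ℂ R3 𝓢'(R3, ℂ)) + smulLeftCLM ℂ (fun x => (V x : ℂ))).toLinearMap ∘ₗ toDist

theorem schrodingerDist_apply (V : 𝓢(R3, ℝ)) (u : L2) :
    schrodingerDist V u =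
      -Δ (u : 𝓢'(R3, ℂ)) + smulLeftCLM ℂ (fun x => (V x : ℂ)) (u : 𝓢'(R3, ℂ)) := by
  simp [schrodingerDist, toDist_apply]

theorem schrodingerDist_mem_range (V : 𝓢(R3, ℝ)) (u : sobolev 2) :
    schrodingerDist V u.1 ∈ LinearMap.range toDist := by
  rw [schrodingerDist_apply]
  refine Submodule.add_mem _ (Submodule.neg_mem _ ?_) ?_
  · have h := MemSobolev.laplacian u.2
    rw [sub_self, memSobolev_zero_iff] at h
    obtain ⟨f, hf⟩ := h
    exact ⟨f, hf.symm⟩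
  · have hV : (fun x => (V x : ℂ)).HasTemperateGrowth :=
      Function.Complex.hasTemperateGrowth_ofReal.comp V.hasTemperateGrowth
    have hm : MemLp (fun x => (V x : ℂ)) ⊤ (volume : Measure R3) := (V.memLp ⊤).ofReal
    exact ⟨hm.toLp _ • u.1, Lp.toTemperedDistribution_smul_eq hV hm u.1⟩

/-- The Schrödinger operator `H = -Δ + V` on `L²(ℝ³, ℂ)` with domain `H²(ℝ³, ℂ)`. -/
def schrodinger (V : 𝓢(R3, ℝ)) : L2 →ₗ.[ℂ] L2 where
  domain := sobolev 2
  toFun := l2Valued (schrodingerDist V ∘ₗ (sobolev 2).subtype)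
    fun u => schrodingerDist_mem_range V u

theorem toDist_schrodinger (V : 𝓢(R3, ℝ)) (u : (schrodinger V).domain) :
    toDist (schrodinger V u) = schrodingerDist V u.1 :=
  toDist_l2Valued _ _ u

/-- The operator `A - l` on the domain of `A`. -/
def shift (A : L2 →ₗ.[ℂ] L2) (l : ℂ) : A.domain →ₗ[ℂ] L2 :=
  A.toFun - l • A.domain.subtype

/-- The spectrum of an unbounded operator: the `l` for which `A - l` is not a bijection of the
domain onto `L²` with bounded inverse. -/
def spec (A : L2 →ₗ.[ℂ] L2) : Set ℂ :=
  {l | ¬ (Function.Bijective (shift A l) ∧ ∃ C : ℝ, ∀ u, ‖u.1‖ ≤ C * ‖shift A l u‖)}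

/-- The resolvent `(A - l)⁻¹` (meaningful when `l` is not in the spectrum). -/
def resolventOp (A : L2 →ₗ.[ℂ] L2) (l : ℂ) (f : L2) : L2 :=
  (Function.invFun (shift A l) f : A.domain)

/-- The space of solutions of `A u = l u`. -/
def eigenspace (A : L2 →ₗ.[ℂ] L2) (l : ℂ) : Submodule ℂ A.domain := LinearMap.ker (shift A l)

/-- The discrete spectrum (of a self-adjoint operator): the isolated points of the spectrum that are
eigenvalues of finite multiplicity. -/
def discreteSpec (A : L2 →ₗ.[ℂ] L2) : Set ℂ :=
  {l | l ∈ spec A ∧ (∃ ε > 0, ∀ l' ∈ spec A, l' ≠ l → ε ≤ dist l' l) ∧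
    eigenspace A l ≠ ⊥ ∧ FiniteDimensional ℂ (eigenspace A l)}

/-- The spectral assumption: `σ_d(H) = {ω₁ < ⋯ < ω_N}` with all `ω_j` negative and simple, the
`ω_j` linearly independent over `ℤ`, and `φ_j` a real-valued `L²`-normalized eigenfunction of `H`
for `ω_j`. -/
structure SpectralAssumption {N : ℕ} (V : 𝓢(R3, ℝ)) (ω : Fin N → ℝ) (φ : Fin N → L2) : Prop where
  discreteSpec_eq : discreteSpec (schrodinger V) = Set.range fun j => (ω j : ℂ)
  strictMono : StrictMono ω
  neg : ∀ j, ω j < 0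
  simple : ∀ j, Module.finrank ℂ (eigenspace (schrodinger V) (ω j)) = 1
  independent : ∀ m : Fin N → ℤ, m ≠ 0 → ∑ j, (m j : ℝ) * ω j ≠ 0
  eigenfunction : ∀ j, ∃ h : φ j ∈ (schrodinger V).domain,
    schrodinger V ⟨φ j, h⟩ = (ω j : ℂ) • φ j
  norm_eq_one : ∀ j, ‖φ j‖ = 1
  real_valued : ∀ j, ∀ᵐ x, (φ j x).im = 0

/-- The assumption on the nonlinearity: `g` is smooth, `g(0) = 0` and
`|g^{(n)}(s)| ≤ C_n ⟨s⟩^{2-n}`. -/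
structure NonlinearityAssumption (g : ℝ → ℝ) : Prop where
  smooth : ContDiff ℝ (⊤ : ℕ∞) g
  zero : g 0 = 0
  growth : ∀ n : ℕ, ∃ C > 0, ∀ s : ℝ,
    |iteratedDeriv n g s| ≤ C * Real.sqrt (1 + s ^ 2) ^ (2 - (n : ℤ))

/-! ### Resonant and non-resonant indices -/

section Indices

variable {N : ℕ}

/-- `m · ω`. -/
def freq (ω : Fin N → ℝ) (m : Fin N → ℤ) : ℝ := ∑ j, (m j : ℝ) * ω j

/-- The multi-index `e_j`. -/
def unitIdx (j : Fin N) : Fin N → ℤ := Pi.single j 1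

/-- `‖m‖ = ∑_j |m_j|`. -/
def idxNorm (m : Fin N → ℤ) : ℕ := ∑ j, (m j).natAbs

/-- The relation `|m| ≺ |n|`. -/
def AbsLt (m n : Fin N → ℤ) : Prop := (∀ j, |m j| ≤ |n j|) ∧ ∃ j, |m j| ≠ |n j|

/-- Resonant indices `R`. -/
def Res (ω : Fin N → ℝ) : Set (Fin N → ℤ) := {m | ∑ j, m j = 1 ∧ 0 < freq ω m}

/-- Non-resonant indices `NR`. -/
def NonRes (ω : Fin N → ℝ) : Set (Fin N → ℤ) := {m | ∑ j, m j = 1 ∧ freq ω m < 0}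

/-- Minimal resonant indices `R_min`. -/
def ResMin (ω : Fin N → ℝ) : Set (Fin N → ℤ) :=
  {m | m ∈ Res ω ∧ ¬ ∃ n ∈ Res ω, AbsLt n m}

/-- The set `NR₁` of non-resonant indices not larger than a minimal resonant one. -/
def NonRes1 (ω : Fin N → ℝ) : Set (Fin N → ℤ) :=
  {m | m ∈ NonRes ω ∧ ∀ n ∈ ResMin ω, ¬ AbsLt n m}

/-- The set `A(k, m)` of `(2k+1)`-tuples `(m₁, …, m_{2k+1})` in `NR₁` with
`m₁ - m₂ + m₃ - ⋯ + m_{2k+1} = m` and `∑_i |m_i| = |m|` (componentwise). The tuples are indexed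
from `0`, so that the even positions carry the sign `+`. -/
def tuples (ω : Fin N → ℝ) (k : ℕ) (m : Fin N → ℤ) : Set (Fin (2 * k + 1) → Fin N → ℤ) :=
  {p | (∀ i, p i ∈ NonRes1 ω) ∧ (∀ j, ∑ i : Fin (2 * k + 1), (-1) ^ (i : ℕ) * p i j = m j) ∧
    ∀ j, ∑ i, |p i j| = |m j|}

theorem idxNorm_pos {ω : Fin N → ℝ} {m : Fin N → ℤ} (h : m ∈ NonRes1 ω) : 0 < idxNorm m := by
  rw [Nat.pos_iff_ne_zero]
  intro h0
  have hz : ∀ j, m j = 0 := by simpa [idxNorm] using h0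
  have h1 : ∑ j, m j = 1 := h.1.1
  simp [hz] at h1

theorem idxNorm_lt_of_mem_tuples {ω : Fin N → ℝ} {k : ℕ} {m : Fin N → ℤ}
    {p : Fin (2 * (k + 1) + 1) → Fin N → ℤ} (hp : p ∈ tuples ω (k + 1) m)
    (i : Fin (2 * (k + 1) + 1)) : idxNorm (p i) < idxNorm m := by
  have hsum : ∑ l, idxNorm (p l) = idxNorm m := by
    unfold idxNorm
    rw [Finset.sum_comm]
    refine Finset.sum_congr rfl fun j _ => ?_
    have := hp.2.2 j
    zify
    exact this
  obtain ⟨l, hl⟩ : ∃ l : Fin (2 * (k + 1) + 1), l ≠ i := exists_ne i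
  rw [← hsum]
  exact Finset.single_lt_sum (f := fun l => idxNorm (p l)) hl (Finset.mem_univ _) (Finset.mem_univ _) (idxNorm_pos (hp.1 l))
    fun _ _ _ => Nat.zero_le _

end Indices

/-! ### The leading profiles and the forcing terms -/

section Profiles

variable {N : ℕ}

open Classical in
/-- A function as an element of `L²` (zero if it is not square integrable). -/
def toL2 (f : AEFun) : L2 :=
  if h : MemLp f 2 (volume : Measure R3) then h.toLp f else 0

/-- The coefficient `g^{(k)}(0) / k!`. -/
def taylorCoeff (g : ℝ → ℝ) (k : ℕ) : ℂ := ((iteratedDeriv k g 0 / (k.factorial : ℝ) : ℝ) : ℂ)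

open Classical in
/-- The functions `φ̃_m(0)`, `m ∈ NR₁` (and zero for other `m`): `φ̃_{e_j}(0) = φ_j`, and for the
other `m ∈ NR₁`, `φ̃_m(0) = -(H - m · ω)⁻¹ g_m(0)` with
`g_m(0) = ∑_{k ≥ 1} g^{(k)}(0)/k! ∑_{(m₁, …, m_{2k+1}) ∈ A(k, m)} φ̃_{m₁}(0) ⋯ φ̃_{m_{2k+1}}(0)`.
The summation index below is `k - 1`. -/
def leadProfile (V : 𝓢(R3, ℝ)) (g : ℝ → ℝ) (ω : Fin N → ℝ) (φ : Fin N → L2)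
    (m : Fin N → ℤ) : AEFun :=
  if h : ∃ j, m = unitIdx j then (φ h.choose : AEFun)
  else if m ∈ NonRes1 ω then
    ((-resolventOp (schrodinger V) (freq ω m : ℂ) (toL2 (∑ᶠ k : ℕ, taylorCoeff g (k + 1) •
      ∑ᶠ p : tuples ω (k + 1) m, ∏ i, leadProfile V g ω φ (p.1 i))) : L2) : AEFun)
  else 0
termination_by idxNorm m
decreasing_by exact idxNorm_lt_of_mem_tuples p.2 i

/-- The expression
`∑_{k ≥ 1} g^{(k)}(0)/k! ∑_{(m₁, …, m_{2k+1}) ∈ A(k, m)} φ̃_{m₁}(0) ⋯ φ̃_{m_{2k+1}}(0)`, which is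
`g_m(0)` for `m ∈ NR₁ \ NR₀` and the forcing coefficient `G_m` for `m ∈ R_min`. -/
def forcing (V : 𝓢(R3, ℝ)) (g : ℝ → ℝ) (ω : Fin N → ℝ) (φ : Fin N → L2)
    (m : Fin N → ℤ) : AEFun :=
  ∑ᶠ k : ℕ, taylorCoeff g (k + 1) •
    ∑ᶠ p : tuples ω (k + 1) m, ∏ i, leadProfile V g ω φ (p.1 i)

theorem unitIdx_injective : Function.Injective (unitIdx : Fin N → Fin N → ℤ) := by
  intro a b h
  by_contra hab
  have := congrFun h a
  simp [unitIdx, hab] at this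

theorem leadProfile_unitIdx (V : 𝓢(R3, ℝ)) (g : ℝ → ℝ) (ω : Fin N → ℝ) (φ : Fin N → L2)
    (j : Fin N) : leadProfile V g ω φ (unitIdx j) = (φ j : AEFun) := by
  have h : ∃ l, (unitIdx j : Fin N → ℤ) = unitIdx l := ⟨j, rfl⟩
  rw [leadProfile, dif_pos h, ← unitIdx_injective h.choose_spec]

theorem leadProfile_of_mem (V : 𝓢(R3, ℝ)) (g : ℝ → ℝ) (ω : Fin N → ℝ) (φ : Fin N → L2)
    {m : Fin N → ℤ} (hm : m ∈ NonRes1 ω) (h : ∀ j, m ≠ unitIdx j) :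
    leadProfile V g ω φ m =
      ((-resolventOp (schrodinger V) (freq ω m : ℂ) (toL2 (forcing V g ω φ m)) : L2) : AEFun) := by
  have h' : ¬ ∃ j, m = unitIdx j := fun ⟨j, hj⟩ => h j hj
  rw [leadProfile, dif_neg h', if_pos hm, forcing]

/-! ### The refined profile -/

/-- `z^m = ∏_j z_j^{(m_j)}`, where `z^{(k)} = z^k` for `k ≥ 0` and `z^{(k)} = conj(z)^{-k}` for
`k < 0`. -/
def zPow (z : Fin N → ℂ) (m : Fin N → ℤ) : ℂ :=
  ∏ j, if 0 ≤ m j then z j ^ (m j).toNat else (starRingEnd ℂ (z j)) ^ (-m j).toNat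

/-- `|z|² = (|z₁|², …, |z_N|²)`. -/
def absSq (z : Fin N → ℂ) : Fin N → ℝ := fun j => ‖z j‖ ^ 2

/-- `‖z‖ = ∑_j |z_j|`. -/
def zNorm (z : Fin N → ℂ) : ℝ := ∑ j, ‖z j‖

/-- The ball of radius `r` about `0` in `ℝ^N`, for the norm `∑_j |y_j|`. -/
def realBall (N : ℕ) (r : ℝ) : Set (Fin N → ℝ) := {y | ∑ j, |y j| < r}

/-- The ball of radius `r` about `0` in `ℂ^N`, for the norm `∑_j |z_j|`. -/
def complexBall (N : ℕ) (r : ℝ) : Set (Fin N → ℂ) := {z | zNorm z < r}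

/-- The refined profile `φ(z) = z · φ + ∑_{m ∈ NR₁} z^m ψ_m(|z|²)`. -/
def refinedProfile {γ s : ℝ} (ω : Fin N → ℝ) (φ : Fin N → L2)
    (ψ : (Fin N → ℤ) → (Fin N → ℝ) → SigmaSp γ s) (z : Fin N → ℂ) : L2 :=
  ∑ j, z j • φ j + ∑ᶠ m ∈ NonRes1 ω, zPow z m • (ψ m (absSq z)).toL2

/-- `z_j(t) = e^{-i ϖ_j(|z|²) t} z_j`. -/
def zFlow (ϖ : (Fin N → ℝ) → Fin N → ℝ) (z : Fin N → ℂ) (t : ℝ) : Fin N → ℂ :=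
  fun j => Complex.exp (-(Complex.I * (ϖ (absSq z) j : ℂ) * (t : ℂ))) * z j

/-- `u : ℝ → L²` is a strong solution, for all times, of `i ∂_t u = H u + g(|u|²) u - F(t)`. -/
def SolvesForcedNLS (V : 𝓢(R3, ℝ)) (g : ℝ → ℝ) (F : ℝ → AEFun) (u : ℝ → L2) : Prop :=
  ∀ t : ℝ, ∃ (h : u t ∈ (schrodinger V).domain) (u' : L2), HasDerivAt u u' t ∧
    ∀ᵐ x, Complex.I * u' x =
      schrodinger V ⟨u t, h⟩ x + (g (‖u t x‖ ^ 2) : ℂ) * u t x - F t x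

end Profiles

end NLSProfile

end

open NLSProfile

/-!
The refined profile is built on real functions that decay exponentially. The eigenfunctions `φ_j`,
all profiles `ψ_m`, the forcing terms and the real and imaginary parts of the remainder are written
`e^{-α⟨x⟩} a` with `a` in the real Banach algebra `Ck k` of `C^k` functions on `ℝ³` with bounded
derivatives, where `9 α² < -m·ω` for all `m ∈ NR₁`. For `γ < α` and `s ≤ k` the map
`emb : a ↦ e^{-α⟨x⟩} a` goes into `Σ^s_γ`, continuously (`exists_sigmaEmb`), so that `Σ^s` enters
only in the last step.

*Indices.* `R_min` is an antichain for the product order on `|m|`, hence finite (`resMin_finite`).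
An index of `NR₁` with two large coordinates would lie above a resonant one, so `NR₁` is finite too
(`nonRes1_finite`).

*Linear theory.* The operator `H` is a relatively compact perturbation of `-Δ`; by the Fredholm
alternative a negative number outside the discrete spectrum lies in the resolvent set
(`freq_notMem_spec`). The free resolvent `(-Δ + κ)⁻¹` is convolution with a measure which is a
superposition of Gaussians and has exponential moments, so it acts on the weighted `C^k_b`
(`exists_weightedRes`); by the Sobolev embedding and a splitting of `V` into a rapidly decaying and
a small part, `(H - m·ω)⁻¹` does too, and eigenfunctions lie in the image of `emb`
(`exists_emb_eigenfunction`). For `m = e_j` the inverse is taken modulo `φ_j`.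

*Nonlinear equations.* For `u = ∑_m z^m v_m` the modulus `|u|²` splits into a part depending only on
`x = |z|²` and products of off-diagonal terms. A Taylor expansion of `g` about the first part gives
`g(|u|²) u = ∑_m z^m f_m(|z|², v) + …`, with coefficients `f_m` (`nlCoef`) depending smoothly on
`|z|²` and `v` because `u ↦ g ∘ u` is smooth on the algebra `Ck k`. Requiring the `z^m`
coefficients, `m ∈ NR₁`, of the equation to vanish is a fixed point problem `y = T(x, y)` for
`y = (ϖ, ψ)`. At `x = 0` the `m`-th component depends only on components with smaller `‖m‖`, so an
iterate of `T(0, ·)` is constant, its derivative is nilpotent, and the inverse function theorem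
gives a unique smooth solution (`exists_profiles`). At `x = 0` the equations are the recursion that
defines the leading profiles, with `f_m(0, v(0)) = G_m` (`leadProfile_eq`, `forcing_eq`).

*Remainder.* What is left over consists of the terms `z^m (f_m(|z|²) - f_m(0))`, `m ∈ R_min`, the
terms with `m ∉ NR₁ ∪ R_min`, and the Taylor remainder. An index outside `NR₁ ∪ R_min` is strictly
larger than some `n ∈ R_min`, and then `‖m‖ - ‖n‖ ≥ 2` by parity, so that `|z^m| ≤ ‖z‖² |z^n|`.
High powers of products `z_i z_j`, `i ≠ j`, are small in the same sense, because there is an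
`n ∈ R_min` supported on `{i, j}` (`isBigO_remPart`).

*Consistency.* The solution in `Ck k`, viewed in `Ck 0`, solves the equations there, and local
uniqueness identifies it with the solution of lowest regularity (`exists_isSolution`). Hence the
objects belonging to different `s` agree on the smaller of the balls.
-/

noncomputable section

namespace NLSProfile

/-! ### Combinatorics of resonant and non-resonant indices -/

section Indices

variable {N : ℕ}

/-- The vector `|m|` of absolute values, with values in `ℕ`. -/
def absVec (m : Fin N → ℤ) : Fin N → ℕ := fun j => (m j).natAbs

theorem absLt_iff {m n : Fin N → ℤ} : AbsLt m n ↔ absVec m < absVec n := by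
  rw [Pi.lt_def]
  simp only [AbsLt, absVec, Pi.le_def, Int.abs_eq_natAbs]
  constructor
  · rintro ⟨h, j, hj⟩
    exact ⟨fun j => by have := h j; omega, j, by have := h j; omega⟩
  · rintro ⟨h, j, hj⟩
    exact ⟨fun j => by have := h j; omega, j, by omega⟩

theorem finite_absVec_fiber (v : Fin N → ℕ) : {m : Fin N → ℤ | absVec m ≤ v}.Finite := by
  refine (Set.Finite.pi fun j : Fin N => Set.finite_Icc (-(v j : ℤ)) (v j)).subset ?_
  intro m hm j _
  have := hm j
  simp only [absVec] at this
  simp only [Set.mem_Icc]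
  omega

theorem resMin_finite (ω : Fin N → ℝ) : (ResMin ω).Finite := by
  have hanti : IsAntichain (· ≤ ·) (absVec '' ResMin ω) := by
    rintro _ ⟨m, hm, rfl⟩ _ ⟨n, hn, rfl⟩ hne hle
    exact hn.2 ⟨m, hm.1, absLt_iff.mpr (lt_of_le_of_ne hle hne)⟩
  have hfin := WellQuasiOrderedLE.finite_of_isAntichain hanti
  refine (hfin.biUnion fun v _ => finite_absVec_fiber v).subset fun m hm => ?_
  exact Set.mem_biUnion ⟨m, hm, rfl⟩ (le_refl (absVec m))

theorem exists_resMin_le {ω : Fin N → ℝ} {m : Fin N → ℤ} (hm : m ∈ Res ω) :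
    ∃ n ∈ ResMin ω, absVec n ≤ absVec m := by
  induction h : absVec m using WellFoundedLT.induction generalizing m with
  | ind v ih =>
    by_cases hmin : ∃ n ∈ Res ω, AbsLt n m
    · obtain ⟨n, hn, hlt⟩ := hmin
      rw [absLt_iff, h] at hlt
      obtain ⟨r, hr, hle⟩ := ih _ hlt hn rfl
      exact ⟨r, hr, hle.trans hlt.le⟩
    · exact ⟨m, ⟨hm, hmin⟩, h.le⟩

theorem sum_unitIdx (j : Fin N) : ∑ l, unitIdx j l = 1 := by
  simp [unitIdx]

theorem freq_unitIdx (ω : Fin N → ℝ) (j : Fin N) : freq ω (unitIdx j) = ω j := by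
  simp [freq, unitIdx, Pi.single_apply]

theorem freq_sub (ω : Fin N → ℝ) (m n : Fin N → ℤ) : freq ω (m - n) = freq ω m - freq ω n := by
  simp [freq, sub_mul, Finset.sum_sub_distrib]

theorem freq_smul (ω : Fin N → ℝ) (c : ℤ) (m : Fin N → ℤ) : freq ω (c • m) = c * freq ω m := by
  simp [freq, Finset.mul_sum, mul_assoc]

theorem freq_add (ω : Fin N → ℝ) (m n : Fin N → ℤ) : freq ω (m + n) = freq ω m + freq ω n := by
  simp [freq, add_mul, Finset.sum_add_distrib]

/-- For any two distinct modes some minimal resonant index is supported on them: for `ω_j < ω_i`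
the index `(p + 1) e_i - p e_j` is resonant as soon as `p` is large. -/
theorem exists_resMin_pair {ω : Fin N → ℝ} (hinj : Function.Injective ω) {i j : Fin N}
    (hij : i ≠ j) : ∃ r ∈ ResMin ω, ∀ l, l ≠ i → l ≠ j → r l = 0 := by
  wlog hlt : ω j < ω i generalizing i j
  · obtain ⟨r, hr, h⟩ := this hij.symm
      (lt_of_le_of_ne (not_lt.mp hlt) fun h => hij (hinj h))
    exact ⟨r, hr, fun l h1 h2 => h l h2 h1⟩
  obtain ⟨p, hp⟩ := exists_nat_gt (-ω i / (ω i - ω j))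
  rw [div_lt_iff₀ (by linarith)] at hp
  have hres : unitIdx i + (p : ℤ) • (unitIdx i - unitIdx j) ∈ Res ω := by
    constructor
    · simp only [Pi.add_apply, Pi.smul_apply, Pi.sub_apply, smul_eq_mul, Finset.sum_add_distrib,
        ← Finset.mul_sum, Finset.sum_sub_distrib, sum_unitIdx]
      simp
    · rw [freq_add, freq_smul, freq_sub, freq_unitIdx, freq_unitIdx]
      push_cast
      linarith
  obtain ⟨r, hr, hle⟩ := exists_resMin_le hres
  refine ⟨r, hr, fun l hi hj => ?_⟩
  have := hle l
  simpa [absVec, unitIdx, hi, hj] using this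

/-- A bound for all entries of all minimal resonant indices. -/
theorem exists_resMin_bound (ω : Fin N → ℝ) : ∃ P : ℕ, ∀ r ∈ ResMin ω, ∀ l, (r l).natAbs ≤ P := by
  obtain ⟨P, hP⟩ := ((resMin_finite ω).image idxNorm).bddAbove
  refine ⟨P, fun r hr l => le_trans ?_ (hP ⟨r, hr, rfl⟩)⟩
  exact Finset.single_le_sum (f := fun l => (r l).natAbs) (fun _ _ => Nat.zero_le _)
    (Finset.mem_univ l)

/-- An index in `NR₁` has at most one large entry (two large entries would make it larger than a
minimal resonant index supported on them), and its entries add up to `1`. -/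
theorem nonRes1_finite {ω : Fin N → ℝ} (hinj : Function.Injective ω) : (NonRes1 ω).Finite := by
  obtain ⟨P, hP⟩ := exists_resMin_bound ω
  refine (finite_absVec_fiber fun _ : Fin N => 1 + N * (P + 1)).subset ?_
  intro m hm i
  by_contra hcon
  have hi : 1 + N * (P + 1) < (m i).natAbs := not_le.mp hcon
  have hsmall : ∀ j ∈ Finset.univ.erase i, (m j).natAbs ≤ P := by
    intro j hj
    have hji : j ≠ i := Finset.ne_of_mem_erase hj
    by_contra hbig
    rw [not_le] at hbig
    obtain ⟨r, hr, hr0⟩ := exists_resMin_pair hinj hji.symm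
    refine hm.2 r hr (absLt_iff.mpr (Pi.lt_def.mpr ⟨fun l => ?_, j, ?_⟩))
    · by_cases hli : l = i
      · subst hli
        have h1 := hP r hr l
        have : P ≤ N * (P + 1) := by
          have : 0 < N := l.pos
          nlinarith
        simp only [absVec]; omega
      · by_cases hlj : l = j
        · subst hlj
          have h1 := hP r hr l
          simp only [absVec]; omega
        · simp [absVec, hr0 l hli hlj]
    · have h1 := hP r hr j
      simp only [absVec]; omega
  have h1 : ∑ j, m j = 1 := hm.1.1
  rw [← Finset.add_sum_erase _ _ (Finset.mem_univ i)] at h1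
  have h2 : |∑ j ∈ Finset.univ.erase i, m j| ≤ ∑ j ∈ Finset.univ.erase i, (P : ℤ) :=
    (Finset.abs_sum_le_sum_abs _ _).trans
      (Finset.sum_le_sum fun j hj => by
        have := hsmall j hj
        rw [Int.abs_eq_natAbs]
        omega)
  have h3 : (∑ j ∈ (Finset.univ : Finset (Fin N)).erase i, (P : ℤ)) ≤ N * (P + 1) := by
    rw [Finset.sum_const, nsmul_eq_mul, Finset.card_erase_of_mem (Finset.mem_univ i),
      Finset.card_univ, Fintype.card_fin]
    have : ((N - 1 : ℕ) : ℤ) ≤ N := by omega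
    nlinarith
  have hi' : (1 + N * (P + 1) : ℤ) < |m i| := by
    have h4 : |m i| = ((m i).natAbs : ℤ) := Int.abs_eq_natAbs _
    rw [h4]
    exact_mod_cast hi
  rw [abs_le] at h2
  rcases abs_cases (m i) with h | h <;> linarith [h2.1, h2.2]

theorem unitIdx_mem_nonRes1 {ω : Fin N → ℝ} (hneg : ∀ j, ω j < 0) (j : Fin N) :
    unitIdx j ∈ NonRes1 ω := by
  refine ⟨⟨sum_unitIdx j, by rw [freq_unitIdx]; exact hneg j⟩, fun n hn hlt => ?_⟩
  obtain ⟨hle, l, hl⟩ := Pi.lt_def.mp (absLt_iff.mp hlt)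
  have hl' : l = j := by
    by_contra h
    simp [absVec, unitIdx, h] at hl
  subst hl'
  have hz : ∀ i, n i = 0 := by
    intro i
    by_cases hi : i = l
    · subst hi
      simpa [absVec, unitIdx] using hl
    · have := hle i
      simpa [absVec, unitIdx, hi] using this
  have h1 : ∑ i, n i = 1 := hn.1.1
  simp [hz] at h1

theorem freq_ne_of_ne {ω : Fin N → ℝ} (hind : ∀ m : Fin N → ℤ, m ≠ 0 → ∑ j, (m j : ℝ) * ω j ≠ 0)
    {m n : Fin N → ℤ} (h : m ≠ n) : freq ω m ≠ freq ω n := by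
  intro heq
  refine hind (m - n) (sub_ne_zero.mpr h) ?_
  have := freq_sub ω m n
  rw [heq, sub_self] at this
  exact this

/-- Every index with entry sum `1` outside `NR₁` dominates a minimal resonant one, and strictly so
unless it is minimal resonant itself. -/
theorem exists_resMin_of_notMem {ω : Fin N → ℝ}
    (hind : ∀ m : Fin N → ℤ, m ≠ 0 → ∑ j, (m j : ℝ) * ω j ≠ 0) {m : Fin N → ℤ}
    (hsum : ∑ j, m j = 1) (hm : m ∉ NonRes1 ω) (hm' : m ∉ ResMin ω) :
    ∃ r ∈ ResMin ω, absVec r < absVec m := by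
  have hm0 : m ≠ 0 := by rintro rfl; simp at hsum
  rcases lt_or_gt_of_ne (hind m hm0) with h | h
  · have : ¬ ∀ n ∈ ResMin ω, ¬ AbsLt n m := fun hc => hm ⟨⟨hsum, h⟩, hc⟩
    push Not at this
    obtain ⟨r, hr, hlt⟩ := this
    exact ⟨r, hr, absLt_iff.mp hlt⟩
  · have hres : m ∈ Res ω := ⟨hsum, h⟩
    have : ∃ n ∈ Res ω, AbsLt n m := by
      by_contra hc
      exact hm' ⟨hres, hc⟩
    obtain ⟨n, hn, hlt⟩ := this
    obtain ⟨r, hr, hle⟩ := exists_resMin_le hn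
    exact ⟨r, hr, hle.trans_lt (absLt_iff.mp hlt)⟩

/-! ### Monomials -/

/-- The one-variable factor `z^{(a)}` of `z^m`. -/
def zFac (z : ℂ) (a : ℤ) : ℂ := if 0 ≤ a then z ^ a.toNat else (starRingEnd ℂ z) ^ (-a).toNat

theorem zPow_eq_prod (z : Fin N → ℂ) (m : Fin N → ℤ) : zPow z m = ∏ j, zFac (z j) (m j) := rfl

theorem norm_zFac (z : ℂ) (a : ℤ) : ‖zFac z a‖ = ‖z‖ ^ a.natAbs := by
  unfold zFac
  split_ifs with h
  · rw [norm_pow]; congr 1; omega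
  · rw [norm_pow, RCLike.norm_conj]; congr 1; omega

theorem conj_zFac (z : ℂ) (a : ℤ) : starRingEnd ℂ (zFac z a) = zFac z (-a) := by
  unfold zFac
  rcases lt_trichotomy a 0 with h | h | h
  · rw [if_neg (by omega), if_pos (by omega), map_pow, RingHomCompTriple.comp_apply,
      RingHom.id_apply]
  · subst h; simp
  · rw [if_pos (by omega), if_neg (by omega), map_pow, neg_neg]

theorem zFac_natCast (z : ℂ) (a : ℕ) : zFac z a = z ^ a := by simp [zFac]

theorem zFac_neg_natCast (z : ℂ) (a : ℕ) : zFac z (-a) = (starRingEnd ℂ z) ^ a := by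
  rw [← conj_zFac, zFac_natCast, map_pow]

theorem zFac_mul_pos_neg (z : ℂ) (a b : ℕ) : zFac z a * zFac z (-b) =
    zFac z (a - b) * ((‖z‖ ^ 2 : ℝ) : ℂ) ^ (min a b) := by
  have hn : z * starRingEnd ℂ z = ((‖z‖ ^ 2 : ℝ) : ℂ) := by
    rw [Complex.mul_conj, Complex.normSq_eq_norm_sq]
  rw [zFac_natCast, zFac_neg_natCast]
  rcases le_total a b with h | h
  · obtain ⟨c, rfl⟩ := Nat.exists_eq_add_of_le h
    rw [min_eq_left h, show ((a : ℤ) - ((a + c : ℕ) : ℤ)) = -(c : ℤ) by push_cast; ring,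
      zFac_neg_natCast, ← hn, mul_pow, pow_add]
    ring
  · obtain ⟨c, rfl⟩ := Nat.exists_eq_add_of_le h
    rw [min_eq_right h, show ((b + c : ℕ) : ℤ) - (b : ℤ) = c by push_cast; ring,
      zFac_natCast, ← hn, mul_pow, pow_add]
    ring

theorem zFac_mul (z : ℂ) (a b : ℤ) : zFac z a * zFac z b =
    zFac z (a + b) * ((‖z‖ ^ 2 : ℝ) : ℂ) ^ ((a.natAbs + b.natAbs - (a + b).natAbs) / 2) := by
  obtain ⟨m, rfl | rfl⟩ := a.eq_nat_or_neg <;> obtain ⟨n, rfl | rfl⟩ := b.eq_nat_or_neg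
  · rw [show ((m : ℤ).natAbs + (n : ℤ).natAbs - ((m : ℤ) + n).natAbs) / 2 = 0 by omega, pow_zero,
      mul_one, ← Nat.cast_add, zFac_natCast, zFac_natCast, zFac_natCast, pow_add]
  · rw [zFac_mul_pos_neg, ← sub_eq_add_neg]
    congr 2
    omega
  · rw [mul_comm, zFac_mul_pos_neg, show -(m : ℤ) + n = n - m by ring]
    congr 2
    omega
  · rw [show ((-m : ℤ).natAbs + (-n : ℤ).natAbs - (-(m : ℤ) + -n).natAbs) / 2 = 0 by omega,
      pow_zero, mul_one, ← neg_add, ← Nat.cast_add, zFac_neg_natCast, zFac_neg_natCast,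
      zFac_neg_natCast, pow_add]

/-- The exponent `(∑ |q_i| - |∑ q_i|) / 2` of `|z|²` in the product of the monomials `z^{q_i}`. -/
def excess {ι : Type*} (s : Finset ι) (q : ι → Fin N → ℤ) (j : Fin N) : ℕ :=
  (∑ i ∈ s, (q i j).natAbs - (∑ i ∈ s, q i j).natAbs) / 2

theorem two_mul_excess {ι : Type*} (s : Finset ι) (q : ι → Fin N → ℤ) (j : Fin N) :
    2 * excess s q j + (∑ i ∈ s, q i j).natAbs = ∑ i ∈ s, (q i j).natAbs := by
  classical
  unfold excess
  induction s using Finset.induction_on with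
  | empty => simp
  | insert i s hi ih =>
    rw [Finset.sum_insert hi, Finset.sum_insert hi]
    omega

theorem prod_zFac {ι : Type*} (s : Finset ι) (q : ι → Fin N → ℤ) (z : ℂ) (j : Fin N) :
    ∏ i ∈ s, zFac z (q i j) =
      zFac z (∑ i ∈ s, q i j) * ((‖z‖ ^ 2 : ℝ) : ℂ) ^ excess s q j := by
  classical
  induction s using Finset.induction_on with
  | empty => simp [zFac, excess]
  | insert i s hi ih =>
    rw [Finset.prod_insert hi, ih, ← mul_assoc, zFac_mul, Finset.sum_insert hi, mul_assoc,
      ← pow_add]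
    congr 2
    have h1 := two_mul_excess s q j
    have h2 := two_mul_excess (insert i s) q j
    rw [Finset.sum_insert hi, Finset.sum_insert hi] at h2
    omega

theorem prod_zPow {ι : Type*} (s : Finset ι) (q : ι → Fin N → ℤ) (z : Fin N → ℂ) :
    ∏ i ∈ s, zPow z (q i) =
      zPow z (∑ i ∈ s, q i) * ((∏ j, absSq z j ^ excess s q j : ℝ) : ℂ) := by
  simp only [zPow_eq_prod]
  rw [Finset.prod_comm, Complex.ofReal_prod, ← Finset.prod_mul_distrib]
  refine Finset.prod_congr rfl fun j _ => ?_
  rw [prod_zFac, Finset.sum_apply, Complex.ofReal_pow, Complex.ofReal_pow, absSq,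
    Complex.ofReal_pow]

theorem conj_zPow (z : Fin N → ℂ) (m : Fin N → ℤ) :
    starRingEnd ℂ (zPow z m) = zPow z (-m) := by
  simp only [zPow_eq_prod, map_prod, conj_zFac, Pi.neg_apply]

theorem norm_zPow (z : Fin N → ℂ) (m : Fin N → ℤ) : ‖zPow z m‖ = ∏ j, ‖z j‖ ^ absVec m j := by
  simp only [zPow_eq_prod, norm_prod, norm_zFac]; rfl

theorem norm_zPow_sq (z : Fin N → ℂ) (m : Fin N → ℤ) :
    ‖zPow z m‖ ^ 2 = ∏ j, absSq z j ^ absVec m j := by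
  rw [norm_zPow, ← Finset.prod_pow]
  refine Finset.prod_congr rfl fun j _ => ?_
  rw [absSq, ← pow_mul, ← pow_mul, mul_comm]

theorem zPow_unitIdx (z : Fin N → ℂ) (j : Fin N) : zPow z (unitIdx j) = z j := by
  rw [zPow_eq_prod, Finset.prod_eq_single j]
  · simp [unitIdx, zFac]
  · intro l _ hl; simp [unitIdx, zFac, hl]
  · simp

theorem zNorm_nonneg (z : Fin N → ℂ) : 0 ≤ zNorm z := Finset.sum_nonneg fun _ _ => norm_nonneg _

theorem norm_apply_le_zNorm (z : Fin N → ℂ) (j : Fin N) : ‖z j‖ ≤ zNorm z :=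
  Finset.single_le_sum (f := fun j => ‖z j‖) (fun _ _ => norm_nonneg _) (Finset.mem_univ j)

theorem sum_abs_absSq_le (z : Fin N → ℂ) : ∑ j, |absSq z j| ≤ zNorm z ^ 2 := by
  unfold absSq zNorm
  rw [Finset.sum_congr rfl fun j _ => abs_of_nonneg (sq_nonneg ‖z j‖)]
  exact Finset.sum_sq_le_sq_sum_of_nonneg fun _ _ => norm_nonneg _

/-- A strictly smaller index with the same entry sum is smaller by at least two. -/
theorem norm_zPow_le_of_lt {z : Fin N → ℂ} (hz : zNorm z ≤ 1) {r m : Fin N → ℤ}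
    (hsum : ∑ j, r j = ∑ j, m j) (h : absVec r < absVec m) :
    ‖zPow z m‖ ≤ zNorm z ^ 2 * ‖zPow z r‖ := by
  obtain ⟨hle, -⟩ := Pi.lt_def.mp h
  have h1 : ∀ j, ‖z j‖ ^ absVec m j ≤ zNorm z ^ (absVec m j - absVec r j) * ‖z j‖ ^ absVec r j := by
    intro j
    conv_lhs => rw [← Nat.sub_add_cancel (hle j), pow_add]
    gcongr
    exact norm_apply_le_zNorm z j
  rw [norm_zPow, norm_zPow]
  refine (Finset.prod_le_prod (fun _ _ => by positivity) fun j _ => h1 j).trans ?_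
  rw [Finset.prod_mul_distrib, Finset.prod_pow_eq_pow_sum]
  refine mul_le_mul_of_nonneg_right ?_ (Finset.prod_nonneg fun _ _ => by positivity)
  refine pow_le_pow_of_le_one (zNorm_nonneg z) hz ?_
  have hpar : ∀ q : Fin N → ℤ, ((∑ j, absVec q j : ℕ) : ℤ) % 2 = (∑ j, q j) % 2 := by
    intro q
    have hdvd : (2 : ℤ) ∣ ((∑ j, absVec q j : ℕ) : ℤ) - ∑ j, q j := by
      push_cast
      rw [← Finset.sum_sub_distrib]
      exact Finset.dvd_sum fun j _ => by simp only [absVec]; omega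
    omega
  have hlt : ∑ j, absVec r j < ∑ j, absVec m j := by
    obtain ⟨-, l, hl⟩ := Pi.lt_def.mp h
    exact Finset.sum_lt_sum (fun j _ => hle j) ⟨l, Finset.mem_univ l, hl⟩
  have hr := hpar r
  have hm := hpar m
  have hsub : ∑ j, (absVec m j - absVec r j) = ∑ j, absVec m j - ∑ j, absVec r j :=
    Finset.sum_tsub_distrib _ fun j _ => hle j
  rw [hsub]
  omega

/-- Two different indices with entry sum `1` involve two different modes. -/
theorem exists_pair_of_ne {m n : Fin N → ℤ} (hm : ∑ j, m j = 1) (hn : ∑ j, n j = 1)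
    (h : m ≠ n) : ∃ i j, i ≠ j ∧ ∀ z : Fin N → ℂ, zNorm z ≤ 1 →
      ‖zPow z m‖ * ‖zPow z n‖ ≤ ‖z i‖ * ‖z j‖ := by
  have hle1 : ∀ (z : Fin N → ℂ), zNorm z ≤ 1 → ∀ q : Fin N → ℤ, ‖zPow z q‖ ≤ 1 := by
    intro z hz q
    rw [norm_zPow]
    exact Finset.prod_le_one (fun _ _ => by positivity) fun j _ =>
      pow_le_one₀ (norm_nonneg _) ((norm_apply_le_zNorm z j).trans hz)
  have hone : ∀ (z : Fin N → ℂ), zNorm z ≤ 1 → ∀ (q : Fin N → ℤ) (i : Fin N), q i ≠ 0 →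
      ‖zPow z q‖ ≤ ‖z i‖ := by
    intro z hz q i hi
    have hz1 : ∀ j, ‖z j‖ ≤ 1 := fun j => (norm_apply_le_zNorm z j).trans hz
    rw [norm_zPow, ← Finset.mul_prod_erase _ _ (Finset.mem_univ i)]
    calc _ ≤ ‖z i‖ * 1 := by
          gcongr
          · exact pow_le_of_le_one (norm_nonneg _) (hz1 i) (by simpa [absVec] using hi)
          · exact Finset.prod_le_one (fun _ _ => by positivity) fun j _ =>
              pow_le_one₀ (norm_nonneg _) (hz1 j)
      _ = ‖z i‖ := mul_one _
  have htwo : ∀ (z : Fin N → ℂ), zNorm z ≤ 1 → ∀ (q : Fin N → ℤ) (i j : Fin N), i ≠ j → q i ≠ 0 →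
      q j ≠ 0 → ‖zPow z q‖ ≤ ‖z i‖ * ‖z j‖ := by
    intro z hz q i j hij hi hj
    have hz1 : ∀ j, ‖z j‖ ≤ 1 := fun j => (norm_apply_le_zNorm z j).trans hz
    rw [norm_zPow, ← Finset.mul_prod_erase _ _ (Finset.mem_univ i),
      ← Finset.mul_prod_erase _ _ (Finset.mem_erase.mpr ⟨hij.symm, Finset.mem_univ j⟩)]
    calc _ ≤ ‖z i‖ * (‖z j‖ * 1) := by
          gcongr
          · exact pow_le_of_le_one (norm_nonneg _) (hz1 i) (by simpa [absVec] using hi)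
          · exact pow_le_of_le_one (norm_nonneg _) (hz1 j) (by simpa [absVec] using hj)
          · exact Finset.prod_le_one (fun _ _ => by positivity) fun j _ =>
              pow_le_one₀ (norm_nonneg _) (hz1 j)
      _ = ‖z i‖ * ‖z j‖ := by rw [mul_one]
  have hex : ∀ q : Fin N → ℤ, ∑ j, q j = 1 → ∃ i, q i ≠ 0 := by
    intro q hq
    by_contra hc
    push Not at hc
    simp [hc] at hq
  obtain ⟨i, hi⟩ := hex m hm
  by_cases hm2 : ∃ j, i ≠ j ∧ m j ≠ 0
  · obtain ⟨j, hij, hj⟩ := hm2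
    exact ⟨i, j, hij, fun z hz => (mul_le_of_le_one_right (norm_nonneg _) (hle1 z hz n)).trans
      (htwo z hz m i j hij hi hj)⟩
  · push Not at hm2
    -- `m = e_i`, so `n ≠ e_i` has a nonzero entry other than the `i`-th
    have hmi : m i = 1 := by
      rw [Finset.sum_eq_single i (fun j _ hj => hm2 j (Ne.symm hj)) (by simp)] at hm
      exact hm
    have : ∃ j, i ≠ j ∧ n j ≠ 0 := by
      by_contra hc
      push Not at hc
      have hni : n i = 1 := by
        rw [Finset.sum_eq_single i (fun j _ hj => hc j (Ne.symm hj)) (by simp)] at hn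
        exact hn
      refine h (funext fun j => ?_)
      by_cases hj : i = j
      · subst hj; rw [hmi, hni]
      · rw [hm2 j hj, hc j hj]
    obtain ⟨j, hij, hj⟩ := this
    exact ⟨i, j, hij, fun z hz => mul_le_mul (hone z hz m i hi) (hone z hz n j hj)
      (norm_nonneg _) (norm_nonneg _)⟩

/-- The quantity `‖z‖² ∑_{m ∈ R_min} |z^m|` that controls the remainder. -/
def resBound (ω : Fin N → ℝ) (z : Fin N → ℂ) : ℝ :=
  zNorm z ^ 2 * ∑ᶠ m ∈ ResMin ω, ‖zPow z m‖

theorem resBound_nonneg (ω : Fin N → ℝ) (z : Fin N → ℂ) : 0 ≤ resBound ω z :=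
  mul_nonneg (sq_nonneg _) (finsum_nonneg fun _ => finsum_nonneg fun _ => norm_nonneg _)

theorem le_resBound {ω : Fin N → ℝ} {r : Fin N → ℤ} (hr : r ∈ ResMin ω) (z : Fin N → ℂ) :
    zNorm z ^ 2 * ‖zPow z r‖ ≤ resBound ω z := by
  refine mul_le_mul_of_nonneg_left ?_ (sq_nonneg _)
  rw [finsum_mem_eq_finite_toFinset_sum _ (resMin_finite ω)]
  exact Finset.single_le_sum (f := fun m => ‖zPow z m‖) (fun _ _ => norm_nonneg _) (by simpa)

theorem pow_le_resBound {ω : Fin N → ℝ} (hinj : Function.Injective ω) : ∃ P : ℕ,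
    ∀ i j, i ≠ j → ∀ z : Fin N → ℂ, zNorm z ≤ 1 → ∀ K, P ≤ K →
      (‖z i‖ * ‖z j‖) ^ (K + 1) ≤ resBound ω z := by
  obtain ⟨P, hP⟩ := exists_resMin_bound ω
  refine ⟨P, fun i j hij z hz K hK => ?_⟩
  obtain ⟨r, hr, hr0⟩ := exists_resMin_pair hinj hij
  refine le_trans ?_ (le_resBound hr z)
  have hz1 : ∀ j, ‖z j‖ ≤ 1 := fun j => (norm_apply_le_zNorm z j).trans hz
  have h1 : (‖z i‖ * ‖z j‖) ^ K ≤ ‖zPow z r‖ := by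
    rw [norm_zPow, ← Finset.mul_prod_erase _ _ (Finset.mem_univ i),
      ← Finset.mul_prod_erase _ _ (Finset.mem_erase.mpr ⟨hij.symm, Finset.mem_univ j⟩),
      Finset.prod_eq_one, mul_one, mul_pow]
    · exact mul_le_mul (pow_le_pow_of_le_one (norm_nonneg _) (hz1 i) ((hP r hr i).trans hK))
        (pow_le_pow_of_le_one (norm_nonneg _) (hz1 j) ((hP r hr j).trans hK))
        (by positivity) (by positivity)
    · intro l hl
      simp only [Finset.mem_erase, Finset.mem_univ, and_true] at hl
      simp [absVec, hr0 l hl.2 hl.1]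
  rw [pow_succ, mul_comm, sq]
  exact mul_le_mul (mul_le_mul (norm_apply_le_zNorm z i) (norm_apply_le_zNorm z j)
    (norm_nonneg _) (zNorm_nonneg z)) h1 (by positivity)
    (mul_nonneg (zNorm_nonneg z) (zNorm_nonneg z))

end Indices

/-! ### The algebras of `C^k` functions with bounded derivatives -/

section

open scoped BoundedContinuousFunction

/-- The covector on `ℝ³` with coordinates `v`. -/
def covec (v : Fin 3 → ℝ) : R3 →L[ℝ] ℝ := ∑ i, v i • (EuclideanSpace.proj i : R3 →L[ℝ] ℝ)

@[simp] theorem covec_apply (v : Fin 3 → ℝ) (x : R3) : covec v x = ∑ i, v i * x i := by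
  simp [covec]

/-- `g` is the gradient of `f` at every point. -/
def HasGrad (f : R3 → ℝ) (g : Fin 3 → R3 → ℝ) : Prop :=
  ∀ x, HasFDerivAt f (covec fun i => g i x) x

theorem covec_injective {v w : Fin 3 → ℝ} (h : covec v = covec w) : v = w := by
  funext i
  have := congrArg (fun L : R3 →L[ℝ] ℝ => L (EuclideanSpace.single i 1)) h
  simpa [covec_apply, PiLp.single_apply, Pi.single_apply] using this

theorem HasGrad.unique {f : R3 → ℝ} {g g' : Fin 3 → R3 → ℝ} (h : HasGrad f g)
    (h' : HasGrad f g') : g = g' := by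
  have : ∀ x, (fun i => g i x) = fun i => g' i x :=
    fun x => covec_injective ((h x).unique (h' x))
  funext i x
  exact congrFun (this x) i

theorem HasGrad.add {f₁ f₂ : R3 → ℝ} {g₁ g₂ : Fin 3 → R3 → ℝ} (h₁ : HasGrad f₁ g₁)
    (h₂ : HasGrad f₂ g₂) :
    HasGrad (fun x => f₁ x + f₂ x) (fun i x => g₁ i x + g₂ i x) := by
  intro x
  convert! (h₁ x).add (h₂ x) using 1
  ext y
  simp [add_mul, Finset.sum_add_distrib]

theorem HasGrad.mul {f₁ f₂ : R3 → ℝ} {g₁ g₂ : Fin 3 → R3 → ℝ} (h₁ : HasGrad f₁ g₁)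
    (h₂ : HasGrad f₂ g₂) :
    HasGrad (fun x => f₁ x * f₂ x) (fun i x => g₁ i x * f₂ x + f₁ x * g₂ i x) := by
  intro x
  convert! (h₁ x).mul (h₂ x) using 1
  ext y
  simp only [covec_apply, add_mul, Finset.sum_add_distrib, add_apply,
    smul_apply, smul_eq_mul, Finset.mul_sum]
  rw [add_comm]
  congr 1 <;> exact Finset.sum_congr rfl fun i _ => by ring

theorem HasGrad.const_smul {f : R3 → ℝ} {g : Fin 3 → R3 → ℝ} (c : ℝ) (h : HasGrad f g) :
    HasGrad (fun x => c * f x) (fun i x => c * g i x) := by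
  intro x
  convert! (h x).const_mul c using 1
  ext y
  simp [Finset.mul_sum, mul_assoc]

theorem hasGrad_const (c : ℝ) : HasGrad (fun _ => c) (fun _ _ => 0) := by
  intro x
  have h : (covec fun _ => 0) = 0 := by ext y; simp
  rw [h]
  exact hasFDerivAt_const c x

theorem HasGrad.comp {f : R3 → ℝ} {g : Fin 3 → R3 → ℝ} {h h' : ℝ → ℝ}
    (hh : ∀ s, HasDerivAt h (h' s) s) (hf : HasGrad f g) :
    HasGrad (fun x => h (f x)) (fun i x => h' (f x) * g i x) := by
  intro x
  convert! (hh (f x)).comp_hasFDerivAt x (hf x) using 1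
  ext y
  simp [Finset.mul_sum, mul_assoc]

/-- The algebra of functions on `ℝ³` with bounded continuous derivatives up to order `k`. -/
def ckAlg : ℕ → Subalgebra ℝ (R3 →ᵇ ℝ)
  | 0 => ⊤
  | k + 1 =>
    { carrier := {f | f ∈ ckAlg k ∧ ∃ g : Fin 3 → R3 →ᵇ ℝ, (∀ i, g i ∈ ckAlg k) ∧
        HasGrad f fun i => g i}
      mul_mem' := by
        rintro a b ⟨ha, g, hg, hag⟩ ⟨hb, g', hg', hbg⟩
        exact ⟨mul_mem ha hb, fun i => g i * b + a * g' i,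
          fun i => add_mem (mul_mem (hg i) hb) (mul_mem ha (hg' i)), hag.mul hbg⟩
      add_mem' := by
        rintro a b ⟨ha, g, hg, hag⟩ ⟨hb, g', hg', hbg⟩
        exact ⟨add_mem ha hb, fun i => g i + g' i, fun i => add_mem (hg i) (hg' i), hag.add hbg⟩
      algebraMap_mem' := by
        intro r
        exact ⟨Subalgebra.algebraMap_mem _ r, fun _ => 0, fun _ => zero_mem _, hasGrad_const r⟩ }

/-- The space `C^k_b(ℝ³, ℝ)` as a type of its own, to carry its norm. -/
def Ck (k : ℕ) : Type := ckAlg k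

instance (k : ℕ) : CommRing (Ck k) := inferInstanceAs (CommRing (ckAlg k))

instance (k : ℕ) : Algebra ℝ (Ck k) := inferInstanceAs (Algebra ℝ (ckAlg k))

namespace Ck

/-- The underlying bounded continuous function. -/
def ev {k : ℕ} : Ck k →ₐ[ℝ] (R3 →ᵇ ℝ) := (ckAlg k).val

theorem ev_injective {k : ℕ} : Function.Injective (ev : Ck k → R3 →ᵇ ℝ) :=
  Subtype.val_injective

theorem ext_ev {k : ℕ} {a b : Ck k} (h : ∀ x, ev a x = ev b x) : a = b :=
  ev_injective (BoundedContinuousFunction.ext h)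

theorem ev_mul_apply {k : ℕ} (a b : Ck k) (x : R3) : ev (a * b) x = ev a x * ev b x := by
  rw [map_mul]; rfl

theorem ev_add_apply {k : ℕ} (a b : Ck k) (x : R3) : ev (a + b) x = ev a x + ev b x := by
  rw [map_add]; rfl

theorem ev_sub_apply {k : ℕ} (a b : Ck k) (x : R3) : ev (a - b) x = ev a x - ev b x := by
  rw [map_sub]; rfl

theorem ev_smul_apply {k : ℕ} (c : ℝ) (a : Ck k) (x : R3) : ev (c • a) x = c * ev a x := by
  rw [map_smul]; rfl

theorem ev_zero_apply {k : ℕ} (x : R3) : ev (0 : Ck k) x = 0 := by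
  rw [map_zero]; rfl

theorem ev_one_apply {k : ℕ} (x : R3) : ev (1 : Ck k) x = 1 := by
  rw [map_one]; rfl

theorem ev_sum_apply {k : ℕ} {ι : Type*} (s : Finset ι) (a : ι → Ck k) (x : R3) :
    ev (∑ i ∈ s, a i) x = ∑ i ∈ s, ev (a i) x := by
  rw [map_sum, BoundedContinuousFunction.sum_apply]

theorem ev_prod_apply {k : ℕ} {ι : Type*} (s : Finset ι) (a : ι → Ck k) (x : R3) :
    ev (∏ i ∈ s, a i) x = ∏ i ∈ s, ev (a i) x := by
  classical
  induction s using Finset.induction_on with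
  | empty => simp
  | insert i s hi ih => rw [Finset.prod_insert hi, Finset.prod_insert hi, ev_mul_apply, ih]

theorem ev_pow_apply {k : ℕ} (a : Ck k) (n : ℕ) (x : R3) : ev (a ^ n) x = ev a x ^ n := by
  rw [map_pow]; rfl

/-- The inclusion `C^{k+1}_b → C^k_b`. -/
def res {k : ℕ} : Ck (k + 1) →ₐ[ℝ] Ck k := Subalgebra.inclusion fun _ h => h.1

theorem ev_res {k : ℕ} (a : Ck (k + 1)) : ev (res a) = ev a := rfl

theorem exists_grad {k : ℕ} (a : Ck (k + 1)) :
    ∃ g : Fin 3 → Ck k, HasGrad (ev a) fun i => ev (g i) := by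
  obtain ⟨-, g, hg, h⟩ := a.2
  exact ⟨fun i => ⟨g i, hg i⟩, h⟩

/-- The partial derivatives. -/
def pd {k : ℕ} (i : Fin 3) : Ck (k + 1) →ₗ[ℝ] Ck k where
  toFun a := (exists_grad a).choose i
  map_add' a b := by
    refine ext_ev fun x => ?_
    have h := (exists_grad (a + b)).choose_spec.unique (g' := fun i x =>
      ev ((exists_grad a).choose i) x + ev ((exists_grad b).choose i) x)
      (by simpa only [map_add] using! (exists_grad a).choose_spec.add (exists_grad b).choose_spec)
    rw [ev_add_apply]
    exact congrFun (congrFun h i) x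
  map_smul' c a := by
    refine ext_ev fun x => ?_
    have h := (exists_grad (c • a)).choose_spec.unique (g' := fun i x =>
      c * ev ((exists_grad a).choose i) x)
      (by simpa only [map_smul] using! (exists_grad a).choose_spec.const_smul c)
    rw [RingHom.id_apply, ev_smul_apply]
    exact congrFun (congrFun h i) x

theorem hasGrad {k : ℕ} (a : Ck (k + 1)) : HasGrad (ev a) fun i => ev (pd i a) :=
  (exists_grad a).choose_spec

theorem pd_eq {k : ℕ} {a : Ck (k + 1)} {g : Fin 3 → Ck k} (h : HasGrad (ev a) fun i => ev (g i))
    (i : Fin 3) : pd i a = g i :=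
  ext_ev fun x => congrFun (congrFun ((hasGrad a).unique h) i) x

theorem pd_mul {k : ℕ} (a b : Ck (k + 1)) (i : Fin 3) :
    pd i (a * b) = pd i a * res b + res a * pd i b := by
  refine pd_eq (g := fun i => pd i a * res b + res a * pd i b) ?_ i
  have := (hasGrad a).mul (hasGrad b)
  simpa only [map_add, map_mul] using! this

/-- Assembling an element of `C^{k+1}_b` from a function and its partial derivatives in `C^k_b`. -/
def mk {k : ℕ} (a : Ck k) (g : Fin 3 → Ck k) (h : HasGrad (ev a) fun i => ev (g i)) :
    Ck (k + 1) :=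
  ⟨ev a, a.2, fun i => ev (g i), fun i => (g i).2, h⟩

theorem ev_mk {k : ℕ} {a : Ck k} {g : Fin 3 → Ck k} (h : HasGrad (ev a) fun i => ev (g i)) :
    ev (mk a g h) = ev a := rfl

theorem res_mk {k : ℕ} {a : Ck k} {g : Fin 3 → Ck k} (h : HasGrad (ev a) fun i => ev (g i)) :
    res (mk a g h) = a := rfl

theorem pd_mk {k : ℕ} {a : Ck k} {g : Fin 3 → Ck k} (h : HasGrad (ev a) fun i => ev (g i))
    (i : Fin 3) : pd i (mk a g h) = g i :=
  pd_eq (a := mk a g h) h i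

/-- The norm of `C^k_b`: the sum of the suprema of the derivatives along all words of length at most
`k`. In this form it is submultiplicative. -/
def nrm : (k : ℕ) → Ck k → ℝ
  | 0, a => ‖ev a‖
  | k + 1, a => nrm k (res a) + ∑ i, nrm k (pd i a)

theorem nrm_nonneg : ∀ {k : ℕ} (a : Ck k), 0 ≤ nrm k a
  | 0, _ => norm_nonneg _
  | _ + 1, _ => add_nonneg (nrm_nonneg _) (Finset.sum_nonneg fun _ _ => nrm_nonneg _)

theorem nrm_add_le : ∀ {k : ℕ} (a b : Ck k), nrm k (a + b) ≤ nrm k a + nrm k b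
  | 0, a, b => by simpa only [nrm, map_add] using norm_add_le (ev a) (ev b)
  | k + 1, a, b => by
    simp only [nrm, map_add]
    have h1 := nrm_add_le (res a) (res b)
    have h2 : ∑ i, nrm k (pd i a + pd i b) ≤ ∑ i, nrm k (pd i a) + ∑ i, nrm k (pd i b) := by
      rw [← Finset.sum_add_distrib]
      exact Finset.sum_le_sum fun i _ => nrm_add_le _ _
    linarith

theorem nrm_mul_le : ∀ {k : ℕ} (a b : Ck k), nrm k (a * b) ≤ nrm k a * nrm k b
  | 0, a, b => by simpa only [nrm, map_mul] using norm_mul_le (ev a) (ev b)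
  | k + 1, a, b => by
    simp only [nrm, map_mul, pd_mul]
    have h1 := nrm_mul_le (res a) (res b)
    have h2 : ∑ i, nrm k (pd i a * res b + res a * pd i b) ≤
        (∑ i, nrm k (pd i a)) * nrm k (res b) + nrm k (res a) * ∑ i, nrm k (pd i b) := by
      rw [Finset.sum_mul, Finset.mul_sum, ← Finset.sum_add_distrib]
      exact Finset.sum_le_sum fun i _ => (nrm_add_le _ _).trans
        (add_le_add (nrm_mul_le _ _) (nrm_mul_le _ _))
    have h3 : 0 ≤ (∑ i, nrm k (pd i a)) * ∑ i, nrm k (pd i b) :=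
      mul_nonneg (Finset.sum_nonneg fun _ _ => nrm_nonneg _)
        (Finset.sum_nonneg fun _ _ => nrm_nonneg _)
    nlinarith

theorem nrm_smul : ∀ {k : ℕ} (c : ℝ) (a : Ck k), nrm k (c • a) = |c| * nrm k a
  | 0, c, a => by simp only [nrm, map_smul, norm_smul, Real.norm_eq_abs]
  | k + 1, c, a => by
    simp only [nrm, map_smul, nrm_smul, mul_add, Finset.mul_sum]

theorem norm_ev_le_nrm : ∀ {k : ℕ} (a : Ck k), ‖ev a‖ ≤ nrm k a
  | 0, a => le_rfl
  | k + 1, a => by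
    have h := norm_ev_le_nrm (res a)
    rw [ev_res] at h
    exact h.trans (le_add_of_nonneg_right (Finset.sum_nonneg fun _ _ => nrm_nonneg _))

/-- The norm of `C^k_b` as a ring norm. -/
def ringNorm (k : ℕ) : RingNorm (Ck k) where
  toFun := nrm k
  map_zero' := by simpa using nrm_smul (0 : ℝ) (0 : Ck k)
  add_le' := nrm_add_le
  neg' a := by simpa using nrm_smul (-1 : ℝ) a
  mul_le' := nrm_mul_le
  eq_zero_of_map_eq_zero' a h := by
    have h1 := norm_ev_le_nrm a
    have h2 : nrm k a = 0 := h
    rw [h2] at h1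
    exact ev_injective (by rw [norm_le_zero_iff.mp h1, map_zero])

instance (k : ℕ) : NormedCommRing (Ck k) :=
  { (ringNorm k).toNormedRing with mul_comm := mul_comm }

instance (k : ℕ) : NormedAlgebra ℝ (Ck k) :=
  { (inferInstance : Algebra ℝ (Ck k)) with
    norm_smul_le := fun c a => (nrm_smul c a).le }

theorem norm_ev_le {k : ℕ} (a : Ck k) : ‖ev a‖ ≤ ‖a‖ := norm_ev_le_nrm a

theorem abs_ev_le {k : ℕ} (a : Ck k) (x : R3) : |ev a x| ≤ ‖a‖ :=
  ((ev a).norm_coe_le_norm x).trans (norm_ev_le a)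

theorem norm_zero_level (a : Ck 0) : ‖a‖ = ‖ev a‖ := rfl

theorem norm_succ {k : ℕ} (a : Ck (k + 1)) : ‖a‖ = ‖res a‖ + ∑ i, ‖pd i a‖ := rfl

theorem norm_res_le {k : ℕ} (a : Ck (k + 1)) : ‖res a‖ ≤ ‖a‖ := by
  rw [norm_succ]
  exact le_add_of_nonneg_right (Finset.sum_nonneg fun _ _ => norm_nonneg _)

theorem norm_pd_le {k : ℕ} (i : Fin 3) (a : Ck (k + 1)) : ‖pd i a‖ ≤ ‖a‖ := by
  rw [norm_succ]
  have := Finset.single_le_sum (f := fun i => ‖pd i a‖) (fun i _ => norm_nonneg _)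
    (Finset.mem_univ i)
  linarith [norm_nonneg (res a)]

/-- `ev` as a continuous linear map. -/
def evL (k : ℕ) : Ck k →L[ℝ] (R3 →ᵇ ℝ) :=
  LinearMap.mkContinuous ev.toLinearMap 1 fun a => by simpa using norm_ev_le a

/-- `res` as a continuous linear map. -/
def resL (k : ℕ) : Ck (k + 1) →L[ℝ] Ck k :=
  LinearMap.mkContinuous res.toLinearMap 1 fun a => by simpa using norm_res_le a

/-- `pd` as a continuous linear map. -/
def pdL (k : ℕ) (i : Fin 3) : Ck (k + 1) →L[ℝ] Ck k :=
  LinearMap.mkContinuous (pd i) 1 fun a => by simpa using norm_pd_le i a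

@[simp] theorem resL_apply {k : ℕ} (a : Ck (k + 1)) : resL k a = res a := rfl
@[simp] theorem pdL_apply {k : ℕ} (i : Fin 3) (a : Ck (k + 1)) : pdL k i a = pd i a := rfl

theorem tendsto_succ {k : ℕ} {α : Type*} {l : Filter α} {f : α → Ck (k + 1)} {a : Ck (k + 1)}
    (h0 : Filter.Tendsto (fun t => res (f t)) l (nhds (res a)))
    (h1 : ∀ i, Filter.Tendsto (fun t => pd i (f t)) l (nhds (pd i a))) :
    Filter.Tendsto f l (nhds a) := by
  rw [tendsto_iff_norm_sub_tendsto_zero] at h0 ⊢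
  have h1' := fun i => tendsto_iff_norm_sub_tendsto_zero.mp (h1 i)
  have := h0.add (tendsto_finsetSum Finset.univ fun i _ => h1' i)
  simpa only [norm_succ, map_sub, Finset.sum_const_zero, add_zero] using this

/-- Gradients pass to uniform limits. -/
theorem hasGrad_of_tendsto {f : ℕ → R3 →ᵇ ℝ} {g : ℕ → Fin 3 → R3 →ᵇ ℝ} {f₀ : R3 →ᵇ ℝ}
    {g₀ : Fin 3 → R3 →ᵇ ℝ} (h : ∀ n, HasGrad (f n) fun i => g n i)
    (hf : Filter.Tendsto f Filter.atTop (nhds f₀))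
    (hg : ∀ i, Filter.Tendsto (fun n => g n i) Filter.atTop (nhds (g₀ i))) :
    HasGrad f₀ fun i => g₀ i := by
  intro x
  refine hasFDerivAt_of_tendstoUniformlyOnFilter (l := Filter.atTop)
    (f := fun n => (f n : R3 → ℝ)) (f' := fun n x => covec fun i => g n i x)
    (g' := fun x => covec fun i => g₀ i x) ?_ ?_ ?_
  · refine TendstoUniformly.tendstoUniformlyOnFilter ?_ |>.mono_right le_top
    have hu : ∀ i, TendstoUniformly (fun n x => g n i x) (g₀ i) Filter.atTop := fun i =>
      BoundedContinuousFunction.tendsto_iff_tendstoUniformly.mp (hg i)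
    rw [Metric.tendstoUniformly_iff]
    intro ε hε
    have : ∀ i, ∀ᶠ n in Filter.atTop, ∀ x, dist (g₀ i x) (g n i x) < ε / 4 := fun i =>
      Metric.tendstoUniformly_iff.mp (hu i) _ (by positivity)
    filter_upwards [Filter.eventually_all.mpr this] with n hn y
    have hle : dist (covec fun i => g₀ i y) (covec fun i => g n i y) ≤ 3 * (ε / 4) := by
      rw [dist_eq_norm]
      refine ContinuousLinearMap.opNorm_le_bound _ (by positivity) fun z => ?_
      rw [sub_apply, covec_apply, covec_apply, ← Finset.sum_sub_distrib]
      calc ‖∑ i, (g₀ i y * z i - g n i y * z i)‖ ≤ ∑ i : Fin 3, (ε / 4) * ‖z‖ := by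
            refine norm_sum_le_of_le _ fun i _ => ?_
            rw [← sub_mul, norm_mul]
            exact mul_le_mul (by simpa [dist_eq_norm] using (hn i y).le)
              (PiLp.norm_apply_le z i) (norm_nonneg _) (by positivity)
        _ = 3 * (ε / 4) * ‖z‖ := by simp [mul_assoc]
    linarith
  · exact Filter.Eventually.of_forall fun p => h _ _
  · have hu := BoundedContinuousFunction.tendsto_iff_tendstoUniformly.mp hf
    exact Filter.Eventually.of_forall fun y => hu.tendsto_at y

theorem exists_ev_eq_zero (f : R3 →ᵇ ℝ) : ∃ a : Ck 0, ev a = f :=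
  ⟨(⟨f, Algebra.mem_top⟩ : ckAlg 0), rfl⟩

theorem completeSpace_aux : ∀ k : ℕ, CompleteSpace (Ck k)
  | 0 => by
    refine Metric.complete_of_cauchySeq_tendsto fun u hu => ?_
    have h1 : CauchySeq fun n => ev (u n) := hu.map (evL 0).uniformContinuous
    obtain ⟨f, hf⟩ := cauchySeq_tendsto_of_complete h1
    obtain ⟨a, rfl⟩ := exists_ev_eq_zero f
    refine ⟨a, ?_⟩
    rw [tendsto_iff_norm_sub_tendsto_zero] at hf
    refine tendsto_iff_norm_sub_tendsto_zero.mpr (hf.congr fun n => ?_)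
    rw [norm_zero_level, map_sub]
  | k + 1 => by
    have := completeSpace_aux k
    refine Metric.complete_of_cauchySeq_tendsto fun u hu => ?_
    have h1 : CauchySeq fun n => res (u n) := hu.map (resL k).uniformContinuous
    have h2 : ∀ i, CauchySeq fun n => pd i (u n) := fun i =>
      hu.map (pdL k i).uniformContinuous
    obtain ⟨f, hf⟩ := cauchySeq_tendsto_of_complete h1
    choose g hg using fun i => cauchySeq_tendsto_of_complete (h2 i)
    have hfg : HasGrad (ev f) fun i => ev (g i) :=
      hasGrad_of_tendsto (f := fun n => ev (u n)) (g := fun n i => ev (pd i (u n)))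
        (fun n => hasGrad (u n)) (((evL k).continuous.tendsto f).comp hf)
        fun i => ((evL k).continuous.tendsto (g i)).comp (hg i)
    exact ⟨mk f g hfg, tendsto_succ (by rwa [res_mk]) fun i => by rw [pd_mk]; exact hg i⟩

instance (k : ℕ) : CompleteSpace (Ck k) := completeSpace_aux k

theorem hasFDerivAt_succ {k : ℕ} {P : Type*} [NormedAddCommGroup P] [NormedSpace ℝ P]
    {Φ : P → Ck (k + 1)} {L : P →L[ℝ] Ck (k + 1)} {p : P}
    (h0 : HasFDerivAt (fun q => res (Φ q)) ((resL k).comp L) p)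
    (h1 : ∀ i, HasFDerivAt (fun q => pd i (Φ q)) ((pdL k i).comp L) p) :
    HasFDerivAt Φ L p := by
  rw [hasFDerivAt_iff_tendsto] at h0 ⊢
  have h1' := fun i => hasFDerivAt_iff_tendsto.mp (h1 i)
  have := h0.add (tendsto_finsetSum Finset.univ fun i _ => h1' i)
  simp only [Finset.sum_const_zero, add_zero] at this
  refine this.congr fun q => ?_
  rw [norm_succ, mul_add, Finset.mul_sum]
  simp [map_sub]

/-! ### Composition operators -/

/-- The composition `g ∘ u` of a bounded continuous function with a continuous function. -/
def compBdd (g : ℝ → ℝ) (hg : Continuous g) (u : R3 →ᵇ ℝ) : R3 →ᵇ ℝ :=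
  BoundedContinuousFunction.mkOfBound ⟨fun x => g (u x), hg.comp u.continuous⟩
    (Metric.diam (g '' Metric.closedBall 0 ‖u‖)) fun x y => by
      have hc : IsCompact (g '' Metric.closedBall 0 ‖u‖) := (isCompact_closedBall _ _).image hg
      refine Metric.dist_le_diam_of_mem hc.isBounded ⟨u x, ?_, rfl⟩ ⟨u y, ?_, rfl⟩ <;>
      simpa using u.norm_coe_le_norm _

theorem contDiff_deriv {g : ℝ → ℝ} (hg : ContDiff ℝ (⊤ : ℕ∞) g) :
    ContDiff ℝ (⊤ : ℕ∞) (deriv g) :=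
  ((contDiff_succ_iff_deriv (n := (⊤ : ℕ∞)) (f := g)).mp hg).2.2

theorem hasDerivAt_of_contDiff {g : ℝ → ℝ} (hg : ContDiff ℝ (⊤ : ℕ∞) g) (s : ℝ) :
    HasDerivAt g (deriv g s) s :=
  (hg.differentiable (by simp) s).hasDerivAt

theorem compBdd_mem : ∀ {k : ℕ} {g : ℝ → ℝ} (hg : ContDiff ℝ (⊤ : ℕ∞) g) {u : R3 →ᵇ ℝ},
    u ∈ ckAlg k → compBdd g hg.continuous u ∈ ckAlg k
  | 0, _, _, _, _ => trivial
  | k + 1, g, hg, u, hu => by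
    obtain ⟨hu0, v, hv, huv⟩ := hu
    refine ⟨compBdd_mem hg hu0, fun i => compBdd (deriv g) (contDiff_deriv hg).continuous u * v i,
      fun i => mul_mem (compBdd_mem (contDiff_deriv hg) hu0) (hv i), ?_⟩
    exact HasGrad.comp (hasDerivAt_of_contDiff hg) huv

/-- The composition operator `u ↦ g ∘ u` on `C^k_b`. -/
def nem {k : ℕ} {g : ℝ → ℝ} (hg : ContDiff ℝ (⊤ : ℕ∞) g) (u : Ck k) : Ck k :=
  ⟨compBdd g hg.continuous (ev u), compBdd_mem hg u.2⟩

theorem ev_nem_apply {k : ℕ} {g : ℝ → ℝ} (hg : ContDiff ℝ (⊤ : ℕ∞) g) (u : Ck k) (x : R3) :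
    ev (nem hg u) x = g (ev u x) := rfl

theorem res_nem {k : ℕ} {g : ℝ → ℝ} (hg : ContDiff ℝ (⊤ : ℕ∞) g) (u : Ck (k + 1)) :
    res (nem hg u) = nem hg (res u) := rfl

theorem pd_nem {k : ℕ} {g : ℝ → ℝ} (hg : ContDiff ℝ (⊤ : ℕ∞) g) (u : Ck (k + 1)) (i : Fin 3) :
    pd i (nem hg u) = nem (contDiff_deriv hg) (res u) * pd i u := by
  refine pd_eq (g := fun i => nem (contDiff_deriv hg) (res u) * pd i u) ?_ i
  have := HasGrad.comp (hasDerivAt_of_contDiff hg) (hasGrad u)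
  simpa only [map_mul] using! this

theorem hasFDerivAt_nem : ∀ {k : ℕ} {g : ℝ → ℝ} (hg : ContDiff ℝ (⊤ : ℕ∞) g) (u : Ck k),
    HasFDerivAt (nem hg : Ck k → Ck k)
      (ContinuousLinearMap.mul ℝ (Ck k) (nem (contDiff_deriv hg) u)) u
  | 0, g, hg, u => by
    -- on the ball of radius `‖u‖ + 1` the second derivative of `g` is bounded by some `C`
    obtain ⟨C, hC⟩ := (isCompact_closedBall (0 : ℝ) (‖u‖ + 1)).exists_bound_of_continuousOn
      (contDiff_deriv (contDiff_deriv hg)).continuous.continuousOn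
    have hC0 : 0 ≤ C := (norm_nonneg _).trans (hC 0 (by simp; positivity))
    have key : ∀ s t : ℝ, |s| ≤ ‖u‖ → |t| ≤ 1 →
        |g (s + t) - g s - deriv g s * t| ≤ C * |t| ^ 2 := by
      intro s t hs ht
      have hconv : Convex ℝ (Metric.closedBall (0 : ℝ) (‖u‖ + 1) ∩ Metric.closedBall s |t|) :=
        (convex_closedBall _ _).inter (convex_closedBall _ _)
      have hs' : s ∈ Metric.closedBall (0 : ℝ) (‖u‖ + 1) ∩ Metric.closedBall s |t| := by
        constructor
        · simp; linarith
        · simp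
      have hst : s + t ∈ Metric.closedBall (0 : ℝ) (‖u‖ + 1) ∩ Metric.closedBall s |t| := by
        constructor
        · simp; linarith [abs_add_le s t]
        · simp
      have hlip : ∀ r ∈ Metric.closedBall (0 : ℝ) (‖u‖ + 1) ∩ Metric.closedBall s |t|,
          ‖deriv g r - deriv g s‖ ≤ C * |t| := by
        intro r hr
        have := hconv.norm_image_sub_le_of_norm_hasDerivWithin_le (C := C)
          (fun q _ => (hasDerivAt_of_contDiff (contDiff_deriv hg) q).hasDerivWithinAt)
          (fun q hq => hC q hq.1) hs' hr
        refine this.trans (mul_le_mul_of_nonneg_left ?_ hC0)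
        simpa [dist_eq_norm] using hr.2
      have := hconv.norm_image_sub_le_of_norm_hasDerivWithin_le (C := C * |t|)
        (f := fun r => g r - deriv g s * r) (f' := fun r => deriv g r - deriv g s)
        (fun q _ => ((hasDerivAt_of_contDiff hg q).sub
          (by simpa using (hasDerivAt_id q).const_mul (deriv g s))).hasDerivWithinAt)
        hlip hs' hst
      calc |g (s + t) - g s - deriv g s * t|
          = ‖g (s + t) - deriv g s * (s + t) - (g s - deriv g s * s)‖ := by
            rw [Real.norm_eq_abs]; congr 1; ring
        _ ≤ C * |t| * ‖s + t - s‖ := this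
        _ = C * |t| ^ 2 := by rw [add_sub_cancel_left, Real.norm_eq_abs]; ring
    rw [hasFDerivAt_iff_isLittleO_nhds_zero]
    refine Asymptotics.IsBigO.trans_isLittleO (g := fun h : Ck 0 => ‖h‖ ^ 2) ?_ ?_
    · refine Asymptotics.IsBigO.of_bound C ?_
      filter_upwards [Metric.ball_mem_nhds (0 : Ck 0) one_pos] with h hh
      rw [mem_ball_zero_iff] at hh
      rw [norm_zero_level, BoundedContinuousFunction.norm_le (by positivity)]
      intro x
      have hx := abs_ev_le h x
      have := key (ev u x) (ev h x) (abs_ev_le u x) (hx.trans hh.le)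
      rw [ev_sub_apply, ev_sub_apply, ContinuousLinearMap.mul_apply', ev_mul_apply, ev_nem_apply,
        ev_nem_apply, ev_nem_apply, ev_add_apply, Real.norm_eq_abs]
      refine this.trans (mul_le_mul_of_nonneg_left ?_ hC0)
      rw [Real.norm_eq_abs, abs_of_nonneg (by positivity : (0 : ℝ) ≤ ‖h‖ ^ 2)]
      exact pow_le_pow_left₀ (abs_nonneg _) hx 2
    · exact Asymptotics.isLittleO_norm_pow_id one_lt_two
  | k + 1, g, hg, u => by
    refine hasFDerivAt_succ ?_ fun i => ?_
    · have := (hasFDerivAt_nem hg (res u)).comp u (resL k).hasFDerivAt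
      refine this.congr_fderiv ?_
      ext h : 1
      simp only [ContinuousLinearMap.comp_apply, ContinuousLinearMap.mul_apply', resL_apply,
        map_mul, res_nem]
    · have h1 := (hasFDerivAt_nem (contDiff_deriv hg) (res u)).comp u (resL k).hasFDerivAt
      have h2 := h1.mul (pdL k i).hasFDerivAt
      have h3 : (fun q : Ck (k + 1) => pd i (nem hg q)) =
          fun q => nem (contDiff_deriv hg) (resL k q) * pdL k i q := by
        funext q; exact pd_nem hg q i
      rw [h3]
      refine h2.congr_fderiv ?_
      ext h : 1
      simp only [ContinuousLinearMap.comp_apply, ContinuousLinearMap.mul_apply', resL_apply,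
        res_nem, pd_nem, pd_mul, pdL_apply, add_apply,
        smul_apply, smul_eq_mul, Function.comp_apply]
      ring

/-- Composition with a smooth function is a smooth map of `C^k_b`. -/
theorem contDiff_nem {k : ℕ} {g : ℝ → ℝ} (hg : ContDiff ℝ (⊤ : ℕ∞) g) :
    ContDiff ℝ (⊤ : ℕ∞) (nem hg : Ck k → Ck k) := by
  rw [contDiff_infty]
  intro n
  induction n generalizing g with
  | zero =>
    exact contDiff_zero.mpr <| continuous_iff_continuousAt.mpr
      fun u => (hasFDerivAt_nem hg u).continuousAt
  | succ n ih =>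
    rw [Nat.cast_add, Nat.cast_one, contDiff_succ_iff_hasFDerivAt]
    · exact ⟨fun u => ContinuousLinearMap.mul ℝ (Ck k) (nem (contDiff_deriv hg) u),
        (ContinuousLinearMap.mul ℝ (Ck k)).contDiff.comp (ih (contDiff_deriv hg)),
        hasFDerivAt_nem hg⟩

end Ck

end

/-! ### Membership in `C^k_b` and the exponential weight -/

section

open scoped BoundedContinuousFunction LineDeriv

/-- The `i`-th standard basis vector of `ℝ³`. -/
def bvec (i : Fin 3) : R3 := EuclideanSpace.single i 1

theorem covec_bvec (v : Fin 3 → ℝ) (i : Fin 3) : covec v (bvec i) = v i := by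
  simp [bvec, covec_apply, PiLp.single_apply]

theorem clm_eq_covec (L : R3 →L[ℝ] ℝ) : L = covec fun i => L (bvec i) := by
  ext x
  have hx : x = ∑ i, x i • bvec i := by
    ext j
    simp [bvec, Pi.single_apply]
  conv_lhs => rw [hx]
  simp [covec_apply, mul_comm]

theorem hasGrad_of_hasFDerivAt {f : R3 → ℝ} {L : R3 → R3 →L[ℝ] ℝ}
    (h : ∀ x, HasFDerivAt f (L x) x) : HasGrad f fun i x => L x (bvec i) := by
  intro x
  rw [← clm_eq_covec]
  exact h x

theorem HasGrad.congr {f : R3 → ℝ} {g g' : Fin 3 → R3 → ℝ} (h : HasGrad f g)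
    (hg : ∀ i x, g i x = g' i x) : HasGrad f g' := by
  have : g = g' := by funext i x; exact hg i x
  rwa [← this]

theorem HasGrad.congr_left {f f' : R3 → ℝ} {g : Fin 3 → R3 → ℝ} (h : HasGrad f g)
    (hf : ∀ x, f x = f' x) : HasGrad f' g := by
  have : f = f' := by funext x; exact hf x
  rwa [← this]

theorem HasGrad.continuous {f : R3 → ℝ} {g : Fin 3 → R3 → ℝ} (h : HasGrad f g) : Continuous f :=
  continuous_iff_continuousAt.mpr fun x => (h x).continuousAt

/-- The function `f` belongs to `C^k_b`. -/
def InCk (k : ℕ) (f : R3 → ℝ) : Prop := ∃ a : Ck k, ∀ x, Ck.ev a x = f x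

theorem InCk.zero_level {f : R3 → ℝ} (hf : Continuous f) {C : ℝ} (hC : ∀ x, |f x| ≤ C) :
    InCk 0 f := by
  obtain ⟨a, ha⟩ := Ck.exists_ev_eq_zero (BoundedContinuousFunction.ofNormedAddCommGroup f hf C hC)
  exact ⟨a, fun x => by rw [ha]; rfl⟩

theorem InCk.succ {k : ℕ} {f : R3 → ℝ} {g : Fin 3 → R3 → ℝ} (hf : InCk k f)
    (hg : ∀ i, InCk k (g i)) (h : HasGrad f g) : InCk (k + 1) f := by
  obtain ⟨a, ha⟩ := hf
  choose b hb using hg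
  refine ⟨Ck.mk a b ?_, fun x => ?_⟩
  · have h1 : (Ck.ev a : R3 → ℝ) = f := funext ha
    have h2 : (fun i => (Ck.ev (b i) : R3 → ℝ)) = g := by funext i x; exact hb i x
    rw [h1, h2]
    exact h
  · rw [Ck.ev_mk, ha]

theorem InCk.mul {k : ℕ} {f g : R3 → ℝ} (hf : InCk k f) (hg : InCk k g) :
    InCk k fun x => f x * g x := by
  obtain ⟨a, ha⟩ := hf
  obtain ⟨b, hb⟩ := hg
  exact ⟨a * b, fun x => by rw [Ck.ev_mul_apply, ha, hb]⟩

theorem InCk.add {k : ℕ} {f g : R3 → ℝ} (hf : InCk k f) (hg : InCk k g) :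
    InCk k fun x => f x + g x := by
  obtain ⟨a, ha⟩ := hf
  obtain ⟨b, hb⟩ := hg
  exact ⟨a + b, fun x => by rw [Ck.ev_add_apply, ha, hb]⟩

theorem InCk.const_mul {k : ℕ} {f : R3 → ℝ} (c : ℝ) (hf : InCk k f) :
    InCk k fun x => c * f x := by
  obtain ⟨a, ha⟩ := hf
  exact ⟨c • a, fun x => by rw [Ck.ev_smul_apply, ha]⟩

/-- The Japanese bracket `⟨x⟩ = √(1 + |x|²)`. -/
def jb (x : R3) : ℝ := Real.sqrt (1 + ‖x‖ ^ 2)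

theorem jb_sq (x : R3) : jb x ^ 2 = 1 + ‖x‖ ^ 2 := Real.sq_sqrt (by positivity)

theorem one_le_jb (x : R3) : 1 ≤ jb x := by
  rw [jb, Real.one_le_sqrt]
  nlinarith [sq_nonneg ‖x‖]

theorem jb_pos (x : R3) : 0 < jb x := one_pos.trans_le (one_le_jb x)

theorem norm_le_jb (x : R3) : ‖x‖ ≤ jb x :=
  Real.le_sqrt_of_sq_le (by linarith)

theorem jb_sub_le (x y : R3) : jb x - jb (x - y) ≤ ‖y‖ := by
  have h1 := jb_sq x
  have h2 := jb_sq (x - y)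
  have h3 : ‖x‖ ≤ ‖x - y‖ + ‖y‖ := by
    simpa using norm_add_le (x - y) y
  have h4 := norm_le_jb (x - y)
  have h5 := jb_pos x
  have h6 := jb_pos (x - y)
  by_contra hc
  rw [not_le] at hc
  have h7 : jb (x - y) + ‖y‖ < jb x := by linarith
  have h8 : ‖x‖ ^ 2 ≤ (‖x - y‖ + ‖y‖) ^ 2 := pow_le_pow_left₀ (norm_nonneg _) h3 2
  nlinarith [norm_nonneg y, norm_nonneg (x - y)]

theorem hasGrad_norm_sq : HasGrad (fun x => ‖x‖ ^ 2) fun i x => 2 * x i := by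
  intro x
  have h := (hasStrictFDerivAt_norm_sq x).hasFDerivAt
  refine h.congr_fderiv ?_
  ext y
  rw [covec_apply]
  simp only [smul_apply, innerSL_apply_apply, PiLp.inner_apply, RCLike.inner_apply, conj_trivial,
    nsmul_eq_mul, Finset.mul_sum]
  exact Finset.sum_congr rfl fun i _ => by push_cast; ring

theorem hasGrad_jb : HasGrad jb fun i x => x i / jb x := by
  have h1 := (hasGrad_const 1).add hasGrad_norm_sq
  intro x
  have h2 := (h1 x).sqrt (by positivity)
  refine h2.congr_fderiv ?_
  ext y
  simp only [smul_apply, covec_apply, smul_eq_mul, Finset.mul_sum]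
  refine Finset.sum_congr rfl fun i _ => ?_
  rw [show Real.sqrt (1 + ‖x‖ ^ 2) = jb x from rfl]
  have := (jb_pos x).ne'
  field_simp
  ring

theorem continuous_jb : Continuous jb := hasGrad_jb.continuous

theorem hasGrad_coord (j : Fin 3) : HasGrad (fun x => x j) fun i _ => if i = j then 1 else 0 := by
  intro x
  refine (EuclideanSpace.proj j : R3 →L[ℝ] ℝ).hasFDerivAt.congr_fderiv ?_
  ext y
  simp [covec_apply]

theorem hasGrad_inv_jb : HasGrad (fun x => (jb x)⁻¹)
    fun i x => -1 * ((x i / jb x) * ((jb x)⁻¹ * (jb x)⁻¹)) := by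
  intro x
  have h2 := (hasDerivAt_inv (jb_pos x).ne').comp_hasFDerivAt x (hasGrad_jb x)
  refine h2.congr_fderiv ?_
  ext y
  simp only [smul_apply, covec_apply, smul_eq_mul, Finset.mul_sum]
  refine Finset.sum_congr rfl fun i _ => ?_
  have := (jb_pos x).ne'
  field_simp

theorem inCk_bracket : ∀ k : ℕ, InCk k (fun x => (jb x)⁻¹) ∧ ∀ j, InCk k fun x => x j / jb x
  | 0 => by
    have hc : Continuous fun x => (jb x)⁻¹ := hasGrad_inv_jb.continuous
    refine ⟨InCk.zero_level (C := 1) hc fun x => ?_,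
      fun j => InCk.zero_level (C := 1) ?_ fun x => ?_⟩
    · rw [abs_of_nonneg (by have := jb_pos x; positivity)]
      exact inv_le_one_of_one_le₀ (one_le_jb x)
    · simp only [div_eq_mul_inv]
      exact (EuclideanSpace.proj j : R3 →L[ℝ] ℝ).continuous.mul hc
    · rw [abs_div, abs_of_pos (jb_pos x), div_le_one (jb_pos x)]
      exact (PiLp.norm_apply_le x j).trans (norm_le_jb x)
  | k + 1 => by
    obtain ⟨hs, hp⟩ := inCk_bracket k
    refine ⟨hs.succ (fun i => ((hp i).mul (hs.mul hs)).const_mul (-1)) hasGrad_inv_jb,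
      fun j => ?_⟩
    refine (hp j).succ (g := fun i x => (if i = j then 1 else 0) * (jb x)⁻¹ +
      -1 * ((x j / jb x) * ((x i / jb x) * (jb x)⁻¹)))
      (fun i => (hs.const_mul _).add (((hp j).mul ((hp i).mul hs)).const_mul _)) ?_
    refine (((hasGrad_coord j).mul hasGrad_inv_jb).congr fun i x => ?_).congr_left fun x => ?_
    · ring
    · rw [div_eq_mul_inv]

/-- The function `exp(α⟨x⟩ - ε⟨x⟩²)`. -/
def expW (α ε : ℝ) (x : R3) : ℝ := Real.exp (α * jb x - ε * jb x ^ 2)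

theorem expW_pos (α ε : ℝ) (x : R3) : 0 < expW α ε x := Real.exp_pos _

theorem hasGrad_expW (α ε : ℝ) : HasGrad (expW α ε) fun i x =>
    (α * (x i / jb x) - 2 * ε * x i) * expW α ε x := by
  intro x
  have h2 := (((hasGrad_jb x).const_mul α).sub (((hasGrad_jb x).pow 2).const_mul ε)).exp
  refine h2.congr_fderiv ?_
  ext y
  simp only [smul_apply, sub_apply, covec_apply, smul_eq_mul, Finset.mul_sum,
    ← Finset.sum_sub_distrib]
  refine Finset.sum_congr rfl fun i _ => ?_
  have := (jb_pos x).ne'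
  simp only [nsmul_eq_mul, Pi.sub_apply, expW]
  push_cast
  field_simp

theorem continuous_expW (α ε : ℝ) : Continuous (expW α ε) := (hasGrad_expW α ε).continuous

theorem inCk_expW_neg {α : ℝ} (hα : 0 ≤ α) : ∀ k : ℕ, InCk k (expW (-α) 0)
  | 0 => InCk.zero_level (C := 1) (continuous_expW _ _) fun x => by
      rw [abs_of_pos (expW_pos _ _ _), expW, Real.exp_le_one_iff]
      nlinarith [jb_pos x]
  | k + 1 => by
    have h := inCk_expW_neg hα k
    refine h.succ (fun i => (((inCk_bracket k).2 i).mul h).const_mul (-α))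
      ((hasGrad_expW (-α) 0).congr fun i x => ?_)
    ring

/-! ### Schwartz functions -/

theorem hasGrad_schwartz (V : 𝓢(R3, ℝ)) : HasGrad V fun i => (∂_{bvec i} V : 𝓢(R3, ℝ)) := by
  have := hasGrad_of_hasFDerivAt fun x => (V.differentiable x).hasFDerivAt
  exact this.congr fun i x => (SchwartzMap.lineDerivOp_apply_eq_fderiv _ _ _).symm

theorem abs_schwartz_le (V : 𝓢(R3, ℝ)) : ∃ C, 0 ≤ C ∧ ∀ x, |V x| ≤ C := by
  obtain ⟨C, hC0, hC⟩ := V.decay 0 0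
  exact ⟨C, hC0.le, fun x => by simpa using hC x⟩

theorem inCk_schwartz : ∀ (k : ℕ) (V : 𝓢(R3, ℝ)), InCk k V
  | 0, V => by
    obtain ⟨C, -, hC⟩ := abs_schwartz_le V
    exact InCk.zero_level V.continuous hC
  | k + 1, V => (inCk_schwartz k V).succ (fun _ => inCk_schwartz k _) (hasGrad_schwartz V)

/-- The product of a function of temperate growth and a Schwartz function. -/
def tMul (p : R3 → ℝ) (V : 𝓢(R3, ℝ)) : 𝓢(R3, ℝ) := SchwartzMap.smulLeftCLM ℝ p V

theorem tMul_apply {p : R3 → ℝ} (hp : p.HasTemperateGrowth) (V : 𝓢(R3, ℝ)) (x : R3) :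
    tMul p V x = p x * V x := SchwartzMap.smulLeftCLM_apply_apply hp V x

theorem temperate_coord (i : Fin 3) : (fun x : R3 => x i).HasTemperateGrowth :=
  (EuclideanSpace.proj i : R3 →L[ℝ] ℝ).hasTemperateGrowth

theorem temperate_inv_jb : (fun x : R3 => (jb x)⁻¹).HasTemperateGrowth := by
  have h : (fun x : R3 => (jb x)⁻¹) = fun x => (1 + ‖x‖ ^ 2) ^ (-1 / 2 : ℝ) := by
    funext x
    rw [show jb x = (1 + ‖x‖ ^ 2) ^ (1 / 2 : ℝ) from Real.sqrt_eq_rpow _,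
      ← Real.rpow_neg (by positivity)]
    norm_num
  rw [h]
  exact Function.hasTemperateGrowth_one_add_norm_sq_rpow R3 (-1 / 2)

theorem temperate_jb_sq : (fun x : R3 => jb x ^ 2).HasTemperateGrowth := by
  simp only [jb_sq]
  exact (Function.HasTemperateGrowth.const 1).add (Function.hasTemperateGrowth_norm_sq R3)

theorem inCk_schwartz_mul_expW {α ε : ℝ} (hε : 0 < ε) : ∀ (k : ℕ) (V : 𝓢(R3, ℝ)),
    InCk k fun x => V x * expW α ε x
  | 0, V => by
    obtain ⟨C, hC0, hC⟩ := abs_schwartz_le V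
    refine InCk.zero_level (C := C * Real.exp (α ^ 2 / (4 * ε)))
      (V.continuous.mul (continuous_expW α ε)) fun x => ?_
    rw [abs_mul, abs_of_pos (expW_pos _ _ _)]
    refine mul_le_mul (hC x) (Real.exp_le_exp.mpr ?_) (expW_pos _ _ _).le hC0
    rw [le_div_iff₀ (by positivity)]
    nlinarith [sq_nonneg (α - 2 * ε * jb x)]
  | k + 1, V => by
    refine (inCk_schwartz_mul_expW hε k V).succ (g := fun i x =>
      (∂_{bvec i} V : 𝓢(R3, ℝ)) x * expW α ε x +
        (α * (tMul (fun x => x i * (jb x)⁻¹) V x * expW α ε x) +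
          (-2 * ε) * (tMul (fun x => x i) V x * expW α ε x)))
      (fun i => (inCk_schwartz_mul_expW hε k _).add
        (((inCk_schwartz_mul_expW hε k _).const_mul _).add
          ((inCk_schwartz_mul_expW hε k _).const_mul _))) ?_
    refine ((hasGrad_schwartz V).mul (hasGrad_expW α ε)).congr fun i x => ?_
    have h1 : tMul (fun x => x i * (jb x)⁻¹) V x = x i * (jb x)⁻¹ * V x :=
      tMul_apply ((temperate_coord i).mul temperate_inv_jb) V x
    rw [tMul_apply (temperate_coord i), h1]
    ring

/-- The tail `V (1 - exp(-ε⟨x⟩²))` of a Schwartz function is small in `C^k_b` for small `ε`. -/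
theorem exists_small_tail : ∀ (k : ℕ) (V : 𝓢(R3, ℝ)) {η : ℝ}, 0 < η →
    ∀ᶠ ε in nhdsWithin 0 (Set.Ioi 0), ∃ a : Ck k, ‖a‖ ≤ η ∧ ∀ x, Ck.ev a x = V x * (1 - expW 0 ε x)
  | 0, V, η, hη => by
    obtain ⟨C, hC0, hC⟩ := abs_schwartz_le (tMul (fun x => jb x ^ 2) V)
    filter_upwards [Ioo_mem_nhdsGT (show 0 < η / (C + 1) by positivity)] with ε hlt'
    obtain ⟨hε, hlt⟩ := hlt'
    have hb : ∀ x, |V x * (1 - expW 0 ε x)| ≤ η := by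
      intro x
      have h1 : 1 - expW 0 ε x ≤ ε * jb x ^ 2 := by
        have := Real.add_one_le_exp (0 * jb x - ε * jb x ^ 2)
        rw [expW]; linarith
      have h2 : 0 ≤ 1 - expW 0 ε x := by
        rw [sub_nonneg, expW, Real.exp_le_one_iff]
        have := mul_pos hε (pow_pos (jb_pos x) 2)
        linarith
      have h3 := hC x
      rw [tMul_apply temperate_jb_sq, abs_mul, abs_of_nonneg (by positivity)] at h3
      rw [abs_mul, abs_of_nonneg h2]
      calc |V x| * (1 - expW 0 ε x) ≤ |V x| * (ε * jb x ^ 2) := by gcongr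
        _ = ε * (jb x ^ 2 * |V x|) := by ring
        _ ≤ η / (C + 1) * (C + 1) := by gcongr; linarith
        _ = η := by field_simp
    obtain ⟨a, ha⟩ := InCk.zero_level
      (V.continuous.mul (continuous_const.sub (continuous_expW 0 ε))) hb
    refine ⟨a, ?_, ha⟩
    rw [Ck.norm_zero_level, BoundedContinuousFunction.norm_le hη.le]
    intro x
    rw [ha]
    exact hb x
  | k + 1, V, η, hη => by
    have h0 := exists_small_tail k V (η := η / 4) (by positivity)
    have h1 := Filter.eventually_all.mpr fun i : Fin 3 =>
      exists_small_tail k (∂_{bvec i} V : 𝓢(R3, ℝ)) (η := η / 8) (by positivity)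
    have h2 := Filter.eventually_all.mpr fun i : Fin 3 =>
      exists_small_tail k (tMul (fun x => x i) V) (η := 1) one_pos
    choose b hb using fun i : Fin 3 => inCk_schwartz k (tMul (fun x => x i) V)
    have h3 := Filter.eventually_all.mpr fun i : Fin 3 =>
      Ioo_mem_nhdsGT (show 0 < η / (16 * (‖b i‖ + 1)) by positivity)
    -- `∂_i` of the tail is the tail of `∂_i V` plus `2ε x_i V` minus `2ε` times the tail of `x_i V`
    filter_upwards [h0, h1, h2, h3] with ε h0 h1 h2 h3
    have hε : 0 < ε := (h3 0).1
    have l3 := fun i => (h3 i).2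
    obtain ⟨a, han, ha⟩ := h0
    choose c hcn hc using h1
    choose d hdn hd using h2
    have hgrad : HasGrad (Ck.ev a) fun i => Ck.ev (c i + (2 * ε) • (b i - d i)) := by
      have := (hasGrad_schwartz V).mul ((hasGrad_const 1).add ((hasGrad_expW 0 ε).const_smul (-1)))
      refine (this.congr fun i x => ?_).congr_left fun x => ?_
      · rw [Ck.ev_add_apply, Ck.ev_smul_apply, Ck.ev_sub_apply, hc, hb, hd,
          tMul_apply (temperate_coord i)]
        ring
      · rw [ha]; ring
    refine ⟨Ck.mk a _ hgrad, ?_, fun x => by rw [Ck.ev_mk, ha]⟩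
    rw [Ck.norm_succ, Ck.res_mk]
    simp only [Ck.pd_mk]
    have hi : ∀ i, ‖c i + (2 * ε) • (b i - d i)‖ ≤ η / 4 := by
      intro i
      have h3 : ‖b i - d i‖ ≤ ‖b i‖ + 1 := (norm_sub_le _ _).trans (by linarith [hdn i])
      have h4 : 2 * ε * (‖b i‖ + 1) ≤ η / 8 := by
        have := (lt_div_iff₀ (by positivity)).mp (l3 i)
        linarith
      calc _ ≤ ‖c i‖ + ‖(2 * ε) • (b i - d i)‖ := norm_add_le _ _
        _ ≤ η / 8 + 2 * ε * (‖b i‖ + 1) := by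
            rw [norm_smul, Real.norm_eq_abs, abs_of_pos (by positivity)]
            exact add_le_add (hcn i) (by gcongr)
        _ ≤ η / 4 := by linarith
    calc ‖a‖ + ∑ i, ‖c i + (2 * ε) • (b i - d i)‖ ≤ η / 4 + ∑ i : Fin 3, η / 4 :=
          add_le_add han (Finset.sum_le_sum fun i _ => hi i)
      _ = η := by simp; ring

/-! ### The hyperbolic cosine of the norm -/

/-- The Taylor coefficients of the `n`-th derivative of the entire function `t ↦ cosh √t`. -/
def coshCoeff : ℕ → ℕ → ℝ
  | 0, k => ((2 * k).factorial : ℝ)⁻¹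
  | n + 1, k => (k + 1) * coshCoeff n (k + 1)

theorem coshCoeff_nonneg : ∀ n k : ℕ, 0 ≤ coshCoeff n k
  | 0, k => by unfold coshCoeff; positivity
  | n + 1, k => mul_nonneg (by positivity) (coshCoeff_nonneg n (k + 1))

theorem coshCoeff_le : ∀ n k : ℕ, coshCoeff n k ≤ ((2 * k).factorial : ℝ)⁻¹
  | 0, k => le_rfl
  | n + 1, k => by
    have h := coshCoeff_le n (k + 1)
    calc coshCoeff (n + 1) k = (k + 1) * coshCoeff n (k + 1) := rfl
      _ ≤ (k + 1) * ((2 * (k + 1)).factorial : ℝ)⁻¹ := by gcongr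
      _ ≤ ((2 * k).factorial : ℝ)⁻¹ := by
        rw [show 2 * (k + 1) = 2 * k + 1 + 1 by ring, Nat.factorial_succ, Nat.factorial_succ]
        push_cast
        have h0 : (0 : ℝ) < (2 * k).factorial := by positivity
        rw [mul_inv_le_iff₀ (by positivity), inv_mul_eq_div, le_div_iff₀ h0]
        have hk : (0 : ℝ) ≤ k := by positivity
        have : (1 : ℝ) * ((k + 1) * (2 * k).factorial) ≤
            (2 * k + 1) * ((2 * k + 1 + 1) * (2 * k).factorial) := by
          have h1 : (k + 1 : ℝ) ≤ 2 * k + 1 + 1 := by linarith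
          gcongr
          linarith
        linarith

/-- The `n`-th derivative of the entire function `t ↦ cosh √t`. -/
def coshSer (n : ℕ) (t : ℝ) : ℝ := ∑' k : ℕ, coshCoeff n k * t ^ k

theorem summable_coshSer_bound {t : ℝ} (ht : 0 ≤ t) :
    Summable fun k : ℕ => ((2 * k).factorial : ℝ)⁻¹ * t ^ k := by
  refine (Real.hasSum_cosh (Real.sqrt t)).summable.congr fun k => ?_
  rw [pow_mul, Real.sq_sqrt ht]
  ring

theorem abs_coshCoeff_mul_le (n k : ℕ) {t R : ℝ} (ht : |t| ≤ R) :
    |coshCoeff n k * t ^ k| ≤ ((2 * k).factorial : ℝ)⁻¹ * R ^ k := by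
  rw [abs_mul, abs_pow, abs_of_nonneg (coshCoeff_nonneg n k)]
  have hR : 0 ≤ R := (abs_nonneg t).trans ht
  exact mul_le_mul (coshCoeff_le n k) (pow_le_pow_left₀ (abs_nonneg t) ht k) (by positivity)
    (by positivity)

theorem summable_coshSer (n : ℕ) (t : ℝ) : Summable fun k : ℕ => coshCoeff n k * t ^ k :=
  Summable.of_norm_bounded (summable_coshSer_bound (abs_nonneg t))
    fun k => abs_coshCoeff_mul_le n k le_rfl

theorem abs_coshSer_le (n : ℕ) {t : ℝ} (ht : 0 ≤ t) : |coshSer n t| ≤ Real.cosh (Real.sqrt t) := by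
  rw [coshSer, ← Real.norm_eq_abs]
  refine tsum_of_norm_bounded (Real.hasSum_cosh (Real.sqrt t)) fun k => ?_
  refine (abs_coshCoeff_mul_le n k (abs_of_nonneg ht).le).trans_eq ?_
  rw [pow_mul, Real.sq_sqrt ht]
  ring

theorem coshSer_zero_sq (r : ℝ) : coshSer 0 (r ^ 2) = Real.cosh r := by
  rw [coshSer, ← (Real.hasSum_cosh r).tsum_eq]
  refine tsum_congr fun k => ?_
  rw [coshCoeff, ← pow_mul]
  ring

theorem hasDerivAt_coshSer (n : ℕ) (t : ℝ) : HasDerivAt (coshSer n) (coshSer (n + 1) t) t := by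
  set R := |t| + 1
  have hR : 0 ≤ R := by positivity
  have hshift : coshSer (n + 1) t = ∑' k : ℕ, coshCoeff n k * (k * t ^ (k - 1)) := by
    have hs : Summable fun k : ℕ => coshCoeff n k * (k * t ^ (k - 1)) := by
      rw [← summable_nat_add_iff 1]
      refine (summable_coshSer (n + 1) t).congr fun k => ?_
      simp only [coshCoeff, Nat.cast_add, Nat.cast_one, Nat.add_sub_cancel]
      ring
    rw [hs.tsum_eq_zero_add, coshSer]
    simp only [Nat.cast_zero, zero_mul, mul_zero, zero_add]
    refine tsum_congr fun k => ?_
    simp only [coshCoeff, Nat.cast_add, Nat.cast_one, Nat.add_sub_cancel]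
    ring
  rw [hshift]
  have hu : Summable fun k : ℕ => coshCoeff n k * (k * R ^ (k - 1)) := by
    rw [← summable_nat_add_iff 1]
    refine (summable_coshSer (n + 1) R).congr fun k => ?_
    simp only [coshCoeff, Nat.cast_add, Nat.cast_one, Nat.add_sub_cancel]
    ring
  refine hasDerivAt_tsum_of_isPreconnected (t := Metric.ball 0 R) (y₀ := t) hu Metric.isOpen_ball
    (convex_ball 0 R).isPreconnected
    (fun k y _ => (hasDerivAt_pow k y).const_mul (coshCoeff n k)) (fun k y hy => ?_) ?_
    (summable_coshSer n t) ?_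
  · rw [norm_mul, norm_mul, norm_pow, Real.norm_of_nonneg (coshCoeff_nonneg n k),
      Real.norm_natCast]
    have hy' : ‖y‖ ≤ R := by simpa using (mem_ball_zero_iff.mp hy).le
    have := coshCoeff_nonneg n k
    gcongr
  · simp [R]
  · simp [R]

end

/-! ### Sobolev spaces and distributions -/

section

open scoped BoundedContinuousFunction LineDeriv FourierTransform

theorem toDist_apply_apply (u : L2) (f : 𝓢(R3, ℂ)) : toDist u f = ∫ x, f x * u x := by
  rw [toDist_apply, Lp.toTemperedDistribution_apply]
  rfl

theorem mem_sobolev {s : ℝ} {u : L2} : u ∈ sobolev s ↔ MemSobolev s 2 (toDist u) := Iff.rfl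

theorem memSobolev_zero_toDist (u : L2) : MemSobolev 0 2 (toDist u) :=
  memSobolev_zero_iff.mpr ⟨u, rfl⟩

theorem exists_toDist_of_memSobolev {s : ℝ} (hs : 0 ≤ s) {T : 𝓢'(R3, ℂ)}
    (h : MemSobolev s 2 T) : ∃ u : L2, T = toDist u :=
  memSobolev_zero_iff.mp (h.mono hs)

theorem sobolev_mono {s s' : ℝ} (h : s' ≤ s) {u : L2} (hu : u ∈ sobolev s) : u ∈ sobolev s' :=
  MemSobolev.mono h hu

theorem laplacian_eq_sum_bvec (T : 𝓢'(R3, ℂ)) : Δ T = ∑ i, ∂_{bvec i} (∂_{bvec i} T) := by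
  rw [TemperedDistribution.laplacian_eq_sum (EuclideanSpace.basisFun (Fin 3) ℝ)]
  simp [bvec]

/-- A distribution whose first derivatives are in `H^s` and which is in `H^s` is in `H^{s+1}`. -/
theorem memSobolev_succ {s : ℝ} {T : 𝓢'(R3, ℂ)} (h0 : MemSobolev s 2 T)
    (h1 : ∀ i, MemSobolev s 2 (∂_{bvec i} T)) : MemSobolev (s + 1) 2 T := by
  have hb : besselPotential R3 ℂ 2 T = T + (-(((2 * Real.pi) ^ 2)⁻¹ : ℝ) : ℂ) • Δ T := by
    have hpi : ((2 * Real.pi : ℝ) : ℂ) ≠ 0 := by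
      exact_mod_cast (by positivity : (2 * Real.pi : ℝ) ≠ 0)
    rw [laplacian_eq_fourierMultiplierCLM, besselPotential]
    have h2 : (fun x : R3 => (((1 + ‖x‖ ^ 2) ^ ((2 : ℝ) / 2) : ℝ) : ℂ)) =
        fun x => ((1 : ℂ) + ((‖x‖ ^ 2 : ℝ) : ℂ)) := by
      funext x
      norm_num
    have h3 : (fourierMultiplierCLM ℂ fun x : R3 => (1 : ℂ) + ((‖x‖ ^ 2 : ℝ) : ℂ)) T =
        fourierMultiplierCLM ℂ (fun _ : R3 => (1 : ℂ)) T +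
        fourierMultiplierCLM ℂ (fun x : R3 => ((‖x‖ ^ 2 : ℝ) : ℂ)) T := by
      simp only [fourierMultiplierCLM_apply]
      rw [← FourierTransform.fourierInv_add, ← add_apply,
        ← smulLeftCLM_add (by fun_prop) (by fun_prop)]
      rfl
    rw [h2, h3, fourierMultiplierCLM_const]
    simp only [ContinuousLinearMap.id_apply, one_smul]
    congr 1
    rw [← Complex.coe_smul, smul_smul]
    rw [← Complex.ofReal_neg, ← Complex.ofReal_mul,
      show -((2 * Real.pi) ^ 2)⁻¹ * -(2 * Real.pi) ^ 2 = 1 by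
      field_simp, Complex.ofReal_one, one_smul]
  have h2 : MemSobolev (s - 1) 2 (besselPotential R3 ℂ 2 T) := by
    rw [hb, laplacian_eq_sum_bvec]
    refine (h0.mono (by linarith)).add (MemSobolev.smul _ ?_)
    simp only [Fin.sum_univ_three]
    exact ((h1 0).lineDerivOp.add (h1 1).lineDerivOp).add (h1 2).lineDerivOp
  rw [memSobolev_besselPotential_iff] at h2
  convert h2 using 1
  ring

theorem memLp_mul_schwartz {f : R3 → ℂ} (hf : MemLp f 2 volume) (φ : 𝓢(R3, ℂ)) :
    Integrable fun x => φ x * f x :=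
  MemLp.integrable_mul (φ.memLp 2) hf

/-- Classical derivatives of square integrable functions are distributional derivatives. -/
theorem lineDerivOp_toDist {f f' : R3 → ℂ} (hf : MemLp f 2 volume) (hf' : MemLp f' 2 volume)
    {v : R3} (h : ∀ x, HasLineDerivAt ℝ f (f' x) x v) :
    ∂_{v} (toDist (hf.toLp f)) = toDist (hf'.toLp f') := by
  ext φ
  rw [lineDerivOp_apply_apply, map_neg, toDist_apply_apply, toDist_apply_apply]
  have e1 : ∫ x, (∂_{v} φ : 𝓢(R3, ℂ)) x * hf.toLp f x = ∫ x, (∂_{v} φ : 𝓢(R3, ℂ)) x * f x :=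
    integral_congr_ae (by filter_upwards [hf.coeFn_toLp] with x hx; rw [hx])
  have e2 : ∫ x, φ x * hf'.toLp f' x = ∫ x, φ x * f' x :=
    integral_congr_ae (by filter_upwards [hf'.coeFn_toLp] with x hx; rw [hx])
  rw [e1, e2, neg_eq_iff_eq_neg]
  have := integral_bilinear_hasLineDerivAt_right_eq_neg_left_of_integrable (μ := volume)
    (B := (ContinuousLinearMap.mul ℝ ℂ)) (f := f) (f' := f') (g := φ)
    (g' := fun x => (∂_{v} φ : 𝓢(R3, ℂ)) x) (v := v) ?_ ?_ ?_ (fun x _ => h x) (fun x _ => ?_)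
  · simpa only [ContinuousLinearMap.mul_apply', mul_comm] using this
  · simpa only [ContinuousLinearMap.mul_apply', mul_comm] using memLp_mul_schwartz hf' φ
  · simpa only [ContinuousLinearMap.mul_apply', mul_comm] using memLp_mul_schwartz hf (∂_{v} φ)
  · simpa only [ContinuousLinearMap.mul_apply', mul_comm] using memLp_mul_schwartz hf φ
  · rw [SchwartzMap.lineDerivOp_apply_eq_fderiv]
    exact (φ.differentiable x).hasFDerivAt.hasLineDerivAt v

theorem temperate_ofReal {g : R3 → ℝ} (hg : g.HasTemperateGrowth) :
    (fun x => (g x : ℂ)).HasTemperateGrowth :=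
  Function.Complex.hasTemperateGrowth_ofReal.comp hg

/-- The Leibniz rule for the product of a Schwartz function and a tempered distribution. -/
theorem lineDerivOp_smulLeft (V : 𝓢(R3, ℝ)) (T : 𝓢'(R3, ℂ)) (v : R3) :
    ∂_{v} (smulLeftCLM ℂ (fun x => (V x : ℂ)) T) =
      smulLeftCLM ℂ (fun x => ((∂_{v} V : 𝓢(R3, ℝ)) x : ℂ)) T +
      smulLeftCLM ℂ (fun x => (V x : ℂ)) (∂_{v} T) := by
  ext φ
  have hV := temperate_ofReal V.hasTemperateGrowth
  have hV' := temperate_ofReal (∂_{v} V : 𝓢(R3, ℝ)).hasTemperateGrowth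
  have key : ∂_{v} (SchwartzMap.smulLeftCLM ℂ (fun x => (V x : ℂ)) φ) =
      SchwartzMap.smulLeftCLM ℂ (fun x => ((∂_{v} V : 𝓢(R3, ℝ)) x : ℂ)) φ +
      SchwartzMap.smulLeftCLM ℂ (fun x => (V x : ℂ)) (∂_{v} φ) := by
    ext x
    rw [SchwartzMap.lineDerivOp_apply_eq_fderiv, add_apply,
      SchwartzMap.smulLeftCLM_apply_apply hV', SchwartzMap.smulLeftCLM_apply_apply hV]
    have h1 : (SchwartzMap.smulLeftCLM ℂ (fun x => (V x : ℂ)) φ : R3 → ℂ) =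
        fun x => (V x : ℂ) * φ x := by
      funext y
      rw [SchwartzMap.smulLeftCLM_apply_apply hV, smul_eq_mul]
    have h2 : HasFDerivAt (fun x => (V x : ℂ)) (Complex.ofRealCLM.comp (fderiv ℝ V x)) x :=
      Complex.ofRealCLM.hasFDerivAt.comp x (V.differentiable x).hasFDerivAt
    have h3 : HasFDerivAt (fun x => (V x : ℂ) * φ x) _ x :=
      h2.mul (φ.differentiable x).hasFDerivAt
    rw [h1, h3.fderiv]
    simp only [SchwartzMap.lineDerivOp_apply_eq_fderiv, add_apply, smul_apply, smul_eq_mul,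
      ContinuousLinearMap.comp_apply, Complex.ofRealCLM_apply]
    ring
  rw [lineDerivOp_apply_apply, smulLeftCLM_apply_apply, add_apply, smulLeftCLM_apply_apply,
    smulLeftCLM_apply_apply, lineDerivOp_apply_apply, ← map_add, map_neg, key]
  congr 1
  abel

/-- Multiplication by a bounded temperate function preserves `L²`. -/
theorem exists_toDist_smulLeft (V : 𝓢(R3, ℝ)) (u : L2) :
    ∃ w : L2, smulLeftCLM ℂ (fun x => (V x : ℂ)) (toDist u) = toDist w := by
  have hm : MemLp (fun x => (V x : ℂ)) ⊤ (volume : Measure R3) := (V.memLp ⊤).ofReal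
  have h : toDist (hm.toLp _ • u) = smulLeftCLM ℂ (fun x => (V x : ℂ)) (toDist u) :=
    Lp.toTemperedDistribution_smul_eq (temperate_ofReal V.hasTemperateGrowth) hm u
  exact ⟨_, h.symm⟩

/-- Multiplication by a Schwartz function preserves the Sobolev spaces of integer order. -/
theorem memSobolev_smulLeft : ∀ (n : ℕ) (V : 𝓢(R3, ℝ)) {T : 𝓢'(R3, ℂ)},
    MemSobolev n 2 T → MemSobolev n 2 (smulLeftCLM ℂ (fun x => (V x : ℂ)) T)
  | 0, V, T, h => by
    rw [Nat.cast_zero] at h ⊢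
    obtain ⟨u, rfl⟩ := exists_toDist_of_memSobolev le_rfl h
    obtain ⟨w, hw⟩ := exists_toDist_smulLeft V u
    rw [hw]
    exact memSobolev_zero_toDist w
  | n + 1, V, T, h => by
    have h' : MemSobolev n 2 T := h.mono (by push_cast; linarith)
    rw [Nat.cast_add, Nat.cast_one]
    refine memSobolev_succ (memSobolev_smulLeft n V h') fun i => ?_
    rw [lineDerivOp_smulLeft]
    refine (memSobolev_smulLeft n _ h').add (memSobolev_smulLeft n V ?_)
    have := h.lineDerivOp (m := bvec i)
    rwa [Nat.cast_add, Nat.cast_one, add_sub_cancel_right] at this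

/-! ### The Sobolev embedding -/

theorem ae_eq_of_schwartz {f g : R3 → ℂ} (hf : LocallyIntegrable f volume)
    (hg : LocallyIntegrable g volume)
    (h : ∀ φ : 𝓢(R3, ℂ), ∫ x, φ x * f x = ∫ x, φ x * g x) : f =ᵐ[volume] g := by
  refine ae_eq_of_integral_contDiff_smul_eq hf hg fun η hη hηc => ?_
  have h1 : HasCompactSupport (Complex.ofRealCLM ∘ η) := hηc.comp_left rfl
  have h2 : ContDiff ℝ (⊤ : ℕ∞) (Complex.ofRealCLM ∘ η) := by fun_prop
  simpa using! h (h1.toSchwartzMap h2)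

theorem fourierInv_eq_fourierIntegral (f : R3 → ℂ) :
    𝓕⁻ f = VectorFourier.fourierIntegral Real.fourierChar volume (-innerₗ R3) f := by
  funext x
  rw [Real.fourierInv_eq, VectorFourier.fourierIntegral]
  simp

theorem continuous_fourierInv {v : R3 → ℂ} (hv : Integrable v) : Continuous (𝓕⁻ v) := by
  rw [fourierInv_eq_fourierIntegral]
  refine VectorFourier.fourierIntegral_continuous Real.continuous_fourierChar ?_ hv
  simp only [LinearMap.neg_apply, innerₗ_apply_apply]
  fun_prop

theorem norm_fourierInv_le (v : R3 → ℂ) (x : R3) : ‖𝓕⁻ v x‖ ≤ ∫ y, ‖v y‖ := by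
  rw [fourierInv_eq_fourierIntegral]
  exact VectorFourier.norm_fourierIntegral_le_integral_norm _ _ _ _ _

theorem integral_fourierInv_mul (φ : 𝓢(R3, ℂ)) {v : R3 → ℂ} (hv : Integrable v) :
    ∫ x, (𝓕⁻ φ : 𝓢(R3, ℂ)) x * v x = ∫ x, φ x * 𝓕⁻ v x := by
  have := VectorFourier.integral_fourierIntegral_smul_eq_flip (μ := (volume : Measure R3))
    (ν := (volume : Measure R3)) (L := -innerₗ R3) (f := φ) (g := v) Real.continuous_fourierChar
    (by simp only [LinearMap.neg_apply, innerₗ_apply_apply]; fun_prop) φ.integrable hv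
  have hflip : (-innerₗ R3).flip = -innerₗ R3 := by
    ext x y
    simp [real_inner_comm]
  rw [hflip, ← fourierInv_eq_fourierIntegral, ← fourierInv_eq_fourierIntegral] at this
  rw [← SchwartzMap.fourierInv_coe] at this
  simpa using this

/-- A square integrable function with integrable Fourier transform `v` is a.e. the inverse Fourier
integral of `v`. -/
theorem ae_eq_fourierInv {u : L2} {v : Lp ℂ 1 (volume : Measure R3)}
    (h : 𝓕 (toDist u) = (v : 𝓢'(R3, ℂ))) : (u : R3 → ℂ) =ᵐ[volume] 𝓕⁻ (v : R3 → ℂ) := by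
  have hv : Integrable (v : R3 → ℂ) := L1.integrable_coeFn v
  refine ae_eq_of_schwartz ((Lp.memLp u).locallyIntegrable one_le_two)
    (continuous_fourierInv hv).locallyIntegrable fun φ => ?_
  have h1 : toDist u = 𝓕⁻ (v : 𝓢'(R3, ℂ)) := by
    rw [← h, FourierTransform.fourierInv_fourier_eq]
  rw [← toDist_apply_apply, h1, TemperedDistribution.fourierInv_apply,
    Lp.toTemperedDistribution_apply, ← integral_fourierInv_mul φ hv]
  rfl

theorem fourierInv_hasFDerivAt {v : R3 → ℂ} (hv : Integrable v)
    (hv' : Integrable fun ξ => ‖ξ‖ * ‖v ξ‖) (x : R3) : ∃ L : R3 →L[ℝ] ℂ,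
      HasFDerivAt (𝓕⁻ v) L x ∧
      ∀ m, L m = 𝓕⁻ (fun ξ => 2 * Real.pi * Complex.I * (inner ℝ ξ m : ℂ) * v ξ) x := by
  have h1 := Real.hasFDerivAt_fourier hv hv' (-x)
  have h2 : HasFDerivAt (fun y : R3 => -y) (-ContinuousLinearMap.id ℝ R3) x :=
    (hasFDerivAt_id x).neg
  have h3 := HasFDerivAt.comp x h1 h2
  refine ⟨_, h3.congr_of_eventuallyEq (Filter.Eventually.of_forall fun y =>
    Real.fourierInv_eq_fourier_neg v y), fun m => ?_⟩
  rw [Real.fourierInv_eq_fourier_neg, ContinuousLinearMap.comp_apply]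
  have hint : Integrable (VectorFourier.fourierSMulRight (innerSL ℝ) v) := by
    refine (hv'.const_mul (2 * Real.pi * ‖innerSL ℝ (E := R3)‖)).mono' ?_ ?_
    · exact hv.aestronglyMeasurable.fourierSMulRight
    · refine Filter.Eventually.of_forall fun ξ => ?_
      refine (VectorFourier.norm_fourierSMulRight_le _ v ξ).trans_eq (by ring)
  simp only [neg_apply, ContinuousLinearMap.id_apply, map_neg]
  rw [Real.fourier_eq, Real.fourier_eq, ContinuousLinearMap.integral_apply, ← integral_neg]
  · refine integral_congr_ae (Filter.Eventually.of_forall fun ξ => ?_)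
    simp only [Circle.smul_def, smul_apply, VectorFourier.fourierSMulRight_apply, smul_eq_mul,
      Complex.real_smul]
    rw [show (innerSL ℝ ξ) m = inner ℝ ξ m from rfl]
    ring
  · exact (Real.fourierIntegral_convergent_iff (-x)).mpr hint

/-- The Sobolev embedding `H^{k+2} ⊂ C^k_b` in dimension three. -/
theorem exists_ck_of_sobolev : ∀ (k : ℕ) (u : L2), u ∈ sobolev (k + 2) →
    ∃ a b : Ck k, ∀ᵐ x, u x = (Ck.ev a x : ℂ) + Complex.I * (Ck.ev b x : ℂ)
  | 0, u, hu => by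
    obtain ⟨v, hv⟩ := MemSobolev.fourier_memL1 (s := 2) (by simp; norm_num)
      (show MemSobolev 2 2 (toDist u) by simpa [mem_sobolev] using hu)
    have hvi : Integrable (v : R3 → ℂ) := L1.integrable_coeFn v
    have hc := continuous_fourierInv hvi
    obtain ⟨a, ha⟩ := InCk.zero_level (f := fun x => (𝓕⁻ (v : R3 → ℂ) x).re)
      (Complex.continuous_re.comp hc)
      fun x => (Complex.abs_re_le_norm _).trans (norm_fourierInv_le _ x)
    obtain ⟨b, hb⟩ := InCk.zero_level (f := fun x => (𝓕⁻ (v : R3 → ℂ) x).im)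
      (Complex.continuous_im.comp hc)
      fun x => (Complex.abs_im_le_norm _).trans (norm_fourierInv_le _ x)
    refine ⟨a, b, ?_⟩
    filter_upwards [ae_eq_fourierInv hv] with x hx
    rw [hx, ha, hb, mul_comm Complex.I, Complex.re_add_im]
  | k + 1, u, hu => by
    have hu' : MemSobolev ((k + 2 : ℝ) + 1) 2 (toDist u) := by
      have := mem_sobolev.mp hu
      push_cast at this
      convert this using 1
      ring
    obtain ⟨a, b, hab⟩ := exists_ck_of_sobolev k u (MemSobolev.mono (by linarith) hu')
    have hd : ∀ i, MemSobolev (k + 2 : ℝ) 2 (∂_{bvec i} (toDist u)) := fun i => by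
      simpa using hu'.lineDerivOp (m := bvec i)
    choose w hw using fun i => exists_toDist_of_memSobolev (by positivity) (hd i)
    choose a' b' hab' using fun i => exists_ck_of_sobolev k (w i)
      (by rw [mem_sobolev, ← hw]; exact hd i)
    have hdim : (Module.finrank ℝ R3 : ℝ) < 2 * (k + 2 : ℝ) := by
      simp
      linarith [(Nat.cast_nonneg k : (0 : ℝ) ≤ k)]
    obtain ⟨v, hv⟩ := MemSobolev.fourier_memL1 hdim (MemSobolev.mono (by linarith) hu')
    choose v' hv' using fun i => MemSobolev.fourier_memL1 hdim (hd i)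
    have hvi : Integrable (v : R3 → ℂ) := L1.integrable_coeFn v
    have hvi' : ∀ i, Integrable (v' i : R3 → ℂ) := fun i => L1.integrable_coeFn (v' i)
    -- the Fourier transform of the `i`-th derivative is `2πi ξ_i v`
    have hmul : ∀ i, (v' i : R3 → ℂ) =ᵐ[volume]
        fun ξ => 2 * Real.pi * Complex.I * (inner ℝ ξ (bvec i) : ℂ) * v ξ := by
      intro i
      have hcont : Continuous fun ξ : R3 =>
          2 * Real.pi * Complex.I * ((inner ℝ ξ (bvec i) : ℝ) : ℂ) := by fun_prop
      refine ae_eq_of_schwartz (hvi' i).locallyIntegrable ?_ fun φ => ?_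
      · have := (hvi.locallyIntegrable).locallyIntegrableOn Set.univ
        rw [← locallyIntegrableOn_univ]
        exact this.continuousOn_mul hcont.continuousOn isOpen_univ.isLocallyClosed
      · have h1 : (v' i : 𝓢'(R3, ℂ)) = (2 * Real.pi * Complex.I) •
            smulLeftCLM ℂ (fun ξ => ((inner ℝ ξ (bvec i) : ℝ) : ℂ)) (v : 𝓢'(R3, ℂ)) := by
          rw [← hv' i, ← hv, fourier_lineDerivOp_eq]
        have h2 := congrArg (fun T : 𝓢'(R3, ℂ) => T φ) h1
        have ht : (fun ξ : R3 => ((inner ℝ ξ (bvec i) : ℝ) : ℂ)).HasTemperateGrowth := by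
          fun_prop
        simp only [smul_apply, smulLeftCLM_apply_apply, Lp.toTemperedDistribution_apply,
          smul_eq_mul] at h2
        rw [h2, ← integral_const_mul]
        refine integral_congr_ae (Filter.Eventually.of_forall fun ξ => ?_)
        simp only [SchwartzMap.smulLeftCLM_apply_apply ht, smul_eq_mul]
        ring
    have hnorm : Integrable fun ξ : R3 => ‖ξ‖ * ‖v ξ‖ := by
      refine (integrable_finsetSum Finset.univ fun i (_ : i ∈ Finset.univ) =>
        (hvi' i).norm).mono' ?_ ?_
      · exact continuous_norm.aestronglyMeasurable.mul hvi.aestronglyMeasurable.norm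
      · filter_upwards [MeasureTheory.ae_all_iff.mpr hmul] with ξ hξ
        have hn : ‖ξ‖ ≤ ∑ i, |ξ i| := by
          rw [EuclideanSpace.norm_eq]
          refine Real.sqrt_le_iff.mpr ⟨Finset.sum_nonneg fun _ _ => abs_nonneg _, ?_⟩
          simp only [Real.norm_eq_abs]
          exact Finset.sum_sq_le_sq_sum_of_nonneg fun _ _ => abs_nonneg _
        rw [norm_mul, norm_norm, norm_norm]
        refine (mul_le_mul_of_nonneg_right hn (norm_nonneg _)).trans ?_
        rw [Finset.sum_mul]
        refine Finset.sum_le_sum fun i _ => ?_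
        rw [hξ i]
        have h2 : (inner ℝ ξ (bvec i) : ℝ) = ξ i := by
          simp [bvec, EuclideanSpace.inner_single_right]
        rw [h2]
        simp only [norm_mul, Complex.norm_I, Complex.norm_real, Complex.norm_ofNat,
          Real.norm_eq_abs, abs_of_pos Real.pi_pos, mul_one]
        have h3 : 0 ≤ |ξ i| * ‖v ξ‖ := by positivity
        nlinarith [Real.pi_gt_three]
    -- the continuous representatives agree everywhere
    have hrep : ∀ x, 𝓕⁻ (v : R3 → ℂ) x = (Ck.ev a x : ℂ) + Complex.I * (Ck.ev b x : ℂ) := by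
      have : 𝓕⁻ (v : R3 → ℂ) =
          fun x => (Ck.ev a x : ℂ) + Complex.I * (Ck.ev b x : ℂ) := by
        refine (continuous_fourierInv hvi).ae_eq_iff_eq volume ?_ |>.mp ?_
        · have h1 := (Ck.ev a).continuous
          have h2 := (Ck.ev b).continuous
          fun_prop
        · filter_upwards [hab, ae_eq_fourierInv hv] with x h1 h2
          rw [← h2, h1]
      exact fun x => congrFun this x
    have hrep' : ∀ i x, 𝓕⁻ (v' i : R3 → ℂ) x =
        (Ck.ev (a' i) x : ℂ) + Complex.I * (Ck.ev (b' i) x : ℂ) := by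
      intro i
      have : 𝓕⁻ (v' i : R3 → ℂ) =
          fun x => (Ck.ev (a' i) x : ℂ) + Complex.I * (Ck.ev (b' i) x : ℂ) := by
        refine (continuous_fourierInv (hvi' i)).ae_eq_iff_eq volume ?_ |>.mp ?_
        · have h1 := (Ck.ev (a' i)).continuous
          have h2 := (Ck.ev (b' i)).continuous
          fun_prop
        · filter_upwards [hab' i, ae_eq_fourierInv (u := w i) (v := v' i)
            (by rw [← hw, hv'])] with x h1 h2
          rw [← h2, h1]
      exact fun x => congrFun this x
    choose L hL hLm using fourierInv_hasFDerivAt hvi hnorm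
    have hLi : ∀ i x, L x (bvec i) =
        (Ck.ev (a' i) x : ℂ) + Complex.I * (Ck.ev (b' i) x : ℂ) := by
      intro i x
      rw [hLm, ← hrep', Real.fourierInv_eq, Real.fourierInv_eq]
      refine integral_congr_ae ?_
      filter_upwards [hmul i] with ξ hξ
      rw [hξ]
    have hga : HasGrad (Ck.ev a) fun i => Ck.ev (a' i) := by
      refine ((hasGrad_of_hasFDerivAt fun x =>
        Complex.reCLM.hasFDerivAt.comp x (hL x)).congr fun i x => ?_).congr_left fun x => ?_
      · simp [hLi]
      · simp [hrep]
    have hgb : HasGrad (Ck.ev b) fun i => Ck.ev (b' i) := by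
      refine ((hasGrad_of_hasFDerivAt fun x =>
        Complex.imCLM.hasFDerivAt.comp x (hL x)).congr fun i x => ?_).congr_left fun x => ?_
      · simp [hLi]
      · simp [hrep]
    exact ⟨Ck.mk a a' hga, Ck.mk b b' hgb, hab⟩

end

/-! ### Compact perturbations of a symmetric resolvent -/

section

open scoped InnerProductSpace Topology

section Abstract

variable {E : Type*} [NormedAddCommGroup E] [InnerProductSpace ℂ E]

theorem isCompactOperator_starProjection (T : E →L[ℂ] E) (K : Submodule ℂ E)
    [FiniteDimensional ℂ K] : IsCompactOperator (T ∘L K.starProjection) := by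
  have h1 : IsCompactOperator (id : K → K) :=
    by
    have := FiniteDimensional.proper ℂ K
    exact isCompactOperator_id_iff_locallyCompactSpace.mpr inferInstance
  exact ((h1.comp_clm K.orthogonalProjectionOnto).clm_comp K.subtypeL).clm_comp T

/-- An operator on a Hilbert space is compact if the sums `∑ ‖T e_i‖²` over orthonormal families
are bounded: otherwise one could choose orthonormal vectors with `‖T e_i‖` bounded below. -/
theorem isCompactOperator_of_orthonormal_bound [CompleteSpace E] (T : E →L[ℂ] E) (B : ℝ)
    (hB : ∀ e : ℕ → E, Orthonormal ℂ e → ∀ n, ∑ i ∈ Finset.range n, ‖T (e i)‖ ^ 2 ≤ B) :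
    IsCompactOperator T := by
  have key : ∀ ε : ℝ, 0 < ε → ∃ s : Finset E, ∀ y : E, ‖y‖ = 1 → (∀ x ∈ s, ⟪x, y⟫_ℂ = 0) →
      ‖T y‖ < ε := by
    intro ε hε
    by_contra! hcon
    obtain ⟨f, hf1, hf2⟩ := exists_seq_of_forall_finset_exists
      (fun y : E => ‖y‖ = 1 ∧ ε ≤ ‖T y‖) (fun x y => ⟪x, y⟫_ℂ = 0) (fun s _ => by
        obtain ⟨y, h1, h2, h3⟩ := hcon s
        exact ⟨y, ⟨h1, h3⟩, h2⟩)
    have ho : Orthonormal ℂ f := by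
      refine ⟨fun n => (hf1 n).1, fun m n hmn => ?_⟩
      rcases lt_or_gt_of_ne hmn with h | h
      · exact hf2 m n h
      · exact inner_eq_zero_symm.mp (hf2 n m h)
    obtain ⟨n, hn⟩ := exists_nat_gt (B / ε ^ 2)
    have h1 := hB f ho n
    have h2 : ∑ i ∈ Finset.range n, ε ^ 2 ≤ ∑ i ∈ Finset.range n, ‖T (f i)‖ ^ 2 :=
      Finset.sum_le_sum fun i _ => pow_le_pow_left₀ hε.le (hf1 i).2 2
    rw [Finset.sum_const, Finset.card_range, nsmul_eq_mul] at h2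
    rw [div_lt_iff₀ (by positivity)] at hn
    linarith
  choose s hs using fun n : ℕ => key (1 / (n + 1 : ℝ)) (by positivity)
  let K : ℕ → Submodule ℂ E := fun n => Submodule.span ℂ (s n : Set E)
  have hfin : ∀ n, FiniteDimensional ℂ (K n) := fun n =>
    FiniteDimensional.span_finset ℂ (s n)
  refine isCompactOperator_of_tendsto (l := Filter.atTop)
    (F := fun n => T ∘L (K n).starProjection) (f := T) ?_ (Filter.Eventually.of_forall fun n => ?_)
  · refine tendsto_iff_norm_sub_tendsto_zero.mpr
      (squeeze_zero (fun _ => norm_nonneg _) (fun n => ?_) tendsto_one_div_add_atTop_nhds_zero_nat)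
    refine ContinuousLinearMap.opNorm_le_bound _ (by positivity) fun x => ?_
    have h1 : (T ∘L (K n).starProjection - T) x = -T (x - (K n).starProjection x) := by
      simp
    rw [h1, norm_neg]
    set y := x - (K n).starProjection x with hy
    have hyn : ‖y‖ ≤ ‖x‖ := by
      have h2 : y = (K n)ᗮ.starProjection x := by
        rw [hy, Submodule.starProjection_orthogonal_val]
      rw [h2]
      exact Submodule.norm_starProjection_apply_le _ x
    refine le_trans ?_ (mul_le_mul_of_nonneg_left hyn (by positivity))
    by_cases h0 : y = 0
    · simp [h0]
    · have hpos : 0 < ‖y‖ := norm_pos_iff.mpr h0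
      have h3 := hs n (((‖y‖ : ℂ))⁻¹ • y) (by
        rw [norm_smul, norm_inv, Complex.norm_real, norm_norm, inv_mul_cancel₀ hpos.ne'])
        (fun v hv => by
          rw [inner_smul_right]
          have hv' : v ∈ K n := Submodule.subset_span hv
          rw [hy, (Submodule.sub_starProjection_mem_orthogonal x) v hv', mul_zero])
      rw [map_smul, norm_smul, norm_inv, Complex.norm_real, norm_norm, inv_mul_eq_div,
        div_lt_iff₀ hpos] at h3
      exact h3.le
  · exact isCompactOperator_starProjection T (K n)

variable {R M : E →L[ℂ] E}

/-- The space of solutions of `u = -R (M u)`. -/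
def homSol (R M : E →L[ℂ] E) : Submodule ℂ E := LinearMap.ker (1 + R ∘L M).toLinearMap

theorem mem_homSol {u : E} : u ∈ homSol R M ↔ u = R (0 - M u) := by
  rw [homSol, LinearMap.mem_ker, zero_sub, map_neg, eq_neg_iff_add_eq_zero]
  rfl

theorem finiteDimensional_homSol (hc : IsCompactOperator (R ∘L M)) :
    FiniteDimensional ℂ (homSol R M) := by
  have hcl : IsClosed (homSol R M : Set E) := (1 + R ∘L M).isClosed_ker
  have hV : ∀ v ∈ homSol R M, (-(R ∘L M).toLinearMap : E →ₗ[ℂ] E) v ∈ homSol R M := by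
    intro v hv
    have h : (-(R ∘L M).toLinearMap : E →ₗ[ℂ] E) v = v := by
      rw [mem_homSol, zero_sub, map_neg] at hv
      exact hv.symm
    rwa [h]
  have h1 : IsCompactOperator ((-(R ∘L M).toLinearMap : E →ₗ[ℂ] E).restrict hV) :=
    IsCompactOperator.restrict (f := -(R ∘L M).toLinearMap) hc.neg hV hcl
  refine FiniteDimensional.of_isCompactOperator_id (𝕜 := ℂ) ?_
  convert! h1 using 1
  funext v
  refine Subtype.ext ?_
  have hv := mem_homSol.mp v.2
  rw [zero_sub, map_neg] at hv
  exact hv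

/-- The symmetry of the operator `R⁻¹ + M`. -/
theorem inner_eq_of_sol (hR : ∀ a b, ⟪R a, b⟫_ℂ = ⟪a, R b⟫_ℂ) (hM : ∀ a b, ⟪M a, b⟫_ℂ = ⟪a, M b⟫_ℂ)
    {u v f h : E} (hu : u = R (f - M u)) (hv : v = R (h - M v)) : ⟪v, f⟫_ℂ = ⟪h, u⟫_ℂ := by
  have h1 : ⟪v, f - M u⟫_ℂ = ⟪h - M v, u⟫_ℂ := by
    conv_lhs => rw [hv]
    rw [hR, ← hu]
  rw [inner_sub_right, inner_sub_left, hM] at h1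
  linear_combination h1

theorem inner_homSol_eq_zero (hR : ∀ a b, ⟪R a, b⟫_ℂ = ⟪a, R b⟫_ℂ)
    (hM : ∀ a b, ⟪M a, b⟫_ℂ = ⟪a, M b⟫_ℂ) {u v f : E} (hu : u = R (f - M u))
    (hv : v ∈ homSol R M) : ⟪v, f⟫_ℂ = 0 := by
  rw [inner_eq_of_sol hR hM hu (mem_homSol.mp hv), inner_zero_left]

theorem starProjection_eq_zero_of_sol [(homSol R M).HasOrthogonalProjection]
    (hR : ∀ a b, ⟪R a, b⟫_ℂ = ⟪a, R b⟫_ℂ)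
    (hM : ∀ a b, ⟪M a, b⟫_ℂ = ⟪a, M b⟫_ℂ) {u f : E} (hu : u = R (f - M u)) :
    (homSol R M).starProjection f = 0 :=
  (Submodule.starProjection_apply_eq_zero_iff _).mpr fun _ hv => inner_homSol_eq_zero hR hM hu hv

theorem sol_add {u v f h : E} (hu : u = R (f - M u)) (hv : v = R (h - M v)) :
    u + v = R (f + h - M (u + v)) := by
  conv_lhs => rw [hu, hv]
  rw [← map_add, map_add M]
  congr 1
  abel

theorem sol_smul {u f : E} (c : ℂ) (hu : u = R (f - M u)) : c • u = R (c • f - M (c • u)) := by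
  conv_lhs => rw [hu]
  rw [← map_smul, smul_sub, map_smul M]

theorem eq_unit_inv_iff (S : (E →L[ℂ] E)ˣ) (a b : E) :
    a = ((S⁻¹ : (E →L[ℂ] E)ˣ) : E →L[ℂ] E) b ↔ (S : E →L[ℂ] E) a = b := by
  constructor
  · rintro rfl
    rw [← mul_apply_eq_comp, Units.mul_inv]; rfl
  · rintro rfl
    rw [← mul_apply_eq_comp, Units.inv_mul]; rfl

/-- With `P` the projection on the kernel of `R⁻¹ + M`, the operator `R⁻¹ + M + P` is invertible. -/
theorem exists_inverse_add_proj [CompleteSpace E] [(homSol R M).HasOrthogonalProjection]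
    [FiniteDimensional ℂ (homSol R M)] (hR : ∀ a b, ⟪R a, b⟫_ℂ = ⟪a, R b⟫_ℂ)
    (hM : ∀ a b, ⟪M a, b⟫_ℂ = ⟪a, M b⟫_ℂ) (hc : IsCompactOperator (R ∘L M)) :
    ∃ B : E →L[ℂ] E, ∀ f u, u = B f ↔ u = R (f - (homSol R M).starProjection u - M u) := by
  set P := (homSol R M).starProjection with hP
  have hcomp : IsCompactOperator (R ∘L M + R ∘L P) :=
    hc.add (isCompactOperator_starProjection R _)
  -- by symmetry a solution has `P u = 0`, so it lies in the kernel and equals `P u`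
  have hinj : ∀ u, u + (R ∘L M + R ∘L P) u = 0 → u = 0 := by
    intro u hu
    have h1 : u = R (-P u - M u) := by
      have h2 : R (-P u - M u) = - (R ∘L M + R ∘L P) u := by
        simp only [map_sub, map_neg, add_apply, ContinuousLinearMap.comp_apply]
        abel
      rw [h2]
      exact eq_neg_of_add_eq_zero_left hu
    have h3 := starProjection_eq_zero_of_sol hR hM h1
    have h4 : P u = 0 := by
      rw [map_neg, neg_eq_zero] at h3
      rwa [← Submodule.starProjection_eq_self_iff.mpr
        (Submodule.starProjection_apply_mem (homSol R M) u)]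
    rw [h4, neg_zero] at h1
    have h5 := Submodule.starProjection_eq_self_iff.mpr (mem_homSol.mpr h1)
    rw [← h5]
    exact h4
  -- the Fredholm alternative
  have hunit : IsUnit (1 + (R ∘L M + R ∘L P)) := by
    rcases hcomp.hasEigenvalue_or_mem_resolventSet (T := R ∘L M + R ∘L P) (μ := (-1 : ℂ))
      (by norm_num) with h | h
    · obtain ⟨v, hv⟩ := h.exists_hasEigenvector
      have h6 : (R ∘L M + R ∘L P) v = (-1 : ℂ) • v := hv.apply_eq_smul
      exact absurd (hinj v (by rw [h6]; simp)) hv.2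
    · rw [spectrum.mem_resolventSet_iff] at h
      have h7 : (1 + (R ∘L M + R ∘L P)) = -((algebraMap ℂ (E →L[ℂ] E)) (-1) -
          (R ∘L M + R ∘L P)) := by
        rw [map_neg, map_one]; abel
      rw [h7]
      exact h.neg
  obtain ⟨S, hS⟩ := hunit
  refine ⟨((S⁻¹ : (E →L[ℂ] E)ˣ) : E →L[ℂ] E) ∘L R, fun f u => ?_⟩
  rw [ContinuousLinearMap.comp_apply, eq_unit_inv_iff, hS]
  simp only [add_apply, ContinuousLinearMap.comp_apply, map_sub, one_apply_eq_self]
  constructor <;> intro h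
  · rw [← h]; abel
  · conv_lhs => enter [1]; rw [h]
    abel

/-- The operator `R⁻¹ + M - ζ` is invertible for all small `ζ ≠ 0`: on the range of `P` it is
`-ζ`, and on the complement it agrees with `R⁻¹ + M + P - ζ`, a small perturbation of an
invertible operator. -/
theorem exists_inverse_near [CompleteSpace E] [(homSol R M).HasOrthogonalProjection]
    [FiniteDimensional ℂ (homSol R M)] (hR : ∀ a b, ⟪R a, b⟫_ℂ = ⟪a, R b⟫_ℂ)
    (hM : ∀ a b, ⟪M a, b⟫_ℂ = ⟪a, M b⟫_ℂ) (hc : IsCompactOperator (R ∘L M)) :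
    ∃ ε > 0, ∀ ζ : ℂ, ‖ζ‖ < ε → ζ ≠ 0 →
      ∃ C : E →L[ℂ] E, ∀ f u, u = C f ↔ u = R (f + ζ • u - M u) := by
  obtain ⟨B, hB⟩ := exists_inverse_add_proj hR hM hc
  set P := (homSol R M).starProjection with hP
  refine ⟨min 1 (1 / (‖B‖ + 1)), by positivity, fun ζ hζ hζ0 => ?_⟩
  have hζ1 : ‖ζ‖ < 1 := hζ.trans_le (min_le_left _ _)
  have hζB : ‖ζ • B‖ < 1 := by
    have h1 := hζ.trans_le (min_le_right _ _)
    rw [lt_div_iff₀ (by positivity)] at h1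
    rw [norm_smul]
    nlinarith [norm_nonneg ζ, norm_nonneg B]
  obtain ⟨S, hS⟩ := isUnit_one_sub_of_norm_lt_one hζB
  set D : E →L[ℂ] E := ((S⁻¹ : (E →L[ℂ] E)ˣ) : E →L[ℂ] E) ∘L B with hD
  have hDeq : ∀ f u, u = D f ↔ u = R (f + ζ • u - P u - M u) := by
    intro f u
    rw [← hB, hD, ContinuousLinearMap.comp_apply, eq_unit_inv_iff, hS, sub_apply, smul_apply,
      one_apply_eq_self, map_add, map_smul, sub_eq_iff_eq_add]
  have hPP : ∀ x, P (P x) = P x := fun x =>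
    Submodule.starProjection_eq_self_iff.mpr (Submodule.starProjection_apply_mem _ x)
  have hPsol : ∀ x, P x = R (0 - M (P x)) := fun x =>
    mem_homSol.mp (Submodule.starProjection_apply_mem _ x)
  refine ⟨D ∘L (1 - P) - ζ⁻¹ • P, fun f u => ?_⟩
  simp only [sub_apply, smul_apply, ContinuousLinearMap.comp_apply, one_apply_eq_self]
  constructor
  · intro h
    set w := D (f - P f) with hw
    have h1 := (hDeq (f - P f) w).mp hw
    have h2 := starProjection_eq_zero_of_sol hR hM h1
    rw [← hP] at h2
    have h3 : P w = 0 := by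
      simp only [map_sub, map_add, map_smul, hPP, sub_self, zero_add] at h2
      have h4 : (ζ - 1) • P w = 0 := by rw [sub_smul, one_smul]; exact h2
      refine (smul_eq_zero.mp h4).resolve_left fun h5 => ?_
      rw [sub_eq_zero.mp h5, norm_one] at hζ1
      exact lt_irrefl _ hζ1
    rw [h3, sub_zero] at h1
    have h5 := sol_add h1 (sol_smul (-ζ⁻¹) (hPsol f))
    rw [smul_zero, add_zero, neg_smul, ← sub_eq_add_neg, ← h] at h5
    have h6 : f + ζ • u = f - P f + ζ • w := by
      rw [h, smul_sub, smul_smul, mul_inv_cancel₀ hζ0, one_smul]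
      abel
    rw [h6]
    exact h5
  · intro h
    have h1 := starProjection_eq_zero_of_sol hR hM h
    rw [← hP, map_add, map_smul] at h1
    have h2 : P u = -(ζ⁻¹ • P f) := by
      rw [add_eq_zero_iff_eq_neg.mp h1, smul_neg, smul_smul, inv_mul_cancel₀ hζ0, one_smul, neg_neg]
    have h3 := sol_add h (sol_smul (-1) (hPsol u))
    rw [smul_zero, add_zero, neg_smul, one_smul, ← sub_eq_add_neg] at h3
    have h4 : u - P u = D (f - P f) := by
      rw [hDeq]
      have h5 : f - P f + ζ • (u - P u) - P (u - P u) = f + ζ • u := by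
        rw [map_sub, hPP, sub_self, sub_zero, smul_sub]
        have h6 : ζ • P u = -P f := by rw [h2, smul_neg, smul_smul, mul_inv_cancel₀ hζ0, one_smul]
        rw [h6]
        abel
      rw [h5]
      exact h3
    rw [← h4, h2]
    abel

end Abstract

end

/-! ### The free resolvent and the potential as operators on `L²` -/

section

open scoped InnerProductSpace Topology FourierTransform

/-- Multiplication by an essentially bounded function. -/
def mulL (m : R3 → ℂ) (hm : MemLp m ⊤ (volume : Measure R3)) : L2 →L[ℂ] L2 :=
  (ContinuousLinearMap.mul ℂ ℂ).holderL volume ⊤ 2 2 (hm.toLp m)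

theorem coeFn_mulL {m : R3 → ℂ} (hm : MemLp m ⊤ (volume : Measure R3)) (u : L2) :
    mulL m hm u =ᵐ[volume] fun x => m x * u x := by
  have h1 := (ContinuousLinearMap.mul ℂ ℂ).coeFn_holder (r := 2) (hm.toLp m) u
  filter_upwards [h1, hm.coeFn_toLp] with x hx hx'
  rw [← hx']
  exact hx

theorem toDist_mulL {m : R3 → ℂ} (hm : MemLp m ⊤ (volume : Measure R3))
    (ht : m.HasTemperateGrowth) (u : L2) : toDist (mulL m hm u) = smulLeftCLM ℂ m (toDist u) := by
  have h : mulL m hm u = hm.toLp m • u := by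
    refine Lp.ext ?_
    filter_upwards [coeFn_mulL hm u, Lp.coeFn_lpSMul (r := 2) (hm.toLp m) u, hm.coeFn_toLp]
      with x h1 h2 h3
    rw [h1, h2, Pi.smul_apply', smul_eq_mul, h3]
  rw [h]
  exact Lp.toTemperedDistribution_smul_eq ht hm u

theorem inner_eq_integral (u v : L2) : ⟪u, v⟫_ℂ = ∫ x, starRingEnd ℂ (u x) * v x := by
  rw [L2.inner_def]
  refine integral_congr_ae (Filter.Eventually.of_forall fun x => ?_)
  simp [mul_comm]

theorem norm_sq_eq_integral (u : L2) : ‖u‖ ^ 2 = ∫ x, ‖u x‖ ^ 2 := by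
  have h := inner_self_eq_norm_sq_to_K (𝕜 := ℂ) u
  rw [inner_eq_integral] at h
  have h2 : ∫ x, starRingEnd ℂ (u x) * u x = ((∫ x, ‖u x‖ ^ 2 : ℝ) : ℂ) := by
    rw [← integral_complex_ofReal]
    refine integral_congr_ae (Filter.Eventually.of_forall fun x => ?_)
    simp only [Complex.conj_mul']
    push_cast
    rfl
  rw [h2] at h
  exact (Complex.ofReal_injective (by rw [h]; push_cast; rfl)).symm

theorem integrable_norm_sq (u : L2) : Integrable fun x => ‖u x‖ ^ 2 :=
  (memLp_two_iff_integrable_sq_norm (Lp.aestronglyMeasurable u)).mp (Lp.memLp u)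

theorem inner_mulL {m : R3 → ℝ} (hm : MemLp (fun x => (m x : ℂ)) ⊤ (volume : Measure R3))
    (u v : L2) : ⟪mulL _ hm u, v⟫_ℂ = ⟪u, mulL _ hm v⟫_ℂ := by
  rw [inner_eq_integral, inner_eq_integral]
  refine integral_congr_ae ?_
  filter_upwards [coeFn_mulL hm u, coeFn_mulL hm v] with x h1 h2
  rw [h1, h2, map_mul, Complex.conj_ofReal]
  ring

/-- The symbol `1 / (4π²|ξ|² + κ)` of `(-Δ + κ)⁻¹`. -/
def resSymbol (κ : ℝ) (ξ : R3) : ℝ := ((2 * Real.pi) ^ 2 * ‖ξ‖ ^ 2 + κ)⁻¹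

theorem temperate_resSymbol {κ : ℝ} (hκ : 0 < κ) : (resSymbol κ).HasTemperateGrowth := by
  have h : resSymbol κ = fun ξ => κ⁻¹ *
      ((fun x : R3 => (1 + ‖x‖ ^ 2) ^ (-1 : ℝ)) ∘
        (((2 * Real.pi / Real.sqrt κ) • ContinuousLinearMap.id ℝ R3 : R3 →L[ℝ] R3))) ξ := by
    funext ξ
    have h1 : Real.sqrt κ ^ 2 = κ := Real.sq_sqrt hκ.le
    have h2 : 0 < Real.sqrt κ := Real.sqrt_pos.mpr hκ
    simp only [Function.comp, smul_apply, ContinuousLinearMap.id_apply, norm_smul, mul_pow,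
      Real.norm_eq_abs, sq_abs, div_pow, h1]
    rw [Real.rpow_neg_one, ← mul_inv, resSymbol]
    congr 1
    field_simp
    ring
  rw [h]
  exact (Function.HasTemperateGrowth.const _).mul
    ((Function.hasTemperateGrowth_one_add_norm_sq_rpow R3 (-1)).comp
      (ContinuousLinearMap.hasTemperateGrowth _))

theorem resSymbol_pos {κ : ℝ} (hκ : 0 < κ) (ξ : R3) : 0 < resSymbol κ ξ := by
  unfold resSymbol; positivity

theorem resSymbol_le {κ : ℝ} (hκ : 0 < κ) (ξ : R3) : resSymbol κ ξ ≤ κ⁻¹ := by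
  unfold resSymbol
  gcongr
  nlinarith [sq_nonneg (2 * Real.pi * ‖ξ‖)]

theorem memLp_top_resSymbol {κ : ℝ} (hκ : 0 < κ) :
    MemLp (fun ξ => (resSymbol κ ξ : ℂ)) ⊤ (volume : Measure R3) := by
  refine memLp_top_of_bound ?_ κ⁻¹ (Filter.Eventually.of_forall fun ξ => ?_)
  · exact (Complex.continuous_ofReal.comp
      (temperate_resSymbol hκ).1.continuous).aestronglyMeasurable
  · rw [Complex.norm_real, Real.norm_eq_abs, abs_of_pos (resSymbol_pos hκ ξ)]
    exact resSymbol_le hκ ξ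

/-- `resSymbol` decays quadratically, hence is square integrable in dimension three. -/
theorem integrable_resSymbol_sq {κ : ℝ} (hκ : 0 < κ) : Integrable fun ξ => resSymbol κ ξ ^ 2 := by
  have h := (integrable_rpow_neg_one_add_norm_sq (E := R3) (μ := volume) (r := 4)
    (by simp; norm_num)).const_mul ((min 1 κ)⁻¹ ^ 2)
  refine h.mono' ((temperate_resSymbol hκ).1.continuous.pow 2).aestronglyMeasurable
    (Filter.Eventually.of_forall fun ξ => ?_)
  have h0 : 0 < min 1 κ := lt_min one_pos hκ
  have h1 : resSymbol κ ξ ≤ (min 1 κ)⁻¹ * (1 + ‖ξ‖ ^ 2)⁻¹ := by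
    rw [resSymbol, ← mul_inv]
    refine inv_anti₀ (by positivity) ?_
    have h2 : 1 ≤ (2 * Real.pi) ^ 2 := by nlinarith [Real.pi_gt_three]
    nlinarith [min_le_left 1 κ, min_le_right 1 κ, sq_nonneg ‖ξ‖,
      mul_le_mul_of_nonneg_right ((min_le_left 1 κ).trans h2) (sq_nonneg ‖ξ‖)]
  rw [Real.norm_eq_abs, abs_of_nonneg (sq_nonneg _)]
  refine (pow_le_pow_left₀ (resSymbol_pos hκ ξ).le h1 2).trans_eq ?_
  rw [mul_pow, show (-4 / 2 : ℝ) = -(2 : ℕ) by norm_num, Real.rpow_neg (by positivity),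
    Real.rpow_natCast, inv_pow (1 + ‖ξ‖ ^ 2)]

/-- The Fourier multiplier on `L²` with a bounded symbol. -/
def fourierMul (m : R3 → ℂ) (hm : MemLp m ⊤ (volume : Measure R3)) : L2 →L[ℂ] L2 :=
  ((Lp.fourierTransformₗᵢ R3 ℂ).symm.toContinuousLinearEquiv : L2 →L[ℂ] L2) ∘L
    mulL m hm ∘L ((Lp.fourierTransformₗᵢ R3 ℂ).toContinuousLinearEquiv : L2 →L[ℂ] L2)

theorem fourier_fourierMul {m : R3 → ℂ} (hm : MemLp m ⊤ (volume : Measure R3)) (f : L2) :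
    𝓕 (fourierMul m hm f) = mulL m hm (𝓕 f) := by
  rw [show fourierMul m hm f = 𝓕⁻ (mulL m hm (𝓕 f)) from rfl,
    FourierTransform.fourier_fourierInv_eq]

theorem toDist_fourierMul {m : R3 → ℂ} (hm : MemLp m ⊤ (volume : Measure R3))
    (ht : m.HasTemperateGrowth) (f : L2) :
    toDist (fourierMul m hm f) = fourierMultiplierCLM ℂ m (toDist f) := by
  rw [fourierMultiplierCLM_apply, show fourierMul m hm f = 𝓕⁻ (mulL m hm (𝓕 f)) from rfl,
    toDist_apply, ← Lp.fourierInv_toTemperedDistribution_eq, ← toDist_apply, toDist_mulL _ ht,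
    toDist_apply, ← Lp.fourier_toTemperedDistribution_eq]
  rfl

/-- The free resolvent `(-Δ + κ)⁻¹` on `L²`. -/
def freeRes {κ : ℝ} (hκ : 0 < κ) : L2 →L[ℂ] L2 := fourierMul _ (memLp_top_resSymbol hκ)

theorem fourier_freeRes {κ : ℝ} (hκ : 0 < κ) (f : L2) :
    𝓕 (freeRes hκ f) = mulL _ (memLp_top_resSymbol hκ) (𝓕 f) := fourier_fourierMul _ f

theorem inner_freeRes {κ : ℝ} (hκ : 0 < κ) (u v : L2) :
    ⟪freeRes hκ u, v⟫_ℂ = ⟪u, freeRes hκ v⟫_ℂ := by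
  rw [← Lp.inner_fourier_eq, ← Lp.inner_fourier_eq u, fourier_freeRes, fourier_freeRes, inner_mulL]

theorem toDist_freeRes {κ : ℝ} (hκ : 0 < κ) (f : L2) :
    toDist (freeRes hκ f) = fourierMultiplierCLM ℂ (fun ξ => (resSymbol κ ξ : ℂ)) (toDist f) :=
  toDist_fourierMul _ (temperate_ofReal (temperate_resSymbol hκ)) f

/-- The free resolvent gains two derivatives. -/
theorem freeRes_mem_sobolev {κ : ℝ} (hκ : 0 < κ) {s : ℝ} {f : L2} (hf : f ∈ sobolev s) :
    freeRes hκ f ∈ sobolev (s + 2) := by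
  have h1 : (fun x : R3 => (((1 + ‖x‖ ^ 2) ^ ((2 : ℝ) / 2) : ℝ) : ℂ)).HasTemperateGrowth :=
    temperate_ofReal (Function.hasTemperateGrowth_one_add_norm_sq_rpow R3 _)
  have hr := temperate_ofReal (temperate_resSymbol hκ)
  rw [mem_sobolev, add_comm, ← memSobolev_besselPotential_iff, toDist_freeRes, besselPotential,
    fourierMultiplierCLM_fourierMultiplierCLM_apply hr h1]
  refine MemSobolev.fourierMultiplierCLM_of_bounded hf (hr.mul h1) ⟨κ⁻¹ + 1, fun x => ?_⟩
  rw [Pi.mul_apply, ← Complex.ofReal_mul, Complex.norm_real, Real.norm_eq_abs, div_self two_ne_zero,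
    Real.rpow_one, abs_of_nonneg (mul_nonneg (resSymbol_pos hκ x).le (by positivity)), mul_add,
    mul_one]
  refine add_le_add (resSymbol_le hκ x) ?_
  rw [resSymbol, inv_mul_eq_div, div_le_one (by positivity)]
  have h2 : 1 ≤ (2 * Real.pi) ^ 2 := by nlinarith [Real.pi_gt_three]
  nlinarith [mul_le_mul_of_nonneg_right h2 (sq_nonneg ‖x‖)]

/-- `u = (-Δ + κ)⁻¹ f` means that `-Δ u + κ u = f` in the sense of distributions. -/
theorem eq_freeRes_iff {κ : ℝ} (hκ : 0 < κ) (u f : L2) :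
    u = freeRes hκ f ↔ -Δ (toDist u) + (κ : ℂ) • toDist u = toDist f := by
  have hsq : (fun x : R3 => ((‖x‖ ^ 2 : ℝ) : ℂ)).HasTemperateGrowth :=
    temperate_ofReal (Function.hasTemperateGrowth_norm_sq R3)
  set q : R3 → ℂ := fun x => (((2 * Real.pi) ^ 2 * ‖x‖ ^ 2 + κ : ℝ) : ℂ) with hq
  have hqt : q.HasTemperateGrowth := temperate_ofReal
    (((Function.HasTemperateGrowth.const _).mul (Function.hasTemperateGrowth_norm_sq R3)).add
      (Function.HasTemperateGrowth.const _))
  have hr := temperate_ofReal (temperate_resSymbol hκ)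
  have key : ∀ T : 𝓢'(R3, ℂ), -Δ T + (κ : ℂ) • T = fourierMultiplierCLM ℂ q T := by
    intro T
    have e1 : q = (((2 * Real.pi) ^ 2 : ℝ) : ℂ) • (fun x : R3 => ((‖x‖ ^ 2 : ℝ) : ℂ)) +
        fun _ => (κ : ℂ) := by
      funext x
      simp [hq]
    rw [laplacian_eq_fourierMultiplierCLM, e1]
    simp only [fourierMultiplierCLM_apply]
    have e2 : ((((2 * Real.pi) ^ 2 : ℝ) : ℂ) •
        (fun x : R3 => ((‖x‖ ^ 2 : ℝ) : ℂ))).HasTemperateGrowth :=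
      (Function.HasTemperateGrowth.const _).mul hsq
    rw [smulLeftCLM_add e2 (Function.HasTemperateGrowth.const _), smulLeftCLM_smul hsq,
      add_apply, smulLeftCLM_const, FourierTransform.fourierInv_add, smul_apply,
      FourierTransform.fourierInv_smul,
      FourierTransform.fourierInv_smul, FourierTransform.fourierInv_fourier_eq,
      ← Complex.coe_smul]
    push_cast
    rw [neg_smul, neg_neg]
  have hinv : q * (fun ξ => (resSymbol κ ξ : ℂ)) = fun _ => (1 : ℂ) := by
    funext x
    rw [Pi.mul_apply, hq, ← Complex.ofReal_mul, resSymbol, mul_inv_cancel₀ (by positivity),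
      Complex.ofReal_one]
  rw [key]
  constructor
  · rintro rfl
    rw [toDist_freeRes, fourierMultiplierCLM_fourierMultiplierCLM_apply hr hqt, mul_comm, hinv]
    simp
  · intro h
    refine toDist_injective ?_
    rw [toDist_freeRes, ← h, fourierMultiplierCLM_fourierMultiplierCLM_apply hqt hr, hinv]
    simp

/-- Multiplication by a Schwartz function on `L²`. -/
def mulSchwartz (V : 𝓢(R3, ℝ)) : L2 →L[ℂ] L2 :=
  mulL (fun x => (V x : ℂ)) (V.memLp ⊤).ofReal

theorem coeFn_mulSchwartz (V : 𝓢(R3, ℝ)) (u : L2) :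
    mulSchwartz V u =ᵐ[volume] fun x => (V x : ℂ) * u x := coeFn_mulL _ u

theorem toDist_mulSchwartz (V : 𝓢(R3, ℝ)) (u : L2) :
    toDist (mulSchwartz V u) = smulLeftCLM ℂ (fun x => (V x : ℂ)) (toDist u) :=
  toDist_mulL _ (temperate_ofReal V.hasTemperateGrowth) u

/-- The eigenvalue and resolvent equations of `H` below the essential spectrum, in terms of the free
resolvent. -/
theorem shift_eq_iff (V : 𝓢(R3, ℝ)) {κ : ℝ} (hκ : 0 < κ) (u f : L2) :
    (∃ h : u ∈ (schrodinger V).domain, shift (schrodinger V) ((-κ : ℝ) : ℂ) ⟨u, h⟩ = f) ↔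
      u = freeRes hκ (f - mulSchwartz V u) := by
  have h1 : ∀ h : u ∈ (schrodinger V).domain,
      toDist (shift (schrodinger V) ((-κ : ℝ) : ℂ) ⟨u, h⟩) =
        -Δ (toDist u) + (κ : ℂ) • toDist u + toDist (mulSchwartz V u) := by
    intro h
    have e1 : shift (schrodinger V) ((-κ : ℝ) : ℂ) ⟨u, h⟩ =
        schrodinger V ⟨u, h⟩ + (κ : ℂ) • u := by
      simp [shift, sub_eq_add_neg]
      rfl
    rw [e1, map_add, map_smul, toDist_schrodinger, schrodingerDist_apply, toDist_mulSchwartz,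
      ← toDist_apply]
    abel
  rw [eq_freeRes_iff, map_sub, eq_sub_iff_add_eq]
  constructor
  · rintro ⟨h, rfl⟩
    rw [h1]
  · intro h
    have h2 : u = freeRes hκ (f - mulSchwartz V u) := by
      rw [eq_freeRes_iff, map_sub, eq_sub_iff_add_eq, h]
    have hdom : u ∈ (schrodinger V).domain := by
      rw [h2]
      have := freeRes_mem_sobolev hκ (s := 0) (f := f - mulSchwartz V u)
        (memSobolev_zero_toDist _)
      rwa [zero_add] at this
    exact ⟨hdom, toDist_injective (by rw [h1, h])⟩

/-! ### Compactness -/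

theorem integral_fourier_mul (φ : 𝓢(R3, ℂ)) {v : R3 → ℂ} (hv : Integrable v) :
    ∫ x, (𝓕 φ : 𝓢(R3, ℂ)) x * v x = ∫ x, φ x * 𝓕 v x := by
  have := VectorFourier.integral_fourierIntegral_smul_eq_flip (μ := (volume : Measure R3))
    (ν := (volume : Measure R3)) (L := innerₗ R3) (f := φ) (g := v) Real.continuous_fourierChar
    (by simp only [innerₗ_apply_apply]; fun_prop) φ.integrable hv
  rw [flip_innerₗ] at this
  rw [SchwartzMap.fourier_coe]
  simpa using! this

/-- On `L¹ ∩ L²` the Fourier transform is given by the Fourier integral. -/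
theorem ae_eq_fourier {u : L2} (hu : Integrable (u : R3 → ℂ)) :
    ((𝓕 u : L2) : R3 → ℂ) =ᵐ[volume] 𝓕 (u : R3 → ℂ) := by
  refine ae_eq_of_schwartz ((Lp.memLp (𝓕 u : L2)).locallyIntegrable one_le_two)
    ?_ fun φ => ?_
  · exact (VectorFourier.fourierIntegral_continuous Real.continuous_fourierChar
      (by simp only [innerₗ_apply_apply]; fun_prop) hu).locallyIntegrable
  · rw [← toDist_apply_apply, toDist_apply, ← Lp.fourier_toTemperedDistribution_eq,
      TemperedDistribution.fourier_apply, Lp.toTemperedDistribution_apply,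
      ← integral_fourier_mul φ hu]
    rfl

/-- `(-Δ + κ)⁻¹ V` is a Hilbert–Schmidt operator. -/
theorem isCompactOperator_freeRes_mulSchwartz (V : 𝓢(R3, ℝ)) {κ : ℝ} (hκ : 0 < κ) :
    IsCompactOperator (freeRes hκ ∘L mulSchwartz V) := by
  -- the functions `k ξ` represent the Fourier transform of `V u` at `ξ`
  have hk : ∀ ξ : R3, MemLp (fun x => (Real.fourierChar (inner ℝ x ξ) : ℂ) * (V x : ℂ)) 2
      (volume : Measure R3) := by
    intro ξ
    refine MemLp.of_le (V.memLp 2 (volume : Measure R3)) ?_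
      (Filter.Eventually.of_forall fun x => ?_)
    · have hV := V.continuous
      have h1 : Continuous fun x : R3 => (Real.fourierChar (inner ℝ x ξ) : ℂ) :=
        continuous_subtype_val.comp (Real.continuous_fourierChar.comp (by fun_prop))
      exact (h1.mul (Complex.continuous_ofReal.comp hV)).aestronglyMeasurable
    · rw [norm_mul, Circle.norm_coe, one_mul, Complex.norm_real]
  set C := ∫ x, V x ^ 2 with hC
  have hkn : ∀ ξ, ‖(hk ξ).toLp _‖ ^ 2 = C := by
    intro ξ
    rw [norm_sq_eq_integral]
    refine integral_congr_ae ?_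
    filter_upwards [(hk ξ).coeFn_toLp] with x hx
    rw [hx, norm_mul, Circle.norm_coe, one_mul, Complex.norm_real, Real.norm_eq_abs, sq_abs]
  have hrep : ∀ u : L2, ((𝓕 (mulSchwartz V u) : L2) : R3 → ℂ) =ᵐ[volume]
      fun ξ => ⟪(hk ξ).toLp _, u⟫_ℂ := by
    intro u
    have hi : Integrable (mulSchwartz V u : R3 → ℂ) :=
      (MemLp.integrable_mul ((V.memLp 2).ofReal (K := ℂ)) (Lp.memLp u)).congr
        (coeFn_mulSchwartz V u).symm
    filter_upwards [ae_eq_fourier hi] with ξ hξ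
    rw [hξ, Real.fourier_eq, inner_eq_integral]
    refine integral_congr_ae ?_
    filter_upwards [coeFn_mulSchwartz V u, (hk ξ).coeFn_toLp] with x h1 h2
    rw [h1, h2, map_mul, Complex.conj_ofReal, Circle.smul_def, smul_eq_mul,
      ← Circle.coe_inv_eq_conj,
      ← AddChar.map_neg_eq_inv, mul_assoc]
  refine isCompactOperator_of_orthonormal_bound _ (∫ ξ, resSymbol κ ξ ^ 2 * C) fun e he n => ?_
  have hnorm : ∀ u : L2, ‖(freeRes hκ ∘L mulSchwartz V) u‖ ^ 2 =
      ∫ ξ, resSymbol κ ξ ^ 2 * ‖⟪(hk ξ).toLp _, u⟫_ℂ‖ ^ 2 := by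
    intro u
    rw [ContinuousLinearMap.comp_apply, ← Lp.norm_fourier_eq, fourier_freeRes, norm_sq_eq_integral]
    refine integral_congr_ae ?_
    filter_upwards [coeFn_mulL (memLp_top_resSymbol hκ) (𝓕 (mulSchwartz V u)), hrep u] with ξ h1 h2
    rw [h1, h2, norm_mul, mul_pow, Complex.norm_real, Real.norm_eq_abs, sq_abs]
  have hint : ∀ u : L2, Integrable fun ξ => resSymbol κ ξ ^ 2 * ‖⟪(hk ξ).toLp _, u⟫_ℂ‖ ^ 2 := by
    intro u
    refine (integrable_norm_sq (mulL _ (memLp_top_resSymbol hκ) (𝓕 (mulSchwartz V u)))).congr ?_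
    filter_upwards [coeFn_mulL (memLp_top_resSymbol hκ) (𝓕 (mulSchwartz V u)), hrep u] with ξ h1 h2
    rw [h1, h2, norm_mul, mul_pow, Complex.norm_real, Real.norm_eq_abs, sq_abs]
  simp only [hnorm]
  rw [← integral_finsetSum _ fun i _ => hint (e i)]
  refine integral_mono (integrable_finsetSum _ fun i _ => hint (e i))
    ((integrable_resSymbol_sq hκ).mul_const C) fun ξ => ?_
  simp only [← Finset.mul_sum]
  refine mul_le_mul_of_nonneg_left ?_ (sq_nonneg _)
  rw [← hkn ξ]
  simp only [norm_inner_symm ((hk ξ).toLp _)]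
  exact he.sum_inner_products_le _

end

/-! ### The spectrum of `H` below zero -/

section

open scoped InnerProductSpace Topology FourierTransform

theorem notMem_spec_of_inverse {A : L2 →ₗ.[ℂ] L2} {l : ℂ} (C : L2 →L[ℂ] L2)
    (hC : ∀ f u, u = C f ↔ ∃ h : u ∈ A.domain, shift A l ⟨u, h⟩ = f) : l ∉ spec A := by
  rw [spec, Set.mem_ofPred_eq, not_not]
  have h1 : ∀ u : A.domain, (u : L2) = C (shift A l u) := fun u => (hC _ _).mpr ⟨u.2, rfl⟩
  refine ⟨⟨fun u v huv => Subtype.ext ?_, fun f => ?_⟩, ‖C‖, fun u => ?_⟩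
  · rw [h1 u, h1 v, huv]
  · obtain ⟨h, hf⟩ := (hC f (C f)).mp rfl
    exact ⟨_, hf⟩
  · conv_lhs => rw [h1 u]
    exact C.le_opNorm _

theorem shift_add {A : L2 →ₗ.[ℂ] L2} (l ζ : ℂ) (u : A.domain) (f : L2) :
    shift A (l + ζ) u = f ↔ shift A l u = f + ζ • (u : L2) := by
  simp only [shift, LinearMap.sub_apply, LinearMap.smul_apply, Submodule.subtype_apply, add_smul]
  rw [sub_eq_iff_eq_add, sub_eq_iff_eq_add]
  rw [show (l • A.domain.subtype + ζ • A.domain.subtype) u = l • (u : L2) + ζ • (u : L2) from rfl]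
  constructor <;> intro h <;> rw [h] <;> abel

theorem inner_mulSchwartz (V : 𝓢(R3, ℝ)) (u v : L2) :
    ⟪mulSchwartz V u, v⟫_ℂ = ⟪u, mulSchwartz V v⟫_ℂ := inner_mulL _ u v

variable (V : 𝓢(R3, ℝ)) {κ : ℝ} (hκ : 0 < κ)

/-- The kernel of `H + κ`, as a subspace of `L²`. -/
abbrev kerH : Submodule ℂ L2 := homSol (freeRes hκ) (mulSchwartz V)

instance finiteDimensional_kerH : FiniteDimensional ℂ (kerH V hκ) :=
  finiteDimensional_homSol (isCompactOperator_freeRes_mulSchwartz V hκ)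

theorem mem_kerH_iff (u : L2) : u ∈ kerH V hκ ↔
    ∃ h : u ∈ (schrodinger V).domain, shift (schrodinger V) ((-κ : ℝ) : ℂ) ⟨u, h⟩ = 0 := by
  rw [mem_homSol, shift_eq_iff V hκ]

theorem map_eigenspace : (eigenspace (schrodinger V) ((-κ : ℝ) : ℂ)).map
    (schrodinger V).domain.subtype = kerH V hκ := by
  ext u
  rw [mem_kerH_iff]
  constructor
  · rintro ⟨v, hv, rfl⟩
    exact ⟨v.2, hv⟩
  · rintro ⟨h, hu⟩
    exact ⟨⟨u, h⟩, hu, rfl⟩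

/-- Negative eigenvalues belong to the discrete spectrum. -/
theorem mem_discreteSpec (h : kerH V hκ ≠ ⊥) :
    ((-κ : ℝ) : ℂ) ∈ discreteSpec (schrodinger V) := by
  have hne : eigenspace (schrodinger V) ((-κ : ℝ) : ℂ) ≠ ⊥ := by
    intro h0
    rw [← map_eigenspace, h0, Submodule.map_bot] at h
    exact h rfl
  refine ⟨?_, ?_, hne, ?_⟩
  · rw [spec, Set.mem_ofPred_eq]
    rintro ⟨⟨hinj, -⟩, -⟩
    exact hne (LinearMap.ker_eq_bot.mpr hinj)
  · obtain ⟨ε, hε, hC⟩ := exists_inverse_near (inner_freeRes hκ) (inner_mulSchwartz V)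
      (isCompactOperator_freeRes_mulSchwartz V hκ)
    refine ⟨ε, hε, fun l' hl' hne' => ?_⟩
    by_contra! hlt
    obtain ⟨C, hC'⟩ := hC (l' - ((-κ : ℝ) : ℂ)) (by rwa [← dist_eq_norm]) (sub_ne_zero.mpr hne')
    refine notMem_spec_of_inverse C (fun f u => ?_) hl'
    rw [hC']
    have h2 := shift_eq_iff V hκ u (f + (l' - ((-κ : ℝ) : ℂ)) • u)
    refine h2.symm.trans (exists_congr fun hu => ?_)
    rw [← shift_add, add_sub_cancel]
  · have e := (Submodule.equivMapOfInjective (schrodinger V).domain.subtype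
      (Submodule.injective_subtype _) (eigenspace (schrodinger V) ((-κ : ℝ) : ℂ)))
    have : FiniteDimensional ℂ ((eigenspace (schrodinger V) ((-κ : ℝ) : ℂ)).map
      (schrodinger V).domain.subtype) := by
      rw [map_eigenspace V hκ]; infer_instance
    exact e.symm.finiteDimensional

theorem notMem_spec_of_kerH_eq_bot (h : kerH V hκ = ⊥) :
    ((-κ : ℝ) : ℂ) ∉ spec (schrodinger V) := by
  obtain ⟨B, hB⟩ := exists_inverse_add_proj (inner_freeRes hκ) (inner_mulSchwartz V)
      (isCompactOperator_freeRes_mulSchwartz V hκ)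
  refine notMem_spec_of_inverse B fun f u => ?_
  rw [hB, shift_eq_iff V hκ]
  have h1 : (homSol (freeRes hκ) (mulSchwartz V)).starProjection u = 0 := by
    rw [Submodule.starProjection_apply_eq_zero_iff]
    intro v hv
    have : v ∈ (⊥ : Submodule ℂ L2) := h ▸ hv
    rw [(Submodule.mem_bot ℂ).mp this, inner_zero_left]
  change u = freeRes hκ (f - (homSol (freeRes hκ) (mulSchwartz V)).starProjection u - _) ↔ _
  rw [h1, sub_zero]

/-- The reduced resolvent of `H` at `-κ`, for a vector `p` which spans the kernel of `H + κ` (and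
is zero or normalized). -/
theorem exists_reducedResolvent {p : L2} (hp : kerH V hκ = Submodule.span ℂ {p})
    (hpn : p = 0 ∨ ‖p‖ = 1) :
    ∃ S : L2 →L[ℂ] L2, ∀ f v, v = S f ↔
      v = freeRes hκ (f - ⟪p, f⟫_ℂ • p - mulSchwartz V v) ∧ ⟪p, v⟫_ℂ = 0 := by
  obtain ⟨B, hB⟩ := exists_inverse_add_proj (inner_freeRes hκ) (inner_mulSchwartz V)
      (isCompactOperator_freeRes_mulSchwartz V hκ)
  have hP : ∀ u, (homSol (freeRes hκ) (mulSchwartz V)).starProjection u = ⟪p, u⟫_ℂ • p := by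
    intro u
    have hmem : ⟪p, u⟫_ℂ • p ∈ kerH V hκ := by
      rw [hp]
      exact Submodule.smul_mem _ _ (Submodule.mem_span_singleton_self p)
    refine (Submodule.eq_starProjection_of_mem_of_inner_eq_zero hmem fun w hw => ?_)
    have hw' : w ∈ kerH V hκ := hw
    rw [hp, Submodule.mem_span_singleton] at hw'
    obtain ⟨c, rfl⟩ := hw'
    rw [inner_smul_right, ← inner_conj_symm, inner_sub_right, inner_smul_right]
    rcases hpn with h | h
    · simp [h]
    · rw [inner_self_eq_norm_sq_to_K, h]
      simp
  have hpk : p ∈ kerH V hκ := by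
    rw [hp]
    exact Submodule.mem_span_singleton_self p
  refine ⟨B ∘L (1 - (homSol (freeRes hκ) (mulSchwartz V)).starProjection), fun f v => ?_⟩
  rw [ContinuousLinearMap.comp_apply, hB]
  simp only [sub_apply, one_apply_eq_self, hP]
  have hpp : ⟪p, f - ⟪p, f⟫_ℂ • p⟫_ℂ = 0 := by
    rw [inner_sub_right, inner_smul_right]
    rcases hpn with h | h
    · simp [h]
    · rw [inner_self_eq_norm_sq_to_K, h]
      simp
  constructor
  · intro h
    have h1 := inner_homSol_eq_zero (inner_freeRes hκ) (inner_mulSchwartz V) h hpk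
    rw [inner_sub_right, hpp, zero_sub, neg_eq_zero, inner_smul_right] at h1
    have h2 : ⟪p, v⟫_ℂ = 0 := by
      rcases hpn with h3 | h3
      · simp [h3]
      · rw [inner_self_eq_norm_sq_to_K, h3] at h1
        simpa using h1
    rw [h2, zero_smul, sub_zero] at h
    exact ⟨h, h2⟩
  · rintro ⟨h1, h2⟩
    rwa [h2, zero_smul, sub_zero]

section Assumption

variable {N : ℕ} {V : 𝓢(R3, ℝ)} {ω : Fin N → ℝ} {φ : Fin N → L2}

theorem kerH_eq_bot (hH : SpectralAssumption V ω φ) {κ : ℝ} (hκ : 0 < κ)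
    (h : ∀ j, ω j ≠ -κ) : kerH V hκ = ⊥ := by
  by_contra hne
  have h1 := mem_discreteSpec V hκ hne
  rw [hH.discreteSpec_eq] at h1
  obtain ⟨j, hj⟩ := h1
  exact h j (Complex.ofReal_injective hj)

theorem mem_kerH_eigenfunction (hH : SpectralAssumption V ω φ) {κ : ℝ} (hκ : 0 < κ) {j : Fin N}
    (h : ω j = -κ) :
    φ j ∈ kerH V hκ := by
  rw [mem_kerH_iff]
  obtain ⟨h1, h2⟩ := hH.eigenfunction j
  refine ⟨h1, ?_⟩
  rw [← h]
  have : shift (schrodinger V) (ω j : ℂ) ⟨φ j, h1⟩ =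
      schrodinger V ⟨φ j, h1⟩ - (ω j : ℂ) • φ j := rfl
  rw [this, h2, sub_self]

theorem kerH_eq_span (hH : SpectralAssumption V ω φ) {κ : ℝ} (hκ : 0 < κ) {j : Fin N}
    (h : ω j = -κ) :
    kerH V hκ = Submodule.span ℂ {φ j} := by
  have h1 : Module.finrank ℂ (kerH V hκ) = 1 := by
    rw [← map_eigenspace, ← hH.simple j, h]
    exact (Submodule.equivMapOfInjective (schrodinger V).domain.subtype
      (Submodule.injective_subtype _) (eigenspace (schrodinger V) ((-κ : ℝ) : ℂ))).finrank_eq.symm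
  have h0 : φ j ≠ 0 := by
    intro h0
    have := hH.norm_eq_one j
    rw [h0, norm_zero] at this
    exact zero_ne_one this
  symm
  refine Submodule.eq_of_le_of_finrank_eq ?_ ?_
  · rw [Submodule.span_singleton_le_iff_mem]
    exact mem_kerH_eigenfunction hH hκ h
  · rw [h1, finrank_span_singleton h0]

end Assumption

end

/-! ### The kernel of the free resolvent -/

section

open scoped BoundedContinuousFunction FourierTransform
open ProbabilityTheory

theorem map_coord_stdGaussian (i : Fin 3) :
    (stdGaussian R3).map (fun y => y i) = gaussianReal 0 1 := by
  rw [← map_pi_eq_stdGaussian, Measure.map_map (by fun_prop) (by fun_prop)]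
  exact (measurePreserving_eval (fun _ : Fin 3 => gaussianReal 0 1) i).map_eq

theorem integrable_exp_coord (i : Fin 3) (s : ℝ) :
    Integrable (fun y : R3 => Real.exp (s * y i)) (stdGaussian R3) := by
  have h := integrable_exp_mul_gaussianReal (μ := 0) (v := 1) s
  rw [← map_coord_stdGaussian i] at h
  exact (integrable_map_measure (f := fun y : R3 => y i) (g := fun x : ℝ => Real.exp (s * x))
    (by fun_prop) (by fun_prop)).mp h

theorem integral_exp_coord (i : Fin 3) (s : ℝ) :
    ∫ y : R3, Real.exp (s * y i) ∂(stdGaussian R3) = Real.exp (s ^ 2 / 2) := by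
  have h := mgf_gaussianReal (map_coord_stdGaussian i) s
  rw [mgf] at h
  rw [h]
  simp

theorem exp_norm_le (s : ℝ) (hs : 0 ≤ s) (y : R3) : Real.exp (s * ‖y‖) ≤
    ∑ i, (Real.exp (3 * s * y i) + Real.exp (-(3 * s) * y i)) := by
  obtain ⟨i, hi⟩ : ∃ i, ‖y‖ ≤ 3 * |y i| := by
    by_contra! h
    have h1 : ‖y‖ ^ 2 = ∑ i, |y i| ^ 2 := by
      rw [EuclideanSpace.norm_sq_eq]
      rfl
    rw [Fin.sum_univ_three] at h1
    have h2 := fun i => pow_lt_pow_left₀ (h i) (by positivity) two_ne_zero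
    nlinarith [h2 0, h2 1, h2 2, norm_nonneg y, sq_nonneg ‖y‖, sq_nonneg |y 0|, sq_nonneg |y 1|,
      sq_nonneg |y 2|]
  have h0 : ∀ j, 0 ≤ Real.exp (3 * s * y j) + Real.exp (-(3 * s) * y j) := fun j => by positivity
  refine le_trans ?_ (Finset.single_le_sum (fun j _ => h0 j) (Finset.mem_univ i))
  have h1 : s * ‖y‖ ≤ 3 * s * |y i| := by nlinarith
  refine (Real.exp_le_exp.mpr h1).trans ?_
  rcases abs_cases (y i) with ⟨h, -⟩ | ⟨h, -⟩ <;> rw [h]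
  · linarith [Real.exp_pos (-(3 * s) * y i)]
  · rw [mul_neg, neg_mul]
    linarith [Real.exp_pos (3 * s * y i)]

theorem lintegral_exp_norm_stdGaussian_le {s : ℝ} (hs : 0 ≤ s) :
    ∫⁻ y, ENNReal.ofReal (Real.exp (s * ‖y‖)) ∂(stdGaussian R3) ≤
      ENNReal.ofReal (6 * Real.exp (9 * s ^ 2 / 2)) := by
  have hi : Integrable (fun y : R3 => ∑ i, (Real.exp (3 * s * y i) + Real.exp (-(3 * s) * y i)))
      (stdGaussian R3) :=
    integrable_finsetSum _ fun i _ => (integrable_exp_coord i _).add (integrable_exp_coord i _)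
  have h1 : ∫ y : R3, ∑ i, (Real.exp (3 * s * y i) + Real.exp (-(3 * s) * y i)) ∂(stdGaussian R3) =
      6 * Real.exp (9 * s ^ 2 / 2) := by
    have h2 : ∀ i : Fin 3, Integrable (fun y : R3 =>
        Real.exp (3 * s * y i) + Real.exp (-(3 * s) * y i)) (stdGaussian R3) :=
      fun i => (integrable_exp_coord i _).add (integrable_exp_coord i _)
    rw [integral_finsetSum _ fun i _ => h2 i]
    simp only [integral_add (integrable_exp_coord _ _) (integrable_exp_coord _ _),
      integral_exp_coord, Fin.sum_univ_three]
    rw [show (-(3 * s)) ^ 2 / 2 = 9 * s ^ 2 / 2 by ring,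
      show (3 * s) ^ 2 / 2 = 9 * s ^ 2 / 2 by ring]
    ring
  rw [← h1, ofReal_integral_eq_lintegral_ofReal hi
    (Filter.Eventually.of_forall fun y => Finset.sum_nonneg fun i _ => by positivity)]
  exact lintegral_mono fun y => ENNReal.ofReal_le_ofReal (exp_norm_le s hs y)

/-- The weighted time `e^{-κt} dt` on `(0, ∞)`. -/
def timeMeasure (κ : ℝ) : Measure ℝ :=
  (volume.restrict (Set.Ioi 0)).withDensity fun t => ENNReal.ofReal (Real.exp (-κ * t))

instance (κ : ℝ) : SFinite (timeMeasure κ) := by unfold timeMeasure; infer_instance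

/-- The heat kernel representation `∫₀^∞ e^{-κt} e^{tΔ} dt` of the kernel of `(-Δ + κ)⁻¹`, as a
measure: `e^{tΔ}` is the law of `√(2t) Y`, with `Y` a standard Gaussian vector. -/
def resKernel (κ : ℝ) : Measure R3 :=
  ((timeMeasure κ).prod (stdGaussian R3)).map fun p => Real.sqrt (2 * p.1) • p.2

theorem measurable_scale : Measurable fun p : ℝ × R3 => Real.sqrt (2 * p.1) • p.2 :=
  Continuous.measurable (by fun_prop)

/-- Integrating out the Gaussian first leaves `∫₀^∞ 6 e^{-(κ - 9 α²) t} dt`. -/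
theorem integrable_exp_resKernel {κ α : ℝ} (hα : 0 ≤ α) (h : 9 * α ^ 2 < κ) :
    Integrable (fun y => Real.exp (α * ‖y‖)) (resKernel κ) := by
  refine ⟨Continuous.aestronglyMeasurable (by fun_prop), ?_⟩
  have hm : Measurable fun y : R3 => ENNReal.ofReal (Real.exp (α * ‖y‖)) :=
    (Continuous.measurable (by fun_prop)).ennreal_ofReal
  have hd : Measurable fun t : ℝ => ENNReal.ofReal (Real.exp (-κ * t)) :=
    (Continuous.measurable (by fun_prop)).ennreal_ofReal
  have h0 : ∀ y : R3, ‖Real.exp (α * ‖y‖)‖ₑ = ENNReal.ofReal (Real.exp (α * ‖y‖)) :=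
    fun y => Real.enorm_of_nonneg (Real.exp_pos _).le
  rw [HasFiniteIntegral]
  simp only [h0]
  have hm2 : Measurable fun p : ℝ × R3 =>
      ENNReal.ofReal (Real.exp (α * ‖Real.sqrt (2 * p.1) • p.2‖)) := hm.comp measurable_scale
  rw [resKernel, lintegral_map hm measurable_scale, lintegral_prod _ hm2.aemeasurable]
  have h1 : ∀ t : ℝ, ∫⁻ y, ENNReal.ofReal (Real.exp (α * ‖Real.sqrt (2 * t) • y‖))
      ∂(stdGaussian R3) ≤ ENNReal.ofReal (6 * Real.exp (9 * (α * Real.sqrt (2 * t)) ^ 2 / 2)) := by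
    intro t
    refine le_trans (le_of_eq ?_) (lintegral_exp_norm_stdGaussian_le (by positivity))
    refine lintegral_congr fun y => ?_
    rw [norm_smul, Real.norm_eq_abs, abs_of_nonneg (Real.sqrt_nonneg _), mul_assoc]
  refine (lintegral_mono h1).trans_lt ?_
  rw [timeMeasure, lintegral_withDensity_eq_lintegral_mul _ hd
    (Continuous.measurable (by fun_prop)).ennreal_ofReal]
  have h2 : ∀ᵐ t ∂(volume.restrict (Set.Ioi (0 : ℝ))),
      ((fun t : ℝ => ENNReal.ofReal (Real.exp (-κ * t))) *
        fun t : ℝ => ENNReal.ofReal (6 * Real.exp (9 * (α * Real.sqrt (2 * t)) ^ 2 / 2))) t =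
      ENNReal.ofReal (6 * Real.exp (-(κ - 9 * α ^ 2) * t)) := by
    filter_upwards [ae_restrict_mem measurableSet_Ioi] with t ht
    rw [Pi.mul_apply, ← ENNReal.ofReal_mul (Real.exp_pos _).le, mul_left_comm, ← Real.exp_add,
      mul_pow, Real.sq_sqrt (by linarith [Set.mem_Ioi.mp ht])]
    congr 3
    ring
  rw [lintegral_congr_ae h2]
  have h3 := ((exp_neg_integrableOn_Ioi 0 (sub_pos.mpr h)).integrable.const_mul 6)
  have h4 := h3.2
  rw [HasFiniteIntegral] at h4
  refine lt_of_le_of_lt (lintegral_mono fun t => ?_) h4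
  rw [Real.enorm_of_nonneg (by positivity)]

theorem isFiniteMeasure_resKernel {κ : ℝ} (hκ : 0 < κ) : IsFiniteMeasure (resKernel κ) := by
  have h := integrable_exp_resKernel (κ := κ) le_rfl (by simpa using hκ)
  simp only [zero_mul, Real.exp_zero] at h
  exact (integrable_const_iff.mp h).resolve_left one_ne_zero

/-- The Fourier transform of `resKernel` is the symbol of the free resolvent: the Gaussian integral
gives `∫₀^∞ e^{-(4π²|ξ|² + κ) t} dt`. -/
theorem integral_char_resKernel {κ : ℝ} (hκ : 0 < κ) (ξ : R3) :
    ∫ y, (Real.fourierChar (-inner ℝ y ξ) : ℂ) ∂(resKernel κ) = (resSymbol κ ξ : ℂ) := by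
  have := isFiniteMeasure_resKernel hκ
  have hc : Continuous fun y : R3 => (Real.fourierChar (-inner ℝ y ξ) : ℂ) :=
    continuous_subtype_val.comp (Real.continuous_fourierChar.comp (by fun_prop))
  have hi : Integrable (fun y => (Real.fourierChar (-inner ℝ y ξ) : ℂ)) (resKernel κ) := by
    refine (integrable_const (1 : ℝ)).mono' hc.aestronglyMeasurable
      (Filter.Eventually.of_forall fun y => ?_)
    rw [Circle.norm_coe]
  have hi2 := (integrable_map_measure hc.aestronglyMeasurable
    measurable_scale.aemeasurable).mp hi
  rw [resKernel, integral_map measurable_scale.aemeasurable hc.aestronglyMeasurable]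
  refine (integral_prod _ hi2).trans ?_
  have h1 : ∀ t : ℝ, ∫ y, (Real.fourierChar (-inner ℝ (Real.sqrt (2 * t) • y) ξ) : ℂ)
      ∂(stdGaussian R3) = Complex.exp (-‖(-(2 * Real.pi * Real.sqrt (2 * t))) • ξ‖ ^ 2 / 2) := by
    intro t
    rw [← charFun_stdGaussian, charFun_apply]
    refine integral_congr_ae (Filter.Eventually.of_forall fun y => ?_)
    simp only [Real.fourierChar_apply, inner_smul_left, inner_smul_right, conj_trivial]
    congr 1
    push_cast
    ring
  simp only [Function.comp_apply, h1]
  rw [timeMeasure, integral_withDensity_eq_integral_toReal_smul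
    (Continuous.measurable (by fun_prop)).ennreal_ofReal
    (Filter.Eventually.of_forall fun _ => ENNReal.ofReal_lt_top)]
  set c : ℝ := (2 * Real.pi) ^ 2 * ‖ξ‖ ^ 2 + κ with hc'
  have hcpos : 0 < c := by positivity
  have h2 : ∫ t in Set.Ioi (0 : ℝ), (ENNReal.ofReal (Real.exp (-κ * t))).toReal •
      Complex.exp (-‖(-(2 * Real.pi * Real.sqrt (2 * t))) • ξ‖ ^ 2 / 2) =
      ∫ t in Set.Ioi (0 : ℝ), ((Real.exp (-c * t) : ℝ) : ℂ) := by
    refine setIntegral_congr_fun measurableSet_Ioi fun t ht => ?_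
    rw [ENNReal.toReal_ofReal (Real.exp_pos _).le, norm_smul, Complex.real_smul]
    have h3 : (-((‖(-(2 * Real.pi * Real.sqrt (2 * t)))‖ * ‖ξ‖ : ℝ) : ℂ) ^ 2 / 2) =
        ((-((2 * Real.pi) ^ 2 * ‖ξ‖ ^ 2 * t) : ℝ) : ℂ) := by
      rw [← Complex.ofReal_pow, mul_pow, Real.norm_eq_abs, sq_abs, neg_sq, mul_pow,
        Real.sq_sqrt (by linarith [Set.mem_Ioi.mp ht])]
      push_cast
      ring
    rw [h3, ← Complex.ofReal_exp, ← Complex.ofReal_mul, ← Real.exp_add, hc']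
    congr 2
    ring
  rw [h2, integral_complex_ofReal, integral_exp_mul_Ioi (by linarith)]
  rw [mul_zero, Real.exp_zero, neg_div_neg_eq, one_div, resSymbol]

end

/-! ### The free resolvent on exponentially decaying functions -/

section

open scoped BoundedContinuousFunction FourierTransform

theorem expW_add (α β : ℝ) (x : R3) : expW (α + β) 0 x = expW α 0 x * expW β 0 x := by
  rw [expW, expW, expW, ← Real.exp_add]
  congr 1
  ring

theorem expW_zero_zero (x : R3) : expW 0 0 x = 1 := by simp [expW]

theorem expW_mul_neg (α : ℝ) (x : R3) : expW α 0 x * expW (-α) 0 x = 1 := by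
  rw [← expW_add, add_neg_cancel, expW_zero_zero]

theorem integrable_expW_neg {α : ℝ} (hα : 0 < α) : Integrable (expW (-α) 0) := by
  have h := (integrable_one_add_norm (E := R3) (μ := volume) (r := 4)
    (by simp; norm_num)).const_mul (24 / α ^ 4 * Real.exp α)
  refine h.mono' (continuous_expW _ _).aestronglyMeasurable
    (Filter.Eventually.of_forall fun x => ?_)
  rw [Real.norm_eq_abs, abs_of_pos (expW_pos _ _ _)]
  have h1 : (α * (1 + ‖x‖)) ^ 4 / 24 ≤ Real.exp (α * (1 + ‖x‖)) := by
    have := Real.pow_div_factorial_le_exp (x := α * (1 + ‖x‖)) (by positivity) 4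
    simpa [Nat.factorial] using this
  rw [show (-4 : ℝ) = -(4 : ℕ) by norm_num, Real.rpow_neg (by positivity), Real.rpow_natCast]
  have h2 : expW (-α) 0 x ≤ Real.exp α * (Real.exp (α * (1 + ‖x‖)))⁻¹ := by
    rw [← Real.exp_neg, ← Real.exp_add, expW]
    refine Real.exp_le_exp.mpr ?_
    nlinarith [norm_le_jb x]
  refine h2.trans ?_
  rw [div_mul_eq_mul_div, div_mul_eq_mul_div, le_div_iff₀ (by positivity)]
  have h3 : (Real.exp (α * (1 + ‖x‖)))⁻¹ ≤ ((α * (1 + ‖x‖)) ^ 4 / 24)⁻¹ :=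
    inv_anti₀ (by positivity) h1
  calc Real.exp α * (Real.exp (α * (1 + ‖x‖)))⁻¹ * α ^ 4
      ≤ Real.exp α * ((α * (1 + ‖x‖)) ^ 4 / 24)⁻¹ * α ^ 4 := by gcongr
    _ = 24 * Real.exp α * ((1 + ‖x‖) ^ 4)⁻¹ := by
      rw [mul_pow]
      field_simp

theorem memLp_of_le_expW {α C : ℝ} (hα : 0 < α) {f : R3 → ℂ}
    (hf : AEStronglyMeasurable f volume) (h : ∀ x, ‖f x‖ ≤ C * expW (-α) 0 x) :
    Integrable f ∧ MemLp f 2 volume := by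
  have h1 : Integrable f := ((integrable_expW_neg hα).const_mul C).mono' hf
    (Filter.Eventually.of_forall h)
  refine ⟨h1, (memLp_two_iff_integrable_sq_norm hf).mpr ?_⟩
  refine ((integrable_expW_neg (α := α + α) (by positivity)).const_mul (C ^ 2)).mono'
    (hf.norm.pow 2) (Filter.Eventually.of_forall fun x => ?_)
  rw [Real.norm_eq_abs, abs_of_nonneg (sq_nonneg _), neg_add, expW_add]
  refine (pow_le_pow_left₀ (norm_nonneg _) (h x) 2).trans_eq ?_
  ring

/-- Convolution with the kernel of the free resolvent. -/
def resConv (κ : ℝ) (f : R3 → ℝ) (x : R3) : ℝ := ∫ y, f (x - y) ∂(resKernel κ)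

variable {κ : ℝ}

theorem integrable_resConv (hκ : 0 < κ) {f : R3 → ℝ} (hf : Continuous f) {C : ℝ}
    (hC : ∀ x, |f x| ≤ C) (x : R3) : Integrable (fun y => f (x - y)) (resKernel κ) := by
  have := isFiniteMeasure_resKernel hκ
  exact (integrable_const C).mono' (by fun_prop)
    (Filter.Eventually.of_forall fun y => hC (x - y))

theorem continuous_resConv (hκ : 0 < κ) {f : R3 → ℝ} (hf : Continuous f) {C : ℝ}
    (hC : ∀ x, |f x| ≤ C) : Continuous (resConv κ f) := by
  have := isFiniteMeasure_resKernel hκ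
  exact continuous_of_dominated (fun x => by fun_prop)
    (fun x => Filter.Eventually.of_forall fun y => hC (x - y)) (integrable_const C)
    (Filter.Eventually.of_forall fun y => by fun_prop)

theorem hasGrad_resConv (hκ : 0 < κ) {f : R3 → ℝ} {g : Fin 3 → R3 → ℝ} (h : HasGrad f g)
    (hg : ∀ i, Continuous (g i)) {C C' : ℝ} (hC : ∀ x, |f x| ≤ C) (hC' : ∀ i x, |g i x| ≤ C') :
    HasGrad (resConv κ f) fun i => resConv κ (g i) := by
  have := isFiniteMeasure_resKernel hκ
  intro x
  have hcov : Continuous fun v : Fin 3 → ℝ => covec v := by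
    unfold covec
    fun_prop
  have hbound : ∀ v : Fin 3 → ℝ, ‖covec v‖ ≤ ∑ i, |v i| * ‖(EuclideanSpace.proj i : R3 →L[ℝ] ℝ)‖ :=
    fun v => (norm_sum_le _ _).trans (Finset.sum_le_sum fun i _ => (norm_smul (v i) _).le)
  have key := hasFDerivAt_integral_of_dominated_of_fderiv_le (μ := resKernel κ) (𝕜 := ℝ)
    (F := fun x y => f (x - y)) (F' := fun x y => covec fun i => g i (x - y)) (x₀ := x)
    (bound := fun _ => ∑ i, C' * ‖(EuclideanSpace.proj i : R3 →L[ℝ] ℝ)‖)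
    (s := Set.univ) Filter.univ_mem (Filter.Eventually.of_forall fun z =>
      (integrable_resConv hκ h.continuous hC z).aestronglyMeasurable)
    (integrable_resConv hκ h.continuous hC x)
    (Continuous.aestronglyMeasurable (hcov.comp (by fun_prop)))
    (Filter.Eventually.of_forall fun y z _ => (hbound _).trans (Finset.sum_le_sum fun i _ =>
      mul_le_mul_of_nonneg_right (hC' i _) (norm_nonneg _))) (integrable_const _)
    (Filter.Eventually.of_forall fun y z _ => by
      have h1 := (h (z - y)).comp z ((hasFDerivAt_id z).sub_const y)
      exact h1)
  refine key.congr_fderiv ?_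
  ext v
  rw [ContinuousLinearMap.integral_apply, covec_apply]
  · simp only [covec_apply, resConv]
    rw [integral_finsetSum _ fun i _ => (integrable_resConv hκ (hg i) (hC' i) x).mul_const _]
    exact Finset.sum_congr rfl fun i _ => integral_mul_const _ _
  · refine (integrable_const (∑ i, C' * ‖(EuclideanSpace.proj i : R3 →L[ℝ] ℝ)‖)).mono'
      (Continuous.aestronglyMeasurable (hcov.comp (by fun_prop)))
      (Filter.Eventually.of_forall fun y => (hbound _).trans (Finset.sum_le_sum fun i _ =>
        mul_le_mul_of_nonneg_right (hC' i _) (norm_nonneg _)))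

theorem abs_resConv_le {α C : ℝ} (hα : 0 ≤ α) (h : 9 * α ^ 2 < κ) {f : R3 → ℝ}
    (hC : ∀ x, |f x| ≤ C * expW (-α) 0 x) (x : R3) :
    |resConv κ f x| ≤ C * (∫ y, Real.exp (α * ‖y‖) ∂(resKernel κ)) * expW (-α) 0 x := by
  have hC0 : 0 ≤ C := by
    have h1 := (abs_nonneg _).trans (hC 0)
    exact nonneg_of_mul_nonneg_left h1 (expW_pos _ _ _)
  have h1 : ∀ y, |f (x - y)| ≤ C * expW (-α) 0 x * Real.exp (α * ‖y‖) := by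
    intro y
    refine (hC (x - y)).trans ?_
    rw [mul_assoc]
    refine mul_le_mul_of_nonneg_left ?_ hC0
    rw [expW, expW, ← Real.exp_add]
    refine Real.exp_le_exp.mpr ?_
    nlinarith [jb_sub_le x y]
  refine (norm_integral_le_of_norm_le (f := fun y => f (x - y))
    ((integrable_exp_resKernel hα h).const_mul (C * expW (-α) 0 x))
    (Filter.Eventually.of_forall fun y => h1 y)).trans_eq ?_
  rw [integral_const_mul]
  ring

/-- The function `e^{-α⟨x⟩} a(x)`. -/
def wfun {k : ℕ} (α : ℝ) (a : Ck k) (x : R3) : ℝ := expW (-α) 0 x * Ck.ev a x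

theorem continuous_wfun {k : ℕ} (α : ℝ) (a : Ck k) : Continuous (wfun α a) :=
  (continuous_expW _ _).mul (Ck.ev a).continuous

theorem abs_wfun_le {k : ℕ} (α : ℝ) (a : Ck k) (x : R3) :
    |wfun α a x| ≤ ‖a‖ * expW (-α) 0 x := by
  rw [wfun, abs_mul, abs_of_pos (expW_pos _ _ _), mul_comm]
  exact mul_le_mul_of_nonneg_right (Ck.abs_ev_le a x) (expW_pos _ _ _).le

theorem expW_neg_le_one {α : ℝ} (hα : 0 ≤ α) (x : R3) : expW (-α) 0 x ≤ 1 := by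
  rw [expW, Real.exp_le_one_iff]
  nlinarith [jb_pos x]

theorem abs_wfun_le' {k : ℕ} {α : ℝ} (hα : 0 ≤ α) (a : Ck k) (x : R3) : |wfun α a x| ≤ ‖a‖ :=
  (abs_wfun_le α a x).trans (mul_le_of_le_one_right (norm_nonneg _) (expW_neg_le_one hα x))

/-- The weighted free resolvent preserves `C^k_b`. -/
theorem inCk_resConv {α : ℝ} (hα : 0 ≤ α) (h : 9 * α ^ 2 < κ) : ∀ (k : ℕ) (a : Ck k),
    InCk k fun x => expW α 0 x * resConv κ (wfun α a) x
  | 0, a => by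
    have hκ : 0 < κ := lt_of_le_of_lt (by positivity) h
    refine InCk.zero_level (C := ‖a‖ * ∫ y, Real.exp (α * ‖y‖) ∂(resKernel κ))
      ((continuous_expW _ _).mul (continuous_resConv hκ (continuous_wfun α a) (abs_wfun_le' hα a)))
      fun x => ?_
    rw [abs_mul, abs_of_pos (expW_pos _ _ _)]
    refine (mul_le_mul_of_nonneg_left (abs_resConv_le hα h (abs_wfun_le α a) x)
      (expW_pos _ _ _).le).trans_eq ?_
    rw [mul_left_comm, expW_mul_neg, mul_one]
  | k + 1, a => by
    have hκ : 0 < κ := lt_of_le_of_lt (by positivity) h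
    choose br hbr using (inCk_bracket k).2
    set b : Fin 3 → Ck k := fun i => Ck.pd i a - α • (br i * Ck.res a) with hb
    have hgrad : HasGrad (wfun α a) fun i => wfun α (b i) := by
      refine ((hasGrad_expW (-α) 0).mul (Ck.hasGrad a)).congr fun i x => ?_
      rw [wfun, hb, Ck.ev_sub_apply, Ck.ev_smul_apply, Ck.ev_mul_apply, hbr, Ck.ev_res]
      ring
    have h1 := hasGrad_resConv hκ hgrad (fun i => continuous_wfun α (b i)) (abs_wfun_le' hα a)
      (C' := ∑ i, ‖b i‖) fun i x => (abs_wfun_le' hα (b i) x).trans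
        (Finset.single_le_sum (f := fun i => ‖b i‖) (fun _ _ => norm_nonneg _) (Finset.mem_univ i))
    have h2 := inCk_resConv hα h k (Ck.res a)
    refine InCk.succ h2 (fun i => (((inCk_bracket k).2 i).mul h2).const_mul α |>.add
      (inCk_resConv hα h k (b i))) (((hasGrad_expW α 0).mul h1).congr fun i x => ?_)
    rw [show wfun α (Ck.res a) = wfun α a from rfl]
    ring

/-- The Fourier transform of the convolution with `resKernel`. -/
theorem fourier_resConv (hκ : 0 < κ) {f : R3 → ℝ} (hf : Continuous f)
    (hi : Integrable fun x => (f x : ℂ)) (ξ : R3) :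
    𝓕 (fun x => (resConv κ f x : ℂ)) ξ = (resSymbol κ ξ : ℂ) * 𝓕 (fun x => (f x : ℂ)) ξ := by
  have := isFiniteMeasure_resKernel hκ
  have hce : Continuous fun x : R3 => (Real.fourierChar (-inner ℝ x ξ) : ℂ) :=
    continuous_subtype_val.comp (Real.continuous_fourierChar.comp (by fun_prop))
  have hint : Integrable (fun p : R3 × R3 => (Real.fourierChar (-inner ℝ p.1 ξ) : ℂ) *
      (f (p.1 - p.2) : ℂ)) (volume.prod (resKernel κ)) := by
    have hcont : Continuous fun p : R3 × R3 => (Real.fourierChar (-inner ℝ p.1 ξ) : ℂ) *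
        (f (p.1 - p.2) : ℂ) :=
      (hce.comp continuous_fst).mul
        (Complex.continuous_ofReal.comp (hf.comp (continuous_fst.sub continuous_snd)))
    refine (integrable_prod_iff' hcont.aestronglyMeasurable).mpr ?_
    have hn : ∀ x y : R3, ‖(Real.fourierChar (-inner ℝ x ξ) : ℂ) * (f (x - y) : ℂ)‖ =
        ‖(f (x - y) : ℂ)‖ := fun x y => by rw [norm_mul, Circle.norm_coe, one_mul]
    constructor
    · refine Filter.Eventually.of_forall fun y => ?_
      refine (hi.comp_sub_right y).norm.mono'
        (Continuous.aestronglyMeasurable (hce.mul (by fun_prop))) ?_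
      exact Filter.Eventually.of_forall fun x => (hn x y).le
    · simp only [hn]
      refine (integrable_const (∫ x, ‖(f x : ℂ)‖)).congr (Filter.Eventually.of_forall fun y => ?_)
      exact (integral_sub_right_eq_self (fun x => ‖(f x : ℂ)‖) y).symm
  calc 𝓕 (fun x => (resConv κ f x : ℂ)) ξ
      = ∫ x, ∫ y, (Real.fourierChar (-inner ℝ x ξ) : ℂ) * (f (x - y) : ℂ) ∂(resKernel κ) := by
        rw [Real.fourier_eq]
        refine integral_congr_ae (Filter.Eventually.of_forall fun x => ?_)
        simp only [resConv, Circle.smul_def, smul_eq_mul]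
        rw [integral_const_mul, integral_complex_ofReal]
    _ = ∫ y, (∫ x, (Real.fourierChar (-inner ℝ x ξ) : ℂ) * (f (x - y) : ℂ)) ∂(resKernel κ) :=
        integral_integral_swap hint
    _ = ∫ y, (Real.fourierChar (-inner ℝ y ξ) : ℂ) * 𝓕 (fun x => (f x : ℂ)) ξ ∂(resKernel κ) := by
        refine integral_congr_ae (Filter.Eventually.of_forall fun y => ?_)
        simp only
        rw [Real.fourier_eq, ← integral_const_mul]
        rw [← integral_add_right_eq_self _ y]
        refine integral_congr_ae (Filter.Eventually.of_forall fun x => ?_)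
        simp only [Circle.smul_def, smul_eq_mul, add_sub_cancel_right]
        rw [inner_add_left, neg_add, AddChar.map_add_eq_mul, Circle.coe_mul]
        ring
    _ = (resSymbol κ ξ : ℂ) * 𝓕 (fun x => (f x : ℂ)) ξ := by
        rw [integral_mul_const, integral_char_resKernel hκ]

/-- The free resolvent acts on nice functions by convolution. -/
theorem freeRes_toLp (hκ : 0 < κ) {f : R3 → ℝ} (hf : Continuous f)
    (hi : Integrable fun x => (f x : ℂ)) (h2 : MemLp (fun x => (f x : ℂ)) 2 volume)
    (hi' : Integrable fun x => (resConv κ f x : ℂ))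
    (h2' : MemLp (fun x => (resConv κ f x : ℂ)) 2 volume) :
    freeRes hκ (h2.toLp _) = h2'.toLp _ := by
  have key : (𝓕 (freeRes hκ (h2.toLp _)) : L2) = 𝓕 (h2'.toLp _ : L2) := by
    rw [fourier_freeRes]
    refine Lp.ext ?_
    have e1 : 𝓕 (h2.toLp _ : R3 → ℂ) = 𝓕 (fun x => (f x : ℂ)) := by
      funext ξ
      rw [Real.fourier_eq, Real.fourier_eq]
      exact integral_congr_ae (by filter_upwards [h2.coeFn_toLp] with x hx; rw [hx])
    have e2 : 𝓕 (h2'.toLp _ : R3 → ℂ) = 𝓕 (fun x => (resConv κ f x : ℂ)) := by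
      funext ξ
      rw [Real.fourier_eq, Real.fourier_eq]
      exact integral_congr_ae (by filter_upwards [h2'.coeFn_toLp] with x hx; rw [hx])
    filter_upwards [coeFn_mulL (memLp_top_resSymbol hκ) (𝓕 (h2.toLp _ : L2)),
      ae_eq_fourier (u := h2.toLp _) (hi.congr h2.coeFn_toLp.symm),
      ae_eq_fourier (u := h2'.toLp _) (hi'.congr h2'.coeFn_toLp.symm)] with ξ h3 h4 h5
    rw [h3, h4, h5, e1, e2, fourier_resConv hκ hf hi]
  have := congrArg (fun u : L2 => (𝓕⁻ u : L2)) key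
  simpa only [FourierTransform.fourierInv_fourier_eq] using this

end

/-! ### Exponentially weighted `C^k_b` functions in `L²` and in `Σ^s` -/

section

open scoped BoundedContinuousFunction FourierTransform LineDeriv

/-- Lifting of a continuous linear map through an injective one, by the closed graph theorem. -/
theorem exists_lift {X Y Z : Type*} [NormedAddCommGroup X] [NormedSpace ℝ X] [CompleteSpace X]
    [NormedAddCommGroup Y] [NormedSpace ℝ Y] [NormedAddCommGroup Z] [NormedSpace ℝ Z]
    [CompleteSpace Z] (p : Z →L[ℝ] Y) (hp : Function.Injective p) (q : X →L[ℝ] Y)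
    (h : ∀ x, ∃ z, p z = q x) : ∃ S : X →L[ℝ] Z, ∀ x, p (S x) = q x := by
  choose S hS using h
  let T : X →ₗ[ℝ] Z :=
    { toFun := S
      map_add' := fun x y => hp (by rw [map_add, hS, hS, hS, map_add])
      map_smul' := fun c x => hp (by rw [RingHom.id_apply, map_smul, hS, hS, map_smul]) }
  have hT : Continuous T := by
    refine T.continuous_of_seq_closed_graph fun u x y hu hy => hp ?_
    have h1 := (p.continuous.tendsto y).comp hy
    have h2 := (q.continuous.tendsto x).comp hu
    have h3 : p ∘ T ∘ u = q ∘ u := by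
      funext n
      exact hS (u n)
    rw [h3] at h1
    rw [tendsto_nhds_unique h1 h2]
    exact (hS x).symm
  exact ⟨⟨T, hT⟩, hS⟩

variable {α : ℝ}

theorem memLp_mul_wfun {k : ℕ} {β : ℝ} (hβ : β < α) {q : R3 → ℝ} (hq : Continuous q)
    (hqb : ∀ x, |q x| ≤ expW β 0 x) (a : Ck k) :
    (Integrable fun x => ((q x * wfun α a x : ℝ) : ℂ)) ∧
      MemLp (fun x => ((q x * wfun α a x : ℝ) : ℂ)) 2 volume := by
  refine memLp_of_le_expW (sub_pos.mpr hβ) (C := ‖a‖) (Continuous.aestronglyMeasurable ?_)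
    fun x => ?_
  · exact Complex.continuous_ofReal.comp (hq.mul (continuous_wfun α a))
  · rw [Complex.norm_real, Real.norm_eq_abs, abs_mul, show -(α - β) = β + -α by ring, expW_add,
      mul_left_comm]
    exact mul_le_mul (hqb x) (abs_wfun_le α a x) (abs_nonneg _) (expW_pos _ _ _).le

/-- The map `a ↦ q e^{-α⟨x⟩} a` into `L²`, for a multiplier `q` growing at most like `e^{β⟨x⟩}`,
`β < α`. -/
def weightedEmb (k : ℕ) {β : ℝ} (hβ : β < α) {q : R3 → ℝ} (hq : Continuous q)
    (hqb : ∀ x, |q x| ≤ expW β 0 x) : Ck k →L[ℝ] L2 :=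
  LinearMap.mkContinuous
    { toFun := fun a => (memLp_mul_wfun hβ hq hqb a).2.toLp _
      map_add' := fun a b => by
        rw [← MemLp.toLp_add]
        refine MemLp.toLp_congr _ _ (Filter.Eventually.of_forall fun x => ?_)
        simp only [Pi.add_apply, wfun, Ck.ev_add_apply]
        push_cast
        ring
      map_smul' := fun c a => by
        rw [RingHom.id_apply, ← MemLp.toLp_const_smul]
        refine MemLp.toLp_congr _ _ (Filter.Eventually.of_forall fun x => ?_)
        simp only [Pi.smul_apply, wfun, Ck.ev_smul_apply, Complex.real_smul]
        push_cast
        ring }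
    ‖(memLp_mul_wfun (k := 0) hβ hq hqb 1).2.toLp _‖ fun a => by
      refine (Lp.norm_le_mul_norm_of_ae_le_mul ?_).trans_eq (mul_comm _ _)
      filter_upwards [(memLp_mul_wfun hβ hq hqb a).2.coeFn_toLp,
        (memLp_mul_wfun (k := 0) hβ hq hqb 1).2.coeFn_toLp] with x h1 h2
      refine (congrArg norm h1).trans_le ?_
      rw [h2]
      simp only [wfun, Complex.norm_real, Ck.ev_one_apply, mul_one, norm_mul, Real.norm_eq_abs]
      have := Ck.abs_ev_le a x
      calc |q x| * (|expW (-α) 0 x| * |Ck.ev a x|) = |Ck.ev a x| * (|q x| * |expW (-α) 0 x|) := by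
            ring
        _ ≤ _ := by gcongr

theorem coeFn_weightedEmb {k : ℕ} {β : ℝ} (hβ : β < α) {q : R3 → ℝ} (hq : Continuous q)
    (hqb : ∀ x, |q x| ≤ expW β 0 x) (a : Ck k) :
    weightedEmb k hβ hq hqb a =ᵐ[volume] fun x => ((q x * wfun α a x : ℝ) : ℂ) :=
  (memLp_mul_wfun hβ hq hqb a).2.coeFn_toLp

theorem abs_one_le_expW (x : R3) : |(1 : ℝ)| ≤ expW 0 0 x := by rw [expW_zero_zero, abs_one]

/-- The embedding `a ↦ e^{-α⟨x⟩} a` of `C^k_b` into `L²`. -/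
def emb (hα : 0 < α) (k : ℕ) : Ck k →L[ℝ] L2 :=
  weightedEmb k hα continuous_const abs_one_le_expW

theorem coeFn_emb (hα : 0 < α) {k : ℕ} (a : Ck k) :
    emb hα k a =ᵐ[volume] fun x => (wfun α a x : ℂ) := by
  filter_upwards [coeFn_weightedEmb hα continuous_const abs_one_le_expW a] with x hx
  rw [emb, hx, one_mul]

theorem memLp_wfun (hα : 0 < α) {k : ℕ} (a : Ck k) :
    (Integrable fun x => (wfun α a x : ℂ)) ∧ MemLp (fun x => (wfun α a x : ℂ)) 2 volume := by
  simpa using memLp_mul_wfun hα continuous_const abs_one_le_expW a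

theorem emb_eq_toLp (hα : 0 < α) {k : ℕ} (a : Ck k) : emb hα k a = (memLp_wfun hα a).2.toLp _ := by
  refine Lp.ext ?_
  filter_upwards [coeFn_emb hα a, (memLp_wfun hα a).2.coeFn_toLp] with x h1 h2
  rw [h1, h2]

/-- Two complex combinations of embedded functions agree only if the functions do. -/
theorem emb_add_I_injective (hα : 0 < α) {k l : ℕ} {a b : Ck k} {c d : Ck l}
    (h : emb hα k a + Complex.I • emb hα k b = emb hα l c + Complex.I • emb hα l d) :
    (∀ x, Ck.ev a x = Ck.ev c x) ∧ ∀ x, Ck.ev b x = Ck.ev d x := by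
  have h1 : (fun x => (wfun α a x : ℂ) + Complex.I * (wfun α b x : ℂ)) =
      fun x => (wfun α c x : ℂ) + Complex.I * (wfun α d x : ℂ) := by
    have hc : ∀ {n : ℕ} (u v : Ck n),
        Continuous fun x => (wfun α u x : ℂ) + Complex.I * (wfun α v x : ℂ) := fun u v => by
      have h2 := continuous_wfun α u
      have h3 := continuous_wfun α v
      fun_prop
    refine ((hc a b).ae_eq_iff_eq volume (hc c d)).mp ?_
    have h4 := congrArg (fun u : L2 => (u : R3 → ℂ)) h
    filter_upwards [coeFn_emb hα a, coeFn_emb hα b, coeFn_emb hα c, coeFn_emb hα d,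
      Lp.coeFn_add (emb hα k a) (Complex.I • emb hα k b),
      Lp.coeFn_add (emb hα l c) (Complex.I • emb hα l d), Lp.coeFn_smul Complex.I (emb hα k b),
      Lp.coeFn_smul Complex.I (emb hα l d)] with x e1 e2 e3 e4 e5 e6 e7 e8
    have h5 := congrFun h4 x
    simp only [e5, e6, e7, e8, Pi.add_apply, Pi.smul_apply, e1, e2, e3, e4, smul_eq_mul] at h5
    exact h5
  have hx : ∀ x, wfun α a x = wfun α c x ∧ wfun α b x = wfun α d x := fun x => by
    have h2 := congrFun h1 x
    have hre := congrArg Complex.re h2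
    have him := congrArg Complex.im h2
    simp at hre him
    exact ⟨hre, him⟩
  exact ⟨fun x => mul_left_cancel₀ (expW_pos _ _ _).ne' (hx x).1,
    fun x => mul_left_cancel₀ (expW_pos _ _ _).ne' (hx x).2⟩

theorem ev_eq_of_emb_eq (hα : 0 < α) {k l : ℕ} {a : Ck k} {c : Ck l}
    (h : emb hα k a = emb hα l c) (x : R3) : Ck.ev a x = Ck.ev c x :=
  (emb_add_I_injective hα (b := (0 : Ck k)) (d := (0 : Ck l)) (by rw [h, map_zero, map_zero])).1 x

theorem emb_injective (hα : 0 < α) (k : ℕ) : Function.Injective (emb hα k) :=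
  fun _ _ h => Ck.ext_ev (ev_eq_of_emb_eq hα h)

theorem emb_eq_of_ev_eq (hα : 0 < α) {k l : ℕ} {a : Ck k} {c : Ck l}
    (h : ∀ x, Ck.ev a x = Ck.ev c x) : emb hα k a = emb hα l c := by
  refine Lp.ext ?_
  filter_upwards [coeFn_emb hα a, coeFn_emb hα c] with x h1 h2
  rw [h1, h2, wfun, wfun, h]

/-! ### Sobolev regularity of the embedded functions -/

theorem jb_mul_expW_le {δ : ℝ} (hδ : 0 < δ) (x : R3) : jb x * expW (-δ) 0 x ≤ δ⁻¹ := by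
  have h1 := Real.add_one_le_exp (δ * jb x)
  have h2 : expW (-δ) 0 x = (Real.exp (δ * jb x))⁻¹ := by
    rw [expW, ← Real.exp_neg]
    congr 1
    ring
  rw [h2, ← div_eq_mul_inv, div_le_iff₀ (Real.exp_pos _), inv_mul_eq_div, le_div_iff₀ hδ]
  linarith

theorem inCk_jb_mul_expW {δ : ℝ} (hδ : 0 < δ) : ∀ k : ℕ, InCk k fun x => jb x * expW (-δ) 0 x
  | 0 => InCk.zero_level (C := δ⁻¹) (continuous_jb.mul (continuous_expW _ _)) fun x => by
      rw [abs_of_pos (mul_pos (jb_pos x) (expW_pos _ _ _))]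
      exact jb_mul_expW_le hδ x
  | k + 1 => by
    have h := inCk_jb_mul_expW hδ k
    refine h.succ (fun i => (((inCk_bracket k).2 i).mul (inCk_expW_neg hδ.le k)).add
      ((((inCk_bracket k).2 i).mul h).const_mul (-δ)))
      ((hasGrad_jb.mul (hasGrad_expW (-δ) 0)).congr fun i x => ?_)
    ring

/-- The coefficients `coshSer n (γ²|x|²)`, which contain `cosh (γ|x|)` and span a space closed under
`∂_i` up to multiplication by `x_i`. -/
def coshW (γ : ℝ) (n : ℕ) (x : R3) : ℝ := coshSer n (γ ^ 2 * ‖x‖ ^ 2)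

theorem abs_coshW_le {γ : ℝ} (hγ : 0 ≤ γ) (n : ℕ) (x : R3) : |coshW γ n x| ≤ expW γ 0 x := by
  refine (abs_coshSer_le n (by positivity)).trans ?_
  rw [← mul_pow, Real.sqrt_sq (by positivity), expW]
  have h1 : Real.cosh (γ * ‖x‖) ≤ Real.exp (γ * ‖x‖) := by
    rw [Real.cosh_eq]
    have : Real.exp (-(γ * ‖x‖)) ≤ Real.exp (γ * ‖x‖) := Real.exp_le_exp.mpr (by
      have : 0 ≤ γ * ‖x‖ := by positivity
      linarith)
    linarith
  refine h1.trans (Real.exp_le_exp.mpr ?_)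
  nlinarith [norm_le_jb x]

end

section

open scoped BoundedContinuousFunction FourierTransform LineDeriv

theorem hasGrad_coshW (γ : ℝ) (n : ℕ) :
    HasGrad (coshW γ n) fun i x => 2 * γ ^ 2 * x i * coshW γ (n + 1) x := by
  refine (HasGrad.comp (hasDerivAt_coshSer n) (hasGrad_norm_sq.const_smul (γ ^ 2))).congr
    fun i x => ?_
  rw [coshW]
  ring

theorem continuous_coshW (γ : ℝ) (n : ℕ) : Continuous (coshW γ n) := (hasGrad_coshW γ n).continuous

theorem coshW_zero (γ : ℝ) (x : R3) : coshW γ 0 x = Real.cosh (γ * ‖x‖) := by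
  rw [coshW, ← mul_pow, coshSer_zero_sq]

theorem HasGrad.hasLineDerivAt_ofReal {f : R3 → ℝ} {g : Fin 3 → R3 → ℝ} (h : HasGrad f g)
    (i : Fin 3) (x : R3) :
    HasLineDerivAt ℝ (fun x => (f x : ℂ)) ((g i x : ℝ) : ℂ) x (bvec i) := by
  have h1 := (Complex.ofRealCLM.hasFDerivAt.comp x (h x)).hasLineDerivAt (bvec i)
  rw [ContinuousLinearMap.comp_apply, covec_bvec] at h1
  exact h1

variable {α γ : ℝ}

theorem exists_wfun_eq_coord_mul {k : ℕ} {α' : ℝ} (h : α' < α) (a : Ck k) (i : Fin 3) :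
    ∃ c : Ck k, ∀ x, wfun α' c x = x i * wfun α a x := by
  obtain ⟨b, hb⟩ := (inCk_bracket k).2 i
  obtain ⟨d, hd⟩ := inCk_jb_mul_expW (sub_pos.mpr h) k
  refine ⟨b * d * a, fun x => ?_⟩
  rw [wfun, wfun, Ck.ev_mul_apply, Ck.ev_mul_apply, hb, hd,
    show -α = -(α - α') + -α' by ring, expW_add]
  have := (jb_pos x).ne'
  field_simp

theorem hasGrad_wfun {k : ℕ} (α : ℝ) (a : Ck (k + 1)) :
    ∃ b : Fin 3 → Ck k, HasGrad (wfun α a) fun i => wfun α (b i) := by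
  choose br hbr using (inCk_bracket k).2
  refine ⟨fun i => Ck.pd i a - α • (br i * Ck.res a),
    ((hasGrad_expW (-α) 0).mul (Ck.hasGrad a)).congr fun i x => ?_⟩
  rw [wfun, Ck.ev_sub_apply, Ck.ev_smul_apply, Ck.ev_mul_apply, hbr, Ck.ev_res]
  ring

/-- `cosh (γ|x|) e^{-α⟨x⟩} a` belongs to `H^k` if `a ∈ C^k_b` and `γ < α`. -/
theorem weightedEmb_mem_sobolev (hγ : 0 ≤ γ) : ∀ (k n : ℕ) {α : ℝ} (h : γ < α) (a : Ck k),
    weightedEmb k h (continuous_coshW γ n) (abs_coshW_le hγ n) a ∈ sobolev k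
  | 0, n, α, h, a => by
    rw [Nat.cast_zero]
    exact memSobolev_zero_toDist _
  | k + 1, n, α, h, a => by
    have h' : γ < (α + γ) / 2 := by linarith
    obtain ⟨b, hb⟩ := hasGrad_wfun α a
    choose c hc using exists_wfun_eq_coord_mul (show (α + γ) / 2 < α by linarith) (Ck.res a)
    have hgrad := (hasGrad_coshW γ n).mul hb
    have hres : weightedEmb (k + 1) h (continuous_coshW γ n) (abs_coshW_le hγ n) a =
        weightedEmb k h (continuous_coshW γ n) (abs_coshW_le hγ n) (Ck.res a) := rfl
    rw [mem_sobolev, Nat.cast_add, Nat.cast_one]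
    refine memSobolev_succ ?_ fun i => ?_
    · rw [hres]
      exact weightedEmb_mem_sobolev hγ k n h (Ck.res a)
    · have m1 := (memLp_mul_wfun h' (continuous_coshW γ (n + 1)) (abs_coshW_le hγ (n + 1)) (c i)).2
      have m2 := (memLp_mul_wfun h (continuous_coshW γ n) (abs_coshW_le hγ n) (b i)).2
      have hm : MemLp (fun x => ((2 * γ ^ 2 * x i * coshW γ (n + 1) x * wfun α a x +
          coshW γ n x * wfun α (b i) x : ℝ) : ℂ)) 2 volume := by
        refine ((m1.const_smul ((2 * γ ^ 2 : ℝ) : ℂ)).add m2).ae_eq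
          (Filter.Eventually.of_forall fun x => ?_)
        simp only [Pi.add_apply, Pi.smul_apply, hc, smul_eq_mul]
        rw [show wfun α (Ck.res a) x = wfun α a x from rfl]
        push_cast
        ring
      have key := lineDerivOp_toDist
        (memLp_mul_wfun h (continuous_coshW γ n) (abs_coshW_le hγ n) a).2 hm
        (v := bvec i) fun x => hgrad.hasLineDerivAt_ofReal i x
      have e1 : hm.toLp _ = ((2 * γ ^ 2 : ℝ) : ℂ) •
          weightedEmb k h' (continuous_coshW γ (n + 1)) (abs_coshW_le hγ (n + 1)) (c i) +
          weightedEmb k h (continuous_coshW γ n) (abs_coshW_le hγ n) (b i) := by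
        refine Lp.ext ?_
        filter_upwards [hm.coeFn_toLp,
          coeFn_weightedEmb h' (continuous_coshW γ (n + 1)) (abs_coshW_le hγ (n + 1)) (c i),
          coeFn_weightedEmb h (continuous_coshW γ n) (abs_coshW_le hγ n) (b i),
          Lp.coeFn_add (((2 * γ ^ 2 : ℝ) : ℂ) •
            weightedEmb k h' (continuous_coshW γ (n + 1)) (abs_coshW_le hγ (n + 1)) (c i))
            (weightedEmb k h (continuous_coshW γ n) (abs_coshW_le hγ n) (b i)),
          Lp.coeFn_smul ((2 * γ ^ 2 : ℝ) : ℂ)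
            (weightedEmb k h' (continuous_coshW γ (n + 1)) (abs_coshW_le hγ (n + 1)) (c i))]
          with x e1 e2 e3 e4 e5
        rw [e1, e4, Pi.add_apply, e5, Pi.smul_apply, e2, e3, hc, smul_eq_mul]
        rw [show wfun α (Ck.res a) x = wfun α a x from rfl]
        push_cast
        ring
      rw [e1] at key
      have hs : ∂_{bvec i} (toDist (weightedEmb (k + 1) h (continuous_coshW γ n)
          (abs_coshW_le hγ n) a)) = _ := key
      rw [hs]
      exact Submodule.add_mem (sobolev k)
        (Submodule.smul_mem _ _ (weightedEmb_mem_sobolev hγ k (n + 1) h' (c i)))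
        (weightedEmb_mem_sobolev hγ k n h (b i))

theorem emb_mem_sobolev (hα : 0 < α) {k : ℕ} (a : Ck k) : emb hα k a ∈ sobolev k := by
  have h : emb hα k a = weightedEmb k hα (continuous_coshW 0 0) (abs_coshW_le le_rfl 0) a := by
    refine Lp.ext ?_
    filter_upwards [coeFn_emb hα a,
      coeFn_weightedEmb hα (continuous_coshW 0 0) (abs_coshW_le le_rfl 0) a] with x h1 h2
    rw [h1, h2, coshW_zero, zero_mul, Real.cosh_zero, one_mul]
  rw [h]
  exact weightedEmb_mem_sobolev le_rfl k 0 hα a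

/-- The embedding `a ↦ e^{-α⟨x⟩} a` of `C^k_b` into `Σ^s`, for `s ≤ k`. -/
theorem exists_sigmaEmb (hγ : 0 ≤ γ) (h : γ < α) (hα : 0 < α) (k : ℕ) {s : ℝ} (hs : 0 ≤ s)
    (hsk : s ≤ k) :
    ∃ ι : Ck k →L[ℝ] SigmaSp γ s, ∀ a, (ι a).toL2 = emb hα k a := by
  set q : Ck k →L[ℝ] L2 := weightedEmb k h (continuous_coshW γ 0) (abs_coshW_le hγ 0) with hq
  have hw : ∀ a : Ck k, (fun x => weight γ x * emb hα k a x) =ᵐ[volume] q a := by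
    intro a
    filter_upwards [coeFn_emb hα a,
      coeFn_weightedEmb h (continuous_coshW γ 0) (abs_coshW_le hγ 0) a] with x h1 h2
    rw [h1, h2, weight, coshW_zero]
    push_cast
    rfl
  have hwl : ∀ a : Ck k, emb hα k a ∈ weightedL2 γ := fun a =>
    (Lp.memLp (q a)).ae_eq (hw a).symm
  have hwm : ∀ a : Ck k, weightMul γ ⟨emb hα k a, hwl a⟩ = q a := by
    intro a
    refine Lp.ext ?_
    filter_upwards [(memLp_weight_mul ⟨emb hα k a, hwl a⟩).coeFn_toLp, hw a] with x h1 h2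
    rw [← h2]
    exact h1
  have hmem : ∀ a : Ck k, emb hα k a ∈ sigmaSub γ s := by
    intro a
    rw [mem_sigmaSub]
    refine ⟨sobolev_mono hsk (emb_mem_sobolev hα a), hwl a, ?_⟩
    rw [hwm]
    exact sobolev_mono hsk (weightedEmb_mem_sobolev hγ k 0 h a)
  let ι : Ck k →ₗ[ℝ] SigmaSp γ s :=
    { toFun := fun a => (⟨emb hα k a, hmem a⟩ : sigmaSub γ s)
      map_add' := fun a b => Subtype.ext (map_add _ _ _)
      map_smul' := fun c a => Subtype.ext
        (((emb hα k).map_smul c a).trans (Complex.coe_smul c (emb hα k a)).symm) }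
  have hι : ∀ a, SigmaSp.toL2 (ι a) = emb hα k a := fun a => rfl
  -- the bound follows from the closed graph theorem, through `⟨D⟩^{-s}`
  have ht : (fun ξ : R3 => (((1 + ‖ξ‖ ^ 2) ^ ((-s) / 2) : ℝ) : ℂ)).HasTemperateGrowth :=
    temperate_ofReal (Function.hasTemperateGrowth_one_add_norm_sq_rpow R3 _)
  have hm : MemLp (fun ξ : R3 => (((1 + ‖ξ‖ ^ 2) ^ ((-s) / 2) : ℝ) : ℂ)) ⊤ volume := by
    refine memLp_top_of_bound ht.1.continuous.aestronglyMeasurable 1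
      (Filter.Eventually.of_forall fun ξ => ?_)
    rw [Complex.norm_real, Real.norm_eq_abs, abs_of_nonneg (by positivity)]
    exact Real.rpow_le_one_of_one_le_of_nonpos (by nlinarith [sq_nonneg ‖ξ‖]) (by linarith)
  have hdist : ∀ u : L2, toDist (fourierMul _ hm u) = besselPotential R3 ℂ (-s) (toDist u) :=
    fun u => toDist_fourierMul hm ht u
  set p : L2 →L[ℝ] L2 := (fourierMul _ hm).restrictScalars ℝ with hp
  have hpinj : Function.Injective p := by
    intro u v huv
    have h1 := congrArg toDist (show fourierMul _ hm u = fourierMul _ hm v from huv)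
    rw [hdist, hdist] at h1
    have h2 := congrArg (besselPotential R3 ℂ s) h1
    simp only [besselPotential_besselPotential_apply, neg_add_cancel, besselPotential_zero,
      ContinuousLinearMap.id_apply] at h2
    exact toDist_injective h2
  have hpn : ∀ a, p (SigmaSp.normMap γ s (ι a)) = q a := by
    intro a
    refine toDist_injective ?_
    have h1 : toDist (SigmaSp.normMap γ s (ι a)) = besselPotential R3 ℂ s (toDist (q a)) := by
      refine (toDist_bessel s _).trans ?_
      exact congrArg (fun u => besselPotential R3 ℂ s (toDist u)) (hwm a)
    rw [show p (SigmaSp.normMap γ s (ι a)) = fourierMul _ hm (SigmaSp.normMap γ s (ι a)) from rfl,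
      hdist, h1, besselPotential_besselPotential_apply, add_neg_cancel, besselPotential_zero,
      ContinuousLinearMap.id_apply]
  obtain ⟨S, hS⟩ := exists_lift p hpinj q fun a => ⟨_, hpn a⟩
  refine ⟨ι.mkContinuous ‖S‖ fun a => ?_, hι⟩
  have h1 : S a = SigmaSp.normMap γ s (ι a) := hpinj ((hS a).trans (hpn a).symm)
  have h2 : ‖ι a‖ = ‖S a‖ := by rw [h1]; rfl
  rw [h2]
  exact S.le_opNorm a

end

/-! ### Exponential decay of solutions -/

section

open scoped BoundedContinuousFunction FourierTransform LineDeriv InnerProductSpace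

variable {α κ : ℝ} {k : ℕ}

/-- The free resolvent restricts to a bounded operator on the weighted `C^k_b`. -/
theorem exists_weightedRes (hα : 0 < α) (hκ : 0 < κ) (h : 9 * α ^ 2 < κ) (k : ℕ) :
    ∃ R : Ck k →L[ℝ] Ck k, ∀ a, emb hα k (R a) = freeRes hκ (emb hα k a) := by
  refine exists_lift (emb hα k) (emb_injective hα k)
    (((freeRes hκ).restrictScalars ℝ).comp (emb hα k)) fun a => ?_
  obtain ⟨b, hb⟩ := inCk_resConv hα.le h k a
  have hw : ∀ x, wfun α b x = resConv κ (wfun α a) x := fun x => by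
    rw [wfun, hb, ← mul_assoc, mul_comm (expW (-α) 0 x), expW_mul_neg, one_mul]
  refine ⟨b, ?_⟩
  have h1 := memLp_wfun hα b
  have e1 : (fun x => (wfun α b x : ℂ)) = fun x => (resConv κ (wfun α a) x : ℂ) := by
    funext x
    rw [hw]
  rw [e1] at h1
  have h2 := memLp_wfun hα a
  have h3 := freeRes_toLp hκ (continuous_wfun α a) h2.1 h2.2 h1.1 h1.2
  rw [ContinuousLinearMap.comp_apply, ContinuousLinearMap.coe_restrictScalars', emb_eq_toLp hα a,
    h3,
    emb_eq_toLp hα b]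
  exact MemLp.toLp_congr _ _ (Filter.Eventually.of_forall fun x => congrFun e1 x)

theorem memLp_top_ev (c : Ck k) : MemLp (fun x => (Ck.ev c x : ℂ)) ⊤ (volume : Measure R3) := by
  refine memLp_top_of_bound (Complex.continuous_ofReal.comp
    (Ck.ev c).continuous).aestronglyMeasurable ‖c‖ (Filter.Eventually.of_forall fun x => ?_)
  rw [Complex.norm_real]
  exact Ck.abs_ev_le c x

/-- Multiplication by an element of `C^k_b` on `L²`. -/
def mulCk (c : Ck k) : L2 →L[ℂ] L2 := mulL _ (memLp_top_ev c)

theorem coeFn_mulCk (c : Ck k) (u : L2) :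
    mulCk c u =ᵐ[volume] fun x => (Ck.ev c x : ℂ) * u x := coeFn_mulL _ u

theorem norm_mulCk_le (c : Ck k) (u : L2) : ‖mulCk c u‖ ≤ ‖c‖ * ‖u‖ := by
  refine Lp.norm_le_mul_norm_of_ae_le_mul ?_
  filter_upwards [coeFn_mulCk c u] with x hx
  rw [hx, norm_mul, Complex.norm_real]
  exact mul_le_mul_of_nonneg_right (Ck.abs_ev_le c x) (norm_nonneg _)

theorem emb_mul (hα : 0 < α) (c a : Ck k) : emb hα k (c * a) = mulCk c (emb hα k a) := by
  refine Lp.ext ?_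
  filter_upwards [coeFn_emb hα (c * a), coeFn_mulCk c (emb hα k a), coeFn_emb hα a] with x h1 h2 h3
  rw [h1, h2, h3, wfun, wfun, Ck.ev_mul_apply]
  push_cast
  ring

theorem mulCk_eq_mulSchwartz {V : 𝓢(R3, ℝ)} {c : Ck k} (hc : ∀ x, Ck.ev c x = V x) (u : L2) :
    mulCk c u = mulSchwartz V u := by
  refine Lp.ext ?_
  filter_upwards [coeFn_mulCk c u, coeFn_mulSchwartz V u] with x h1 h2
  rw [h1, h2, hc]

theorem mulSchwartz_mem_sobolev (V : 𝓢(R3, ℝ)) (n : ℕ) {u : L2} (hu : u ∈ sobolev n) :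
    mulSchwartz V u ∈ sobolev n := by
  rw [mem_sobolev, toDist_mulSchwartz]
  exact memSobolev_smulLeft n V hu

/-- Elliptic regularity for `(-Δ + V + κ) u = f`. -/
theorem mem_sobolev_of_sol (V : 𝓢(R3, ℝ)) (hκ : 0 < κ) {u f : L2} (hf : f ∈ sobolev k)
    (hu : u = freeRes hκ (f - mulSchwartz V u)) : u ∈ sobolev (k + 2) := by
  have key : ∀ n : ℕ, n ≤ k + 2 → u ∈ sobolev n := by
    intro n
    induction n with
    | zero => exact fun _ => by rw [Nat.cast_zero]; exact memSobolev_zero_toDist u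
    | succ n ih =>
      intro hn
      have h1 := ih (by omega)
      have h2 : f - mulSchwartz V u ∈ sobolev (min n k : ℕ) :=
        Submodule.sub_mem _ (sobolev_mono (by exact_mod_cast min_le_right n k) hf)
          (mulSchwartz_mem_sobolev V _ (sobolev_mono (by exact_mod_cast min_le_left n k) h1))
      rw [hu]
      refine sobolev_mono ?_ (freeRes_mem_sobolev hκ h2)
      have : n + 1 ≤ min n k + 2 := by omega
      exact_mod_cast this
  simpa using key (k + 2) le_rfl

/-- Solutions of `(-Δ + V + κ) u = f` decay exponentially if `f` does. The potential is split into a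
part decaying faster than the weight, and a part which is small and can be treated by a Neumann
series. -/
theorem exists_emb_of_sol (V : 𝓢(R3, ℝ)) (hα : 0 < α) (hκ : 0 < κ) (h : 9 * α ^ 2 < κ) {u : L2}
    (a a' : Ck k)
    (hu : u = freeRes hκ (emb hα k a + Complex.I • emb hα k a' - mulSchwartz V u)) :
    ∃ b b' : Ck k, u = emb hα k b + Complex.I • emb hα k b' := by
  have hsob : u ∈ sobolev (k + 2) := mem_sobolev_of_sol V hκ (Submodule.add_mem _
    (emb_mem_sobolev hα a) (Submodule.smul_mem _ _ (emb_mem_sobolev hα a'))) hu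
  obtain ⟨a₀, b₀, hab⟩ := exists_ck_of_sobolev k u hsob
  obtain ⟨R, hR⟩ := exists_weightedRes hα hκ h k
  set η : ℝ := (2 * (‖R‖ + ‖freeRes hκ‖ + 1))⁻¹ with hη
  have hη0 : 0 < η := by positivity
  obtain ⟨ε, ⟨c, hcn, hc⟩, hε⟩ :=
    ((exists_small_tail k V hη0).and self_mem_nhdsWithin).exists
  obtain ⟨d, hd⟩ := inCk_schwartz_mul_expW (α := α) hε k V
  have hηR : ‖R‖ * η < 1 := by
    rw [hη, ← div_eq_mul_inv, div_lt_one (by positivity)]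
    nlinarith [norm_nonneg R, norm_nonneg (freeRes hκ)]
  have hηF : ‖freeRes hκ‖ * η < 1 := by
    rw [hη, ← div_eq_mul_inv, div_lt_one (by positivity)]
    nlinarith [norm_nonneg R, norm_nonneg (freeRes hκ)]
  -- `d = e^{α⟨x⟩} V e^{-ε⟨x⟩²}` and `c = V (1 - e^{-ε⟨x⟩²})`; by regularity `u = a₀ + i b₀` with
  -- `a₀`, `b₀` in `C^k_b`, so the first part of `V u` decays like `e^{-α⟨x⟩}`
  have hsplit : mulSchwartz V u =
      emb hα k (d * a₀) + Complex.I • emb hα k (d * b₀) + mulCk c u := by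
    refine Lp.ext ?_
    filter_upwards [coeFn_mulSchwartz V u, coeFn_emb hα (d * a₀), coeFn_emb hα (d * b₀),
      coeFn_mulCk c u, hab, Lp.coeFn_add (emb hα k (d * a₀) + Complex.I • emb hα k (d * b₀))
        (mulCk c u), Lp.coeFn_add (emb hα k (d * a₀)) (Complex.I • emb hα k (d * b₀)),
      Lp.coeFn_smul Complex.I (emb hα k (d * b₀))] with x e1 e2 e3 e4 e5 e6 e7 e8
    have h1 : expW (-α) 0 x * expW α ε x = expW 0 ε x := by
      rw [expW, expW, expW, ← Real.exp_add]
      congr 1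
      ring
    rw [e1, e6, Pi.add_apply, e7, Pi.add_apply, e8, Pi.smul_apply, e2, e3, e4, e5, smul_eq_mul,
      wfun, wfun, Ck.ev_mul_apply, Ck.ev_mul_apply, hd, hc, ← h1]
    push_cast
    ring
  -- the Neumann series in `C^k_b`
  set L : Ck k →L[ℝ] Ck k := R ∘L ContinuousLinearMap.mul ℝ (Ck k) c with hL
  have hLn : ‖-L‖ < 1 := by
    rw [norm_neg]
    refine lt_of_le_of_lt (ContinuousLinearMap.opNorm_comp_le _ _) (lt_of_le_of_lt ?_ hηR)
    exact mul_le_mul_of_nonneg_left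
      ((ContinuousLinearMap.opNorm_mul_apply_le ℝ (Ck k) c).trans hcn) (norm_nonneg _)
  obtain ⟨S, hS⟩ := isUnit_one_sub_of_norm_lt_one hLn
  rw [sub_neg_eq_add] at hS
  have hsolve : ∀ f : Ck k, ∃ b : Ck k, b + R (c * b) = f := by
    intro f
    refine ⟨((S⁻¹ : (Ck k →L[ℝ] Ck k)ˣ) : Ck k →L[ℝ] Ck k) f, ?_⟩
    have h1 : (S : Ck k →L[ℝ] Ck k) (((S⁻¹ : (Ck k →L[ℝ] Ck k)ˣ) : Ck k →L[ℝ] Ck k) f) = f := by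
      rw [← mul_apply_eq_comp, Units.mul_inv]; rfl
    rw [hS] at h1
    exact h1
  obtain ⟨b, hb⟩ := hsolve (R (a - d * a₀))
  obtain ⟨b', hb'⟩ := hsolve (R (a' - d * b₀))
  refine ⟨b, b', ?_⟩
  set w : L2 := emb hα k b + Complex.I • emb hα k b' with hw
  have hw1 : w + freeRes hκ (mulCk c w) =
      freeRes hκ (emb hα k (a - d * a₀) + Complex.I • emb hα k (a' - d * b₀)) := by
    rw [hw]
    simp only [map_add, map_smul]
    rw [← emb_mul, ← emb_mul, ← hR, ← hR, ← hR, ← hR, ← hb, ← hb', map_add, map_add, smul_add]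
    abel
  have hu1 : u + freeRes hκ (mulCk c u) =
      freeRes hκ (emb hα k (a - d * a₀) + Complex.I • emb hα k (a' - d * b₀)) := by
    conv_lhs => enter [1]; rw [hu]
    rw [← map_add, hsplit, map_sub, map_sub, smul_sub]
    congr 1
    abel
  -- `u` and `w` solve the same equation, which has at most one solution in `L²` as `c` is small
  have hdiff : u - w = -freeRes hκ (mulCk c (u - w)) := by
    rw [map_sub, map_sub, neg_sub, eq_comm, sub_eq_sub_iff_add_eq_add, add_comm _ w,
      hw1, ← hu1]
  have hn : ‖u - w‖ ≤ ‖freeRes hκ‖ * η * ‖u - w‖ := by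
    conv_lhs => rw [hdiff]
    rw [norm_neg, mul_assoc]
    refine (ContinuousLinearMap.le_opNorm _ _).trans (mul_le_mul_of_nonneg_left ?_ (norm_nonneg _))
    exact (norm_mulCk_le c _).trans (mul_le_mul_of_nonneg_right hcn (norm_nonneg _))
  have hz : ‖u - w‖ = 0 := by
    have := norm_nonneg (u - w)
    nlinarith
  exact sub_eq_zero.mp (norm_eq_zero.mp hz)

/-- If the right-hand side is real, real and imaginary parts of a solution solve separately. -/
theorem sol_parts (V : 𝓢(R3, ℝ)) (hα : 0 < α) (hκ : 0 < κ) (h : 9 * α ^ 2 < κ) {a b b' : Ck k}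
    (hu : emb hα k b + Complex.I • emb hα k b' =
      freeRes hκ (emb hα k a - mulSchwartz V (emb hα k b + Complex.I • emb hα k b'))) :
    emb hα k b = freeRes hκ (emb hα k a - mulSchwartz V (emb hα k b)) := by
  obtain ⟨R, hR⟩ := exists_weightedRes hα hκ h k
  obtain ⟨v, hv⟩ := inCk_schwartz k V
  have h1 : emb hα k b + Complex.I • emb hα k b' =
      emb hα k (R (a - v * b)) + Complex.I • emb hα k (R (-(v * b'))) := by
    rw [hu, hR, hR, map_sub (emb hα k), map_neg (emb hα k), emb_mul, emb_mul,
      mulCk_eq_mulSchwartz hv, mulCk_eq_mulSchwartz hv, map_add (mulSchwartz V),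
      map_smul (mulSchwartz V), ← map_smul (freeRes hκ), ← map_add (freeRes hκ), smul_neg]
    congr 1
    abel
  have h2 : b = R (a - v * b) := Ck.ext_ev (emb_add_I_injective hα h1).1
  conv_lhs => rw [h2]
  rw [hR, map_sub, emb_mul, mulCk_eq_mulSchwartz hv]

theorem inner_emb (hα : 0 < α) {l : ℕ} (a : Ck k) (b : Ck l) :
    ⟪emb hα k a, emb hα l b⟫_ℂ = ((∫ x, wfun α a x * wfun α b x : ℝ) : ℂ) := by
  rw [inner_eq_integral, ← integral_complex_ofReal]
  refine integral_congr_ae ?_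
  filter_upwards [coeFn_emb hα a, coeFn_emb hα b] with x h1 h2
  rw [h1, h2, Complex.conj_ofReal]
  push_cast
  rfl

/-- The reduced resolvent of `H` restricts to the weighted `C^k_b`. -/
theorem exists_reducedResolvent_ck (V : 𝓢(R3, ℝ)) (hα : 0 < α) (hκ : 0 < κ) (h : 9 * α ^ 2 < κ)
    {S : L2 →L[ℂ] L2} (p : Ck k)
    (hS : ∀ f v, v = S f ↔
      v = freeRes hκ (f - ⟪emb hα k p, f⟫_ℂ • emb hα k p - mulSchwartz V v) ∧
        ⟪emb hα k p, v⟫_ℂ = 0) :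
    ∃ T : Ck k →L[ℝ] Ck k, ∀ a, emb hα k (T a) = S (emb hα k a) := by
  refine exists_lift (emb hα k) (emb_injective hα k) ((S.restrictScalars ℝ).comp (emb hα k))
    fun a => ?_
  rw [ContinuousLinearMap.comp_apply, ContinuousLinearMap.coe_restrictScalars']
  obtain ⟨h1, h2⟩ := (hS (emb hα k a) _).mp rfl
  set v := S (emb hα k a) with hv
  set t : ℝ := ∫ x, wfun α p x * wfun α a x with ht
  have hrhs : emb hα k a - ⟪emb hα k p, emb hα k a⟫_ℂ • emb hα k p = emb hα k (a - t • p) := by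
    rw [inner_emb, ← ht, map_sub, map_smul, Complex.coe_smul]
    rfl
  rw [hrhs] at h1
  obtain ⟨b, b', hb⟩ := exists_emb_of_sol V hα hκ h (a - t • p) 0
    (by rw [map_zero, smul_zero, add_zero]; exact h1)
  refine ⟨b, ?_⟩
  rw [hb] at h1 h2
  have h3 := sol_parts V hα hκ h h1
  rw [hv, hS, hrhs]
  refine ⟨h3, ?_⟩
  rw [inner_add_right, inner_smul_right, inner_emb, inner_emb] at h2
  have h4 := congrArg Complex.re h2
  rw [inner_emb]
  simp at h4
  rw [h4, Complex.ofReal_zero]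

/-- The eigenfunctions of `H` decay exponentially, with all their derivatives. -/
theorem exists_emb_eigenfunction {N : ℕ} {V : 𝓢(R3, ℝ)} {ω : Fin N → ℝ} {φ : Fin N → L2}
    (hH : SpectralAssumption V ω φ) (hα : 0 < α) (j : Fin N) (h : 9 * α ^ 2 < -ω j) (k : ℕ) :
    ∃ a : Ck k, φ j = emb hα k a := by
  have hκ : 0 < -ω j := by linarith [hH.neg j]
  have h1 := mem_homSol.mp (mem_kerH_eigenfunction hH hκ (j := j) (by ring))
  obtain ⟨b, b', hb⟩ := exists_emb_of_sol V hα hκ h (0 : Ck k) 0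
    (by rw [map_zero, smul_zero, add_zero]; exact h1)
  have him : (fun x => wfun α b' x) = fun _ => (0 : ℝ) := by
    refine ((continuous_wfun α b').ae_eq_iff_eq volume continuous_const).mp ?_
    filter_upwards [hH.real_valued j, coeFn_emb hα b, coeFn_emb hα b',
      Lp.coeFn_add (emb hα k b) (Complex.I • emb hα k b'),
      Lp.coeFn_smul Complex.I (emb hα k b')] with x e1 e2 e3 e4 e5
    rw [hb, e4, Pi.add_apply, e5, Pi.smul_apply, e2, e3] at e1
    simpa using e1
  refine ⟨b, ?_⟩
  have h2 : emb hα k b' = 0 := by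
    refine Lp.ext ?_
    filter_upwards [coeFn_emb hα b', Lp.coeFn_zero ℂ 2 (volume : Measure R3)] with x e1 e2
    rw [e1, e2, congrFun him x, Complex.ofReal_zero, Pi.zero_apply]
  rw [hb, h2, smul_zero, add_zero]

end

/-! ### A fixed point problem depending on a parameter -/

section

open scoped Topology

/-- A smooth family `T (x, ·)` of maps such that an iterate of `T (0, ·)` is constant has, for small
`x`, a locally unique fixed point, which depends smoothly on `x`: at the fixed point of `T (0, ·)`
the derivative of `T (0, ·)` is nilpotent, so that the inverse function theorem applies to
`(x, y) ↦ (x, y - T (x, y))`. -/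
theorem exists_smooth_fixedPoint {X Y : Type*} [NormedAddCommGroup X] [NormedSpace ℝ X]
    [CompleteSpace X] [NormedAddCommGroup Y] [NormedSpace ℝ Y] [CompleteSpace Y] {T : X × Y → Y}
    (hT : ContDiff ℝ (⊤ : ℕ∞) T) {L : ℕ} {y₀ : Y} (hL : ∀ y, (fun y => T (0, y))^[L] y = y₀) :
    ∃ y : X → Y, ∃ r > 0, ContDiffOn ℝ (⊤ : ℕ∞) y (Metric.ball 0 r) ∧ y 0 = y₀ ∧
      (∀ x ∈ Metric.ball (0 : X) r, T (x, y x) = y x) ∧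
      ∀ᶠ p in 𝓝 ((0, y₀) : X × Y), T p = p.2 → p.2 = y p.1 := by
  have hfix : T (0, y₀) = y₀ := by
    have h1 : (fun y => T (0, y))^[L + 1] y₀ = T (0, y₀) := by
      rw [Function.iterate_succ_apply', hL]
    rw [← h1, Function.iterate_succ_apply, hL]
  have hTd : ∀ p, HasFDerivAt T (fderiv ℝ T p) p := fun p =>
    (hT.differentiable (by simp) p).hasFDerivAt
  set A : X × Y →L[ℝ] Y := fderiv ℝ T (0, y₀) with hA
  set Q : Y →L[ℝ] Y := A.comp (ContinuousLinearMap.inr ℝ X Y) with hQ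
  have hQd : HasFDerivAt (fun y => T (0, y)) Q y₀ :=
    (hTd (0, y₀)).comp y₀ (ContinuousLinearMap.inr ℝ X Y).hasFDerivAt
  -- the derivative of the constant map `T(0, ·)^[L]` is `Q ^ L`
  have hnil : Q ^ L = 0 := by
    have h1 := HasFDerivAt.iterate hQd hfix L
    have h2 : (fun y => T (0, y))^[L] = fun _ => y₀ := funext hL
    rw [h2] at h1
    exact h1.unique (hasFDerivAt_const y₀ y₀)
  -- `1 - Q` is invertible, which makes the derivative of `F` below triangular and invertible
  obtain ⟨U, hU⟩ : IsUnit (1 - Q) := IsNilpotent.isUnit_one_sub ⟨L, hnil⟩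
  have hU1 : ∀ y : Y, (U : Y →L[ℝ] Y) (((U⁻¹ : (Y →L[ℝ] Y)ˣ) : Y →L[ℝ] Y) y) = y := fun y => by
    rw [← mul_apply_eq_comp, Units.mul_inv]; rfl
  have hU2 : ∀ y : Y, ((U⁻¹ : (Y →L[ℝ] Y)ˣ) : Y →L[ℝ] Y) ((U : Y →L[ℝ] Y) y) = y := fun y => by
    rw [← mul_apply_eq_comp, Units.inv_mul]; rfl
  have hU3 : ∀ y : Y, (U : Y →L[ℝ] Y) y = y - A (0, y) := fun y => by rw [hU]; rfl
  have hA2 : ∀ x y, A (x, y) = A (x, 0) + A (0, y) := fun x y => by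
    rw [← map_add]; simp
  set F : X × Y → X × Y := fun p => (p.1, p.2 - T p) with hF
  have hFs : ContDiff ℝ (⊤ : ℕ∞) F := contDiff_fst.prodMk (contDiff_snd.sub hT)
  let F' : X × Y →L[ℝ] X × Y :=
    (ContinuousLinearMap.fst ℝ X Y).prod (ContinuousLinearMap.snd ℝ X Y - A)
  let G' : X × Y →L[ℝ] X × Y :=
    (ContinuousLinearMap.fst ℝ X Y).prod (((U⁻¹ : (Y →L[ℝ] Y)ˣ) : Y →L[ℝ] Y).comp
      (ContinuousLinearMap.snd ℝ X Y + (A.comp (ContinuousLinearMap.inl ℝ X Y)).comp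
        (ContinuousLinearMap.fst ℝ X Y)))
  have hGF : Function.LeftInverse G' F' := by
    rintro ⟨x, y⟩
    refine Prod.ext rfl ?_
    change ((U⁻¹ : (Y →L[ℝ] Y)ˣ) : Y →L[ℝ] Y) ((y - A (x, y)) + A (x, 0)) = y
    rw [hA2 x y, show y - (A (x, 0) + A (0, y)) + A (x, 0) = y - A (0, y) by abel, ← hU3, hU2]
  have hFG : Function.RightInverse G' F' := by
    rintro ⟨x, y⟩
    refine Prod.ext rfl ?_
    change ((U⁻¹ : (Y →L[ℝ] Y)ˣ) : Y →L[ℝ] Y) (y + A (x, 0)) -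
      A (x, ((U⁻¹ : (Y →L[ℝ] Y)ˣ) : Y →L[ℝ] Y) (y + A (x, 0))) = y
    rw [hA2 x (((U⁻¹ : (Y →L[ℝ] Y)ˣ) : Y →L[ℝ] Y) (y + A (x, 0))), sub_add_eq_sub_sub,
      sub_right_comm, ← hU3, hU1, add_sub_cancel_right]
  let Fe : (X × Y) ≃L[ℝ] X × Y := ContinuousLinearEquiv.equivOfInverse F' G' hGF hFG
  have hFd : HasFDerivAt F (Fe : X × Y →L[ℝ] X × Y) (0, y₀) :=
    (ContinuousLinearMap.fst ℝ X Y).hasFDerivAt.prodMk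
      ((ContinuousLinearMap.snd ℝ X Y).hasFDerivAt.sub (hTd (0, y₀)))
  have hFa : ContDiffAt ℝ (⊤ : ℕ∞) F (0, y₀) := hFs.contDiffAt
  set e := hFa.toOpenPartialHomeomorph F hFd (by simp) with he
  have hecoe : ∀ p, e p = F p := fun p => rfl
  have hsrc : (0, y₀) ∈ e.source := hFa.mem_toOpenPartialHomeomorph_source hFd (by simp)
  have he0 : e (0, y₀) = (0, 0) := by rw [hecoe, hF]; simp [hfix]
  have htgt : ((0, 0) : X × Y) ∈ e.target := he0 ▸ e.map_source hsrc
  have hsymm0 : e.symm (0, 0) = (0, y₀) := by rw [← he0, e.left_inv hsrc]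
  -- invertibility of the derivative near `(0, y₀)`, for smoothness of the inverse on a whole ball
  have hinv : ∀ᶠ p in 𝓝 ((0, y₀) : X × Y),
      fderiv ℝ F p ∈ Set.range ((↑) : ((X × Y) ≃L[ℝ] X × Y) → X × Y →L[ℝ] X × Y) := by
    have hc : ContinuousAt (fderiv ℝ F) (0, y₀) := (hFs.continuous_fderiv (by simp)).continuousAt
    refine hc ?_
    rw [hFd.fderiv]
    exact ContinuousLinearEquiv.nhds Fe
  have hev : ∀ᶠ x in 𝓝 (0 : X), (x, (0 : Y)) ∈ e.target ∧ e.symm (x, 0) ∈ e.source ∧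
      fderiv ℝ F (e.symm (x, 0)) ∈
        Set.range ((↑) : ((X × Y) ≃L[ℝ] X × Y) → X × Y →L[ℝ] X × Y) := by
    have hc : Filter.Tendsto (fun x : X => (x, (0 : Y))) (𝓝 0) (𝓝 (0, 0)) :=
      Continuous.tendsto (f := fun x : X => (x, (0 : Y))) (by fun_prop) 0
    have hs : Filter.Tendsto e.symm (𝓝 (0, 0)) (𝓝 (0, y₀)) := by
      have := e.symm.continuousAt (x := (0, 0)) htgt
      rwa [ContinuousAt, hsymm0] at this
    filter_upwards [hc.eventually (e.open_target.mem_nhds htgt),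
      (hs.comp hc).eventually (e.open_source.mem_nhds hsrc), (hs.comp hc).eventually hinv]
      with x h1 h2 h3
    exact ⟨h1, h2, h3⟩
  obtain ⟨r, hr, hball⟩ := Metric.eventually_nhds_iff_ball.mp hev
  refine ⟨fun x => (e.symm (x, 0)).2, r, hr, fun x hx => ?_, congrArg Prod.snd hsymm0,
    fun x hx => ?_, ?_⟩
  · obtain ⟨h1, h2, ⟨B, hB⟩⟩ := hball x hx
    have h3 : HasFDerivAt e (B : X × Y →L[ℝ] X × Y) (e.symm (x, 0)) := by
      rw [hB]
      exact (hFs.differentiable (by simp) _).hasFDerivAt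
    have h4 := e.contDiffAt_symm h1 h3 (hFs.contDiffAt (n := (⊤ : ℕ∞)))
    have h5 : ContDiffAt ℝ (⊤ : ℕ∞) (fun x : X => (x, (0 : Y))) x :=
      contDiffAt_id.prodMk contDiffAt_const
    exact (contDiffAt_snd.comp x (h4.comp x h5)).contDiffWithinAt
  · obtain ⟨h1, h2, -⟩ := hball x hx
    have h3 : F (e.symm (x, 0)) = (x, 0) := e.right_inv h1
    have h4 : (e.symm (x, 0)).1 = x := congrArg Prod.fst h3
    have h5 : (e.symm (x, 0)).2 - T (e.symm (x, 0)) = 0 := congrArg Prod.snd h3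
    have h6 : (x, (e.symm (x, 0)).2) = e.symm (x, 0) := Prod.ext h4.symm rfl
    rw [h6]
    exact (sub_eq_zero.mp h5).symm
  · filter_upwards [e.open_source.mem_nhds hsrc] with p hp hTp
    have h1 : e p = (p.1, 0) := by rw [hecoe, hF]; simp [hTp]
    rw [← h1, e.left_inv hp]

end

/-! ### Taylor expansion of the composition operators -/

section

open scoped Topology

theorem contDiff_iteratedDeriv_top {g : ℝ → ℝ} (hg : ContDiff ℝ (⊤ : ℕ∞) g) :
    ∀ l : ℕ, ContDiff ℝ (⊤ : ℕ∞) (iteratedDeriv l g)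
  | 0 => by rwa [iteratedDeriv_zero]
  | l + 1 => by
    rw [iteratedDeriv_succ]
    exact Ck.contDiff_deriv (contDiff_iteratedDeriv_top hg l)

namespace Ck

theorem nem_congr {k : ℕ} {g h : ℝ → ℝ} (hg : ContDiff ℝ (⊤ : ℕ∞) g) (hh : ContDiff ℝ (⊤ : ℕ∞) h)
    (e : g = h) (u : Ck k) : nem hg u = nem hh u := by
  subst e
  rfl

/-- The Taylor polynomial of `u ↦ g ∘ u` with `n` terms. -/
def taylorPoly {k : ℕ} {g : ℝ → ℝ} (hg : ContDiff ℝ (⊤ : ℕ∞) g) (n : ℕ) (D E : Ck k) : Ck k :=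
  ∑ l ∈ Finset.range n, ((l.factorial : ℝ)⁻¹) • (nem (contDiff_iteratedDeriv_top hg l) D * E ^ l)

theorem hasDerivAt_taylorPoly {k : ℕ} {g : ℝ → ℝ} (hg : ContDiff ℝ (⊤ : ℕ∞) g) (n : ℕ)
    (D E : Ck k) (t : ℝ) : HasDerivAt (fun t : ℝ => taylorPoly hg (n + 1) D (t • E))
      (E * taylorPoly (contDiff_deriv hg) n D (t • E)) t := by
  have h1 : ∀ l : ℕ, HasDerivAt
      (fun t : ℝ => ((l.factorial : ℝ)⁻¹) •
        (nem (contDiff_iteratedDeriv_top hg l) D * (t • E) ^ l))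
      ((((l.factorial : ℝ)⁻¹) * (l * t ^ (l - 1))) •
        (nem (contDiff_iteratedDeriv_top hg l) D * E ^ l)) t := by
    intro l
    have h2 := ((hasDerivAt_pow l t).const_mul ((l.factorial : ℝ)⁻¹)).smul_const
      (nem (contDiff_iteratedDeriv_top hg l) D * E ^ l)
    refine h2.congr_of_eventuallyEq (Filter.Eventually.of_forall fun s => ?_)
    simp only [smul_pow, mul_smul_comm, smul_smul]
  have h2 := HasDerivAt.fun_sum (u := Finset.range (n + 1)) fun l _ => h1 l
  unfold taylorPoly
  refine HasDerivAt.congr_deriv h2 ?_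
  rw [Finset.sum_range_succ', Finset.mul_sum]
  simp only [Nat.cast_zero, zero_mul, mul_zero, zero_smul, add_zero]
  refine Finset.sum_congr rfl fun l _ => ?_
  rw [nem_congr (contDiff_iteratedDeriv_top hg (l + 1))
    (contDiff_iteratedDeriv_top (contDiff_deriv hg) l) iteratedDeriv_succ', smul_pow,
    mul_smul_comm, mul_smul_comm, mul_smul_comm, smul_smul, Nat.add_sub_cancel, Nat.factorial_succ]
  have h3 : (((l + 1 : ℕ) * l.factorial : ℕ) : ℝ)⁻¹ * (((l + 1 : ℕ) : ℝ) * t ^ l) =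
      (l.factorial : ℝ)⁻¹ * t ^ l := by
    push_cast
    have : (l.factorial : ℝ) ≠ 0 := by exact_mod_cast l.factorial_ne_zero
    field_simp
  rw [h3]
  congr 1
  ring

/-- Taylor's formula for `u ↦ g ∘ u`, near zero, by induction on the order: the derivative in `t`
of the remainder at `(D, t E)` is `E` times the remainder of lower order for `g'`. -/
theorem exists_taylor_bound {k : ℕ} : ∀ (n : ℕ) {g : ℝ → ℝ} (hg : ContDiff ℝ (⊤ : ℕ∞) g),
    ∃ r > 0, ∃ C : ℝ, 0 ≤ C ∧ ∀ D E : Ck k, ‖D‖ ≤ r → ‖E‖ ≤ r →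
      ‖nem hg (D + E) - taylorPoly hg n D E‖ ≤ C * ‖E‖ ^ n
  | 0, g, hg => by
    have hc : ContinuousAt (nem hg : Ck k → Ck k) 0 := (contDiff_nem hg).continuous.continuousAt
    obtain ⟨δ, hδ, h⟩ := Metric.continuousAt_iff.mp hc 1 one_pos
    refine ⟨δ / 3, by positivity, ‖(nem hg : Ck k → Ck k) 0‖ + 1, by positivity,
      fun D E hD hE => ?_⟩
    have h1 : dist (D + E) 0 < δ := by
      rw [dist_zero_right]
      linarith [norm_add_le D E]
    have h2 := h h1
    rw [dist_eq_norm] at h2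
    have h3 := norm_add_le (nem hg (D + E) - nem hg 0) (nem hg (0 : Ck k))
    rw [sub_add_cancel] at h3
    simp only [taylorPoly, Finset.range_zero, Finset.sum_empty, sub_zero, pow_zero, mul_one]
    linarith
  | n + 1, g, hg => by
    obtain ⟨r, hr, C, hC, h⟩ := exists_taylor_bound n (contDiff_deriv hg)
    refine ⟨r, hr, C, hC, fun D E hD hE => ?_⟩
    have hd : ∀ t : ℝ, HasDerivAt
        (fun t : ℝ => nem hg (D + t • E) - taylorPoly hg (n + 1) D (t • E))
        (E * (nem (contDiff_deriv hg) (D + t • E) -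
          taylorPoly (contDiff_deriv hg) n D (t • E))) t := by
      intro t
      have h1 : HasDerivAt (fun t : ℝ => D + t • E) E t := by
        have := ((hasDerivAt_id t).smul_const E).const_add D
        rwa [one_smul] at this
      have h2 := (hasFDerivAt_nem hg (D + t • E)).comp_hasDerivAt t h1
      have h3 := h2.sub (hasDerivAt_taylorPoly hg n D E t)
      rw [ContinuousLinearMap.mul_apply', mul_comm, ← mul_sub] at h3
      exact h3
    have h4 := norm_image_sub_le_of_norm_deriv_le_segment_01' (C := C * ‖E‖ ^ (n + 1))
      (fun t _ => (hd t).hasDerivWithinAt) fun t ht => ?_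
    · have h5 : taylorPoly hg (n + 1) D (0 : Ck k) = nem hg D := by
        unfold taylorPoly
        rw [Finset.sum_eq_single 0 (fun l _ hl => by rw [zero_pow hl, mul_zero, smul_zero])
          (by simp)]
        rw [pow_zero, mul_one, Nat.factorial_zero, Nat.cast_one, inv_one, one_smul]
        exact nem_congr _ _ iteratedDeriv_zero _
      simpa [h5] using h4
    · have ht' : |t| ≤ 1 := by rw [abs_of_nonneg ht.1]; exact ht.2.le
      have h6 : ‖t • E‖ ≤ ‖E‖ := by
        rw [norm_smul, Real.norm_eq_abs]
        exact mul_le_of_le_one_left (norm_nonneg _) ht'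
      refine (norm_mul_le _ _).trans ?_
      calc ‖E‖ * _ ≤ ‖E‖ * (C * ‖E‖ ^ n) := by
            refine mul_le_mul_of_nonneg_left ((h D (t • E) hD (h6.trans hE)).trans ?_)
              (norm_nonneg _)
            gcongr
        _ = _ := by ring

end Ck

end

/-! ### Alternating tuples -/

section

open scoped Topology ComplexConjugate

theorem prod_range_odd {M : Type*} [CommMonoid M] (G : ℕ → M) (l : ℕ) :
    ∏ i ∈ Finset.range (2 * l + 1), G i =
      (∏ a ∈ Finset.range l, G (2 * a) * G (2 * a + 1)) * G (2 * l) := by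
  induction l with
  | zero => simp
  | succ l ih =>
    rw [show 2 * (l + 1) + 1 = 2 * l + 1 + 1 + 1 by ring, Finset.prod_range_succ,
      Finset.prod_range_succ, ih, Finset.prod_range_succ, show 2 * (l + 1) = 2 * l + 1 + 1 by ring]
    simp only [mul_assoc]

/-- The position `2a` of a tuple of odd length. -/
def evenPos {l : ℕ} (a : Fin l) : Fin (2 * l + 1) := ⟨2 * a, by omega⟩

/-- The position `2a + 1` of a tuple of odd length. -/
def oddPos {l : ℕ} (a : Fin l) : Fin (2 * l + 1) := ⟨2 * a + 1, by omega⟩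

theorem prod_odd {M : Type*} [CommMonoid M] {l : ℕ} (F : Fin (2 * l + 1) → M) :
    ∏ i, F i = (∏ a : Fin l, F (evenPos a) * F (oddPos a)) * F (Fin.last _) := by
  let G : ℕ → M := fun n => if h : n < 2 * l + 1 then F ⟨n, h⟩ else 1
  have hG : ∀ i : Fin (2 * l + 1), F i = G i := fun i => by simp only [G, dif_pos i.2, Fin.eta]
  rw [Finset.prod_congr rfl fun i _ => hG i, Fin.prod_univ_eq_prod_range, prod_range_odd,
    ← Fin.prod_univ_eq_prod_range (fun a => G (2 * a) * G (2 * a + 1)), hG (Fin.last _)]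
  congr 1
  exact Finset.prod_congr rfl fun a _ => by rw [hG, hG]; rfl

/-- A tuple of odd length as a tuple of pairs and a last element. -/
def pairEquiv (ι : Type*) (l : ℕ) : (Fin l → ι × ι) × ι ≃ (Fin (2 * l + 1) → ι) where
  toFun P i := if h : (i : ℕ) < 2 * l then
    (if (i : ℕ) % 2 = 0 then (P.1 ⟨i / 2, by omega⟩).1 else (P.1 ⟨i / 2, by omega⟩).2) else P.2
  invFun p := (fun a => (p (evenPos a), p (oddPos a)), p (Fin.last _))
  left_inv P := by
    refine Prod.ext (funext fun a => Prod.ext ?_ ?_) ?_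
    · have h1 : 2 * (a : ℕ) < 2 * l := by omega
      simp [evenPos]
    · have h1 : 2 * (a : ℕ) + 1 < 2 * l := by omega
      have h2 : (2 * (a : ℕ) + 1) / 2 = a := by omega
      have h3 : (2 * (a : ℕ) + 1) % 2 = 1 := by omega
      simp [oddPos, h1, h2, h3]
    · simp
  right_inv p := by
    funext i
    by_cases h : (i : ℕ) < 2 * l
    · by_cases h2 : (i : ℕ) % 2 = 0
      · have : (evenPos ⟨i / 2, by omega⟩ : Fin (2 * l + 1)) = i :=
        Fin.ext (by simp [evenPos]; omega)
        simp [h, h2, this]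
      · have : (oddPos ⟨i / 2, by omega⟩ : Fin (2 * l + 1)) = i := Fin.ext (by simp [oddPos]; omega)
        simp [h, h2, this]
    · have : Fin.last (2 * l) = i := Fin.ext (by simp; omega)
      simp [h, this]

theorem pairEquiv_symm_apply {ι : Type*} {l : ℕ} (p : Fin (2 * l + 1) → ι) :
    (pairEquiv ι l).symm p = (fun a => (p (evenPos a), p (oddPos a)), p (Fin.last _)) := rfl

variable {N : ℕ} {ι : Type*}

/-- The indices of a tuple with alternating signs. -/
def signed (q : ι → Fin N → ℤ) {l : ℕ} (p : Fin (2 * l + 1) → ι) (i : Fin (2 * l + 1)) :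
    Fin N → ℤ := fun j => (-1) ^ (i : ℕ) * q (p i) j

/-- The alternating sum of a tuple of indices. -/
def net (q : ι → Fin N → ℤ) {l : ℕ} (p : Fin (2 * l + 1) → ι) : Fin N → ℤ := ∑ i, signed q p i

/-- The powers of `|z_j|²` that split off from the product of the monomials of a tuple. -/
def exc (q : ι → Fin N → ℤ) {l : ℕ} (p : Fin (2 * l + 1) → ι) : Fin N → ℕ :=
  excess Finset.univ (signed q p)

theorem signed_even (q : ι → Fin N → ℤ) {l : ℕ} (p : Fin (2 * l + 1) → ι) (a : Fin l) :
    signed q p (evenPos a) = q (p (evenPos a)) := by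
  funext j
  simp [signed, evenPos]

theorem signed_odd (q : ι → Fin N → ℤ) {l : ℕ} (p : Fin (2 * l + 1) → ι) (a : Fin l) :
    signed q p (oddPos a) = -q (p (oddPos a)) := by
  funext j
  simp [signed, oddPos, pow_succ, pow_mul]

theorem signed_last (q : ι → Fin N → ℤ) {l : ℕ} (p : Fin (2 * l + 1) → ι) :
    signed q p (Fin.last _) = q (p (Fin.last _)) := by
  funext j
  simp [signed, pow_mul]

theorem natAbs_signed (q : ι → Fin N → ℤ) {l : ℕ} (p : Fin (2 * l + 1) → ι)
    (i : Fin (2 * l + 1)) (j : Fin N) : (signed q p i j).natAbs = (q (p i) j).natAbs := by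
  rw [signed, Int.natAbs_mul, Int.natAbs_pow]
  simp

theorem sum_net (q : ι → Fin N → ℤ) (hq : ∀ i, ∑ j, q i j = 1) {l : ℕ}
    (p : Fin (2 * l + 1) → ι) : ∑ j, net q p j = 1 := by
  have h1 : ∑ j, net q p j = ∑ i : Fin (2 * l + 1), (-1 : ℤ) ^ (i : ℕ) := by
    simp only [net, Finset.sum_apply]
    rw [Finset.sum_comm]
    refine Finset.sum_congr rfl fun i _ => ?_
    simp only [signed]
    rw [← Finset.mul_sum, hq, mul_one]
  rw [h1, Fin.sum_univ_eq_sum_range (fun i => (-1 : ℤ) ^ i)]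
  induction l with
  | zero => simp
  | succ l ih =>
    have h2 := ih (fun _ => p 0) (by
      simp only [net, Finset.sum_apply]
      rw [Finset.sum_comm]
      refine Finset.sum_congr rfl fun i _ => ?_
      simp only [signed]
      rw [← Finset.mul_sum, hq, mul_one])
    rw [show 2 * (l + 1) + 1 = 2 * l + 1 + 1 + 1 by ring, Finset.sum_range_succ,
      Finset.sum_range_succ, h2]
    ring

/-- The tuples in which the two members of each pair differ. -/
def Reduced {l : ℕ} (p : Fin (2 * l + 1) → ι) : Prop := ∀ a : Fin l, p (evenPos a) ≠ p (oddPos a)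

theorem exc_eq_zero_iff (q : ι → Fin N → ℤ) {l : ℕ} (p : Fin (2 * l + 1) → ι) :
    (∀ j, exc q p j = 0) ↔ ∀ j, ∑ i, |q (p i) j| = |net q p j| := by
  refine forall_congr' fun j => ?_
  have h := two_mul_excess Finset.univ (signed q p) j
  simp only [natAbs_signed] at h
  have h2 : (∑ i, signed q p i j).natAbs = (net q p j).natAbs := by rw [net, Finset.sum_apply]
  rw [h2] at h
  have h3 : (∑ i, |q (p i) j| = |net q p j|) ↔
      ∑ i, (q (p i) j).natAbs = (net q p j).natAbs := by
    simp only [Int.abs_eq_natAbs]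
    exact_mod_cast Iff.rfl
  rw [h3]
  unfold exc
  omega

theorem reduced_of_exc_eq_zero {q : ι → Fin N → ℤ} (hq : ∀ i, ∑ j, q i j = 1) {l : ℕ}
    {p : Fin (2 * l + 1) → ι} (h : ∀ j, exc q p j = 0) : Reduced p := by
  intro a ha
  have h1 := (exc_eq_zero_iff q p).mp h
  obtain ⟨j, hj⟩ : ∃ j, q (p (evenPos a)) j ≠ 0 := by
    by_contra hc
    push Not at hc
    have := hq (p (evenPos a))
    simp [hc] at this
  have hne : (evenPos a : Fin (2 * l + 1)) ≠ oddPos a := by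
    intro hc
    have := congrArg Fin.val hc
    simp [evenPos, oddPos] at this
  have h2 := h1 j
  have h3 : net q p j = ∑ i ∈ (Finset.univ.erase (evenPos a)).erase (oddPos a), signed q p i j := by
    rw [net, Finset.sum_apply, ← Finset.add_sum_erase _ _ (Finset.mem_univ (evenPos a)),
      ← Finset.add_sum_erase _ _ (Finset.mem_erase.mpr ⟨hne.symm, Finset.mem_univ (oddPos a)⟩),
      signed_even, signed_odd, ← ha]
    simp
  have h4 : |net q p j| ≤ ∑ i ∈ (Finset.univ.erase (evenPos a)).erase (oddPos a), |q (p i) j| := by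
    rw [h3]
    refine (Finset.abs_sum_le_sum_abs _ _).trans (Finset.sum_le_sum fun i _ => ?_)
    rw [Int.abs_eq_natAbs, Int.abs_eq_natAbs, natAbs_signed]
  rw [← Finset.add_sum_erase _ _ (Finset.mem_univ (evenPos a)),
      ← Finset.add_sum_erase _ _ (Finset.mem_erase.mpr ⟨hne.symm, Finset.mem_univ (oddPos a)⟩)]
        at h2
  have h5 := abs_pos.mpr hj
  have h6 := abs_nonneg (q (p (oddPos a)) j)
  linarith

variable [Fintype ι]

/-- All the alternating sums of tuples with less than `K` pairs. -/
def nets (q : ι → Fin N → ℤ) (K : ℕ) : Finset (Fin N → ℤ) :=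
  (Finset.range K).biUnion fun l =>
    (Finset.univ : Finset (Fin (2 * l + 1) → ι)).image fun p => net q p

theorem net_mem_nets (q : ι → Fin N → ℤ) {K l : ℕ} (hl : l < K) (p : Fin (2 * l + 1) → ι) :
    net q p ∈ nets q K :=
  Finset.mem_biUnion.mpr ⟨l, Finset.mem_range.mpr hl, Finset.mem_image_of_mem _ (Finset.mem_univ p)⟩

theorem sum_of_mem_nets {q : ι → Fin N → ℤ} (hq : ∀ i, ∑ j, q i j = 1) {K : ℕ} {m : Fin N → ℤ}
    (hm : m ∈ nets q K) : ∑ j, m j = 1 := by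
  obtain ⟨l, -, h⟩ := Finset.mem_biUnion.mp hm
  obtain ⟨p, -, rfl⟩ := Finset.mem_image.mp h
  exact sum_net q hq p

theorem mem_nets_self (q : ι → Fin N → ℤ) {K : ℕ} (hK : 0 < K) (i : ι) : q i ∈ nets q K := by
  have h := net_mem_nets q (K := K) (l := 0) hK (fun _ => i)
  have h2 : net q (l := 0) (fun _ => i) = q i := by
    funext j
    simp [net, signed]
  rwa [h2] at h

variable [DecidableEq ι]

instance {l : ℕ} (p : Fin (2 * l + 1) → ι) : Decidable (Reduced p) := by
  unfold Reduced
  infer_instance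

/-- The off-diagonal part `∑_{i ≠ i'} ζ_i conj(ζ_i') c_i c_i'` of `|∑_i ζ_i c_i|²`. -/
def offDiag (ζ : ι → ℂ) (c : ι → ℂ) : ℂ :=
  ∑ a : ι × ι, if a.1 = a.2 then 0 else ζ a.1 * conj (ζ a.2) * (c a.1 * c a.2)

theorem offDiag_pow_mul (q : ι → Fin N → ℤ) (z : Fin N → ℂ) (c : ι → ℂ) (l : ℕ) :
    offDiag (fun i => zPow z (q i)) c ^ l * ∑ i, zPow z (q i) * c i =
      ∑ p : Fin (2 * l + 1) → ι with Reduced p,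
        zPow z (net q p) * ((∏ j, absSq z j ^ exc q p j : ℝ) : ℂ) * ∏ i, c (p i) := by
  rw [offDiag, Fintype.sum_pow, Finset.sum_mul_sum, ← Fintype.sum_prod_type',
    ← (pairEquiv ι l).symm.sum_comp, Finset.sum_filter]
  refine Finset.sum_congr rfl fun p _ => ?_
  rw [pairEquiv_symm_apply]
  split_ifs with hp
  · rw [net, exc, ← prod_zPow, ← Finset.prod_mul_distrib, prod_odd, signed_last]
    congr 1
    refine Finset.prod_congr rfl fun a _ => ?_
    rw [if_neg (hp a), signed_even, signed_odd, ← conj_zPow]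
    ring
  · simp only [Reduced, not_forall, not_not] at hp
    obtain ⟨a, ha⟩ := hp
    refine mul_eq_zero_of_left (Finset.prod_eq_zero (i := a) (Finset.mem_univ _) ?_) _
    exact if_pos ha

/-- The coefficient of `z^m` in `offDiag ^ l * ∑ ζ_i v_i`, as a polynomial in `x = |z|²` and `v`. -/
def tupleSum {A : Type*} [CommRing A] [Algebra ℝ A] (q : ι → Fin N → ℤ) (l : ℕ) (m : Fin N → ℤ)
    (x : Fin N → ℝ) (v : ι → A) : A :=
  ∑ p : Fin (2 * l + 1) → ι with Reduced p ∧ net q p = m,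
    (∏ j, x j ^ exc q p j) • ∏ i, v (p i)

theorem offDiag_pow_mul_eq_sum (q : ι → Fin N → ℤ) (z : Fin N → ℂ) (c : ι → ℝ) {K l : ℕ}
    (hl : l < K) :
    offDiag (fun i => zPow z (q i)) (fun i => (c i : ℂ)) ^ l * ∑ i, zPow z (q i) * (c i : ℂ) =
      ∑ m ∈ nets q K, zPow z m * ((tupleSum q l m (absSq z) c : ℝ) : ℂ) := by
  rw [offDiag_pow_mul, ← Finset.sum_fiberwise_of_maps_to (t := nets q K) (g := fun p => net q p)
    fun p _ => net_mem_nets q hl p]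
  refine Finset.sum_congr rfl fun m _ => ?_
  rw [Finset.filter_filter, tupleSum, Complex.ofReal_sum, Finset.mul_sum]
  refine Finset.sum_congr rfl fun p hp => ?_
  rw [(Finset.mem_filter.mp hp).2.2, smul_eq_mul]
  push_cast
  ring

/-- At `x = 0` only the tuples without cancellation contribute. -/
theorem tupleSum_zero {A : Type*} [CommRing A] [Algebra ℝ A] {q : ι → Fin N → ℤ}
    (hq : ∀ i, ∑ j, q i j = 1) (l : ℕ) (m : Fin N → ℤ) (v : ι → A) :
    tupleSum q l m 0 v = ∑ p : Fin (2 * l + 1) → ι with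
      (net q p = m ∧ ∀ j, ∑ i, |q (p i) j| = |m j|), ∏ i, v (p i) := by
  have h1 : ∀ p : Fin (2 * l + 1) → ι,
      (∏ j, (0 : Fin N → ℝ) j ^ exc q p j) = if ∀ j, exc q p j = 0 then 1 else 0 := by
    intro p
    split_ifs with h
    · exact Finset.prod_eq_one fun j _ => by rw [h j, pow_zero]
    · push Not at h
      obtain ⟨j, hj⟩ := h
      exact Finset.prod_eq_zero (Finset.mem_univ j) (by rw [Pi.zero_apply, zero_pow hj])
  rw [tupleSum, Finset.sum_filter, Finset.sum_filter]
  refine Finset.sum_congr rfl fun p _ => ?_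
  rw [h1 p]
  by_cases hm : net q p = m
  · subst hm
    have hiff := exc_eq_zero_iff q p
    by_cases he : ∀ j, exc q p j = 0
    · rw [if_pos ⟨reduced_of_exc_eq_zero hq he, rfl⟩, if_pos he, if_pos ⟨rfl, hiff.mp he⟩, one_smul]
    · rw [if_neg he, zero_smul, ite_self, if_neg fun h => he (hiff.mpr h.2)]
  · rw [if_neg fun h => hm h.2, if_neg fun h => hm h.1]

end

/-! ### The expansion of the nonlinearity -/

section

open scoped Topology ComplexConjugate

variable {N k : ℕ} {ι : Type*} [Fintype ι]

/-- The diagonal part of `|u|²`, for `u = w ∑_i z^{q_i} v_i` and `w2 = w²`, as a function of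
`x = |z|²`. -/
def diagPart (w2 : Ck k) (q : ι → Fin N → ℤ) (x : Fin N → ℝ) (v : ι → Ck k) : Ck k :=
  w2 * ∑ i, (∏ j, x j ^ absVec (q i) j) • (v i * v i)

/-- The sum `∑_i ρ(z^{q_i}) v_i`; with `ρ` the real or the imaginary part these are the real and the
imaginary part of `∑_i z^{q_i} v_i`. -/
def wave (ρ : ℂ →L[ℝ] ℝ) (q : ι → Fin N → ℤ) (z : Fin N → ℂ) (v : ι → Ck k) : Ck k :=
  ∑ i, ρ (zPow z (q i)) • v i

/-- The function `|u|²` for `u = w ∑_i z^{q_i} v_i`, `w2 = w²`. -/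
def modSq (w2 : Ck k) (q : ι → Fin N → ℤ) (z : Fin N → ℂ) (v : ι → Ck k) : Ck k :=
  w2 * (wave Complex.reCLM q z v * wave Complex.reCLM q z v +
    wave Complex.imCLM q z v * wave Complex.imCLM q z v)

theorem ev_wave (ρ : ℂ →L[ℝ] ℝ) (q : ι → Fin N → ℤ) (z : Fin N → ℂ) (v : ι → Ck k) (y : R3) :
    Ck.ev (wave ρ q z v) y = ρ (∑ i, zPow z (q i) * (Ck.ev (v i) y : ℂ)) := by
  rw [wave, Ck.ev_sum_apply, map_sum]
  refine Finset.sum_congr rfl fun i _ => ?_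
  rw [Ck.ev_smul_apply, mul_comm (zPow z (q i)), ← Complex.real_smul, map_smul, smul_eq_mul,
    mul_comm]

variable [DecidableEq ι]

/-- The off-diagonal part of `|u|²`, for `u = w ∑_i z^{q_i} v_i` and `w2 = w²`. -/
def offPart (w2 : Ck k) (q : ι → Fin N → ℤ) (z : Fin N → ℂ) (v : ι → Ck k) : Ck k :=
  w2 * ∑ a : ι × ι, if a.1 = a.2 then 0 else
    (zPow z (q a.1) * conj (zPow z (q a.2))).re • (v a.1 * v a.2)

theorem modSq_eq (w2 : Ck k) (q : ι → Fin N → ℤ) (z : Fin N → ℂ) (v : ι → Ck k) :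
    modSq w2 q z v = diagPart w2 q (absSq z) v + offPart w2 q z v := by
  have h1 : wave Complex.reCLM q z v * wave Complex.reCLM q z v +
      wave Complex.imCLM q z v * wave Complex.imCLM q z v =
      ∑ a : ι × ι, (zPow z (q a.1) * conj (zPow z (q a.2))).re • (v a.1 * v a.2) := by
    rw [wave, wave, Finset.sum_mul_sum, Finset.sum_mul_sum, ← Fintype.sum_prod_type',
      ← Fintype.sum_prod_type', ← Finset.sum_add_distrib]
    refine Finset.sum_congr rfl fun a _ => ?_
    rw [smul_mul_smul_comm, smul_mul_smul_comm, ← add_smul]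
    congr 1
    simp
  have h2 : ∑ i, (∏ j, absSq z j ^ absVec (q i) j) • (v i * v i) =
      ∑ a : ι × ι, if a.1 = a.2 then
        (zPow z (q a.1) * conj (zPow z (q a.2))).re • (v a.1 * v a.2) else 0 := by
    rw [Fintype.sum_prod_type]
    refine Finset.sum_congr rfl fun i _ => ?_
    rw [Finset.sum_ite_eq, if_pos (Finset.mem_univ i), ← norm_zPow_sq, Complex.mul_conj,
      Complex.normSq_eq_norm_sq, Complex.ofReal_re]
  rw [modSq, diagPart, offPart, h1, h2, ← mul_add, ← Finset.sum_add_distrib]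
  congr 1
  refine Finset.sum_congr rfl fun a _ => ?_
  split_ifs <;> simp

theorem offDiag_eq_re (ζ : ι → ℂ) (c : ι → ℝ) : offDiag ζ (fun i => (c i : ℂ)) =
    ((∑ a : ι × ι, if a.1 = a.2 then 0 else (ζ a.1 * conj (ζ a.2)).re * (c a.1 * c a.2) : ℝ) : ℂ) := by
  have h1 : conj (offDiag ζ (fun i => (c i : ℂ))) = offDiag ζ (fun i => (c i : ℂ)) := by
    rw [offDiag, map_sum, ← (Equiv.prodComm ι ι).sum_comp]
    refine Finset.sum_congr rfl fun a _ => ?_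
    simp only [Equiv.prodComm_apply, Prod.fst_swap, Prod.snd_swap, eq_comm (a := a.2)]
    split_ifs
    · rw [map_zero]
    · simp only [map_mul, Complex.conj_conj, Complex.conj_ofReal]
      ring
  rw [← Complex.conj_eq_iff_re.mp h1]
  congr 1
  rw [offDiag, Complex.re_sum]
  refine Finset.sum_congr rfl fun a _ => ?_
  split_ifs
  · rfl
  · rw [← Complex.ofReal_mul, Complex.re_mul_ofReal]

theorem ev_offPart (w2 : Ck k) (q : ι → Fin N → ℤ) (z : Fin N → ℂ) (v : ι → Ck k) (y : R3) :
    (Ck.ev (offPart w2 q z v) y : ℂ) =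
      (Ck.ev w2 y : ℂ) * offDiag (fun i => zPow z (q i)) (fun i => (Ck.ev (v i) y : ℂ)) := by
  rw [offDiag_eq_re, ← Complex.ofReal_mul, offPart, Ck.ev_mul_apply, Ck.ev_sum_apply]
  congr 2
  refine Finset.sum_congr rfl fun a _ => ?_
  split_ifs
  · exact Ck.ev_zero_apply y
  · rw [Ck.ev_smul_apply, Ck.ev_mul_apply]

theorem ev_tupleSum (q : ι → Fin N → ℤ) (l : ℕ) (m : Fin N → ℤ) (x : Fin N → ℝ) (v : ι → Ck k)
    (y : R3) : Ck.ev (tupleSum q l m x v) y = tupleSum q l m x fun i => Ck.ev (v i) y := by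
  rw [tupleSum, tupleSum, Ck.ev_sum_apply]
  refine Finset.sum_congr rfl fun p _ => ?_
  rw [Ck.ev_smul_apply, Ck.ev_prod_apply, smul_eq_mul]

variable {g : ℝ → ℝ}

/-- The coefficient of `z^m` in the expansion of `g(|u|²) u / w`, as a function of `x = |z|²` and of
the profiles. -/
def nlCoef (hg : ContDiff ℝ (⊤ : ℕ∞) g) (w2 : Ck k) (q : ι → Fin N → ℤ) (K : ℕ) (m : Fin N → ℤ)
    (x : Fin N → ℝ) (v : ι → Ck k) : Ck k :=
  ∑ l ∈ Finset.range K, ((l.factorial : ℝ)⁻¹) •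
    (Ck.nem (contDiff_iteratedDeriv_top hg l) (diagPart w2 q x v) * (w2 ^ l * tupleSum q l m x v))

theorem contDiff_nlCoef (hg : ContDiff ℝ (⊤ : ℕ∞) g) (w2 : Ck k) (q : ι → Fin N → ℤ) (K : ℕ)
    (m : Fin N → ℤ) : ContDiff ℝ (⊤ : ℕ∞)
      fun p : (Fin N → ℝ) × (ι → Ck k) => nlCoef hg w2 q K m p.1 p.2 := by
  have hx : ∀ j, ContDiff ℝ (⊤ : ℕ∞) fun p : (Fin N → ℝ) × (ι → Ck k) => p.1 j := fun j =>
    (contDiff_apply ℝ ℝ j).comp contDiff_fst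
  have hv : ∀ i, ContDiff ℝ (⊤ : ℕ∞) fun p : (Fin N → ℝ) × (ι → Ck k) => p.2 i := fun i =>
    (contDiff_apply ℝ (Ck k) i).comp contDiff_snd
  have hD : ContDiff ℝ (⊤ : ℕ∞) fun p : (Fin N → ℝ) × (ι → Ck k) => diagPart w2 q p.1 p.2 :=
    contDiff_const.mul (ContDiff.sum fun i _ =>
      (contDiff_prod fun j _ => (hx j).pow _).smul ((hv i).mul (hv i)))
  have hT : ∀ l, ContDiff ℝ (⊤ : ℕ∞)
      fun p : (Fin N → ℝ) × (ι → Ck k) => tupleSum q l m p.1 p.2 := fun l =>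
    ContDiff.sum fun t _ => (contDiff_prod fun j _ => (hx j).pow _).smul
      (contDiff_prod fun i _ => hv (t i))
  exact ContDiff.sum fun l _ => ContDiff.const_smul _
    (((Ck.contDiff_nem (contDiff_iteratedDeriv_top hg l)).comp hD).mul (contDiff_const.mul (hT l)))

theorem nlCoef_of_notMem (hg : ContDiff ℝ (⊤ : ℕ∞) g) (w2 : Ck k) {q : ι → Fin N → ℤ} {K : ℕ}
    {m : Fin N → ℤ} (hm : m ∉ nets q K) (x : Fin N → ℝ) (v : ι → Ck k) :
    nlCoef hg w2 q K m x v = 0 := by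
  refine Finset.sum_eq_zero fun l hl => ?_
  have h1 : tupleSum q l m x v = 0 := by
    rw [tupleSum, Finset.filter_eq_empty_iff.mpr, Finset.sum_empty]
    rintro p - ⟨-, rfl⟩
    exact hm (net_mem_nets q (Finset.mem_range.mp hl) p)
  rw [h1, mul_zero, mul_zero, smul_zero]

/-- The Taylor polynomial of `g` times `u`, sorted by monomials `z^m`. The identity is first proved
for complex values at a point, where `ρ` has not yet been applied. -/
theorem taylorPoly_mul_wave (hg : ContDiff ℝ (⊤ : ℕ∞) g) (w2 : Ck k) (q : ι → Fin N → ℤ) (K : ℕ)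
    (ρ : ℂ →L[ℝ] ℝ) (z : Fin N → ℂ) (v : ι → Ck k) :
    Ck.taylorPoly hg K (diagPart w2 q (absSq z) v) (offPart w2 q z v) * wave ρ q z v =
      ∑ m ∈ nets q K, ρ (zPow z m) • nlCoef hg w2 q K m (absSq z) v := by
  refine Ck.ext_ev fun y => ?_
  set D := diagPart w2 q (absSq z) v with hD
  set U : ℂ := ∑ i, zPow z (q i) * (Ck.ev (v i) y : ℂ) with hU
  have key : (Ck.ev (Ck.taylorPoly hg K D (offPart w2 q z v)) y : ℂ) * U =
      ∑ m ∈ nets q K, zPow z m * (Ck.ev (nlCoef hg w2 q K m (absSq z) v) y : ℂ) := by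
    simp only [Ck.taylorPoly, nlCoef, Ck.ev_sum_apply, Ck.ev_smul_apply, Ck.ev_mul_apply,
      Ck.ev_pow_apply, Complex.ofReal_sum, Complex.ofReal_mul, Complex.ofReal_pow, ev_offPart,
      ev_tupleSum, Finset.sum_mul, Finset.mul_sum]
    rw [Finset.sum_comm]
    refine Finset.sum_congr rfl fun l hl => ?_
    rw [mul_pow, mul_assoc, mul_assoc, mul_assoc, hU,
      offDiag_pow_mul_eq_sum q z _ (Finset.mem_range.mp hl), Finset.mul_sum, Finset.mul_sum,
      Finset.mul_sum]
    refine Finset.sum_congr rfl fun m _ => ?_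
    ring
  have hρ : ∀ (c : ℂ) (r : ℝ), ρ (c * (r : ℂ)) = ρ c * r := fun c r => by
    rw [mul_comm, ← Complex.real_smul, map_smul, smul_eq_mul, mul_comm]
  have h2 := congrArg ρ key
  rw [mul_comm, hρ] at h2
  rw [Ck.ev_mul_apply, ev_wave, mul_comm, h2, Ck.ev_sum_apply, map_sum]
  exact Finset.sum_congr rfl fun m _ => by rw [hρ, Ck.ev_smul_apply]

end

/-! ### The equations for the profiles -/

section

open scoped Topology ComplexConjugate

variable {N k : ℕ} {ι : Type*}

theorem idxNorm_pos_of_sum {m : Fin N → ℤ} (h : ∑ j, m j = 1) : 0 < idxNorm m := by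
  rw [Nat.pos_iff_ne_zero]
  intro h0
  have hz : ∀ j, m j = 0 := by simpa [idxNorm] using h0
  simp [hz] at h

theorem sum_idxNorm_eq {q : ι → Fin N → ℤ} {l : ℕ} {p : Fin (2 * l + 1) → ι} {m : Fin N → ℤ}
    (hp : ∀ j, ∑ i, |q (p i) j| = |m j|) : ∑ i, idxNorm (q (p i)) = idxNorm m := by
  unfold idxNorm
  rw [Finset.sum_comm]
  refine Finset.sum_congr rfl fun j _ => ?_
  have := hp j
  zify
  exact this

theorem idxNorm_lt_of_sum_abs {q : ι → Fin N → ℤ} (hq : ∀ i, ∑ j, q i j = 1) {l : ℕ} (hl : l ≠ 0)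
    {p : Fin (2 * l + 1) → ι} {m : Fin N → ℤ} (hp : ∀ j, ∑ i, |q (p i) j| = |m j|)
    (i : Fin (2 * l + 1)) : idxNorm (q (p i)) < idxNorm m := by
  rw [← sum_idxNorm_eq hp]
  have : Nontrivial (Fin (2 * l + 1)) := Fin.nontrivial_iff_two_le.mpr (by omega)
  obtain ⟨i', hi'⟩ := exists_ne i
  exact Finset.single_lt_sum (f := fun i => idxNorm (q (p i))) hi' (Finset.mem_univ _)
    (Finset.mem_univ _) (idxNorm_pos_of_sum (hq _)) fun _ _ _ => Nat.zero_le _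

theorem lt_idxNorm_of_sum_abs {q : ι → Fin N → ℤ} (hq : ∀ i, ∑ j, q i j = 1) {l : ℕ}
    {p : Fin (2 * l + 1) → ι} {m : Fin N → ℤ} (hp : ∀ j, ∑ i, |q (p i) j| = |m j|) :
    l < idxNorm m := by
  have h1 : ∑ i : Fin (2 * l + 1), 1 ≤ ∑ i, idxNorm (q (p i)) :=
    Finset.sum_le_sum fun i _ => idxNorm_pos_of_sum (hq _)
  rw [sum_idxNorm_eq hp, Finset.sum_const, Finset.card_univ, Fintype.card_fin, smul_eq_mul,
    mul_one] at h1
  omega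

theorem idxNorm_unitIdx (j : Fin N) : idxNorm (unitIdx j) = 1 := by
  rw [idxNorm, Finset.sum_eq_single j]
  · simp [unitIdx]
  · intro l _ hl
    simp [unitIdx, hl]
  · simp

variable [Fintype ι]

theorem diagPart_zero (w2 : Ck k) {q : ι → Fin N → ℤ} (hq : ∀ i, ∑ j, q i j = 1)
    (v : ι → Ck k) : diagPart w2 q 0 v = 0 := by
  rw [diagPart, Finset.sum_eq_zero, mul_zero]
  intro i _
  obtain ⟨j, hj⟩ : ∃ j, q i j ≠ 0 := by
    by_contra hc
    push Not at hc
    have := hq i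
    simp [hc] at this
  rw [Finset.prod_eq_zero (Finset.mem_univ j), zero_smul]
  rw [Pi.zero_apply, zero_pow]
  simpa [absVec] using hj

variable [DecidableEq ι] {g : ℝ → ℝ}

/-- The coefficients at `x = 0`; the sum is over the tuples with `∑_i |q_{p_i}| = |m|`. -/
theorem nlCoef_zero (hg : ContDiff ℝ (⊤ : ℕ∞) g) (w2 : Ck k) {q : ι → Fin N → ℤ}
    (hq : ∀ i, ∑ j, q i j = 1) (K : ℕ) (m : Fin N → ℤ) (v : ι → Ck k) :
    nlCoef hg w2 q K m 0 v = ∑ l ∈ Finset.range K, (iteratedDeriv l g 0 / l.factorial) •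
      (w2 ^ l * ∑ p : Fin (2 * l + 1) → ι with
        (net q p = m ∧ ∀ j, ∑ i, |q (p i) j| = |m j|), ∏ i, v (p i)) := by
  refine Finset.sum_congr rfl fun l _ => ?_
  rw [diagPart_zero w2 hq, tupleSum_zero hq]
  refine Ck.ext_ev fun y => ?_
  rw [Ck.ev_smul_apply, Ck.ev_smul_apply, Ck.ev_mul_apply _ (w2 ^ l * _), Ck.ev_nem_apply,
    Ck.ev_zero_apply]
  ring

theorem nlCoef_zero_congr (hg : ContDiff ℝ (⊤ : ℕ∞) g) (hg0 : g 0 = 0) (w2 : Ck k)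
    {q : ι → Fin N → ℤ} (hq : ∀ i, ∑ j, q i j = 1) (K : ℕ) (m : Fin N → ℤ) {v v' : ι → Ck k}
    (h : ∀ i, idxNorm (q i) < idxNorm m → v i = v' i) :
    nlCoef hg w2 q K m 0 v = nlCoef hg w2 q K m 0 v' := by
  rw [nlCoef_zero hg w2 hq, nlCoef_zero hg w2 hq]
  refine Finset.sum_congr rfl fun l _ => ?_
  by_cases hl : l = 0
  · subst hl
    rw [iteratedDeriv_zero, hg0, zero_div, zero_smul, zero_smul]
  · congr 2
    refine Finset.sum_congr rfl fun p hp => Finset.prod_congr rfl fun i _ => h _ ?_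
    exact idxNorm_lt_of_sum_abs hq hl (Finset.mem_filter.mp hp).2.2 i

theorem nlCoef_zero_unitIdx (hg : ContDiff ℝ (⊤ : ℕ∞) g) (hg0 : g 0 = 0) (w2 : Ck k)
    {q : ι → Fin N → ℤ} (hq : ∀ i, ∑ j, q i j = 1) (K : ℕ) (j : Fin N) (v : ι → Ck k) :
    nlCoef hg w2 q K (unitIdx j) 0 v = 0 := by
  rw [nlCoef_zero_congr hg hg0 w2 hq K (unitIdx j) (v' := 0), nlCoef_zero hg w2 hq]
  · refine Finset.sum_eq_zero fun l _ => ?_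
    rw [Finset.sum_eq_zero, mul_zero, smul_zero]
    intro p _
    exact Finset.prod_eq_zero (Finset.mem_univ (Fin.last _)) rfl
  · intro i hi
    rw [idxNorm_unitIdx] at hi
    have := idxNorm_pos_of_sum (hq i)
    omega

/-- The coefficients do not depend on the regularity of the spaces in which they are taken. -/
theorem ev_nlCoef_congr (hg : ContDiff ℝ (⊤ : ℕ∞) g) {k' : ℕ} {w2 : Ck k} {w2' : Ck k'}
    (q : ι → Fin N → ℤ) (K : ℕ) (m : Fin N → ℤ) (x : Fin N → ℝ) {v : ι → Ck k} {v' : ι → Ck k'}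
    (hw : ∀ y, Ck.ev w2 y = Ck.ev w2' y) (hv : ∀ i y, Ck.ev (v i) y = Ck.ev (v' i) y) (y : R3) :
    Ck.ev (nlCoef hg w2 q K m x v) y = Ck.ev (nlCoef hg w2' q K m x v') y := by
  have hD : Ck.ev (diagPart w2 q x v) y = Ck.ev (diagPart w2' q x v') y := by
    simp only [diagPart, Ck.ev_mul_apply, Ck.ev_sum_apply, Ck.ev_smul_apply, hw, hv]
  simp only [nlCoef, Ck.ev_sum_apply, Ck.ev_smul_apply, Ck.ev_mul_apply, Ck.ev_nem_apply,
    Ck.ev_pow_apply, ev_tupleSum, hD, hw, hv]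

/-- The map whose fixed points are the frequencies and profiles `(ϖ, ψ)`: `ϖ_j` is determined by the
component of the `e_j`-th equation along `φ_j`, and `ψ_i` by the reduced resolvent `S_i` of `H` at
`q_i · ω`. -/
def profileMap (hg : ContDiff ℝ (⊤ : ℕ∞) g) (w2 : Ck k) (q : ι → Fin N → ℤ) (K : ℕ)
    (ω : Fin N → ℝ) (ℓ : Fin N → Ck k →L[ℝ] ℝ) (S : ι → Ck k →L[ℝ] Ck k) (a : ι → Ck k)
    (p : (Fin N → ℝ) × ((Fin N → ℝ) × (ι → Ck k))) : (Fin N → ℝ) × (ι → Ck k) :=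
  (fun j => ω j + ℓ j (nlCoef hg w2 q K (unitIdx j) p.1 (a + p.2.2)),
   fun i => S i ((∑ j, (q i j : ℝ) * (p.2.1 j - ω j)) • (a i + p.2.2 i) -
    nlCoef hg w2 q K (q i) p.1 (a + p.2.2)))

section
variable (hg : ContDiff ℝ (⊤ : ℕ∞) g) (w2 : Ck k) (q : ι → Fin N → ℤ) (K : ℕ)
    (ω : Fin N → ℝ) (ℓ : Fin N → Ck k →L[ℝ] ℝ) (S : ι → Ck k →L[ℝ] Ck k) (a : ι → Ck k)

theorem contDiff_profileMap :
    ContDiff ℝ (⊤ : ℕ∞) (profileMap hg w2 q K ω ℓ S a) := by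
  have hv : ContDiff ℝ (⊤ : ℕ∞) fun p : (Fin N → ℝ) × ((Fin N → ℝ) × (ι → Ck k)) => a + p.2.2 :=
    contDiff_const.add (contDiff_snd.comp contDiff_snd)
  have hf : ∀ m, ContDiff ℝ (⊤ : ℕ∞) fun p : (Fin N → ℝ) × ((Fin N → ℝ) × (ι → Ck k)) =>
      nlCoef hg w2 q K m p.1 (a + p.2.2) := fun m => by
    have h1 : ContDiff ℝ (⊤ : ℕ∞)
        fun p : (Fin N → ℝ) × ((Fin N → ℝ) × (ι → Ck k)) => (p.1, a + p.2.2) :=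
      contDiff_fst.prodMk hv
    have h2 := contDiff_nlCoef hg w2 q K m
    generalize nlCoef hg w2 q K m = F at h2 ⊢
    exact ContDiff.comp (g := fun p : (Fin N → ℝ) × (ι → Ck k) => F p.1 p.2) h2 h1
  have hvi : ∀ i, ContDiff ℝ (⊤ : ℕ∞)
      fun p : (Fin N → ℝ) × ((Fin N → ℝ) × (ι → Ck k)) => a i + p.2.2 i := fun i =>
    (contDiff_apply ℝ (Ck k) i).comp hv
  have hc : ∀ i, ContDiff ℝ (⊤ : ℕ∞) fun p : (Fin N → ℝ) × ((Fin N → ℝ) × (ι → Ck k)) =>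
      ∑ j, (q i j : ℝ) * (p.2.1 j - ω j) := fun i => by
    have h1 : ContDiff ℝ (⊤ : ℕ∞) fun w : Fin N → ℝ => ∑ j, (q i j : ℝ) * (w j - ω j) := by
      fun_prop
    exact h1.comp (contDiff_fst.comp contDiff_snd)
  have h1 : ContDiff ℝ (⊤ : ℕ∞) fun p : (Fin N → ℝ) × ((Fin N → ℝ) × (ι → Ck k)) =>
      fun j => ω j + ℓ j (nlCoef hg w2 q K (unitIdx j) p.1 (a + p.2.2)) :=
    contDiff_pi.mpr fun j => contDiff_const.add ((ℓ j).contDiff.comp (hf _))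
  have h2 : ContDiff ℝ (⊤ : ℕ∞) fun p : (Fin N → ℝ) × ((Fin N → ℝ) × (ι → Ck k)) =>
      fun i => S i ((∑ j, (q i j : ℝ) * (p.2.1 j - ω j)) • (a i + p.2.2 i) -
        nlCoef hg w2 q K (q i) p.1 (a + p.2.2)) :=
    contDiff_pi.mpr fun i => (S i).contDiff.comp (((hc i).smul (hvi i)).sub (hf _))
  exact h1.prodMk h2

theorem profileMap_zero_fst (hg0 : g 0 = 0) (hq : ∀ i, ∑ j, q i j = 1)
    (y : (Fin N → ℝ) × (ι → Ck k)) : (profileMap hg w2 q K ω ℓ S a (0, y)).1 = ω := by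
  funext j
  change ω j + ℓ j (nlCoef hg w2 q K (unitIdx j) 0 (a + y.2)) = ω j
  rw [nlCoef_zero_unitIdx hg hg0 w2 hq, map_zero, add_zero]

theorem profileMap_zero_snd (y : (Fin N → ℝ) × (ι → Ck k)) (hy : y.1 = ω) (i : ι) :
    (profileMap hg w2 q K ω ℓ S a (0, y)).2 i = -S i (nlCoef hg w2 q K (q i) 0 (a + y.2)) := by
  change S i ((∑ j, (q i j : ℝ) * (y.1 j - ω j)) • (a i + y.2 i) -
    nlCoef hg w2 q K (q i) 0 (a + y.2)) = _
  simp [hy]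

/-- At `x = 0` the profile map has triangular structure, so that an iterate of it is constant. -/
theorem exists_iterate_profileMap (hg0 : g 0 = 0) (hq : ∀ i, ∑ j, q i j = 1) :
    ∃ (L : ℕ) (y₀ : (Fin N → ℝ) × (ι → Ck k)), ∀ y,
      (fun y => profileMap hg w2 q K ω ℓ S a (0, y))^[L] y = y₀ := by
  set T := fun y => profileMap hg w2 q K ω ℓ S a (0, y) with hT
  have hfst : ∀ n y, (T^[n + 1] y).1 = ω := fun n y => by
    rw [Function.iterate_succ_apply']
    exact profileMap_zero_fst hg w2 q K ω ℓ S a hg0 hq _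
  have key : ∀ n y y' i, idxNorm (q i) ≤ n → (T^[n + 1] y).2 i = (T^[n + 1] y').2 i := by
    intro n
    induction n with
    | zero =>
      intro y y' i hi
      have := idxNorm_pos_of_sum (hq i)
      omega
    | succ n ih =>
      intro y y' i hi
      rw [Function.iterate_succ_apply' T (n + 1), Function.iterate_succ_apply' T (n + 1), hT]
      simp only
      rw [profileMap_zero_snd _ _ _ _ _ _ _ _ _ (hfst n y),
        profileMap_zero_snd _ _ _ _ _ _ _ _ _ (hfst n y'), nlCoef_zero_congr hg hg0 w2 hq]
      intro i' hi'
      rw [Pi.add_apply, Pi.add_apply]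
      congr 1
      exact ih y y' i' (by omega)
  refine ⟨∑ i, idxNorm (q i) + 1, T^[∑ i, idxNorm (q i) + 1] 0, fun y => Prod.ext ?_ ?_⟩
  · rw [hfst, hfst]
  · funext i
    exact key _ y 0 i (Finset.single_le_sum (f := fun i => idxNorm (q i))
      (fun _ _ => Nat.zero_le _) (Finset.mem_univ i))

/-- The frequencies and profiles. -/
theorem exists_profiles (hg0 : g 0 = 0) (hq : ∀ i, ∑ j, q i j = 1) :
    ∃ (y : (Fin N → ℝ) → (Fin N → ℝ) × (ι → Ck k)), ∃ r > 0,
      ContDiffOn ℝ (⊤ : ℕ∞) y (Metric.ball 0 r) ∧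
      (∀ x ∈ Metric.ball (0 : Fin N → ℝ) r, profileMap hg w2 q K ω ℓ S a (x, y x) = y x) ∧
      (∀ y', profileMap hg w2 q K ω ℓ S a (0, y') = y' → y' = y 0) ∧
      ∀ᶠ p in 𝓝 ((0, y 0) : (Fin N → ℝ) × ((Fin N → ℝ) × (ι → Ck k))),
        profileMap hg w2 q K ω ℓ S a p = p.2 → p.2 = y p.1 := by
  obtain ⟨L, y₀, hL⟩ := exists_iterate_profileMap hg w2 q K ω ℓ S a hg0 hq
  obtain ⟨y, r, hr, h1, h2, h3, h4⟩ :=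
    exists_smooth_fixedPoint (contDiff_profileMap hg w2 q K ω ℓ S a) hL
  refine ⟨y, r, hr, h1, h3, fun y' hy' => ?_, by rw [h2]; exact h4⟩
  rw [h2, ← hL y']
  exact (Function.iterate_fixed hy' L).symm

end

theorem exists_res (k : ℕ) : ∃ ρ : Ck k →L[ℝ] Ck 0, ∀ a, Ck.ev (ρ a) = Ck.ev a := by
  induction k with
  | zero => exact ⟨ContinuousLinearMap.id ℝ _, fun _ => rfl⟩
  | succ k ih =>
    obtain ⟨ρ, hρ⟩ := ih
    exact ⟨ρ.comp (Ck.resL k), fun a => hρ _⟩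

/-- The profiles of different regularities coincide near zero: the profile map commutes with the
inclusion `ρ : C^k_b → C^0_b`, so that the image of a fixed point is a fixed point, and those are
unique. -/
theorem eventually_res_profiles (hg : ContDiff ℝ (⊤ : ℕ∞) g) {w2 : Ck k} {w2' : Ck 0}
    {q : ι → Fin N → ℤ} {K : ℕ} {ω : Fin N → ℝ} {ℓ : Fin N → Ck k →L[ℝ] ℝ}
    {ℓ' : Fin N → Ck 0 →L[ℝ] ℝ} {S : ι → Ck k →L[ℝ] Ck k} {S' : ι → Ck 0 →L[ℝ] Ck 0}
    {a : ι → Ck k} {a' : ι → Ck 0} {ρ : Ck k →L[ℝ] Ck 0} (hρ : ∀ b, Ck.ev (ρ b) = Ck.ev b)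
    (hw : ρ w2 = w2') (ha : ∀ i, ρ (a i) = a' i) (hℓ : ∀ j b, ℓ' j (ρ b) = ℓ j b)
    (hS : ∀ i b, S' i (ρ b) = ρ (S i b))
    {y : (Fin N → ℝ) → (Fin N → ℝ) × (ι → Ck k)} {y' : (Fin N → ℝ) → (Fin N → ℝ) × (ι → Ck 0)}
    {r : ℝ} (hr : 0 < r) (hy : ContinuousAt y 0)
    (h : ∀ x ∈ Metric.ball (0 : Fin N → ℝ) r, profileMap hg w2 q K ω ℓ S a (x, y x) = y x)
    (h0 : ∀ b, profileMap hg w2' q K ω ℓ' S' a' (0, b) = b → b = y' 0)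
    (h' : ∀ᶠ p in 𝓝 ((0, y' 0) : (Fin N → ℝ) × ((Fin N → ℝ) × (ι → Ck 0))),
        profileMap hg w2' q K ω ℓ' S' a' p = p.2 → p.2 = y' p.1) :
    ∀ᶠ x in 𝓝 (0 : Fin N → ℝ), (y x).1 = (y' x).1 ∧ ∀ i, ρ ((y x).2 i) = (y' x).2 i := by
  have hn : ∀ m x (v : ι → Ck k), ρ (nlCoef hg w2 q K m x v) =
      nlCoef hg w2' q K m x fun i => ρ (v i) := fun m x v => by
    refine Ck.ext_ev fun t => ?_
    rw [hρ]
    exact ev_nlCoef_congr hg q K m x (fun t => by rw [← hw, hρ]) (fun i t => by rw [hρ]) t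
  have hv : ∀ v : ι → Ck k, (fun i => ρ ((a + v) i)) = a' + fun i => ρ (v i) := fun v => by
    funext i
    rw [Pi.add_apply, map_add, ha, Pi.add_apply]
  have hfix : ∀ x ∈ Metric.ball (0 : Fin N → ℝ) r,
      profileMap hg w2' q K ω ℓ' S' a' (x, ((y x).1, fun i => ρ ((y x).2 i))) =
        ((y x).1, fun i => ρ ((y x).2 i)) := by
    intro x hx
    have h1 := h x hx
    conv_rhs => rw [← h1]
    unfold profileMap
    simp only
    rw [← hv]
    refine Prod.ext (funext fun j => ?_) (funext fun i => ?_)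
    · simp only
      rw [← hn, hℓ]
    · simp only
      rw [← hn, ← ha, ← map_add, ← map_smul, ← map_sub, hS]
  have hc : ContinuousAt (fun x => (x, ((y x).1, fun i => ρ ((y x).2 i)))) (0 : Fin N → ℝ) := by
    fun_prop
  have hy0 : ((y 0).1, fun i => ρ ((y 0).2 i)) = y' 0 := h0 _ (hfix 0 (Metric.mem_ball_self hr))
  rw [ContinuousAt, hy0] at hc
  filter_upwards [hc.eventually h', Metric.ball_mem_nhds 0 hr] with x hx1 hx2
  have h2 := hx1 (hfix x hx2)
  exact ⟨congrArg Prod.fst h2, fun i => congrFun (congrArg Prod.snd h2) i⟩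

end

/-! ### The remainder -/

section

open scoped Topology ComplexConjugate
open Asymptotics

section Monomials

variable {N : ℕ}

theorem contDiff_zPow (m : Fin N → ℤ) : ContDiff ℝ (⊤ : ℕ∞) fun z : Fin N → ℂ => zPow z m := by
  unfold zPow
  refine contDiff_prod fun j _ => ?_
  have h1 : ContDiff ℝ (⊤ : ℕ∞) fun z : Fin N → ℂ => z j := contDiff_apply ℝ ℂ j
  split_ifs
  · exact h1.pow _
  · exact (Complex.conjCLE.contDiff.comp h1).pow _

theorem contDiff_absSq : ContDiff ℝ (⊤ : ℕ∞) (absSq : (Fin N → ℂ) → Fin N → ℝ) :=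
  contDiff_pi.mpr fun j => (contDiff_apply ℝ ℂ j).norm_sq ℝ

theorem continuous_zNorm : Continuous (zNorm : (Fin N → ℂ) → ℝ) := by
  unfold zNorm
  fun_prop

theorem absSq_zero : absSq (0 : Fin N → ℂ) = 0 := by
  funext j
  simp [absSq]

theorem zNorm_zero : zNorm (0 : Fin N → ℂ) = 0 := by simp [zNorm]

theorem zPow_zero_eq_zero {m : Fin N → ℤ} (hm : ∑ j, m j = 1) : zPow (0 : Fin N → ℂ) m = 0 := by
  obtain ⟨j, hj⟩ : ∃ j, m j ≠ 0 := by
    by_contra hc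
    push Not at hc
    simp [hc] at hm
  rw [← norm_eq_zero, norm_zPow]
  refine Finset.prod_eq_zero (Finset.mem_univ j) ?_
  rw [Pi.zero_apply, norm_zero, zero_pow]
  simpa [absVec] using hj

theorem tendsto_absSq : Filter.Tendsto (absSq : (Fin N → ℂ) → Fin N → ℝ) (𝓝 0) (𝓝 0) := by
  have := (contDiff_absSq (N := N)).continuous.tendsto 0
  rwa [absSq_zero] at this

theorem eventually_zNorm_lt {r : ℝ} (hr : 0 < r) : ∀ᶠ z in 𝓝 (0 : Fin N → ℂ), zNorm z < r := by
  have := (continuous_zNorm (N := N)).tendsto 0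
  rw [zNorm_zero] at this
  exact this.eventually_lt_const hr

theorem isBigO_absSq : (absSq : (Fin N → ℂ) → Fin N → ℝ) =O[𝓝 0] fun z => zNorm z ^ 2 := by
  refine IsBigO.of_bound 1 (Filter.Eventually.of_forall fun z => ?_)
  rw [one_mul, Real.norm_eq_abs, abs_of_nonneg (sq_nonneg _),
    pi_norm_le_iff_of_nonneg (sq_nonneg _)]
  intro j
  exact (Finset.single_le_sum (f := fun j => |absSq z j|) (fun _ _ => abs_nonneg _)
    (Finset.mem_univ j)).trans (sum_abs_absSq_le z)

theorem isBigO_zNorm_sq_mul_zPow {ω : Fin N → ℝ} {r : Fin N → ℤ} (hr : r ∈ ResMin ω) :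
    (fun z : Fin N → ℂ => zNorm z ^ 2 * ‖zPow z r‖) =O[𝓝 0] resBound ω := by
  refine IsBigO.of_bound 1 (Filter.Eventually.of_forall fun z => ?_)
  rw [one_mul, Real.norm_of_nonneg (by positivity), Real.norm_of_nonneg (resBound_nonneg _ _)]
  exact le_resBound hr z

theorem isBigO_zPow_of_notMem {ω : Fin N → ℝ}
    (hind : ∀ m : Fin N → ℤ, m ≠ 0 → ∑ j, (m j : ℝ) * ω j ≠ 0) {m : Fin N → ℤ}
    (hsum : ∑ j, m j = 1) (hm : m ∉ NonRes1 ω) (hm' : m ∉ ResMin ω) :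
    (fun z : Fin N → ℂ => zPow z m) =O[𝓝 0] resBound ω := by
  obtain ⟨r, hr, hlt⟩ := exists_resMin_of_notMem hind hsum hm hm'
  refine IsBigO.trans (IsBigO.of_bound 1 ?_) (isBigO_zNorm_sq_mul_zPow hr)
  filter_upwards [eventually_zNorm_lt one_pos] with z hz
  rw [one_mul, Real.norm_of_nonneg (by positivity)]
  refine norm_zPow_le_of_lt hz.le ?_ hlt
  rw [hsum]
  exact hr.1.1

end Monomials

variable {N k : ℕ} {ι : Type*} [Fintype ι] [DecidableEq ι] {g : ℝ → ℝ}

/-- The size of the off-diagonal part. -/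
def offSize (q : ι → Fin N → ℤ) (z : Fin N → ℂ) : ℝ :=
  ∑ a : ι × ι, if a.1 = a.2 then 0 else ‖zPow z (q a.1)‖ * ‖zPow z (q a.2)‖

theorem offSize_nonneg (q : ι → Fin N → ℤ) (z : Fin N → ℂ) : 0 ≤ offSize q z :=
  Finset.sum_nonneg fun a _ => by split_ifs <;> positivity

theorem tendsto_offSize {q : ι → Fin N → ℤ} (hq : ∀ i, ∑ j, q i j = 1) :
    Filter.Tendsto (offSize q) (𝓝 0) (𝓝 0) := by
  have h1 : Continuous (offSize q) := by
    refine continuous_finsetSum _ fun a _ => ?_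
    split_ifs
    · exact continuous_const
    · exact (contDiff_zPow _).continuous.norm.mul (contDiff_zPow _).continuous.norm
  have h2 := h1.tendsto 0
  have h3 : offSize q 0 = 0 := by
    refine Finset.sum_eq_zero fun a _ => ?_
    rw [zPow_zero_eq_zero (hq a.1), norm_zero, zero_mul, ite_self]
  rwa [h3] at h2

/-- Two different non-resonant indices involve two different modes, so a high power of the
off-diagonal part is controlled by the minimal resonant monomials. -/
theorem exists_isBigO_offSize_pow {ω : Fin N → ℝ} (hω : Function.Injective ω) {q : ι → Fin N → ℤ}
    (hq : ∀ i, ∑ j, q i j = 1) (hinj : Function.Injective q) : ∃ P : ℕ, ∀ K, P < K →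
      (fun z => offSize q z ^ K) =O[𝓝 0] resBound ω := by
  obtain ⟨P, hP⟩ := pow_le_resBound hω
  refine ⟨P, fun K hK => IsBigO.of_bound ((Fintype.card (ι × ι) : ℝ) ^ K) ?_⟩
  filter_upwards [eventually_zNorm_lt one_pos] with z hz
  have hr := resBound_nonneg ω z
  have hK0 : K ≠ 0 := by omega
  rw [Real.norm_of_nonneg (pow_nonneg (offSize_nonneg q z) K), Real.norm_of_nonneg hr]
  have h1 : ∀ a : ι × ι, (if a.1 = a.2 then 0 else ‖zPow z (q a.1)‖ * ‖zPow z (q a.2)‖) ≤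
      resBound ω z ^ ((K : ℝ)⁻¹) := by
    intro a
    split_ifs with ha
    · exact Real.rpow_nonneg hr _
    · obtain ⟨i, j, hij, h⟩ := exists_pair_of_ne (hq a.1) (hq a.2) (fun h => ha (hinj h))
      obtain ⟨K', rfl⟩ : ∃ K', K = K' + 1 := ⟨K - 1, by omega⟩
      have h2 : (‖zPow z (q a.1)‖ * ‖zPow z (q a.2)‖) ^ (K' + 1) ≤ resBound ω z :=
        (pow_le_pow_left₀ (by positivity) (h z hz.le) _).trans (hP i j hij z hz.le K' (by omega))
      rw [← Real.pow_rpow_inv_natCast (x := ‖zPow z (q a.1)‖ * ‖zPow z (q a.2)‖)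
        (by positivity) hK0]
      exact Real.rpow_le_rpow (by positivity) h2 (by positivity)
  have h2 : offSize q z ≤ Fintype.card (ι × ι) * resBound ω z ^ ((K : ℝ)⁻¹) := by
    refine (Finset.sum_le_sum fun a _ => h1 a).trans ?_
    rw [Finset.sum_const, Finset.card_univ, nsmul_eq_mul]
  refine (pow_le_pow_left₀ (offSize_nonneg q z) h2 K).trans ?_
  rw [mul_pow, Real.rpow_inv_natCast_pow hr hK0]

/-- The remainder (real part for `ρ = re`, imaginary part for `ρ = im`, and divided by the weight):
the nonlinearity without the terms `z^{q_i}`, and without the value at `x = 0` of the coefficients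
of the minimal resonant monomials. -/
def remPart (hg : ContDiff ℝ (⊤ : ℕ∞) g) (w2 : Ck k) (q : ι → Fin N → ℤ) (K : ℕ) (ω : Fin N → ℝ)
    (v : (Fin N → ℝ) → ι → Ck k) (ρ : ℂ →L[ℝ] ℝ) (z : Fin N → ℂ) : Ck k :=
  Ck.nem hg (modSq w2 q z (v (absSq z))) * wave ρ q z (v (absSq z)) -
    ∑ i, ρ (zPow z (q i)) • nlCoef hg w2 q K (q i) (absSq z) (v (absSq z)) -
    ∑ m ∈ (resMin_finite ω).toFinset, ρ (zPow z m) • nlCoef hg w2 q K m 0 (v 0)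

section
variable (hg : ContDiff ℝ (⊤ : ℕ∞) g) (w2 : Ck k) {q : ι → Fin N → ℤ} {K : ℕ} {ω : Fin N → ℝ}
    {v : (Fin N → ℝ) → ι → Ck k} (ρ : ℂ →L[ℝ] ℝ)

theorem contDiffOn_remPart {δ : ℝ} (hv : ContDiffOn ℝ (⊤ : ℕ∞) v (realBall N (δ ^ 2))) :
    ContDiffOn ℝ (⊤ : ℕ∞) (remPart hg w2 q K ω v ρ) (complexBall N δ) := by
  have hmaps : Set.MapsTo absSq (complexBall N δ) (realBall N (δ ^ 2)) := fun z hz => by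
    have h0 := zNorm_nonneg z
    have hz' : zNorm z < δ := hz
    exact (sum_abs_absSq_le z).trans_lt (by nlinarith)
  have hx : ContDiffOn ℝ (⊤ : ℕ∞) (absSq : (Fin N → ℂ) → Fin N → ℝ) (complexBall N δ) :=
    contDiff_absSq.contDiffOn
  have h1 : ContDiffOn ℝ (⊤ : ℕ∞) (fun z => v (absSq z)) (complexBall N δ) := hv.comp hx hmaps
  have hvi : ∀ i, ContDiffOn ℝ (⊤ : ℕ∞) (fun z => v (absSq z) i) (complexBall N δ) := fun i =>
    (contDiff_apply ℝ (Ck k) i).comp_contDiffOn h1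
  have hρ : ∀ (ρ : ℂ →L[ℝ] ℝ) m,
      ContDiffOn ℝ (⊤ : ℕ∞) (fun z => ρ (zPow z m)) (complexBall N δ) := fun ρ m =>
    (ρ.contDiff.comp (contDiff_zPow m)).contDiffOn
  have hw : ∀ ρ : ℂ →L[ℝ] ℝ,
      ContDiffOn ℝ (⊤ : ℕ∞) (fun z => wave ρ q z (v (absSq z))) (complexBall N δ) := fun ρ =>
    ContDiffOn.sum fun i _ => (hρ ρ _).smul (hvi i)
  have hm : ContDiffOn ℝ (⊤ : ℕ∞) (fun z => modSq w2 q z (v (absSq z))) (complexBall N δ) :=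
    contDiffOn_const.mul (((hw _).mul (hw _)).add ((hw _).mul (hw _)))
  have hf : ∀ m, ContDiffOn ℝ (⊤ : ℕ∞)
      (fun z => nlCoef hg w2 q K m (absSq z) (v (absSq z))) (complexBall N δ) := fun m => by
    have h2 := contDiff_nlCoef hg w2 q K m
    have h3 : ContDiffOn ℝ (⊤ : ℕ∞) (fun z => (absSq z, v (absSq z))) (complexBall N δ) :=
      hx.prodMk h1
    generalize nlCoef hg w2 q K m = F at h2 ⊢
    exact ContDiff.comp_contDiffOn (g := fun p : (Fin N → ℝ) × (ι → Ck k) => F p.1 p.2) h2 h3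
  have hn := (Ck.contDiff_nem (k := k) hg).comp_contDiffOn hm
  exact ((hn.mul (hw ρ)).sub (ContDiffOn.sum fun i _ => (hρ ρ _).smul (hf _))).sub
    (ContDiffOn.sum fun m _ => (hρ ρ _).smul contDiffOn_const)

theorem isBigO_smul_one {F : (Fin N → ℂ) → Ck k} (hF : F =O[𝓝 0] fun _ => (1 : ℝ))
    (m : Fin N → ℤ) : (fun z => ρ (zPow z m) • F z) =O[𝓝 0] fun z => zPow z m := by
  have h1 : (fun z => ρ (zPow z m)) =O[𝓝 (0 : Fin N → ℂ)] fun z => ‖zPow z m‖ :=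
    (ρ.isBigO_comp _ _).norm_right
  have h2 := h1.smul hF
  simp only [smul_eq_mul, mul_one] at h2
  exact h2.of_norm_right

/-- The Taylor remainder is of the order of the `K`-th power of the off-diagonal part of `|u|²`. -/
theorem isBigO_taylor (hq : ∀ i, ∑ j, q i j = 1) (hv : ContinuousAt v 0) :
    (fun z => (Ck.nem hg (modSq w2 q z (v (absSq z))) -
      Ck.taylorPoly hg K (diagPart w2 q (absSq z) (v (absSq z))) (offPart w2 q z (v (absSq z)))) *
        wave ρ q z (v (absSq z))) =O[𝓝 0] fun z => offSize q z ^ K := by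
  have hvc : ContinuousAt (fun z => v (absSq z)) (0 : Fin N → ℂ) := by
    refine ContinuousAt.comp (f := absSq) ?_ contDiff_absSq.continuous.continuousAt
    rwa [absSq_zero]
  have hvi : ∀ i, ContinuousAt (fun z => v (absSq z) i) (0 : Fin N → ℂ) := fun i =>
    continuousAt_pi.mp hvc i
  have hone : ∀ {F : (Fin N → ℂ) → Ck k}, ContinuousAt F 0 → F =O[𝓝 0] fun _ => (1 : ℝ) :=
    fun hF => hF.isBigO_one ℝ
  have hwave : (fun z => wave ρ q z (v (absSq z))) =O[𝓝 0] fun _ => (1 : ℝ) := by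
    refine hone (F := fun z => wave ρ q z (v (absSq z))) (tendsto_finsetSum _ fun i _ =>
      Filter.Tendsto.smul (ContinuousAt.tendsto ?_) (hvi i).tendsto)
    exact (ρ.continuous.comp (contDiff_zPow _).continuous).continuousAt
  have hE : (fun z => offPart w2 q z (v (absSq z))) =O[𝓝 0] offSize q := by
    have h1 : ∀ a : ι × ι, (fun z => if a.1 = a.2 then (0 : Ck k) else
        (zPow z (q a.1) * conj (zPow z (q a.2))).re • (v (absSq z) a.1 * v (absSq z) a.2))
          =O[𝓝 0] offSize q := by
      intro a
      split_ifs with ha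
      · exact isBigO_zero _ _
      · have h2 : (fun z => (zPow z (q a.1) * conj (zPow z (q a.2))).re) =O[𝓝 0] offSize q := by
          refine IsBigO.of_bound 1 (Filter.Eventually.of_forall fun z => ?_)
          rw [one_mul, Real.norm_of_nonneg (offSize_nonneg q z), Real.norm_eq_abs]
          refine (Complex.abs_re_le_norm _).trans ?_
          rw [norm_mul, RCLike.norm_conj]
          have := Finset.single_le_sum (f := fun a : ι × ι => if a.1 = a.2 then 0 else
            ‖zPow z (q a.1)‖ * ‖zPow z (q a.2)‖) (fun a _ => by split_ifs <;> positivity)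
            (Finset.mem_univ a)
          rw [if_neg ha] at this
          exact this
        have h3 := h2.smul (hone (F := fun z => v (absSq z) a.1 * v (absSq z) a.2)
          ((hvi a.1).mul (hvi a.2)))
        simp only [smul_eq_mul, mul_one] at h3
        exact h3
    have h4 := (isBigO_const_const w2 (one_ne_zero : (1 : ℝ) ≠ 0) (𝓝 (0 : Fin N → ℂ))).mul
      (IsBigO.fun_sum (s := Finset.univ) fun a _ => h1 a)
    simp only [one_mul] at h4
    exact h4
  have hE0 : Filter.Tendsto (fun z => offPart w2 q z (v (absSq z))) (𝓝 0) (𝓝 0) :=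
    hE.trans_tendsto (tendsto_offSize hq)
  have hD0 : Filter.Tendsto (fun z => diagPart w2 q (absSq z) (v (absSq z))) (𝓝 0) (𝓝 0) := by
    have h1 : ContinuousAt (fun z => diagPart w2 q (absSq z) (v (absSq z))) (0 : Fin N → ℂ) := by
      refine continuousAt_const.mul (tendsto_finsetSum _ fun i _ =>
        Filter.Tendsto.smul (ContinuousAt.tendsto ?_) ((hvi i).tendsto.mul (hvi i).tendsto))
      have h2 : Continuous fun x : Fin N → ℝ => ∏ j, x j ^ absVec (q i) j := by fun_prop
      exact (h2.comp contDiff_absSq.continuous).continuousAt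
    have h2 := h1.tendsto
    rwa [absSq_zero, diagPart_zero w2 hq] at h2
  obtain ⟨r, hr, C, hC, hT⟩ := Ck.exists_taylor_bound (k := k) K hg
  have hmain : (fun z => Ck.nem hg (modSq w2 q z (v (absSq z))) -
      Ck.taylorPoly hg K (diagPart w2 q (absSq z) (v (absSq z))) (offPart w2 q z (v (absSq z))))
        =O[𝓝 0] fun z => offSize q z ^ K := by
    refine IsBigO.trans (IsBigO.of_bound C ?_) (hE.norm_left.pow K)
    have hball := Metric.closedBall_mem_nhds (0 : Ck k) hr
    filter_upwards [hE0 hball, hD0 hball] with z h1 h2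
    rw [Set.mem_preimage, mem_closedBall_zero_iff] at h1 h2
    rw [modSq_eq, norm_pow, norm_norm]
    exact hT _ _ h2 h1
  simpa only [mul_one] using hmain.mul hwave

/-- The bound for the remainder, which splits into the Taylor remainder, of order `offSize ^ K`, the
variation of the coefficients of `z^m` for `m ∈ R_min`, and the terms `z^m` with `m` outside
`NR₁ ∪ R_min`. -/
theorem isBigO_remPart (hind : ∀ m : Fin N → ℤ, m ≠ 0 → ∑ j, (m j : ℝ) * ω j ≠ 0)
    (hinj : Function.Injective q) (hrange : ∀ m, m ∈ NonRes1 ω ↔ ∃ i, q i = m)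
    (hK0 : 0 < K) (hK : (fun z => offSize q z ^ K) =O[𝓝 0] resBound ω)
    (hv : DifferentiableAt ℝ v 0) :
    remPart hg w2 q K ω v ρ =O[𝓝 0] resBound ω := by
  have hq : ∀ i, ∑ j, q i j = 1 := fun i => ((hrange _).mpr ⟨i, rfl⟩).1.1
  set f : (Fin N → ℤ) → (Fin N → ℝ) → Ck k := fun m x => nlCoef hg w2 q K m x (v x) with hf
  have hfd : ∀ m, DifferentiableAt ℝ (f m) 0 := fun m => by
    have h2 := (contDiff_nlCoef hg w2 q K m).differentiable (by simp)
    have h3 : DifferentiableAt ℝ (fun x => (x, v x)) (0 : Fin N → ℝ) :=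
      differentiableAt_id.prodMk hv
    simp only [hf]
    generalize nlCoef hg w2 q K m = F at h2 ⊢
    exact DifferentiableAt.comp (0 : Fin N → ℝ)
      (g := fun p : (Fin N → ℝ) × (ι → Ck k) => F p.1 p.2) (h2 _) h3
  set Rf := (resMin_finite ω).toFinset with hRf
  set I : Finset (Fin N → ℤ) := Finset.univ.image q with hI
  have hdisj : Disjoint I Rf := by
    rw [Finset.disjoint_left]
    intro m h1 h2
    obtain ⟨i, -, rfl⟩ := Finset.mem_image.mp h1
    have h3 := ((hrange _).mpr ⟨i, rfl⟩ : q i ∈ NonRes1 ω).1.2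
    have h4 : q i ∈ ResMin ω := (resMin_finite ω).mem_toFinset.mp h2
    exact lt_asymm h3 h4.1.2
  -- all indices that occur; those outside `I ∪ Rf` dominate a minimal resonant one strictly
  set M := nets q K ∪ Rf with hM
  have hIM : I ∪ Rf ⊆ M := by
    refine Finset.union_subset_union ?_ subset_rfl
    intro m hm
    obtain ⟨i, -, rfl⟩ := Finset.mem_image.mp hm
    exact mem_nets_self q hK0 i
  have hdecomp : ∀ z, remPart hg w2 q K ω v ρ z =
      (Ck.nem hg (modSq w2 q z (v (absSq z))) -
        Ck.taylorPoly hg K (diagPart w2 q (absSq z) (v (absSq z)))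
          (offPart w2 q z (v (absSq z)))) * wave ρ q z (v (absSq z)) +
      (∑ m ∈ Rf, ρ (zPow z m) • (f m (absSq z) - f m 0) +
        ∑ m ∈ M \ (I ∪ Rf), ρ (zPow z m) • f m (absSq z)) := by
    intro z
    have h1 : ∑ m ∈ nets q K, ρ (zPow z m) • f m (absSq z) =
        ∑ i, ρ (zPow z (q i)) • f (q i) (absSq z) + ∑ m ∈ Rf, ρ (zPow z m) • f m (absSq z) +
          ∑ m ∈ M \ (I ∪ Rf), ρ (zPow z m) • f m (absSq z) := by
      rw [Finset.sum_subset Finset.subset_union_left (fun m _ hm => by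
          rw [hf]
          simp only
          rw [nlCoef_of_notMem hg w2 hm, smul_zero]) (s₂ := M),
        ← Finset.sum_sdiff hIM, Finset.sum_union hdisj, hI,
        Finset.sum_image fun i _ j _ h => hinj h, add_comm]
    rw [sub_mul, taylorPoly_mul_wave, h1, remPart]
    simp only [smul_sub, Finset.sum_sub_distrib]
    abel
  rw [show remPart hg w2 q K ω v ρ = _ from funext hdecomp]
  refine ((isBigO_taylor hg w2 ρ hq hv.continuousAt).trans hK).add
    ((IsBigO.fun_sum fun m hm => ?_).add (IsBigO.fun_sum fun m hm => ?_))
  · have hm' : m ∈ ResMin ω := (resMin_finite ω).mem_toFinset.mp hm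
    refine IsBigO.trans ?_ (isBigO_zNorm_sq_mul_zPow hm')
    have h1 : (fun z => f m (absSq z) - f m 0) =O[𝓝 (0 : Fin N → ℂ)] fun z => zNorm z ^ 2 := by
      have h2 := (hfd m).isBigO_sub.comp_tendsto (tendsto_absSq (N := N))
      refine IsBigO.trans ?_ isBigO_absSq
      simpa only [Function.comp_def, sub_zero] using h2
    have h3 : (fun z => ρ (zPow z m)) =O[𝓝 (0 : Fin N → ℂ)] fun z => ‖zPow z m‖ :=
      (ρ.isBigO_comp _ _).norm_right
    have h4 := h3.smul h1
    simpa only [smul_eq_mul, mul_comm] using h4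
  · rw [Finset.mem_sdiff, Finset.notMem_union] at hm
    obtain ⟨hm1, hm2, hm3⟩ := hm
    have hnet : m ∈ nets q K := (Finset.mem_union.mp hm1).resolve_right hm3
    have hn1 : m ∉ NonRes1 ω := fun h => hm2 (by
      obtain ⟨i, rfl⟩ := (hrange m).mp h
      exact Finset.mem_image_of_mem _ (Finset.mem_univ i))
    have hn2 : m ∉ ResMin ω := fun h => hm3 ((resMin_finite ω).mem_toFinset.mpr h)
    refine IsBigO.trans (isBigO_smul_one ρ ?_ m)
      (isBigO_zPow_of_notMem hind (sum_of_mem_nets hq hnet) hn1 hn2)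
    have h1 : ContinuousAt (fun z => f m (absSq z)) (0 : Fin N → ℂ) := by
      refine ContinuousAt.comp (g := f m) (f := absSq) ?_ contDiff_absSq.continuous.continuousAt
      rw [absSq_zero]
      exact (hfd m).continuousAt
    exact h1.isBigO_one ℝ

end

end

/-! ### The stationary equations -/

section

open scoped Topology ComplexConjugate InnerProductSpace

variable {N k : ℕ} {V : 𝓢(R3, ℝ)} {ω : Fin N → ℝ} {φ : Fin N → L2} {α : ℝ}

theorem neg_freq_pos {m : Fin N → ℤ} (hm : m ∈ NonRes1 ω) : 0 < -freq ω m := neg_pos.mpr hm.1.2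

/-- A family of unit eigenvectors `p_m` (or zero) and reduced resolvents `S_m` of `H` at `m · ω`,
for `m ∈ NR₁`. -/
structure IsModes (V : 𝓢(R3, ℝ)) (ω : Fin N → ℝ) (φ : Fin N → L2) (p : NonRes1 ω → L2)
    (S : NonRes1 ω → L2 →L[ℂ] L2) : Prop where
  eq_iff : ∀ m f v, v = S m f ↔
    v = freeRes (neg_freq_pos m.2) (f - ⟪p m, f⟫_ℂ • p m - mulSchwartz V v) ∧ ⟪p m, v⟫_ℂ = 0
  unit : ∀ m j, m.1 = unitIdx j → p m = φ j
  of_ne : ∀ m, (∀ j, m.1 ≠ unitIdx j) → p m = 0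

theorem omega_ne_freq (hH : SpectralAssumption V ω φ) {m : Fin N → ℤ} (h : ∀ j, m ≠ unitIdx j)
    (j : Fin N) : ω j ≠ -(-freq ω m) := by
  rw [neg_neg, ← freq_unitIdx ω j]
  exact freq_ne_of_ne hH.independent (h j).symm

/-- For `m = e_j` the kernel of `H - m · ω` is spanned by `φ_j`; otherwise it is trivial, since by
the independence of the `ω_j` the number `m · ω` is not an eigenvalue. -/
theorem exists_isModes (hH : SpectralAssumption V ω φ) : ∃ p S, IsModes V ω φ p S := by
  have h : ∀ m : NonRes1 ω, ∃ (p : L2) (S : L2 →L[ℂ] L2), (∀ f v, v = S f ↔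
      v = freeRes (neg_freq_pos m.2) (f - ⟪p, f⟫_ℂ • p - mulSchwartz V v) ∧ ⟪p, v⟫_ℂ = 0) ∧
      (∀ j, m.1 = unitIdx j → p = φ j) ∧ ((∀ j, m.1 ≠ unitIdx j) → p = 0) := by
    intro m
    by_cases hm : ∃ j, m.1 = unitIdx j
    · obtain ⟨j, hj⟩ := hm
      have h1 : ω j = -(-freq ω m.1) := by rw [neg_neg, hj, freq_unitIdx]
      obtain ⟨S, hS⟩ := exists_reducedResolvent V (neg_freq_pos m.2)
        (kerH_eq_span hH (neg_freq_pos m.2) h1) (Or.inr (hH.norm_eq_one j))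
      refine ⟨φ j, S, hS, fun j' hj' => ?_, fun h => absurd hj (h j)⟩
      rw [unitIdx_injective (hj.symm.trans hj')]
    · push Not at hm
      have h1 : kerH V (neg_freq_pos m.2) = Submodule.span ℂ {(0 : L2)} := by
        rw [Submodule.span_zero_singleton]
        exact kerH_eq_bot hH _ (omega_ne_freq hH hm)
      obtain ⟨S, hS⟩ := exists_reducedResolvent V (neg_freq_pos m.2) h1 (Or.inl rfl)
      exact ⟨0, S, hS, fun j hj => absurd hj (hm j), fun _ => rfl⟩
  choose p S h1 h2 h3 using h
  exact ⟨p, S, h1, h2, h3⟩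

theorem freq_notMem_spec (hH : SpectralAssumption V ω φ) {m : Fin N → ℤ} (hm : m ∈ NonRes1 ω)
    (h : ∀ j, m ≠ unitIdx j) : (freq ω m : ℂ) ∉ spec (schrodinger V) := by
  have h1 := notMem_spec_of_kerH_eq_bot V (neg_freq_pos hm)
    (kerH_eq_bot hH _ (omega_ne_freq hH h))
  rwa [neg_neg] at h1

/-- The square of the weight, the eigenvectors and the reduced resolvents in the weighted
`C^k_b`. -/
structure IsLevel (hα : 0 < α) (k : ℕ) (p : NonRes1 ω → L2) (S : NonRes1 ω → L2 →L[ℂ] L2)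
    (w2 : Ck k) (a : NonRes1 ω → Ck k) (T : NonRes1 ω → Ck k →L[ℝ] Ck k) : Prop where
  ev_w2 : ∀ x, Ck.ev w2 x = expW (-α) 0 x ^ 2
  emb_a : ∀ m, emb hα k (a m) = p m
  emb_T : ∀ m b, emb hα k (T m b) = S m (emb hα k b)

theorem exists_isLevel (hH : SpectralAssumption V ω φ) (hα : 0 < α)
    (h9 : ∀ m ∈ NonRes1 ω, 9 * α ^ 2 < -freq ω m) {p : NonRes1 ω → L2}
    {S : NonRes1 ω → L2 →L[ℂ] L2} (hM : IsModes V ω φ p S) (k : ℕ) :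
    ∃ w2 a T, IsLevel hα k p S w2 a T := by
  obtain ⟨c, hc⟩ := inCk_expW_neg hα.le k
  have ha : ∀ m, ∃ b : Ck k, emb hα k b = p m := by
    intro m
    by_cases hm : ∃ j, m.1 = unitIdx j
    · obtain ⟨j, hj⟩ := hm
      have h1 := h9 _ (unitIdx_mem_nonRes1 hH.neg j)
      rw [freq_unitIdx] at h1
      obtain ⟨b, hb⟩ := exists_emb_eigenfunction hH hα j h1 k
      exact ⟨b, by rw [hM.unit m j hj, hb]⟩
    · push Not at hm
      exact ⟨0, by rw [hM.of_ne m hm, map_zero]⟩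
  choose a ha using ha
  have hT : ∀ m, ∃ T : Ck k →L[ℝ] Ck k, ∀ b, emb hα k (T b) = S m (emb hα k b) := fun m =>
    exists_reducedResolvent_ck V hα (neg_freq_pos m.2) (h9 m m.2) (a m) (by
      rw [ha]
      exact hM.eq_iff m)
  choose T hT using hT
  exact ⟨c ^ 2, a, T, fun x => by rw [Ck.ev_pow_apply, hc], ha, hT⟩

/-- The functional `b ↦ ⟨φ_j, e^{-α⟨x⟩} b⟩`. -/
def modeFun (hα : 0 < α) (k : ℕ) (φ : Fin N → L2) (j : Fin N) : Ck k →L[ℝ] ℝ :=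
  Complex.reCLM.comp (((innerSL ℂ (φ j)).restrictScalars ℝ).comp (emb hα k))

theorem modeFun_apply (hα : 0 < α) (φ : Fin N → L2) (j : Fin N) (b : Ck k) :
    modeFun hα k φ j b = (⟪φ j, emb hα k b⟫_ℂ).re := rfl

theorem inner_eq_modeFun (hα : 0 < α) {φ : Fin N → L2} {j : Fin N} {a : Ck k}
    (ha : emb hα k a = φ j) (b : Ck k) : ⟪φ j, emb hα k b⟫_ℂ = (modeFun hα k φ j b : ℂ) := by
  rw [modeFun_apply, ← ha, inner_emb, Complex.ofReal_re]

theorem shift_apply (A : L2 →ₗ.[ℂ] L2) (l : ℂ) (u : A.domain) :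
    shift A l u = A u - l • (u : L2) := rfl

variable {g : ℝ → ℝ} (hg : ContDiff ℝ (⊤ : ℕ∞) g) [Fintype (NonRes1 ω)]

/-- A fixed point of the profile map solves the stationary equations
`H v_m = (m · ϖ) v_m - f_m(x, v)`. -/
theorem profile_equation (hH : SpectralAssumption V ω φ) (hα : 0 < α) {p : NonRes1 ω → L2}
    {S : NonRes1 ω → L2 →L[ℂ] L2} (hM : IsModes V ω φ p S) {w2 : Ck k} {a : NonRes1 ω → Ck k}
    {T : NonRes1 ω → Ck k →L[ℝ] Ck k} (hL : IsLevel hα k p S w2 a T) {K : ℕ} {x w : Fin N → ℝ}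
    {ψ : NonRes1 ω → Ck k}
    (hfix : profileMap hg w2 Subtype.val K ω (modeFun hα k φ) T a (x, (w, ψ)) = (w, ψ))
    (m : NonRes1 ω) : ∃ h : emb hα k (a m + ψ m) ∈ (schrodinger V).domain,
      schrodinger V ⟨emb hα k (a m + ψ m), h⟩ =
        ((∑ j, (m.1 j : ℝ) * w j : ℝ) : ℂ) • emb hα k (a m + ψ m) -
          emb hα k (nlCoef hg w2 Subtype.val K m.1 x (a + ψ)) := by
  have hκ := neg_freq_pos m.2
  set f : (Fin N → ℤ) → Ck k := fun n => nlCoef hg w2 Subtype.val K n x (a + ψ) with hf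
  set c : ℝ := ∑ j, (m.1 j : ℝ) * (w j - ω j) with hc
  have h1 : ∀ j, ω j + modeFun hα k φ j (f (unitIdx j)) = w j := fun j =>
    congrFun (congrArg Prod.fst hfix) j
  have h2 : T m (c • (a m + ψ m) - f m.1) = ψ m := congrFun (congrArg Prod.snd hfix) m
  set F : Ck k := c • (a m + ψ m) - f m.1 with hF
  have h3 : emb hα k (ψ m) = S m (emb hα k F) := by rw [← hL.emb_T, h2]
  obtain ⟨h4, h5⟩ := (hM.eq_iff m _ _).mp h3
  -- the solvability condition determines the frequency
  have h6 : ⟪p m, emb hα k F⟫_ℂ • p m = 0 := by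
    by_cases hm : ∃ j, m.1 = unitIdx j
    · obtain ⟨j, hj⟩ := hm
      have hp := hM.unit m j hj
      have hcj : c = w j - ω j := by
        rw [hc, hj, Finset.sum_eq_single j]
        · simp [unitIdx]
        · intro l _ hl
          simp [unitIdx, hl]
        · simp
      have ha : emb hα k (a m) = φ j := by rw [hL.emb_a, hp]
      have h7 : modeFun hα k φ j (a m) = 1 := by
        rw [modeFun_apply, ha, inner_self_eq_norm_sq_to_K, hH.norm_eq_one j]
        simp
      have h8 : modeFun hα k φ j (ψ m) = 0 := by
        rw [modeFun_apply, ← hp, h5, Complex.zero_re]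
      have h9 : modeFun hα k φ j F = 0 := by
        rw [hF, map_sub, map_smul, map_add, h7, h8, hj, smul_eq_mul, hcj]
        linarith [h1 j]
      rw [hp, inner_eq_modeFun hα ha, h9, Complex.ofReal_zero, zero_smul]
    · push Not at hm
      rw [hM.of_ne m hm, smul_zero]
  rw [h6, sub_zero] at h4
  obtain ⟨d1, e1⟩ := (shift_eq_iff V hκ _ _).mpr h4
  have h10 : ∃ d : emb hα k (a m) ∈ (schrodinger V).domain,
      shift (schrodinger V) ((-(-freq ω m.1) : ℝ) : ℂ) ⟨_, d⟩ = 0 := by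
    rw [hL.emb_a]
    by_cases hm : ∃ j, m.1 = unitIdx j
    · obtain ⟨j, hj⟩ := hm
      rw [hM.unit m j hj]
      exact (mem_kerH_iff V hκ _).mp (mem_kerH_eigenfunction hH hκ (by
        rw [neg_neg, hj, freq_unitIdx]))
    · push Not at hm
      rw [hM.of_ne m hm]
      exact ⟨Submodule.zero_mem _, map_zero (shift (schrodinger V) _)⟩
  obtain ⟨d2, e2⟩ := h10
  have hd : emb hα k (a m + ψ m) ∈ (schrodinger V).domain := by
    rw [map_add]
    exact Submodule.add_mem _ d2 d1
  refine ⟨hd, ?_⟩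
  have e3 : shift (schrodinger V) ((-(-freq ω m.1) : ℝ) : ℂ) ⟨emb hα k (a m + ψ m), hd⟩ =
      emb hα k F := by
    have : (⟨emb hα k (a m + ψ m), hd⟩ : (schrodinger V).domain) =
        ⟨emb hα k (a m), d2⟩ + ⟨emb hα k (ψ m), d1⟩ := Subtype.ext (map_add _ _ _)
    rw [this, map_add, e1, e2, zero_add]
  rw [shift_apply, sub_eq_iff_eq_add] at e3
  have hsum : ∑ j, (m.1 j : ℝ) * w j = c + freq ω m.1 := by
    rw [hc, freq, ← Finset.sum_add_distrib]
    exact Finset.sum_congr rfl fun j _ => by ring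
  rw [e3, hF, map_sub, map_smul, neg_neg, hsum, Complex.ofReal_add, add_smul, Complex.coe_smul]
  change c • emb hα k (a m + ψ m) - _ + _ = c • emb hα k (a m + ψ m) + _ - _
  abel

end

/-! ### The leading profiles and the forcing terms -/

section

open scoped Topology ComplexConjugate InnerProductSpace

variable {N k : ℕ} {V : 𝓢(R3, ℝ)} {ω : Fin N → ℝ} {φ : Fin N → L2} {α : ℝ}

theorem toL2_coe (u : L2) : toL2 (u : AEFun) = u := by
  rw [toL2, dif_pos (Lp.memLp u)]
  exact Lp.toLp_coeFn u (Lp.memLp u)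

theorem coe_sum_L2 {β : Type*} (s : Finset β) (u : β → L2) :
    ((∑ b ∈ s, u b : L2) : AEFun) = ∑ b ∈ s, (u b : AEFun) :=
  AddSubgroup.val_finsetSum _ _ _

theorem coe_smul_L2 (c : ℂ) (u : L2) : ((c • u : L2) : AEFun) = c • (u : AEFun) := rfl

/-- Products of functions in the image of `C^k_b`. -/
theorem prod_coe_emb (hα : 0 < α) {w2 : Ck k} (hw : ∀ x, Ck.ev w2 x = expW (-α) 0 x ^ 2) (l : ℕ)
    (b : Fin (2 * l + 1) → Ck k) :
    ∏ i, (emb hα k (b i) : AEFun) = (emb hα k (w2 ^ l * ∏ i, b i) : AEFun) := by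
  have h1 : ∀ s : Finset (Fin (2 * l + 1)),
      (∏ i ∈ s, (emb hα k (b i) : AEFun) : AEFun) =ᵐ[volume]
        fun x => ∏ i ∈ s, (wfun α (b i) x : ℂ) := by
    intro s
    induction s using Finset.induction_on with
    | empty =>
      simp only [Finset.prod_empty]
      exact AEEqFun.coeFn_one
    | insert i s hi ih =>
      rw [Finset.prod_insert hi]
      filter_upwards [AEEqFun.coeFn_mul (emb hα k (b i) : AEFun)
        (∏ i ∈ s, (emb hα k (b i) : AEFun)), ih, coeFn_emb hα (b i)] with x e1 e2 e3
      rw [e1, Pi.mul_apply, e2, e3, Finset.prod_insert hi]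
  refine AEEqFun.ext ?_
  filter_upwards [h1 Finset.univ, coeFn_emb hα (w2 ^ l * ∏ i, b i)] with x e1 e2
  rw [e1, e2, ← Complex.ofReal_prod]
  congr 1
  simp only [wfun]
  rw [Finset.prod_mul_distrib, Finset.prod_const, Finset.card_univ, Fintype.card_fin,
    Ck.ev_mul_apply, Ck.ev_pow_apply, hw, Ck.ev_prod_apply]
  ring

theorem sum_eq_one_of_mem (m : NonRes1 ω) : ∑ j, m.1 j = 1 := m.2.1.1

theorem net_apply {l : ℕ} (p : Fin (2 * l + 1) → NonRes1 ω) (j : Fin N) :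
    net Subtype.val p j = ∑ i : Fin (2 * l + 1), (-1) ^ (i : ℕ) * (p i).1 j := by
  rw [net, Finset.sum_apply]
  rfl

variable [Fintype (NonRes1 ω)]

theorem finsum_tuples {M : Type*} [AddCommMonoid M] {l : ℕ} {m : Fin N → ℤ}
    (F : (Fin (2 * l + 1) → Fin N → ℤ) → M) :
    ∑ᶠ p : tuples ω l m, F p.1 = ∑ p : Fin (2 * l + 1) → NonRes1 ω with
      (net Subtype.val p = m ∧ ∀ j, ∑ i, |(p i).1 j| = |m j|), F fun i => (p i).1 := by
  have himg : tuples ω l m = (fun (p : Fin (2 * l + 1) → NonRes1 ω) i => (p i).1) ''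
      ((Finset.univ.filter fun p : Fin (2 * l + 1) → NonRes1 ω =>
        net Subtype.val p = m ∧ ∀ j, ∑ i, |(p i).1 j| = |m j| : Finset _) : Set _) := by
    ext p
    simp only [Finset.coe_filter, Finset.mem_univ, true_and]
    constructor
    · rintro ⟨h1, h2, h3⟩
      exact ⟨fun i => ⟨p i, h1 i⟩, ⟨funext fun j => by rw [net_apply]; exact h2 j, h3⟩, rfl⟩
    · rintro ⟨p, ⟨h1, h2⟩, rfl⟩
      exact ⟨fun i => (p i).2, fun j => by rw [← h1, net_apply], h2⟩
  have hinj : Function.Injective fun (p : Fin (2 * l + 1) → NonRes1 ω) i => (p i).1 :=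
    fun p p' h => funext fun i => Subtype.ext (congrFun h i)
  rw [finsum_set_coe_eq_finsum_mem, himg, finsum_mem_image hinj.injOn, finsum_mem_coe_finset]

variable {g : ℝ → ℝ} (hg : ContDiff ℝ (⊤ : ℕ∞) g)

/-- The forcing term at `m` is the coefficient of `z^m` at `x = 0`, if the profiles of smaller index
are the leading ones. -/
theorem forcing_eq (hg0 : g 0 = 0) (hα : 0 < α) {w2 : Ck k}
    (hw : ∀ x, Ck.ev w2 x = expW (-α) 0 x ^ 2) {K : ℕ} (hK0 : 0 < K) {m : Fin N → ℤ}
    (hK : idxNorm m ≤ K) {v : NonRes1 ω → Ck k}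
    (h : ∀ i : NonRes1 ω, idxNorm i.1 < idxNorm m →
      leadProfile V g ω φ i.1 = (emb hα k (v i) : AEFun)) :
    forcing V g ω φ m = (emb hα k (nlCoef hg w2 Subtype.val K m 0 v) : AEFun) := by
  obtain ⟨K, rfl⟩ : ∃ K', K = K' + 1 := ⟨K - 1, by omega⟩
  set P : (l : ℕ) → Ck k := fun l => w2 ^ l * ∑ p : Fin (2 * l + 1) → NonRes1 ω with
      (net Subtype.val p = m ∧ ∀ j, ∑ i, |(p i).1 j| = |m j|), ∏ i, v (p i) with hP
  have hinner : ∀ l : ℕ, ∑ᶠ p : tuples ω (l + 1) m, ∏ i, leadProfile V g ω φ (p.1 i) =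
      (emb hα k (P (l + 1)) : AEFun) := by
    intro l
    rw [finsum_tuples (M := AEFun) (fun p => ∏ i, leadProfile V g ω φ (p i)), hP]
    simp only
    rw [Finset.mul_sum, map_sum, coe_sum_L2]
    refine Finset.sum_congr rfl fun p hp => ?_
    rw [← prod_coe_emb hα hw]
    refine Finset.prod_congr rfl fun i _ => h _ ?_
    exact idxNorm_lt_of_sum_abs (q := Subtype.val) sum_eq_one_of_mem l.succ_ne_zero
      (Finset.mem_filter.mp hp).2.2 i
  have hzero : ∀ l, K ≤ l → P (l + 1) = 0 := by
    intro l hl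
    rw [hP]
    simp only
    rw [Finset.filter_eq_empty_iff.mpr, Finset.sum_empty, mul_zero]
    rintro p - ⟨-, hp⟩
    have := lt_idxNorm_of_sum_abs (q := Subtype.val) sum_eq_one_of_mem hp
    omega
  rw [forcing, nlCoef_zero hg w2 sum_eq_one_of_mem, Finset.sum_range_succ', iteratedDeriv_zero,
    hg0, zero_div, zero_smul, add_zero, map_sum, coe_sum_L2,
    finsum_eq_sum_of_support_subset (s := Finset.range K)]
  · refine Finset.sum_congr rfl fun l _ => ?_
    rw [hinner, map_smul, ← coe_smul_L2, taylorCoeff, Complex.coe_smul]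
    rfl
  · intro l hl
    rw [Finset.coe_range, Set.mem_Iio]
    by_contra hc
    refine hl ?_
    change taylorCoeff g (l + 1) • _ = _
    rw [hinner, hzero l (not_lt.mp hc), map_zero]
    exact smul_zero _

theorem resolventOp_eq {A : L2 →ₗ.[ℂ] L2} {l : ℂ} (hl : l ∉ spec A) {u f : L2} (hu : u ∈ A.domain)
    (h : shift A l ⟨u, hu⟩ = f) : resolventOp A l f = u := by
  rw [spec, Set.mem_ofPred_eq, not_not] at hl
  rw [resolventOp, ← h, Function.leftInverse_invFun hl.1.1]

variable {p : NonRes1 ω → L2} {S : NonRes1 ω → L2 →L[ℂ] L2} {w2 : Ck k} {a : NonRes1 ω → Ck k}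
    {T : NonRes1 ω → Ck k →L[ℝ] Ck k} {K : ℕ} {y : (Fin N → ℝ) × (NonRes1 ω → Ck k)}

/-- The profiles at `x = 0`. -/
theorem fixed_zero (hα : 0 < α) (hg0 : g 0 = 0)
    (hfix : profileMap hg w2 Subtype.val K ω (modeFun hα k φ) T a (0, y) = y) :
    y.1 = ω ∧ ∀ m, (∃ j, m.1 = unitIdx j) → y.2 m = 0 := by
  have h1 : y.1 = ω := by
    rw [← hfix]
    exact profileMap_zero_fst hg w2 _ K ω _ T a hg0 sum_eq_one_of_mem y
  refine ⟨h1, ?_⟩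
  rintro m ⟨j, hj⟩
  rw [← hfix, profileMap_zero_snd hg w2 _ K ω _ T a y h1, hj,
    nlCoef_zero_unitIdx hg hg0 w2 sum_eq_one_of_mem, map_zero, neg_zero]

theorem leadProfile_eq (hg0 : g 0 = 0) (hH : SpectralAssumption V ω φ) (hα : 0 < α)
    (hM : IsModes V ω φ p S) (hL : IsLevel hα k p S w2 a T) (hK0 : 0 < K)
    (hK : ∀ m ∈ NonRes1 ω, idxNorm m ≤ K)
    (hfix : profileMap hg w2 Subtype.val K ω (modeFun hα k φ) T a (0, y) = y) (m : NonRes1 ω) :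
    leadProfile V g ω φ m.1 = (emb hα k (a m + y.2 m) : AEFun) := by
  induction hn : idxNorm m.1 using Nat.strong_induction_on generalizing m with
  | _ n ih =>
    subst hn
    obtain ⟨h1, h2⟩ := fixed_zero hg hα hg0 hfix
    by_cases hm : ∃ j, m.1 = unitIdx j
    · rw [h2 m hm, add_zero, hL.emb_a]
      obtain ⟨j, hj⟩ := hm
      rw [hM.unit m j hj, hj, leadProfile_unitIdx]
    · push Not at hm
      have hf := forcing_eq (V := V) (φ := φ) hg hg0 hα hL.ev_w2 hK0 (hK m.1 m.2) (v := a + y.2)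
        fun i hi => ih _ hi i rfl
      obtain ⟨hd, he⟩ := profile_equation hg hH hα hM hL (w := y.1) (ψ := y.2) hfix m
      have hs : shift (schrodinger V) (freq ω m.1 : ℂ)
          ⟨-emb hα k (a m + y.2 m), Submodule.neg_mem _ hd⟩ =
            emb hα k (nlCoef hg w2 Subtype.val K m.1 0 (a + y.2)) := by
        have hneg : (⟨-emb hα k (a m + y.2 m), Submodule.neg_mem _ hd⟩ :
            (schrodinger V).domain) = -⟨emb hα k (a m + y.2 m), hd⟩ := rfl
        rw [hneg, map_neg, shift_apply, he, h1, freq]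
        abel
      rw [leadProfile_of_mem V g ω φ m.2 hm, hf, toL2_coe,
        resolventOp_eq (freq_notMem_spec hH m.2 hm) _ hs, neg_neg]

end

/-! ### The time evolution -/

section

open scoped Topology ComplexConjugate InnerProductSpace

section Flow

variable {N : ℕ} (ϖ : (Fin N → ℝ) → Fin N → ℝ) (z : Fin N → ℂ) (t : ℝ)

theorem norm_zFlow (j : Fin N) : ‖zFlow ϖ z t j‖ = ‖z j‖ := by
  rw [zFlow, norm_mul, show -(Complex.I * (ϖ (absSq z) j : ℂ) * (t : ℂ)) =
    ((-(ϖ (absSq z) j * t) : ℝ) : ℂ) * Complex.I by push_cast; ring,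
    Complex.norm_exp_ofReal_mul_I, one_mul]

theorem absSq_zFlow : absSq (zFlow ϖ z t) = absSq z :=
  funext fun j => by rw [absSq, absSq, norm_zFlow]

theorem zFac_exp_mul (θ : ℝ) (z : ℂ) (a : ℤ) :
    zFac (Complex.exp (-(Complex.I * (θ : ℂ))) * z) a =
      Complex.exp (-(Complex.I * ((a * θ : ℝ) : ℂ))) * zFac z a := by
  obtain ⟨n, rfl | rfl⟩ := a.eq_nat_or_neg
  · rw [zFac_natCast, zFac_natCast, mul_pow, ← Complex.exp_nat_mul]
    congr 2
    push_cast
    ring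
  · rw [zFac_neg_natCast, zFac_neg_natCast, map_mul, mul_pow, ← Complex.exp_conj,
      ← Complex.exp_nat_mul]
    congr 2
    simp
    ring

theorem zPow_zFlow (m : Fin N → ℤ) : zPow (zFlow ϖ z t) m =
    Complex.exp (-(Complex.I * ((∑ j, (m j : ℝ) * ϖ (absSq z) j : ℝ) : ℂ)) * t) * zPow z m := by
  have h1 : ∀ j, zFac (zFlow ϖ z t j) (m j) =
      Complex.exp (-(Complex.I * ((m j * (ϖ (absSq z) j * t) : ℝ) : ℂ))) * zFac (z j) (m j) := by
    intro j
    rw [← zFac_exp_mul, zFlow]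
    congr 3
    push_cast
    ring
  rw [zPow_eq_prod, Finset.prod_congr rfl fun j _ => h1 j, Finset.prod_mul_distrib,
    ← Complex.exp_sum, zPow_eq_prod]
  congr 2
  push_cast
  rw [Finset.sum_neg_distrib, ← Finset.mul_sum, neg_mul, mul_assoc, Finset.sum_mul]
  congr 2
  exact Finset.sum_congr rfl fun j _ => by ring

theorem hasDerivAt_zPow_zFlow (m : Fin N → ℤ) :
    HasDerivAt (fun t => zPow (zFlow ϖ z t) m)
      (-(Complex.I * ((∑ j, (m j : ℝ) * ϖ (absSq z) j : ℝ) : ℂ)) * zPow (zFlow ϖ z t) m) t := by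
  set c : ℂ := -(Complex.I * ((∑ j, (m j : ℝ) * ϖ (absSq z) j : ℝ) : ℂ)) with hc
  have h1 : HasDerivAt (fun t : ℝ => Complex.exp (c * t) * zPow z m)
      (Complex.exp (c * t) * c * zPow z m) t := by
    have h2 : HasDerivAt (fun t : ℝ => c * (t : ℂ)) c t := by
      simpa using (Complex.ofRealCLM.hasDerivAt (x := t)).const_mul c
    exact h2.cexp.mul_const _
  simp only [zPow_zFlow, ← hc]
  convert h1 using 1
  ring

end Flow

variable {N k : ℕ} {V : 𝓢(R3, ℝ)} {ω : Fin N → ℝ} {φ : Fin N → L2} {α : ℝ}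

theorem emb_smul (hα : 0 < α) (r : ℝ) (b : Ck k) : emb hα k (r • b) = (r : ℂ) • emb hα k b := by
  rw [map_smul, Complex.coe_smul]
  rfl

theorem smul_emb (hα : 0 < α) (c : ℂ) (b : Ck k) :
    c • emb hα k b = emb hα k (c.re • b) + Complex.I • emb hα k (c.im • b) := by
  rw [emb_smul, emb_smul, smul_smul, ← add_smul]
  congr 1
  rw [mul_comm, Complex.re_add_im]

theorem smul_emb_eq (hα : 0 < α) (c : ℂ) (b : Ck k) :
    c • emb hα k b = emb hα k (Complex.reCLM c • b) + Complex.I • emb hα k (Complex.imCLM c • b) :=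
  smul_emb hα c b

theorem sum_smul_emb (hα : 0 < α) {β : Type*} (s : Finset β) (c : β → ℂ) (b : β → Ck k) :
    ∑ i ∈ s, c i • emb hα k (b i) = emb hα k (∑ i ∈ s, Complex.reCLM (c i) • b i) +
      Complex.I • emb hα k (∑ i ∈ s, Complex.imCLM (c i) • b i) := by
  rw [map_sum, map_sum, Finset.smul_sum, ← Finset.sum_add_distrib]
  exact Finset.sum_congr rfl fun i _ => smul_emb_eq hα (c i) (b i)

variable {g : ℝ → ℝ} (hg : ContDiff ℝ (⊤ : ℕ∞) g)

theorem nonlinearity_ae (hα : 0 < α) {w2 : Ck k} (hw : ∀ x, Ck.ev w2 x = expW (-α) 0 x ^ 2)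
    (b c : Ck k) : ∀ᵐ x, (g (‖(emb hα k b + Complex.I • emb hα k c : L2) x‖ ^ 2) : ℂ) *
      (emb hα k b + Complex.I • emb hα k c : L2) x =
      (emb hα k (Ck.nem hg (w2 * (b * b + c * c)) * b) +
        Complex.I • emb hα k (Ck.nem hg (w2 * (b * b + c * c)) * c) : L2) x := by
  have hco : ∀ b c : Ck k, ∀ᵐ x, (emb hα k b + Complex.I • emb hα k c : L2) x =
      (wfun α b x : ℂ) + Complex.I * (wfun α c x : ℂ) := by
    intro b c
    filter_upwards [coeFn_emb hα b, coeFn_emb hα c,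
      Lp.coeFn_add (emb hα k b) (Complex.I • emb hα k c),
      Lp.coeFn_smul Complex.I (emb hα k c)] with x e1 e2 e3 e4
    rw [e3, Pi.add_apply, e4, Pi.smul_apply, e1, e2, smul_eq_mul]
  filter_upwards [hco b c, hco (Ck.nem hg (w2 * (b * b + c * c)) * b)
    (Ck.nem hg (w2 * (b * b + c * c)) * c)] with x e1 e2
  have h1 : ‖(wfun α b x : ℂ) + Complex.I * (wfun α c x : ℂ)‖ ^ 2 =
      Ck.ev (w2 * (b * b + c * c)) x := by
    rw [mul_comm, ← Complex.normSq_eq_norm_sq, Complex.normSq_add_mul_I, Ck.ev_mul_apply,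
      Ck.ev_add_apply, Ck.ev_mul_apply, Ck.ev_mul_apply, hw, wfun, wfun]
    ring
  rw [e1, e2, h1, wfun, wfun, wfun, wfun, Ck.ev_mul_apply _ b, Ck.ev_mul_apply _ c,
    Ck.ev_nem_apply]
  push_cast
  ring

variable [Fintype (NonRes1 ω)]

/-- Solutions of the profile equations give solutions of the forced nonlinear equation. -/
theorem solvesForcedNLS (hH : SpectralAssumption V ω φ) (hα : 0 < α) {p : NonRes1 ω → L2}
    {S : NonRes1 ω → L2 →L[ℂ] L2} (hM : IsModes V ω φ p S) {w2 : Ck k} {a : NonRes1 ω → Ck k}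
    {T : NonRes1 ω → Ck k →L[ℝ] Ck k} (hL : IsLevel hα k p S w2 a T) {K : ℕ}
    {ϖ : (Fin N → ℝ) → Fin N → ℝ} {ψ v : (Fin N → ℝ) → NonRes1 ω → Ck k}
    (hv : ∀ x, v x = a + ψ x) {z : Fin N → ℂ}
    (hfix : profileMap hg w2 Subtype.val K ω (modeFun hα k φ) T a
      (absSq z, (ϖ (absSq z), ψ (absSq z))) = (ϖ (absSq z), ψ (absSq z))) :
    SolvesForcedNLS V g (fun t => ((∑ m ∈ (resMin_finite ω).toFinset, zPow (zFlow ϖ z t) m •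
        emb hα k (nlCoef hg w2 Subtype.val K m 0 (v 0)) +
      (emb hα k (remPart hg w2 Subtype.val K ω v Complex.reCLM (zFlow ϖ z t)) +
        Complex.I • emb hα k (remPart hg w2 Subtype.val K ω v Complex.imCLM (zFlow ϖ z t))) : L2) :
          AEFun))
      (fun t => ∑ m : NonRes1 ω, zPow (zFlow ϖ z t) m.1 • emb hα k (v (absSq z) m)) := by
  intro t
  set Z := zFlow ϖ z t with hZ
  have hx : absSq Z = absSq z := absSq_zFlow ϖ z t
  set c : NonRes1 ω → ℝ := fun m => ∑ j, (m.1 j : ℝ) * ϖ (absSq z) j with hc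
  choose d e using profile_equation hg hH hα hM hL hfix
  have hva : ∀ m, a m + ψ (absSq z) m = v (absSq z) m := fun m => by rw [hv, Pi.add_apply]
  have hdom : ∀ m, emb hα k (v (absSq z) m) ∈ (schrodinger V).domain := fun m => by
    rw [← hva]
    exact d m
  set f : (Fin N → ℤ) → Ck k := fun n => nlCoef hg w2 Subtype.val K n (absSq z) (v (absSq z))
    with hf
  have he : ∀ m, schrodinger V ⟨emb hα k (v (absSq z) m), hdom m⟩ =
      (c m : ℂ) • emb hα k (v (absSq z) m) - emb hα k (f m.1) := by
    intro m
    have h1 := e m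
    simp only [hva, ← hv] at h1
    exact h1
  have hu : ∑ m : NonRes1 ω, zPow Z m.1 • emb hα k (v (absSq z) m) ∈ (schrodinger V).domain :=
    Submodule.sum_mem _ fun m _ => Submodule.smul_mem _ _ (hdom m)
  have hHu : schrodinger V ⟨_, hu⟩ = ∑ m : NonRes1 ω, zPow Z m.1 •
      ((c m : ℂ) • emb hα k (v (absSq z) m) - emb hα k (f m.1)) := by
    have h1 : (⟨_, hu⟩ : (schrodinger V).domain) = ∑ m : NonRes1 ω, zPow Z m.1 •
        (⟨emb hα k (v (absSq z) m), hdom m⟩ : (schrodinger V).domain) := by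
      refine Subtype.ext ?_
      rw [Submodule.coe_sum]
      rfl
    rw [h1]
    change (schrodinger V).toFun _ = _
    rw [map_sum]
    refine Finset.sum_congr rfl fun m _ => ?_
    rw [map_smul]
    congr 1
    exact he m
  refine ⟨hu, ∑ m : NonRes1 ω, (-(Complex.I * (c m : ℂ)) * zPow Z m.1) •
    emb hα k (v (absSq z) m), ?_, ?_⟩
  · exact HasDerivAt.fun_sum fun m _ => (hasDerivAt_zPow_zFlow ϖ z t m.1).smul_const _
  set b := wave Complex.reCLM Subtype.val Z (v (absSq z)) with hb
  set b' := wave Complex.imCLM Subtype.val Z (v (absSq z)) with hb'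
  have hub : ∑ m : NonRes1 ω, zPow Z m.1 • emb hα k (v (absSq z) m) =
      emb hα k b + Complex.I • emb hα k b' := sum_smul_emb hα Finset.univ _ _
  set n := Ck.nem hg (w2 * (b * b + b' * b')) with hn
  have hrem : emb hα k (remPart hg w2 Subtype.val K ω v Complex.reCLM Z) +
      Complex.I • emb hα k (remPart hg w2 Subtype.val K ω v Complex.imCLM Z) =
      (emb hα k (n * b) + Complex.I • emb hα k (n * b')) -
        ∑ m : NonRes1 ω, zPow Z m.1 • emb hα k (f m.1) -
        ∑ m ∈ (resMin_finite ω).toFinset, zPow Z m •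
          emb hα k (nlCoef hg w2 Subtype.val K m 0 (v 0)) := by
    rw [sum_smul_emb, sum_smul_emb, remPart, remPart, hx, ← hb, ← hb', modSq, ← hb, ← hb', ← hn,
      map_sub, map_sub, map_sub (emb hα k) (n * b' - _), map_sub (emb hα k) (n * b'), smul_sub,
      smul_sub]
    abel
  have hsum : Complex.I • (∑ m : NonRes1 ω, (-(Complex.I * (c m : ℂ)) * zPow Z m.1) •
      emb hα k (v (absSq z) m)) = schrodinger V ⟨_, hu⟩ +
        ((emb hα k (n * b) + Complex.I • emb hα k (n * b')) -
        (∑ m ∈ (resMin_finite ω).toFinset, zPow Z m •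
          emb hα k (nlCoef hg w2 Subtype.val K m 0 (v 0)) +
          (emb hα k (remPart hg w2 Subtype.val K ω v Complex.reCLM Z) +
        Complex.I • emb hα k (remPart hg w2 Subtype.val K ω v Complex.imCLM Z)))) := by
    have h1 : Complex.I • (∑ m : NonRes1 ω, (-(Complex.I * (c m : ℂ)) * zPow Z m.1) •
        emb hα k (v (absSq z) m)) =
          ∑ m : NonRes1 ω, zPow Z m.1 • ((c m : ℂ) • emb hα k (v (absSq z) m)) := by
      rw [Finset.smul_sum]
      refine Finset.sum_congr rfl fun m _ => ?_
      rw [smul_smul, smul_smul]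
      congr 1
      linear_combination (-(c m : ℂ) * zPow Z m.1) * Complex.I_mul_I
    rw [h1, hHu, hrem]
    simp only [smul_sub, Finset.sum_sub_distrib]
    abel
  set G : L2 := ∑ m ∈ (resMin_finite ω).toFinset, zPow Z m •
          emb hα k (nlCoef hg w2 Subtype.val K m 0 (v 0)) +
          (emb hα k (remPart hg w2 Subtype.val K ω v Complex.reCLM Z) +
        Complex.I • emb hα k (remPart hg w2 Subtype.val K ω v Complex.imCLM Z)) with hG
  have hnl := nonlinearity_ae hg hα hL.ev_w2 b b'
  rw [← hub] at hnl
  set u' : L2 := ∑ m : NonRes1 ω, (-(Complex.I * (c m : ℂ)) * zPow Z m.1) •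
    emb hα k (v (absSq z) m) with hu'
  set NL : L2 := emb hα k (n * b) + Complex.I • emb hα k (n * b') with hNL
  have h2 := Lp.coeFn_smul Complex.I u'
  rw [hsum] at h2
  filter_upwards [hnl, h2, Lp.coeFn_add (schrodinger V ⟨_, hu⟩) (NL - G), Lp.coeFn_sub NL G]
    with x e1 e2 e3 e4
  rw [e3, Pi.add_apply, e4, Pi.sub_apply, Pi.smul_apply, smul_eq_mul] at e2
  rw [← e2, e1]
  ring

end

/-! ### The profiles in all regularities -/

section

open scoped Topology ComplexConjugate InnerProductSpace

section Balls

variable {N : ℕ}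

theorem exists_realBall_subset {s : Set (Fin N → ℝ)} (hs : s ∈ 𝓝 0) :
    ∃ r > 0, realBall N r ⊆ s := by
  obtain ⟨r, hr, h⟩ := Metric.mem_nhds_iff.mp hs
  refine ⟨r, hr, fun x hx => h ?_⟩
  rw [mem_ball_zero_iff, pi_norm_lt_iff hr]
  intro j
  exact (Finset.single_le_sum (f := fun j => |x j|) (fun _ _ => abs_nonneg _)
    (Finset.mem_univ j)).trans_lt hx

theorem exists_complexBall_subset {s : Set (Fin N → ℂ)} (hs : s ∈ 𝓝 0) :
    ∃ r > 0, complexBall N r ⊆ s := by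
  obtain ⟨r, hr, h⟩ := Metric.mem_nhds_iff.mp hs
  refine ⟨r, hr, fun x hx => h ?_⟩
  rw [mem_ball_zero_iff, pi_norm_lt_iff hr]
  intro j
  exact (norm_apply_le_zNorm x j).trans_lt hx

theorem absSq_mem_realBall {δ : ℝ} {z : Fin N → ℂ} (hz : z ∈ complexBall N δ) :
    absSq z ∈ realBall N (δ ^ 2) := by
  have h0 := zNorm_nonneg z
  have hz' : zNorm z < δ := hz
  exact (sum_abs_absSq_le z).trans_lt (by nlinarith)

theorem realBall_mono {r r' : ℝ} (h : r ≤ r') : realBall N r ⊆ realBall N r' :=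
  fun _ hx => lt_of_lt_of_le hx h

theorem complexBall_mono {r r' : ℝ} (h : r ≤ r') : complexBall N r ⊆ complexBall N r' :=
  fun _ hx => lt_of_lt_of_le hx h

theorem zero_mem_realBall {r : ℝ} (hr : 0 < r) : (0 : Fin N → ℝ) ∈ realBall N r := by
  simpa [realBall] using hr

end Balls

variable {N k : ℕ} {V : 𝓢(R3, ℝ)} {ω : Fin N → ℝ} {φ : Fin N → L2} {α : ℝ} {g : ℝ → ℝ}

theorem ev_remPart_congr {ι : Type*} [Fintype ι] [DecidableEq ι] (hg : ContDiff ℝ (⊤ : ℕ∞) g)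
    {k' : ℕ} {w2 : Ck k} {w2' : Ck k'} (q : ι → Fin N → ℤ) (K : ℕ)
    {v : (Fin N → ℝ) → ι → Ck k} {v' : (Fin N → ℝ) → ι → Ck k'} (ρ : ℂ →L[ℝ] ℝ) (z : Fin N → ℂ)
    (hw : ∀ y, Ck.ev w2 y = Ck.ev w2' y) (h0 : ∀ i y, Ck.ev (v 0 i) y = Ck.ev (v' 0 i) y)
    (hz : ∀ i y, Ck.ev (v (absSq z) i) y = Ck.ev (v' (absSq z) i) y) (y : R3) :
    Ck.ev (remPart hg w2 q K ω v ρ z) y = Ck.ev (remPart hg w2' q K ω v' ρ z) y := by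
  have hwave : ∀ ρ : ℂ →L[ℝ] ℝ, Ck.ev (wave ρ q z (v (absSq z))) y =
      Ck.ev (wave ρ q z (v' (absSq z))) y := fun ρ => by
    simp only [ev_wave, hz]
  simp only [remPart, modSq, Ck.ev_sub_apply, Ck.ev_mul_apply, Ck.ev_nem_apply, Ck.ev_add_apply,
    Ck.ev_sum_apply, Ck.ev_smul_apply, hwave, hw, ev_nlCoef_congr hg q K _ _ hw h0,
    ev_nlCoef_congr hg q K _ _ hw hz]

/-- The objects of regularity `k`: eigenfunctions `a`, forcing terms `G`, frequencies `ϖ`, profiles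
`ψ` and the real and imaginary part `R`, `R'` of the remainder, all divided by the weight, on the
balls given by `δ`; and their relation to objects `W`, `Ψ`, `Q` which do not depend on `k`. -/
structure IsSolution (V : 𝓢(R3, ℝ)) (g : ℝ → ℝ) (ω : Fin N → ℝ) (φ : Fin N → L2)
    [Fintype (NonRes1 ω)] (hα : 0 < α)
    (W : (Fin N → ℝ) → Fin N → ℝ) (Ψ : (Fin N → ℝ) → NonRes1 ω → L2) (Q : (Fin N → ℂ) → L2)
    (k : ℕ) (δ C : ℝ) (a : NonRes1 ω → Ck k) (G : (Fin N → ℤ) → Ck k)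
    (ϖ : (Fin N → ℝ) → Fin N → ℝ) (ψ : (Fin N → ℝ) → NonRes1 ω → Ck k)
    (R R' : (Fin N → ℂ) → Ck k) : Prop where
  contDiff_profile : ContDiffOn ℝ (⊤ : ℕ∞) ψ (realBall N (δ ^ 2))
  contDiff_freq : ContDiffOn ℝ (⊤ : ℕ∞) ϖ (realBall N (δ ^ 2))
  contDiff_re : ContDiffOn ℝ (⊤ : ℕ∞) R (complexBall N δ)
  contDiff_im : ContDiffOn ℝ (⊤ : ℕ∞) R' (complexBall N δ)
  freq_zero : ϖ 0 = ω
  profile_unit : ∀ m, (∃ j, m.1 = unitIdx j) → ψ 0 m = 0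
  profile_lead : ∀ m, (∀ j, m.1 ≠ unitIdx j) →
    (emb hα k (ψ 0 m) : AEFun) = leadProfile V g ω φ m.1
  mode_unit : ∀ m j, m.1 = unitIdx j → emb hα k (a m) = φ j
  mode_of_ne : ∀ m, (∀ j, m.1 ≠ unitIdx j) → emb hα k (a m) = 0
  forcing : ∀ m ∈ ResMin ω, (emb hα k (G m) : AEFun) = forcing V g ω φ m
  bound_re : ∀ z ∈ complexBall N δ, ‖R z‖ ≤ C * resBound ω z
  bound_im : ∀ z ∈ complexBall N δ, ‖R' z‖ ≤ C * resBound ω z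
  solves : ∀ z ∈ complexBall N δ, SolvesForcedNLS V g
    (fun t => ((∑ m ∈ (resMin_finite ω).toFinset, zPow (zFlow ϖ z t) m • emb hα k (G m) +
      (emb hα k (R (zFlow ϖ z t)) + Complex.I • emb hα k (R' (zFlow ϖ z t))) : L2) : AEFun))
    (fun t => ∑ m : NonRes1 ω, zPow (zFlow ϖ z t) m.1 • emb hα k (a m + ψ (absSq z) m))
  freq_eq : ∀ x ∈ realBall N (δ ^ 2), ϖ x = W x
  profile_eq : ∀ x ∈ realBall N (δ ^ 2), ∀ m, emb hα k (ψ x m) = Ψ x m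
  rem_eq : ∀ z ∈ complexBall N δ, emb hα k (R z) + Complex.I • emb hα k (R' z) = Q z

theorem exists_idxNorm_le {s : Set (Fin N → ℤ)} (hs : s.Finite) : ∃ B, ∀ m ∈ s, idxNorm m ≤ B := by
  obtain ⟨B, hB⟩ := (hs.image idxNorm).bddAbove
  exact ⟨B, fun m hm => hB ⟨m, hm, rfl⟩⟩

/-- For every regularity `k` there are solutions on some balls; the objects `W`, `Ψ`, `Q` common to
all `k` are those of regularity `0`. -/
theorem exists_isSolution [Fintype (NonRes1 ω)] (hg : NonlinearityAssumption g)
    (hH : SpectralAssumption V ω φ) (hα : 0 < α)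
    (h9 : ∀ m ∈ NonRes1 ω, 9 * α ^ 2 < -freq ω m) :
    ∃ W Ψ Q, ∀ k, ∃ δ > 0, ∃ C > 0, ∃ a G ϖ ψ R R',
      IsSolution V g ω φ hα W Ψ Q k δ C a G ϖ ψ R R' := by
  have hω := hH.strictMono.injective
  obtain ⟨p, S, hM⟩ := exists_isModes hH
  obtain ⟨P, hP⟩ := exists_isBigO_offSize_pow hω (q := (Subtype.val : NonRes1 ω → Fin N → ℤ))
    sum_eq_one_of_mem Subtype.val_injective
  obtain ⟨B, hB⟩ := exists_idxNorm_le (nonRes1_finite hω)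
  obtain ⟨B', hB'⟩ := exists_idxNorm_le (resMin_finite ω)
  -- enough Taylor terms to bound the remainder by `resBound` and to reach all indices of `NR₁` and
  -- `R_min`
  set K := P + 1 + B + B' with hK
  have hgs := hg.smooth
  obtain ⟨w2₀, a₀, T₀, hL₀⟩ := exists_isLevel hH hα h9 hM 0
  obtain ⟨y₀, r₀, hr₀, hs₀, hfix₀, huniq₀, hloc₀⟩ := exists_profiles hgs w2₀ Subtype.val K ω
    (modeFun hα 0 φ) T₀ a₀ hg.zero sum_eq_one_of_mem
  set v₀ : (Fin N → ℝ) → NonRes1 ω → Ck 0 := fun x => a₀ + (y₀ x).2 with hv₀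
  refine ⟨fun x => (y₀ x).1, fun x m => emb hα 0 ((y₀ x).2 m), fun z =>
    emb hα 0 (remPart hgs w2₀ Subtype.val K ω v₀ Complex.reCLM z) +
      Complex.I • emb hα 0 (remPart hgs w2₀ Subtype.val K ω v₀ Complex.imCLM z), fun k => ?_⟩
  obtain ⟨w2, a, T, hL⟩ := exists_isLevel hH hα h9 hM k
  obtain ⟨y, r, hr, hs, hfix, -, -⟩ := exists_profiles hgs w2 Subtype.val K ω
    (modeFun hα k φ) T a hg.zero sum_eq_one_of_mem
  set v : (Fin N → ℝ) → NonRes1 ω → Ck k := fun x => a + (y x).2 with hv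
  have hball : Metric.ball (0 : Fin N → ℝ) r ∈ 𝓝 0 := Metric.ball_mem_nhds 0 hr
  have hyd : ContDiffAt ℝ (⊤ : ℕ∞) y 0 := hs.contDiffAt hball
  have hvd : DifferentiableAt ℝ v 0 :=
    ((hyd.differentiableAt (by simp)).snd).const_add a
  -- comparison with the lowest regularity
  obtain ⟨ρ, hρ⟩ := exists_res k
  have hemb : ∀ b, emb hα 0 (ρ b) = emb hα k b := fun b =>
    emb_eq_of_ev_eq hα fun x => by rw [hρ]
  have hcomp := eventually_res_profiles hgs hρ (w2' := w2₀) (a' := a₀) (ℓ' := modeFun hα 0 φ)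
    (S' := T₀) (Ck.ext_ev fun x => by rw [hρ, hL.ev_w2, hL₀.ev_w2])
    (fun i => emb_injective hα 0 (by rw [hemb, hL.emb_a, hL₀.emb_a]))
    (fun j b => by rw [modeFun_apply, modeFun_apply, hemb])
    (fun i b => emb_injective hα 0 (by rw [hL₀.emb_T, hemb, hemb, hL.emb_T]))
    hr hyd.continuousAt hfix huniq₀ hloc₀
  have hrange : ∀ m, m ∈ NonRes1 ω ↔ ∃ i : NonRes1 ω, i.1 = m := fun m =>
    ⟨fun h => ⟨⟨m, h⟩, rfl⟩, fun ⟨i, hi⟩ => hi ▸ i.2⟩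
  have hrem : ∀ ρ : ℂ →L[ℝ] ℝ, ∃ C > 0, ∀ᶠ z in 𝓝 (0 : Fin N → ℂ),
      ‖remPart hgs w2 Subtype.val K ω v ρ z‖ ≤ C * resBound ω z := fun ρ => by
    obtain ⟨C, hC, h⟩ := (isBigO_remPart hgs w2 ρ hH.independent Subtype.val_injective hrange
      (by omega) (hP K (by omega)) hvd).exists_pos
    refine ⟨C, hC, ?_⟩
    filter_upwards [h.bound] with z hz
    rwa [Real.norm_of_nonneg (resBound_nonneg ω z)] at hz
  obtain ⟨C₁, hC₁, hb₁⟩ := hrem Complex.reCLM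
  obtain ⟨C₂, hC₂, hb₂⟩ := hrem Complex.imCLM
  obtain ⟨r₁, hr₁, hs₁⟩ := exists_realBall_subset (Filter.inter_mem hcomp hball)
  obtain ⟨r₂, hr₂, hs₂⟩ := exists_complexBall_subset (Filter.inter_mem hb₁ hb₂)
  set δ := min (min r₁ 1) r₂ with hδ
  have hδ0 : 0 < δ := lt_min (lt_min hr₁ one_pos) hr₂
  have hδ1 : δ ^ 2 ≤ r₁ := by
    have h1 : δ ≤ r₁ := (min_le_left _ _).trans (min_le_left _ _)
    have h2 : δ ≤ 1 := (min_le_left _ _).trans (min_le_right _ _)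
    nlinarith
  have hδ2 : complexBall N δ ⊆ complexBall N r₂ := complexBall_mono (min_le_right _ _)
  have hx : ∀ x ∈ realBall N (δ ^ 2), ((y x).1 = (y₀ x).1 ∧ ∀ i, ρ ((y x).2 i) = (y₀ x).2 i) ∧
      x ∈ Metric.ball (0 : Fin N → ℝ) r := fun x hx => hs₁ (realBall_mono hδ1 hx)
  have h0 : (0 : Fin N → ℝ) ∈ realBall N (δ ^ 2) := zero_mem_realBall (by positivity)
  have hyc : ContDiffOn ℝ (⊤ : ℕ∞) y (realBall N (δ ^ 2)) := hs.mono fun x h => (hx x h).2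
  have hvc : ContDiffOn ℝ (⊤ : ℕ∞) v (realBall N (δ ^ 2)) := contDiffOn_const.add hyc.snd
  have hfix0 := hfix 0 (Metric.mem_ball_self hr)
  obtain ⟨hf1, hf2⟩ := fixed_zero hgs hα hg.zero hfix0
  have hlead := leadProfile_eq hgs hg.zero hH hα hM hL (by omega)
    (fun m hm => (hB m hm).trans (by omega)) hfix0
  have hevv : ∀ x ∈ realBall N (δ ^ 2), ∀ i t, Ck.ev (v x i) t = Ck.ev (v₀ x i) t := by
    intro x hxx i t
    have h1 : ρ (a i) = a₀ i := emb_injective hα 0 (by rw [hemb, hL.emb_a, hL₀.emb_a])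
    rw [hv, hv₀]
    simp only [Pi.add_apply]
    rw [← (hx x hxx).1.2, ← h1, ← map_add, hρ]
  refine ⟨δ, hδ0, C₁ + C₂, by positivity, a, fun m => nlCoef hgs w2 Subtype.val K m 0 (v 0),
    fun x => (y x).1, fun x => (y x).2, remPart hgs w2 Subtype.val K ω v Complex.reCLM,
    remPart hgs w2 Subtype.val K ω v Complex.imCLM, ?_⟩
  refine
    { contDiff_profile := hyc.snd
      contDiff_freq := hyc.fst
      contDiff_re := contDiffOn_remPart hgs w2 _ hvc
      contDiff_im := contDiffOn_remPart hgs w2 _ hvc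
      freq_zero := hf1
      profile_unit := hf2
      profile_lead := fun m hm => ?_
      mode_unit := fun m j hj => by rw [hL.emb_a, hM.unit m j hj]
      mode_of_ne := fun m hm => by rw [hL.emb_a, hM.of_ne m hm]
      forcing := fun m hm => ?_
      bound_re := fun z hz => ?_
      bound_im := fun z hz => ?_
      solves := fun z hz => ?_
      freq_eq := fun x hxx => (hx x hxx).1.1
      profile_eq := fun x hxx m => by rw [← hemb, (hx x hxx).1.2]
      rem_eq := fun z hz => ?_ }
  · rw [hlead, map_add, hL.emb_a, hM.of_ne m hm, zero_add]
  · exact (forcing_eq hgs hg.zero hα hL.ev_w2 (by omega) ((hB' m hm).trans (by omega))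
      fun i _ => hlead i).symm
  · refine ((hs₂ (hδ2 hz)).1).trans (mul_le_mul_of_nonneg_right (by linarith) (resBound_nonneg _ _))
  · refine ((hs₂ (hδ2 hz)).2).trans (mul_le_mul_of_nonneg_right (by linarith) (resBound_nonneg _ _))
  · exact solvesForcedNLS hgs hH hα hM hL (v := v) (ψ := fun x => (y x).2) (fun _ => rfl)
      (hfix _ (hx _ (absSq_mem_realBall hz)).2)
  · have hev : ∀ σ : ℂ →L[ℝ] ℝ, emb hα k (remPart hgs w2 Subtype.val K ω v σ z) =
        emb hα 0 (remPart hgs w2₀ Subtype.val K ω v₀ σ z) := fun σ =>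
      emb_eq_of_ev_eq hα (ev_remPart_congr hgs _ K σ z
        (fun t => by rw [hL.ev_w2, hL₀.ev_w2]) (hevv 0 h0) (hevv _ (absSq_mem_realBall hz)))
    rw [hev, hev]

end

/-! ### Transfer to the weighted Sobolev spaces -/

section Transfer

variable {N : ℕ} {V : 𝓢(R3, ℝ)} {g : ℝ → ℝ} {ω : Fin N → ℝ} {φ : Fin N → L2} {α γ : ℝ}

theorem exists_decay_rate [Fintype (NonRes1 ω)] :
    ∃ α > 0, ∀ m ∈ NonRes1 ω, 9 * α ^ 2 < -freq ω m := by
  have h : ∃ c > 0, c ≤ 1 ∧ ∀ m : NonRes1 ω, c ≤ -freq ω m.1 := by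
    rcases isEmpty_or_nonempty (NonRes1 ω) with h | h
    · exact ⟨1, one_pos, le_rfl, fun m => h.elim m⟩
    · obtain ⟨m₀, hm₀⟩ := Finite.exists_min fun m : NonRes1 ω => -freq ω m.1
      refine ⟨min 1 (-freq ω m₀.1), lt_min one_pos (neg_pos.mpr m₀.2.1.2), min_le_left _ _,
        fun m => (min_le_right _ _).trans (hm₀ m)⟩
  obtain ⟨c, hc, hc1, hcm⟩ := h
  refine ⟨c / 9, by positivity, fun m hm => lt_of_lt_of_le ?_ (hcm ⟨m, hm⟩)⟩
  nlinarith

/-- For each `s`, an embedding of the functions of regularity `⌈s⌉` into `Σ^s` (of no meaning for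
`s < 0`). -/
theorem exists_sigmaEmb_ceil (hγ : 0 < γ) (h : γ < α) (hα : 0 < α) (s : ℝ) :
    ∃ ι : Ck ⌈s⌉₊ →L[ℝ] SigmaSp γ s, 0 ≤ s → ∀ a, (ι a).toL2 = emb hα ⌈s⌉₊ a := by
  by_cases hs : 0 ≤ s
  · obtain ⟨ι, hι⟩ := exists_sigmaEmb hγ.le h hα ⌈s⌉₊ hs (Nat.le_ceil s)
    exact ⟨ι, fun _ => hι⟩
  · exact ⟨0, fun h' => absurd h' hs⟩

theorem memSigmaInfty_of_emb (hγ : 0 < γ) (h : γ < α) (hα : 0 < α) {f : AEFun}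
    (hf : ∀ k : ℕ, ∃ a : Ck k, (emb hα k a : AEFun) = f) : MemSigmaInfty γ f := by
  intro s hs
  obtain ⟨ι, hι⟩ := exists_sigmaEmb_ceil hγ h hα s
  obtain ⟨a, ha⟩ := hf ⌈s⌉₊
  exact ⟨(ι a).toL2, (ι a).2, by rw [hι hs, ha]⟩

theorem refinedProfile_eq_sum [Fintype (NonRes1 ω)] (hneg : ∀ j, ω j < 0) {s : ℝ} (hα : 0 < α)
    {k : ℕ} {a : NonRes1 ω → Ck k} (h1 : ∀ m j, m.1 = unitIdx j → emb hα k (a m) = φ j)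
    (h2 : ∀ m : NonRes1 ω, (∀ j, m.1 ≠ unitIdx j) → emb hα k (a m) = 0)
    {ψ : (Fin N → ℤ) → (Fin N → ℝ) → SigmaSp γ s} (z : Fin N → ℂ) {b : NonRes1 ω → Ck k}
    (hb : ∀ m : NonRes1 ω, (ψ m.1 (absSq z)).toL2 = emb hα k (b m)) :
    refinedProfile ω φ ψ z = ∑ m : NonRes1 ω, zPow z m.1 • emb hα k (a m + b m) := by
  simp only [map_add, smul_add, Finset.sum_add_distrib]
  rw [refinedProfile]
  congr 1
  · refine Finset.sum_of_injOn (fun j => ⟨unitIdx j, unitIdx_mem_nonRes1 hneg j⟩)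
      (fun i _ j _ h => unitIdx_injective (congrArg Subtype.val h)) (fun _ _ => Finset.mem_univ _)
      (fun m _ hm => ?_) (fun j _ => ?_)
    · rw [h2 m fun j hj => hm ⟨j, Finset.mem_coe.mpr (Finset.mem_univ j), Subtype.ext hj.symm⟩,
        smul_zero]
    · rw [h1 _ j rfl, zPow_unitIdx]
  · rw [← finsum_set_coe_eq_finsum_mem, finsum_eq_sum_of_fintype]
    exact Finset.sum_congr rfl fun m _ => by rw [hb]

/-- The radii `δ 0, …, δ ⌈s⌉` have a common lower bound which is nonincreasing in `s`. -/
theorem exists_antitone_radius {δ : ℕ → ℝ} (hδ : ∀ k, 0 < δ k) :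
    ∃ r : ℝ → ℝ, Antitone r ∧ (∀ s, 0 < r s) ∧ ∀ s (k : ℕ), k ≤ ⌈s⌉₊ → r s ≤ δ k := by
  refine ⟨fun s => (Finset.range (⌈s⌉₊ + 1)).inf' Finset.nonempty_range_add_one δ,
    fun s t hst => Finset.inf'_mono δ (Finset.range_mono
      (Nat.add_le_add_right (Nat.ceil_mono hst) 1)) _, fun s => ?_, fun s k hk => ?_⟩
  · exact (Finset.lt_inf'_iff _).mpr fun k _ => hδ k
  · exact Finset.inf'_le δ (Finset.mem_range.mpr (Nat.lt_succ_of_le hk))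

end Transfer

end NLSProfile

end

open NLSProfile

theorem proposition1p6 {N : ℕ} (hN : 2 ≤ N) (V : 𝓢(R3, ℝ)) (g : ℝ → ℝ)
    (hg : NonlinearityAssumption g) (ω : Fin N → ℝ) (φ : Fin N → L2)
    (hH : SpectralAssumption V ω φ) :
    (ResMin ω).Finite ∧ (NonRes1 ω).Finite ∧
    ∃ γ₁ > 0, ∀ γ : ℝ, 0 < γ → γ < γ₁ →
      (∀ j, MemSigmaInfty γ (φ j : AEFun)) ∧
      (∀ m ∈ ResMin ω, MemSigmaInfty γ (forcing V g ω φ m)) ∧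
      ∃ (δ C : ℝ → ℝ) (ψ : (s : ℝ) → (Fin N → ℤ) → (Fin N → ℝ) → SigmaSp γ s)
        (ϖ : ℝ → (Fin N → ℝ) → Fin N → ℝ) (R : (s : ℝ) → (Fin N → ℂ) → SigmaSp γ s),
        AntitoneOn δ (Set.Ici 0) ∧
        (∀ s : ℝ, 0 ≤ s →
          0 < δ s ∧ 0 < C s ∧
          (∀ m ∈ NonRes1 ω, ContDiffOn ℝ (⊤ : ℕ∞) (ψ s m) (realBall N (δ s ^ 2))) ∧
          ContDiffOn ℝ (⊤ : ℕ∞) (ϖ s) (realBall N (δ s ^ 2)) ∧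
          ContDiffOn ℝ (⊤ : ℕ∞) (R s) (complexBall N (δ s)) ∧
          ϖ s 0 = ω ∧
          (∀ j, ψ s (unitIdx j) 0 = 0) ∧
          (∀ m ∈ NonRes1 ω, (∀ j, m ≠ unitIdx j) →
            ((ψ s m 0).toL2 : AEFun) = leadProfile V g ω φ m) ∧
          (∀ z ∈ complexBall N (δ s),
            ‖R s z‖ ≤ C s * zNorm z ^ 2 * ∑ᶠ m ∈ ResMin ω, ‖zPow z m‖) ∧
          (∀ z ∈ complexBall N (δ s),
            SolvesForcedNLS V g
              (fun t => (∑ᶠ m ∈ ResMin ω, zPow (zFlow (ϖ s) z t) m • forcing V g ω φ m) +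
                ((R s (zFlow (ϖ s) z t)).toL2 : AEFun))
              (fun t => refinedProfile ω φ (ψ s) (zFlow (ϖ s) z t)))) ∧
        (∀ s₁ s₂ : ℝ, 0 ≤ s₁ → s₁ < s₂ → ∀ z ∈ complexBall N (δ s₂),
          (∀ m ∈ NonRes1 ω, (ψ s₁ m (absSq z)).toL2 = (ψ s₂ m (absSq z)).toL2) ∧
          ϖ s₁ (absSq z) = ϖ s₂ (absSq z) ∧
          (R s₁ z).toL2 = (R s₂ z).toL2) := by
  have hfin := nonRes1_finite hH.strictMono.injective
  refine ⟨resMin_finite ω, hfin, ?_⟩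
  have : Fintype (NonRes1 ω) := hfin.fintype
  obtain ⟨α, hα, h9⟩ := exists_decay_rate (ω := ω)
  obtain ⟨W, Ψ, Q, hsol⟩ := exists_isSolution hg hH hα h9
  choose δ hδ C hC a G ϖ ψ R R' hS using hsol
  have hunit := unitIdx_mem_nonRes1 hH.neg
  refine ⟨α, hα, fun γ hγ hγα => ⟨fun j => ?_, fun m hm => ?_, ?_⟩⟩
  · exact memSigmaInfty_of_emb hγ hγα hα fun k =>
      ⟨a k ⟨_, hunit j⟩, by rw [(hS k).mode_unit ⟨_, hunit j⟩ j rfl]⟩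
  · exact memSigmaInfty_of_emb hγ hγα hα fun k => ⟨G k m, (hS k).forcing m hm⟩
  -- the objects belonging to `s` are those of regularity `⌈s⌉`
  choose ι hι using exists_sigmaEmb_ceil hγ hγα hα
  obtain ⟨r, hr, hr0, hrδ⟩ := exists_antitone_radius hδ
  have hball : ∀ s (k : ℕ), k ≤ ⌈s⌉₊ → realBall N (r s ^ 2) ⊆ realBall N (δ k ^ 2) :=
    fun s k hk => realBall_mono (pow_le_pow_left₀ (hr0 s).le (hrδ s k hk) 2)
  have hball' : ∀ s (k : ℕ), k ≤ ⌈s⌉₊ → complexBall N (r s) ⊆ complexBall N (δ k) :=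
    fun s k hk => complexBall_mono (hrδ s k hk)
  classical
  -- outside `NR₁` the profiles are of no meaning
  set ψ' : (s : ℝ) → (Fin N → ℤ) → (Fin N → ℝ) → SigmaSp γ s := fun s m x =>
    if h : m ∈ NonRes1 ω then ι s (ψ ⌈s⌉₊ x ⟨m, h⟩) else 0 with hψ'
  set Rs : (s : ℝ) → (Fin N → ℂ) → SigmaSp γ s := fun s z =>
    ι s (R ⌈s⌉₊ z) + Complex.I • ι s (R' ⌈s⌉₊ z) with hRs
  have hψ : ∀ s x m (h : m ∈ NonRes1 ω), ψ' s m x = ι s (ψ ⌈s⌉₊ x ⟨m, h⟩) := fun s x m h =>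
    dif_pos h
  have hψL : ∀ s, 0 ≤ s → ∀ x m (h : m ∈ NonRes1 ω),
      (ψ' s m x).toL2 = emb hα ⌈s⌉₊ (ψ ⌈s⌉₊ x ⟨m, h⟩) := fun s hs x m h => by
    rw [hψ s x m h, hι s hs]
  have hRL : ∀ s, 0 ≤ s → ∀ z, (Rs s z).toL2 =
      emb hα ⌈s⌉₊ (R ⌈s⌉₊ z) + Complex.I • emb hα ⌈s⌉₊ (R' ⌈s⌉₊ z) := fun s hs z => by
    rw [hRs, map_add, map_smul, hι s hs, hι s hs]
  refine ⟨r, fun s => 2 * ‖ι s‖ * C ⌈s⌉₊ + 1, ψ', fun s => ϖ ⌈s⌉₊, Rs, hr.antitoneOn _, ?_, ?_⟩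
  · intro s hs
    have hk := hS ⌈s⌉₊
    have hb := hball s _ le_rfl
    have hb' := hball' s _ le_rfl
    have hCs := hC ⌈s⌉₊
    refine ⟨hr0 s, by positivity, fun m hm => ?_, hk.contDiff_freq.mono hb, ?_, hk.freq_zero,
      fun j => ?_, fun m hm hne => ?_, fun z hz => ?_, fun z hz => ?_⟩
    · have h1 : ContDiffOn ℝ (⊤ : ℕ∞) (fun x => ψ ⌈s⌉₊ x ⟨m, hm⟩) (realBall N (r s ^ 2)) :=
        contDiffOn_pi.mp (hk.contDiff_profile.mono hb) ⟨m, hm⟩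
      exact ((ι s).contDiff.comp_contDiffOn h1).congr fun x _ => hψ s x m hm
    · exact ((ι s).contDiff.comp_contDiffOn (hk.contDiff_re.mono hb')).add
        (((ι s).contDiff.comp_contDiffOn (hk.contDiff_im.mono hb')).const_smul Complex.I)
    · rw [hψ s 0 _ (hunit j), hk.profile_unit _ ⟨j, rfl⟩, map_zero]
    · rw [hψL s hs 0 m hm, hk.profile_lead ⟨m, hm⟩ hne]
    · have hle : ∀ b : Ck ⌈s⌉₊, ‖b‖ ≤ C ⌈s⌉₊ * resBound ω z →
          ‖ι s b‖ ≤ ‖ι s‖ * (C ⌈s⌉₊ * resBound ω z) := fun b h =>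
        (ι s).le_opNorm_of_le h
      have h1 := hle _ (hk.bound_re z (hb' hz))
      have h2 := hle _ (hk.bound_im z (hb' hz))
      have h3 : ‖Rs s z‖ ≤ ‖ι s (R ⌈s⌉₊ z)‖ + ‖ι s (R' ⌈s⌉₊ z)‖ := by
        refine (norm_add_le _ _).trans_eq ?_
        rw [norm_smul, Complex.norm_I, one_mul]
      have h0 := resBound_nonneg ω z
      have h4 : (2 * ‖ι s‖ * C ⌈s⌉₊ + 1) * zNorm z ^ 2 * ∑ᶠ m ∈ ResMin ω, ‖zPow z m‖ =
          (2 * ‖ι s‖ * C ⌈s⌉₊ + 1) * resBound ω z := by rw [resBound, mul_assoc]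
      rw [h4]
      linarith
    · have h := hk.solves z (hb' hz)
      convert h using 2 with t t
      · rw [finsum_mem_eq_finite_toFinset_sum _ (resMin_finite ω), hRL s hs]
        refine Eq.trans ?_ (AddSubgroup.coe_add _ _ _).symm
        rw [coe_sum_L2]
        refine congrArg (· + _) (Finset.sum_congr rfl fun m hm => ?_)
        rw [coe_smul_L2, hk.forcing m ((resMin_finite ω).mem_toFinset.mp hm)]
      · rw [refinedProfile_eq_sum hH.neg hα hk.mode_unit hk.mode_of_ne _
          fun m => hψL s hs _ m.1 m.2, absSq_zFlow]
  · intro s₁ s₂ hs₁ hs z hz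
    have hs₂ := hs₁.trans hs.le
    have hc : ⌈s₁⌉₊ ≤ ⌈s₂⌉₊ := Nat.ceil_mono hs.le
    have hx := absSq_mem_realBall hz
    have hx₁ := hball s₂ _ hc hx
    have hx₂ := hball s₂ _ le_rfl hx
    refine ⟨fun m hm => ?_, ?_, ?_⟩
    · rw [hψL s₁ hs₁ _ m hm, hψL s₂ hs₂ _ m hm, (hS _).profile_eq _ hx₁, (hS _).profile_eq _ hx₂]
    · exact ((hS _).freq_eq _ hx₁).trans ((hS _).freq_eq _ hx₂).symm
    · rw [hRL s₁ hs₁, hRL s₂ hs₂, (hS _).rem_eq z (hball' s₂ _ hc hz),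
        (hS _).rem_eq z (hball' s₂ _ le_rfl hz)]
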